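/- A quantum digital signature (QDS) scheme with message spaces $(M_\lambda)_{\lambda\in\mathbb N}$, $M_\lambda\subseteq\{0,1\}^*$, consists of four (uniform) quantum polynomial-time (QPT) algorithms, all of which also receive $1^\lambda$: $\mathsf{SKGen}(1^\lambda)\to sk$ outputs a classical secret key, $\mathsf{PKGen}(sk)\to pk$ outputs a quantum public key, $\mathsf{Sign}(sk,m)\to\sigma$ outputs a classical signature, and $\mathsf{Ver}(pk,m,\sigma)$ outputs $\top$ or $\bot$. It has to be correct: there is a negligible function $\varepsilon$ such that for all $\lambda$ and all $m\in M_\lambda$, with $sk\leftarrow\mathsf{SKGen}(1^\lambda)$, $pk\leftarrow\mathsf{PKGen}(sk)$, $\sigma\leftarrow\mathsf{Sign}(sk,m)$, the probability that $\mathsf{Ver}(pk,m,\sigma)=\top$ is at least $1-\varepsilon(\lambda)$. For a function $q:\mathbb N\to\mathbb N$ the scheme is $q$-time secure if for every QPT adversary $\mathcal A$ and every polynomial $t$ the probability that the following game outputs $1$ is negligible in $\lambda$. (1) The challenger runs $sk\leftarrow\mathsf{SKGen}(1^\lambda)$. (2) It runs $\mathsf{PKGen}(sk)$ independently $t(\lambda)+1$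 times and sends $t(\lambda)$ of the resulting public keys to $\mathcal A$. (3) For $i=1,\dots,q(\lambda)$: $\mathcal A$ sends a message $m^{(i)}$, and the challenger returns $\sigma^{(i)}\leftarrow\mathsf{Sign}(sk,m^{(i)})$. (4) $\mathcal A$ outputs $(m',\sigma')$. (5) The challenger runs $\mathsf{Ver}(pk,m',\sigma')$ on the remaining public key $pk$. The game outputs $1$ if and only if all messages $m^{(i)}$ and $m'$ lie in $M_\lambda$, $m'\notin\{m^{(1)},\dots,m^{(q(\lambda))}\}$, and the verification outputs $\top$. One-time security is the case $q=1$. **Theorem.** Let $(M_\lambda)_\lambda$ be any family of message spaces and let $q$ be any nonzero polynomial with coefficients in $\mathbb N$. If a one-time-secure QDS scheme with message spaces $(M_\lambda)_\lambda$ exists, then a $q$-time-secure QDS scheme with the same message spaces exists. -/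

import Mathlib

open Polynomial

noncomputable section

namespace QDSModel

/-! ### Quantum memory

All parties of an experiment share one supply of qubits, numbered by `ℕ`. A computational basis
state is the finite set of the qubits whose value is `1`; a vector is a finitely supported family of
amplitudes. A party can act only on those qubits whose number is stored in its own registers. -/

/-- (Unnormalised) pure states of the supply of qubits. -/
abbrev Ket : Type := Finset ℕ →₀ ℂ

/-- The linear operator with given values on the computational basis. -/
def onBasis (g : Finset ℕ → Ket) : Ket →ₗ[ℂ] Ket := Finsupp.linearCombination ℂ g

/-- The Hadamard gate on qubit `i`. -/
def hadamard (i : ℕ) : Ket →ₗ[ℂ] Ket :=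
  onBasis fun s =>
    ((Real.sqrt 2 : ℂ)⁻¹) •
      (Finsupp.single (s.erase i) 1 + Finsupp.single (insert i s) (if i ∈ s then -1 else 1))

/-- The gate `T = diag(1, exp(iπ/4))` on qubit `i`. -/
def tGate (i : ℕ) : Ket →ₗ[ℂ] Ket :=
  onBasis fun s =>
    Finsupp.single s (if i ∈ s then Complex.exp (Complex.I * (Real.pi : ℂ) / 4) else 1)

/-- The controlled-NOT gate with control `i` and target `j` (for `i ≠ j`). -/
def cnotGate (i j : ℕ) : Ket →ₗ[ℂ] Ket :=
  onBasis fun s => Finsupp.single (if i ∈ s then symmDiff s {j} else s) 1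

/-- The projection onto the subspace in which qubit `i` has the value `b`. -/
def project (i : ℕ) (b : Bool) (ψ : Ket) : Ket := ψ.filter fun s => (i ∈ s ↔ b = true)

/-- The qubits numbered `next`, `next + 1`, … are still unused (and in the state `0`). -/
structure Heap where
  next : ℕ
  ket : Ket

/-- The start of every experiment: no qubit is in use. -/
def Heap.empty : Heap := ⟨0, Finsupp.single ∅ 1⟩

/-- The squared norm of the state. -/
def Heap.weight (h : Heap) : ℝ := h.ket.sum fun _ z => ‖z‖ ^ 2

/-- Computations with a classical result: the list of all branches (one for each sequence of
measurement outcomes), each with its result and its unnormalised final state, so that the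
probability of a branch is the squared norm of its state. -/
def Comp (α : Type) : Type := Heap → List (α × Heap)

instance : Monad Comp where
  pure a := fun h => [(a, h)]
  bind c f := fun h => (c h).flatMap fun o => f o.1 o.2

/-- The probability that the result of `c`, run on the empty heap, satisfies `E`. -/
def prob {α : Type} (c : Comp α) (E : α → Prop) : ℝ :=
  open Classical in ((c Heap.empty).map fun o => if E o.1 then o.2.weight else 0).sum

/-- Take an unused qubit. -/
def newQubit : Comp ℕ := fun h => [(h.next, ⟨h.next + 1, h.ket⟩)]

/-- Apply a unitary operator. -/
def applyGate (U : Ket →ₗ[ℂ] Ket) : Comp Unit := fun h => [((), ⟨h.next, U h.ket⟩)]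

/-- Measure qubit `i` in the computational basis. -/
def measureQubit (i : ℕ) : Comp Bool := fun h =>
  [(false, ⟨h.next, project i false h.ket⟩), (true, ⟨h.next, project i true h.ket⟩)]

/-! ### Programs

Quantum programs with classical control. A program has finitely many registers; a register is a
stack whose cells hold a classical bit or a qubit. Every polynomial-time computation can be run
under a polynomial clock, so that bounded loops suffice to write all of them. -/

/-- The content of one cell; a qubit is given by its number, which no instruction can read,
compare or copy. -/
inductive Cell where
  | bit (b : Bool)
  | qubit (i : ℕ)

/-- The registers; the head of the list is the top of the stack. -/
abbrev Mem : Type := ℕ → List Cell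

inductive Prog where
  | skip
  /-- push a classical bit -/
  | push (r : ℕ) (b : Bool)
  /-- discard the top cell -/
  | pop (r : ℕ)
  /-- move the top cell of `r` to the top of `s` -/
  | move (r s : ℕ)
  /-- push a fresh qubit in the state `0` -/
  | alloc (r : ℕ)
  /-- gates on the qubits on top of the registers; without effect if there is no such qubit -/
  | had (r : ℕ)
  | tgate (r : ℕ)
  | cnot (r s : ℕ)
  /-- replace the qubit on top of `r` by the outcome of its measurement -/
  | meas (r : ℕ)
  | seq (P Q : Prog)
  /-- branch on the top cell of `r`: no cell, bit `0`, bit `1`, or a qubit -/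
  | test (r : ℕ) (onEmpty onFalse onTrue onQubit : Prog)
  /-- repeat `P` as many times as `r` has cells when the loop is entered -/
  | loop (r : ℕ) (P : Prog)

/-- Repeat `f` and add up the numbers of steps. -/
def iter (f : Mem → Comp (Mem × ℕ)) : ℕ → Mem → Comp (Mem × ℕ)
  | 0, μ => pure (μ, 0)
  | k + 1, μ => do
      let o ← f μ
      let o' ← iter f k o.1
      pure (o'.1, o.2 + o'.2)

/-- Run a program; the result is the final content of the registers and the number of steps. -/
def exec : Prog → Mem → Comp (Mem × ℕ)
  | .skip, μ => pure (μ, 1)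
  | .push r b, μ => pure (Function.update μ r (.bit b :: μ r), 1)
  | .pop r, μ => pure (Function.update μ r (μ r).tail, 1)
  | .move r s, μ =>
      match μ r with
      | [] => pure (μ, 1)
      | c :: l =>
          let μ' : Mem := Function.update μ r l
          pure (Function.update μ' s (c :: μ' s), 1)
  | .alloc r, μ => do
      let i ← newQubit
      pure (Function.update μ r (.qubit i :: μ r), 1)
  | .had r, μ =>
      match μ r with
      | .qubit i :: _ => do
          applyGate (hadamard i)
          pure (μ, 1)
      | _ => pure (μ, 1)
  | .tgate r, μ =>
      match μ r with
      | .qubit i :: _ => do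
          applyGate (tGate i)
          pure (μ, 1)
      | _ => pure (μ, 1)
  | .cnot r s, μ =>
      match μ r, μ s with
      | .qubit i :: _, .qubit j :: _ =>
          if i = j then pure (μ, 1)
          else do
            applyGate (cnotGate i j)
            pure (μ, 1)
      | _, _ => pure (μ, 1)
  | .meas r, μ =>
      match μ r with
      | .qubit i :: l => do
          let b ← measureQubit i
          pure (Function.update μ r (.bit b :: l), 1)
      | _ => pure (μ, 1)
  | .seq P Q, μ => do
      let o ← exec P μ
      let o' ← exec Q o.1
      pure (o'.1, o.2 + o'.2)
  | .test r P₀ P₁ P₂ P₃, μ => do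
      let o ← (match μ r with
        | [] => exec P₀ μ
        | .bit false :: _ => exec P₁ μ
        | .bit true :: _ => exec P₂ μ
        | .qubit _ :: _ => exec P₃ μ)
      pure (o.1, o.2 + 1)
  | .loop r P, μ => do
      let o ← iter (exec P) (μ r).length μ
      pure (o.1, o.2 + 1)

/-- A classical string as the content of a register. -/
def ofBits (x : List Bool) : List Cell := x.map Cell.bit

/-- The classical string in a register (qubits are ignored). -/
def toBits (x : List Cell) : List Bool :=
  x.filterMap fun c => match c with
    | .bit b => some b
    | .qubit _ => none

/-- The unary string `1ⁿ`. -/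
def unary (n : ℕ) : List Cell := ofBits (List.replicate n true)

/-- The registers `0, 1, 2, …` hold the given inputs; all others are empty. -/
def load (xs : List (List Cell)) : Mem := fun r => xs.getD r []

/-- The register in which an adversary receives what the challenger sends. -/
def inReg : ℕ := 1

/-- The register for outputs (and for the messages of an adversary). -/
def outReg : ℕ := 4

/-- The register for the signature that an adversary outputs at the end. -/
def sigReg : ℕ := 5

/-- Run `P` on the security parameter `1ⁿ` and further inputs, with fresh registers, and return
its output register. -/
def runOn (P : Prog) (n : ℕ) (xs : List (List Cell)) : Comp (List Cell) := do
  let o ← exec P (load (unary n :: xs))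
  pure (o.1 outReg)

/-- `P` is a QPT algorithm with `k` inputs besides `1ⁿ`: on every sequence of measurement outcomes,
the number of steps is at most a polynomial in the total length of the inputs. -/
def IsQPT (k : ℕ) (P : Prog) : Prop :=
  ∃ p : ℕ[X], ∀ (n : ℕ) (xs : List (List Cell)), xs.length = k →
    ∀ (h : Heap), ∀ o ∈ exec P (load (unary n :: xs)) h,
      o.1.2 ≤ p.eval (n + (xs.map List.length).sum)

/-! ### Quantum digital signatures -/

/-- The four algorithms of a QDS scheme. Each of them receives `1ⁿ` in register `0`; the secret key,
the message and the signature are classical strings, the public key is a quantum state. -/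
structure QDS where
  skGen : Prog
  pkGen : Prog
  sign : Prog
  ver : Prog

namespace QDS

variable (S : QDS)

def SKGen (n : ℕ) : Comp (List Bool) := do
  let x ← runOn S.skGen n []
  pure (toBits x)

def PKGen (n : ℕ) (sk : List Bool) : Comp (List Cell) := runOn S.pkGen n [ofBits sk]

def Sign (n : ℕ) (sk m : List Bool) : Comp (List Bool) := do
  let x ← runOn S.sign n [ofBits sk, ofBits m]
  pure (toBits x)

def Ver (n : ℕ) (pk : List Cell) (m σ : List Bool) : Comp Bool := do
  let x ← runOn S.ver n [pk, ofBits m, ofBits σ]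
  pure ((toBits x).head? == some true)

/-- All four algorithms are QPT. -/
def Efficient : Prop := IsQPT 0 S.skGen ∧ IsQPT 1 S.pkGen ∧ IsQPT 2 S.sign ∧ IsQPT 3 S.ver

/-- Generate keys, sign `m`, and verify the signature. -/
def honestRun (n : ℕ) (m : List Bool) : Comp Bool := do
  let sk ← S.SKGen n
  let pk ← S.PKGen n sk
  let σ ← S.Sign n sk m
  S.Ver n pk m σ

end QDS

/-- Negligible functions. -/
def Negligible (f : ℕ → ℝ) : Prop :=
  Asymptotics.SuperpolynomialDecay Filter.atTop (fun n : ℕ => (n : ℝ)) f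

/-- Correctness for the message spaces `M n`, where `n` is the security parameter. -/
def QDS.Correct (S : QDS) (M : ℕ → Set (List Bool)) : Prop :=
  ∃ ε : ℕ → ℝ, Negligible ε ∧
    ∀ n, ∀ m ∈ M n, 1 - ε n ≤ prob (S.honestRun n m) (fun v => v = true)

/-- A self-delimiting form of a string of cells, in which a sequence of public keys is sent. -/
def frame (x : List Cell) : List Cell :=
  x.flatMap (fun c => [Cell.bit true, c]) ++ [Cell.bit false]

/-- An adversary is a program that is activated once for each string sent to it. It keeps all its
registers between two activations; the incoming string is written into its register `inReg`. -/
def activate (A : Prog) (μ : Mem) (x : List Cell) : Comp (Mem × ℕ) :=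
  exec A (Function.update μ inReg x)

/-- Activate `A` with one incoming string after the other; returns also the total number of
steps. -/
def activations (A : Prog) : Mem → List (List Cell) → Comp (Mem × ℕ)
  | μ, [] => pure (μ, 0)
  | μ, x :: xs => do
      let o ← activate A μ x
      let o' ← activations A o.1 xs
      pure (o'.1, o.2 + o'.2)

/-- `A` is a QPT adversary with `q` queries: the total number of steps of its `q + 1` activations is
at most a polynomial in the security parameter, whatever is sent to it. -/
def IsQPTAdversary (q : ℕ → ℕ) (A : Prog) : Prop :=
  ∃ p : ℕ[X], ∀ (n : ℕ) (xs : List (List Cell)), xs.length ≤ q n + 1 →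
    ∀ (h : Heap), ∀ o ∈ activations A (load [unary n]) xs h, o.1.2 ≤ p.eval n

/-- Run a computation `k` times. -/
def repeated {α : Type} (c : Comp α) : ℕ → Comp (List α)
  | 0 => pure []
  | k + 1 => do
      let a ← c
      let l ← repeated c k
      pure (a :: l)

/-- The query phase: `k` times, the adversary's message is read and signed, and the signature is
sent to the adversary. Returns the messages and the adversary's registers at the end. -/
def QDS.queries (S : QDS) (A : Prog) (n : ℕ) (sk : List Bool) :
    ℕ → Mem → Comp (List (List Bool) × Mem)
  | 0, μ => pure ([], μ)
  | k + 1, μ => do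
      let m := toBits (μ outReg)
      let σ ← S.Sign n sk m
      let o ← activate A μ (ofBits σ)
      let o' ← QDS.queries S A n sk k o.1
      pure (m :: o'.1, o'.2)

/-- The security game with `t` copies of the public key and `q` queries. The result consists of the
queried messages, the message `m'` of the forgery, and the verdict of the verification. -/
def QDS.experiment (S : QDS) (A : Prog) (n t q : ℕ) :
    Comp (List (List Bool) × List Bool × Bool) := do
  let sk ← S.SKGen n
  let pks ← repeated (S.PKGen n sk) t
  let pk ← S.PKGen n sk
  let o ← activate A (load [unary n]) (pks.flatMap frame)
  let o' ← S.queries A n sk q o.1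
  let m' := toBits (o'.2 outReg)
  let σ' := toBits (o'.2 sigReg)
  let v ← S.Ver n pk m' σ'
  pure (o'.1, m', v)

/-- The game outputs `1`: all messages are in the message space, `m'` was not queried, and the
forgery is accepted. -/
def Wins (M : Set (List Bool)) (r : List (List Bool) × List Bool × Bool) : Prop :=
  (∀ m ∈ r.1, m ∈ M) ∧ r.2.1 ∈ M ∧ r.2.1 ∉ r.1 ∧ r.2.2 = true

/-- `q`-time security for the message spaces `M n`. -/
def QDS.Secure (S : QDS) (M : ℕ → Set (List Bool)) (q : ℕ → ℕ) : Prop :=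
  ∀ (A : Prog) (t : ℕ[X]), IsQPTAdversary q A →
    Negligible fun n => prob (S.experiment A n (t.eval n) (q n)) (Wins (M n))

/-- `S` is a `q`-time-secure QDS scheme with the message spaces `M n`. -/
def QDS.IsTimeSecure (S : QDS) (M : ℕ → Set (List Bool)) (q : ℕ → ℕ) : Prop :=
  S.Efficient ∧ S.Correct M ∧ S.Secure M q

end QDSModel

end

open Function (update update_apply update_of_ne update_self update_idem update_eq_self update_comm
  iterate_succ_apply extend iterate_add_apply)
open Equiv (Perm)
open Nat (size)
open Finset (range range_mono mem_insert sum_congr mem_inter mem_powerset)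
open Finsupp (single sum_single smul_single)
open Option (map_some)
open Polynomial

noncomputable section

namespace QDSModel

/-! Write n for the security parameter and q for the number q(n) of queries. The new scheme
(`QDS.table`) keeps a table of independent one-time keys with R = `rows n` > n rows and C = `cols cs
n` > 2q² columns. To sign, one column is drawn uniformly and independently in every row and the
message is signed with the R selected keys, so that signing needs no state. A signature is accepted
if every row contains at least one component that is valid under the public key of its place.
Correctness is a union bound over the RC keys (`QDS.honestT_fail_le`, `QDS.prob_honestRun_table`).

Security. Within one row, some two of the q queries select the same column with probability at most
q²/C ≤ 1/2. The rows are independent, so a collision occurs in all of them with probability at most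
2^(-R) (`QDS.coreT_coll`). If some row has no collision, each of its keys has signed at most one
message, and a successful forgery has a valid component in this row, at a position e, for a message
that was never signed. A one-time forger therefore guesses e and the number k of the only query that
may use e. It builds all other entries of the table itself, puts the public keys of the challenger
at place e, passes the message of query k to the challenger, and finally returns component e of the
forgery. The guess is right for at least one pair (e, k) (`winR_le`), and for a fixed pair the
reduction does at least as well as the forger (`QDS.coreT_hit_le`). The simulation is wrong only if
e is selected in a query other than k, and such runs contribute nothing (`QDS.stepT_le_hybridT`,
`queriesT_le`). Since the number of guesses is polynomial, `QDS.prob_table_le` bounds the success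
probability by 2^(-R) plus a polynomial multiple of the one-time success probability.

Comparing the games means changing the order of independent computations, for example generating the
public key for the verification at the end instead of at the beginning. All parties share one supply
of qubits, so this needs proof. Computations become trees (`Tree`) whose rewards have an expectation
`acc`. Renaming qubits acts on trees, and `Supp` expresses by invariance which qubits a computation
may touch. `acc_swap` then combines the commutation of operators on disjoint qubits
(`LocalOp.commute`) with the renaming of freshly allocated ones.

Finally, the scheme and the reduction have to be written as programs with polynomial running time.
`Runs` records the effect and the cost of a program fragment. The reduction runs the given adversary
as a subroutine, interleaved with other work, whereas the time bound of the adversary speaks of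
uninterrupted activations. It carries over because the possible control flow depends neither on the
quantum state nor on the names of qubits (`exec_sim`). The reduction also reads only a prefix of
polynomial length of what it is sent (`clipP`), as its own time bound has to hold for all inputs. -/

/-- The content of a register. -/
abbrev Str := List Cell

/-- The memory all of whose registers are empty. -/
notation "𝟎" => load []

/-! ### Local operators on the supply of qubits -/

/-- An operator that acts only on the qubits in `S`. -/
def LocalOp (S : Finset ℕ) (U : Ket →ₗ[ℂ] Ket) : Prop :=
  ∃ c : Finset ℕ → Finset ℕ → ℂ, ∀ s,
    U (single s 1) = ∑ v ∈ S.powerset, single (s \ S ∪ v) (c (s ∩ S) v)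

/-- These are operators on different tensor factors: on a basis state both orders replace the bits
in `S1` and those in `S2` independently, with the product of the two coefficients. -/
lemma LocalOp.commute {S1 S2 : Finset ℕ} {U1 U2 : Ket →ₗ[ℂ] Ket} (h1 : LocalOp S1 U1)
    (h2 : LocalOp S2 U2) (hd : Disjoint S1 S2) (ψ : Ket) : U1 (U2 ψ) = U2 (U1 ψ) := by
  obtain ⟨c1, h1⟩ := h1
  obtain ⟨c2, h2⟩ := h2
  have e : ∀ (U : Ket →ₗ[ℂ] Ket) (s : Finset ℕ) (z : ℂ),
      U (single s z) = z • U (single s 1) := by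
    intro U s z
    rw [← map_smul, smul_single, smul_eq_mul, mul_one]
  suffices U1 ∘ₗ U2 = U2 ∘ₗ U1 from LinearMap.congr_fun this ψ
  refine Finsupp.lhom_ext' fun s => LinearMap.ext_ring ?_
  simp only [LinearMap.comp_apply, Finsupp.lsingle_apply]
  rw [h2, h1, map_sum, map_sum]
  -- Rewriting the bits in `A` leaves the bits in `B` alone, so the coefficients of the second
  -- operator can be read off the original `s`.
  have key : ∀ (A B : Finset ℕ) (v : Finset ℕ), Disjoint A B → v ⊆ A →
      (s \ A ∪ v) ∩ B = s ∩ B := by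
    intro A B v hAB hv
    ext x
    have : x ∈ A → x ∉ B := fun h => Finset.disjoint_left.1 hAB h
    have : x ∈ v → x ∈ A := fun h => hv h
    simp only [Finset.mem_inter, Finset.mem_union, Finset.mem_sdiff]
    tauto
  have e1 : ∀ v ∈ S2.powerset, U1 (single (s \ S2 ∪ v) (c2 (s ∩ S2) v)) =
      ∑ w ∈ S1.powerset, single ((s \ S2 ∪ v) \ S1 ∪ w)
        (c2 (s ∩ S2) v * c1 (s ∩ S1) w) := by
    intro v hv
    rw [e, h1, Finset.smul_sum, key _ _ _ hd.symm (Finset.mem_powerset.1 hv)]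
    simp
  have e2 : ∀ w ∈ S1.powerset, U2 (single (s \ S1 ∪ w) (c1 (s ∩ S1) w)) =
      ∑ v ∈ S2.powerset, single ((s \ S1 ∪ w) \ S2 ∪ v)
        (c1 (s ∩ S1) w * c2 (s ∩ S2) v) := by
    intro v hv
    rw [e, h2, Finset.smul_sum, key _ _ _ hd (Finset.mem_powerset.1 hv)]
    simp
  rw [sum_congr rfl e1, sum_congr rfl e2, Finset.sum_comm]
  refine sum_congr rfl fun w hw => sum_congr rfl fun v hv => ?_
  rw [mul_comm]
  congr 1
  ext x
  have : x ∈ S1 → x ∉ S2 := fun h => Finset.disjoint_left.1 hd h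
  have : x ∈ w → x ∈ S1 := fun h => Finset.mem_powerset.1 hw h
  have : x ∈ v → x ∈ S2 := fun h => Finset.mem_powerset.1 hv h
  simp only [Finset.mem_union, Finset.mem_sdiff]
  tauto

lemma onBasis_single (g : Finset ℕ → Ket) (s : Finset ℕ) :
    onBasis g (single s 1) = g s := by
  simp [onBasis]

lemma localOp_hadamard (i : ℕ) : LocalOp {i} (hadamard i) := by
  refine ⟨fun u v => (Real.sqrt 2 : ℂ)⁻¹ * (if v = ∅ then 1 else if i ∈ u then -1 else 1),
    fun s => ?_⟩
  rw [hadamard, onBasis_single]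
  have : ({i} : Finset ℕ).powerset = {∅, {i}} := rfl
  rw [this, Finset.sum_pair (by simp)]
  have e1 : s \ {i} ∪ ∅ = s.erase i := by ext; simp [and_comm]
  have e2 : s \ {i} ∪ {i} = insert i s := by ext x; simp
  rw [e1, e2, smul_add, smul_single, smul_single]
  simp

lemma localOp_tGate (i : ℕ) : LocalOp {i} (tGate i) := by
  refine ⟨fun u v => if v = u then
    (if i ∈ u then Complex.exp (Complex.I * (Real.pi : ℂ) / 4) else 1) else 0, fun s => ?_⟩
  rw [tGate, onBasis_single, Finset.sum_eq_single (s ∩ {i})]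
  · simp [Finset.sdiff_union_inter]
  · intro b _ hb
    simp [hb]
  · intro h
    exact absurd (Finset.mem_powerset.2 Finset.inter_subset_right) h

/-- Locality also holds for `i = j`, where the operator is not unitary; `Gate.op` replaces it by the
identity in that case. -/
lemma localOp_cnotGate {i j : ℕ} : LocalOp {i, j} (cnotGate i j) := by
  refine ⟨fun u v => if v = (if i ∈ u then symmDiff u {j} else u) then 1 else 0, fun s => ?_⟩
  rw [cnotGate, onBasis_single,
    Finset.sum_eq_single (if i ∈ s then symmDiff (s ∩ {i, j}) {j} else s ∩ {i, j})]
  · by_cases h : i ∈ s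
    · simp only [h, if_true, Finset.mem_inter, mem_insert, true_or, and_true]
      congr 1
      ext x
      simp only [Finset.mem_union, Finset.mem_sdiff, Finset.mem_symmDiff, Finset.mem_inter,
        mem_insert, Finset.mem_singleton]
      by_cases hx : x = j <;> by_cases hy : x = i <;> simp_all
    · simp only [h, if_false, Finset.mem_inter, false_and, if_true, Finset.sdiff_union_inter]
  · intro b _ hb
    by_cases h : i ∈ s <;> simp_all
  · intro h
    exfalso
    apply h
    rw [Finset.mem_powerset]
    intro x
    split_ifs
    · simp only [Finset.mem_symmDiff, Finset.mem_inter, mem_insert, Finset.mem_singleton]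
      tauto
    · simp

/-- The projection onto the value `b` of qubit `i`, as a linear map. -/
def proj (i : ℕ) (b : Bool) : Ket →ₗ[ℂ] Ket :=
  onBasis fun s => single s (if (i ∈ s ↔ b = true) then 1 else 0)

/-- In this linear form `LocalOp.commute` applies to measurements as well as to gates. -/
lemma project_eq_proj (i : ℕ) (b : Bool) (ψ : Ket) : project i b ψ = proj i b ψ := by
  induction ψ using Finsupp.induction_linear with
  | zero => ext; simp [project, Finsupp.filter_apply]
  | add f g hf hg =>
    rw [map_add, ← hf, ← hg]
    ext s
    simp only [project, Finsupp.filter_apply, Finsupp.add_apply]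
    split_ifs <;> simp
  | single s z =>
    have : (single s z : Ket) = z • single s 1 := by simp
    conv_rhs => rw [this, map_smul, proj, onBasis_single, smul_single]
    ext t
    simp only [project, Finsupp.filter_apply, Finsupp.single_apply]
    by_cases h : s = t
    · subst h; simp
    · simp [h]

lemma localOp_proj (i : ℕ) (b : Bool) : LocalOp {i} (proj i b) := by
  refine ⟨fun u v => if v = u then (if (i ∈ u ↔ b = true) then 1 else 0) else 0, fun s => ?_⟩
  rw [proj, onBasis_single, Finset.sum_eq_single (s ∩ {i})]
  · simp [Finset.sdiff_union_inter]
  · intro b _ hb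
    simp [hb]
  · intro h
    exact absurd (Finset.mem_powerset.2 Finset.inter_subset_right) h

/-! ### The squared norm -/

/-- The squared norm of a vector. -/
def nsq (ψ : Ket) : ℝ := ψ.sum fun _ z => ‖z‖ ^ 2

/-- The inner product. -/
def ip (ψ φ : Ket) : ℂ := ψ.sum fun s z => star z * φ s

lemma ip_self (ψ : Ket) : ip ψ ψ = nsq ψ := by
  simp only [ip, nsq, Finsupp.sum, Complex.ofReal_sum]
  refine sum_congr rfl fun s _ => ?_
  rw [Complex.star_def, ← Complex.normSq_eq_conj_mul_self, Complex.normSq_eq_norm_sq]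

lemma ip_add_left (ψ ψ' φ : Ket) : ip (ψ + ψ') φ = ip ψ φ + ip ψ' φ := by
  rw [ip, Finsupp.sum_add_index' (by simp) (by intros; simp [add_mul])]
  rfl

lemma ip_smul_left (c : ℂ) (ψ φ : Ket) : ip (c • ψ) φ = star c * ip ψ φ := by
  rw [ip, Finsupp.sum_smul_index' (by simp), ip, Finsupp.mul_sum]
  refine Finsupp.sum_congr fun s _ => ?_
  simp [mul_assoc]

lemma ip_add_right (ψ φ φ' : Ket) : ip ψ (φ + φ') = ip ψ φ + ip ψ φ' := by
  simp [ip, mul_add, Finsupp.sum_add]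

lemma ip_smul_right (c : ℂ) (ψ φ : Ket) : ip ψ (c • φ) = c * ip ψ φ := by
  rw [ip, ip, Finsupp.mul_sum]
  refine Finsupp.sum_congr fun s _ => ?_
  simp; ring

lemma ip_single (s t : Finset ℕ) (z w : ℂ) :
    ip (single s z) (single t w) = if s = t then star z * w else 0 := by
  rw [ip, Finsupp.sum_single_index (by simp), Finsupp.single_apply]
  by_cases h : s = t <;> simp [h, eq_comm]

/-- Preservation of the inner product is checked on basis states and extended by sesquilinearity.
The gates and the renaming of qubits are all treated in this way. -/
lemma ip_map {U : Ket →ₗ[ℂ] Ket}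
    (h : ∀ s t, ip (U (single s 1)) (U (single t 1)) = if s = t then 1 else 0)
    (ψ φ : Ket) : ip (U ψ) (U φ) = ip ψ φ := by
  have z1 : ∀ φ, ip 0 φ = 0 := by simp [ip]
  have z2 : ∀ φ, ip φ 0 = 0 := by simp [ip]
  induction ψ using Finsupp.induction_linear with
  | zero => simp [z1]
  | add f g hf hg => rw [map_add, ip_add_left, hf, hg, ip_add_left]
  | single s z =>
    induction φ using Finsupp.induction_linear with
    | zero => simp [z2]
    | add f g hf hg => rw [map_add, ip_add_right, hf, hg, ip_add_right]
    | single t w =>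
      have e : ∀ (s : Finset ℕ) (z : ℂ), (single s z : Ket) = z • single s 1 := by
        simp
      rw [e s, e t, map_smul, map_smul, ip_smul_left, ip_smul_right, h, ip_smul_left,
        ip_smul_right, ip_single]
      simp

lemma nsq_map {U : Ket →ₗ[ℂ] Ket}
    (h : ∀ s t, ip (U (single s 1)) (U (single t 1)) = if s = t then 1 else 0)
    (ψ : Ket) : nsq (U ψ) = nsq ψ := by
  have := ip_map h ψ ψ
  rw [ip_self, ip_self] at this
  exact_mod_cast this

lemma nsq_nonneg (ψ : Ket) : 0 ≤ nsq ψ := Finset.sum_nonneg fun _ _ => by positivity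

lemma nsq_smul (c : ℂ) (ψ : Ket) : nsq (c • ψ) = ‖c‖ ^ 2 * nsq ψ := by
  rw [nsq, Finsupp.sum_smul_index' (by simp), nsq, Finsupp.mul_sum]
  refine Finsupp.sum_congr fun s _ => ?_
  simp [mul_pow]

/-- Pythagoras: the two outcomes have disjoint supports, so a measurement loses no weight. -/
lemma nsq_project (i : ℕ) (ψ : Ket) :
    nsq (project i false ψ) + nsq (project i true ψ) = nsq ψ := by
  have e : ψ.filter (fun s => (i ∈ s ↔ false = true)) = ψ.filter (fun s => ¬ i ∈ s) := by
    congr 1; ext s; simp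
  have e' : ψ.filter (fun s => (i ∈ s ↔ true = true)) = ψ.filter (fun s => i ∈ s) := by
    congr 1; ext s; simp
  rw [project, project, e, e']
  simp only [nsq, Finsupp.sum, Finsupp.support_filter]
  rw [add_comm, ← Finset.sum_filter_add_sum_filter_not ψ.support (fun s => i ∈ s)]
  congr 1 <;>
  · refine sum_congr rfl fun s hs => ?_
    rw [Finsupp.filter_apply_pos]
    exact (Finset.mem_filter.1 hs).2

lemma sqrt_two_inv_mul_self : (Real.sqrt 2 : ℂ)⁻¹ * (Real.sqrt 2 : ℂ)⁻¹ = 1 / 2 := by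
  rw [← mul_inv, ← Complex.ofReal_mul, Real.mul_self_sqrt (by norm_num)]
  norm_num

lemma nsq_hadamard (i : ℕ) (ψ : Ket) : nsq (hadamard i ψ) = nsq ψ := by
  refine nsq_map (fun s t => ?_) ψ
  rw [hadamard, onBasis_single, onBasis_single, ip_smul_left, ip_smul_right, ip_add_left,
    ip_add_right, ip_add_right, ip_single, ip_single, ip_single, ip_single]
  have h1 : s.erase i ≠ insert i t := fun h => by
    have := Finset.mem_insert_self i t
    rw [← h] at this
    simp at this
  have h2 : insert i s ≠ t.erase i := fun h => by
    have := Finset.mem_insert_self i s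
    rw [h] at this
    simp at this
  have h3 : s.erase i = t.erase i ↔ insert i s = insert i t := by
    constructor
    · intro h
      have e : ∀ s : Finset ℕ, insert i s = insert i (s.erase i) := by
        intro s; ext x; simp [mem_insert, Finset.mem_erase]; tauto
      rw [e, h, ← e]
    · intro h
      have e : ∀ s : Finset ℕ, s.erase i = (insert i s).erase i := by
        intro s; ext x; simp [Finset.mem_erase]
      rw [e, h, ← e]
  have h4 : s = t ↔ s.erase i = t.erase i ∧ (i ∈ s ↔ i ∈ t) := by
    constructor
    · rintro rfl; simp
    · rintro ⟨h, h'⟩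
      by_cases hi : i ∈ s
      · rw [← Finset.insert_erase hi, h, Finset.insert_erase (h'.1 hi)]
      · rwa [Finset.erase_eq_of_notMem hi, Finset.erase_eq_of_notMem (fun h => hi (h'.2 h))] at h
  have hs : star ((Real.sqrt 2 : ℂ)⁻¹) = (Real.sqrt 2 : ℂ)⁻¹ := by
    simp
  rw [hs, ← mul_assoc, sqrt_two_inv_mul_self]
  rw [if_neg h1, if_neg h2]
  simp only [← h3, h4]
  -- If `s` and `t` differ away from `i`, all overlaps vanish. Otherwise two of them survive and add
  -- up to half of 1 plus the product of the signs, which is 1 or 0 according to whether `s` and `t`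
  -- agree at `i`.
  by_cases h : s.erase i = t.erase i <;> by_cases a : i ∈ s <;> by_cases b : i ∈ t <;> simp only [h, a, b] <;> norm_num

lemma nsq_tGate (i : ℕ) (ψ : Ket) : nsq (tGate i ψ) = nsq ψ := by
  refine nsq_map (fun s t => ?_) ψ
  rw [tGate, onBasis_single, onBasis_single, ip_single]
  by_cases h : s = t
  · subst h
    by_cases hi : i ∈ s
    · simp only [hi, if_true, Complex.star_def]
      rw [← Complex.normSq_eq_conj_mul_self, Complex.normSq_eq_norm_sq]
      have : Complex.I * (Real.pi : ℂ) / 4 = ((Real.pi / 4 : ℝ) : ℂ) * Complex.I := by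
        push_cast; ring
      rw [this, Complex.norm_exp_ofReal_mul_I]
      simp
    · simp [hi]
  · simp [h]

lemma nsq_cnotGate {i j : ℕ} (hij : i ≠ j) (ψ : Ket) : nsq (cnotGate i j ψ) = nsq ψ := by
  refine nsq_map (fun s t => ?_) ψ
  rw [cnotGate, onBasis_single, onBasis_single, ip_single]
  have m : ∀ s : Finset ℕ, i ∈ (if i ∈ s then symmDiff s {j} else s) ↔ i ∈ s := by
    intro s
    split_ifs with h
    · simp [Finset.mem_symmDiff, h, hij]
    · simp [h]
  have inj : (if i ∈ s then symmDiff s {j} else s) = (if i ∈ t then symmDiff t {j} else t) ↔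
      s = t := by
    constructor
    · intro h
      have hst : i ∈ s ↔ i ∈ t := by rw [← m s, h, m t]
      by_cases hs : i ∈ s
      · rw [if_pos hs, if_pos (hst.1 hs)] at h
        exact symmDiff_left_injective _ h
      · rwa [if_neg hs, if_neg (fun h => hs (hst.2 h))] at h
    · rintro rfl; rfl
  simp [inj]

/-! ### Gates -/

inductive Gate where
  | had (i : ℕ)
  | t (i : ℕ)
  | cnot (i j : ℕ)

namespace Gate

/-- The operator of a gate; a controlled-NOT of a qubit with itself is not carried out. -/
def op : Gate → Ket →ₗ[ℂ] Ket
  | had i => hadamard i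
  | t i => tGate i
  | cnot i j => if i = j then LinearMap.id else cnotGate i j

def names : Gate → Finset ℕ
  | had i => {i}
  | t i => {i}
  | cnot i j => {i, j}

lemma localOp_op (g : Gate) : LocalOp g.names g.op := by
  cases g with
  | had i => exact localOp_hadamard i
  | t i => exact localOp_tGate i
  | cnot i j =>
    by_cases h : i = j
    · refine ⟨fun u v => if v = u then 1 else 0, fun s => ?_⟩
      rw [op, if_pos h, Finset.sum_eq_single (s ∩ {i, j})]
      · simp only [names, if_true, Finset.sdiff_union_inter]
        rfl
      · intro b _ hb
        simp [names, hb]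
      · simp [names, Finset.inter_subset_right]
    · rw [op, if_neg h]
      exact localOp_cnotGate

lemma nsq_op (g : Gate) (ψ : Ket) : nsq (g.op ψ) = nsq ψ := by
  cases g with
  | had i => exact nsq_hadamard i ψ
  | t i => exact nsq_tGate i ψ
  | cnot i j =>
    by_cases h : i = j
    · rw [op, if_pos h]; rfl
    · rw [op, if_neg h]; exact nsq_cnotGate h ψ

end Gate

/-- The vector involves only the qubits with numbers below `n`. -/
def Below (n : ℕ) (ψ : Ket) : Prop := ∀ s ∈ ψ.support, ∀ i ∈ s, i < n

lemma Below.mono {n m : ℕ} (h : n ≤ m) {ψ : Ket} (hψ : Below n ψ) : Below m ψ :=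
  fun s hs i hi => (hψ s hs i hi).trans_le h

lemma Below.localOp {n : ℕ} {S : Finset ℕ} {U : Ket →ₗ[ℂ] Ket} (hU : LocalOp S U)
    (hS : ∀ i ∈ S, i < n) {ψ : Ket} (hψ : Below n ψ) : Below n (U ψ) := by
  classical
  obtain ⟨c, hc⟩ := hU
  intro s hs i hi
  have e : U ψ = ∑ t ∈ ψ.support, ψ t • U (single t 1) := by
    conv_lhs => rw [← Finsupp.sum_single ψ, Finsupp.sum, map_sum]
    refine sum_congr rfl fun t _ => ?_
    rw [← map_smul, smul_single, smul_eq_mul, mul_one]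
  rw [e] at hs
  obtain ⟨t, ht, hs⟩ := Finset.mem_biUnion.1 (Finsupp.support_finsetSum hs)
  have hs := Finsupp.support_smul hs
  rw [hc] at hs
  obtain ⟨v, hv, hs⟩ := Finset.mem_biUnion.1 (Finsupp.support_finsetSum hs)
  have hs := Finset.mem_singleton.1 (Finsupp.support_single_subset hs)
  rw [hs] at hi
  rcases Finset.mem_union.1 hi with hi | hi
  · exact hψ t ht i (Finset.mem_sdiff.1 hi).1
  · exact hS i (Finset.mem_powerset.1 hv hi)

lemma Below.gate {n : ℕ} {g : Gate} (hg : ∀ i ∈ g.names, i < n) {ψ : Ket} (hψ : Below n ψ) :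
    Below n (g.op ψ) := hψ.localOp g.localOp_op hg

lemma Below.project {n i : ℕ} {b : Bool} {ψ : Ket} (hψ : Below n ψ) :
    Below n (project i b ψ) := fun s hs =>
  hψ s (by
    rw [QDSModel.project, Finsupp.support_filter] at hs
    exact Finset.mem_of_mem_filter s hs)

/-! ### Renaming of qubits -/

/-- Types on which the permutations of the qubit numbers act. -/
class Ren (α : Type) where
  ren : Perm ℕ → α → α

open Ren (ren)

/-- Types of classical data. -/
class ClassicalData (α : Type) extends Ren α where
  ren_eq : ∀ (π : Perm ℕ) (a : α), ren π a = a

attribute [simp] ClassicalData.ren_eq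

instance : ClassicalData Bool where
  ren _ a := a
  ren_eq _ _ := rfl
instance : ClassicalData ℕ where
  ren _ a := a
  ren_eq _ _ := rfl
instance : ClassicalData ℝ where
  ren _ a := a
  ren_eq _ _ := rfl
instance : ClassicalData Unit where
  ren _ a := a
  ren_eq _ _ := rfl

instance {α : Type} [Ren α] : Ren (List α) := ⟨fun π => List.map (ren π)⟩
instance {α : Type} [Ren α] : Ren (Option α) := ⟨fun π => Option.map (ren π)⟩
instance {α β : Type} [Ren α] [Ren β] : Ren (α × β) := ⟨fun π => Prod.map (ren π) (ren π)⟩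
instance : Ren Cell := ⟨fun π c => match c with
  | .bit b => .bit b
  | .qubit i => .qubit (π i)⟩
instance : Ren Mem := ⟨fun π μ r => ren π (μ r)⟩

@[simp] lemma ren_nil {α : Type} [Ren α] (π : Perm ℕ) : ren π ([] : List α) = [] := rfl
@[simp] lemma ren_cons {α : Type} [Ren α] (π : Perm ℕ) (a : α) (l : List α) :
    ren π (a :: l) = ren π a :: ren π l := rfl
@[simp] lemma ren_append {α : Type} [Ren α] (π : Perm ℕ) (l l' : List α) :
    ren π (l ++ l') = ren π l ++ ren π l' := List.map_append
@[simp] lemma ren_length {α : Type} [Ren α] (π : Perm ℕ) (l : List α) :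
    (ren π l).length = l.length := List.length_map _
@[simp] lemma ren_none {α : Type} [Ren α] (π : Perm ℕ) : ren π (none : Option α) = none :=
  rfl
@[simp] lemma ren_some {α : Type} [Ren α] (π : Perm ℕ) (a : α) :
    ren π (some a) = some (ren π a) := rfl
@[simp] lemma ren_mk {α β : Type} [Ren α] [Ren β] (π : Perm ℕ) (a : α) (b : β) :
    ren π (a, b) = (ren π a, ren π b) := rfl
@[simp] lemma ren_bit (π : Perm ℕ) (b : Bool) : ren π (Cell.bit b) = Cell.bit b := rfl
@[simp] lemma ren_qubit (π : Perm ℕ) (i : ℕ) : ren π (Cell.qubit i) = Cell.qubit (π i) :=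
  rfl
lemma ren_mem_apply (π : Perm ℕ) (μ : Mem) (r : ℕ) : ren π μ r = ren π (μ r) := rfl

instance {α : Type} [ClassicalData α] : ClassicalData (List α) where
  ren_eq π l := by induction l <;> simp_all
instance {α : Type} [ClassicalData α] : ClassicalData (Option α) where
  ren_eq π l := by cases l <;> simp
instance {α β : Type} [ClassicalData α] [ClassicalData β] : ClassicalData (α × β) where
  ren_eq π l := by cases l; simp

lemma ren_update (π : Perm ℕ) (μ : Mem) (r : ℕ) (l : Str) :
    ren π (update μ r l : Mem) = update (ren π μ) r (ren π l) := by
  funext s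
  rw [ren_mem_apply, update_apply, update_apply]
  split_ifs <;> rfl

@[simp] lemma ren_ofBits (π : Perm ℕ) (x : List Bool) : ren π (ofBits x) = ofBits x := by
  induction x <;> simp_all [ofBits]

@[simp] lemma toBits_ren (π : Perm ℕ) (x : Str) : toBits (ren π x) = toBits x := by
  induction x with
  | nil => rfl
  | cons c l ih => cases c <;> simp_all [toBits]

lemma ren_load (π : Perm ℕ) (xs : List Str) :
    ren π (load xs : Mem) = load (ren π xs) := by
  funext r
  rw [ren_mem_apply, load, load]
  show List.map _ _ = (List.map (ren π) xs).getD r []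
  rw [List.getD_eq_getElem?_getD, List.getD_eq_getElem?_getD, List.getElem?_map]
  cases xs[r]? <;> rfl

@[simp] lemma ren_frame (π : Perm ℕ) (x : Str) :
    ren π (frame x) = frame (ren π x) := by
  rw [frame, ren_append, frame]
  congr 1
  induction x with
  | nil => rfl
  | cons c l ih => simp_all

/-- The renaming of the qubits in a vector. -/
def kren (π : Perm ℕ) : Ket →ₗ[ℂ] Ket :=
  Finsupp.lmapDomain ℂ ℂ (Finset.map π.toEmbedding)

lemma kren_single (π : Perm ℕ) (s : Finset ℕ) (z : ℂ) :
    kren π (single s z) = single (s.map π.toEmbedding) z := by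
  simp [kren]

lemma nsq_kren (π : Perm ℕ) (ψ : Ket) : nsq (kren π ψ) = nsq ψ := by
  refine nsq_map (fun s t => ?_) ψ
  rw [kren_single, kren_single, ip_single]
  simp

lemma kren_of_below {n : ℕ} {π : Perm ℕ} (hπ : ∀ i < n, π i = i) {ψ : Ket}
    (hψ : Below n ψ) : kren π ψ = ψ := by
  conv_lhs => rw [← Finsupp.sum_single ψ, Finsupp.sum, map_sum]
  conv_rhs => rw [← Finsupp.sum_single ψ, Finsupp.sum]
  refine sum_congr rfl fun s hs => ?_
  rw [kren_single]
  congr 1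
  ext x
  simp only [Finset.mem_map, Equiv.coe_toEmbedding]
  constructor
  · rintro ⟨y, hy, rfl⟩
    rwa [hπ y (hψ s hs y hy)]
  · intro hx
    exact ⟨x, hx, hπ x (hψ s hs x hx)⟩

lemma kren_intertwine {π : Perm ℕ} {U V : Ket →ₗ[ℂ] Ket}
    (h : ∀ s : Finset ℕ, U (single (s.map π.toEmbedding) 1) =
      kren π (V (single s 1))) (ψ : Ket) : U (kren π ψ) = kren π (V ψ) := by
  suffices U ∘ₗ kren π = kren π ∘ₗ V from LinearMap.congr_fun this ψ
  refine Finsupp.lhom_ext' fun s => LinearMap.ext_ring ?_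
  simp only [LinearMap.comp_apply, Finsupp.lsingle_apply]
  rw [kren_single, h]

lemma project_kren (π : Perm ℕ) (i : ℕ) (b : Bool) (ψ : Ket) :
    project (π i) b (kren π ψ) = kren π (project i b ψ) := by
  rw [project_eq_proj, project_eq_proj]
  refine kren_intertwine (fun s => ?_) ψ
  rw [proj, proj, onBasis_single, onBasis_single, kren_single]
  congr 1
  simp

namespace Gate

def ren (π : Perm ℕ) : Gate → Gate
  | had i => had (π i)
  | t i => t (π i)
  | cnot i j => cnot (π i) (π j)

lemma op_ren (π : Perm ℕ) (g : Gate) (ψ : Ket) :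
    (g.ren π).op (kren π ψ) = kren π (g.op ψ) := by
  refine kren_intertwine (fun s => ?_) ψ
  cases g with
  | had i =>
    simp only [ren, op, hadamard]
    rw [onBasis_single, onBasis_single, map_smul, map_add, kren_single, kren_single,
      Finset.map_erase, Finset.map_insert]
    simp
  | t i =>
    simp only [ren, op, tGate]
    rw [onBasis_single, onBasis_single, kren_single]
    simp
  | cnot i j =>
    simp only [ren, op, π.injective.eq_iff]
    by_cases h : i = j
    · simp [h, kren_single]
    · simp only [h, if_false, cnotGate]
      rw [onBasis_single, onBasis_single, kren_single]
      congr 1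
      simp only [Finset.mem_map_equiv, Equiv.symm_apply_apply]
      by_cases hs : i ∈ s
      · rw [if_pos hs, if_pos hs]
        ext x
        simp only [Finset.mem_symmDiff, Finset.mem_map_equiv, Finset.mem_singleton,
          Equiv.symm_apply_eq]
      · rw [if_neg hs, if_neg hs]

end Gate

/-! ### Computation trees -/

/-- Computations, before qubit numbers are chosen and measurement outcomes are drawn. -/
inductive Tree (α : Type) : Type where
  | ret (a : α)
  | alloc (k : ℕ → Tree α)
  | gate (g : Gate) (k : Tree α)
  | meas (i : ℕ) (k : Bool → Tree α)

namespace Tree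

variable {α β γ : Type}

def bind : Tree α → (α → Tree β) → Tree β
  | ret a, f => f a
  | alloc k, f => alloc fun i => (k i).bind f
  | gate g k, f => gate g (k.bind f)
  | meas i k, f => meas i fun b => (k b).bind f

instance : Monad Tree where
  pure := ret
  bind := bind

@[simp] lemma ret_bind (a : α) (f : α → Tree β) : ret a >>= f = f a := rfl
@[simp] lemma alloc_bind (k : ℕ → Tree α) (f : α → Tree β) :
    alloc k >>= f = alloc fun i => k i >>= f := rfl
@[simp] lemma gate_bind (g : Gate) (k : Tree α) (f : α → Tree β) :
    gate g k >>= f = gate g (k >>= f) := rfl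
@[simp] lemma meas_bind (i : ℕ) (k : Bool → Tree α) (f : α → Tree β) :
    meas i k >>= f = meas i fun b => k b >>= f := rfl

lemma bind_ret (t : Tree α) : t >>= ret = t := by
  induction t with
  | ret a => rfl
  | alloc k ih => simp [ih]
  | gate g k ih => simp [ih]
  | meas i k ih => simp [ih]

lemma bind_bind (t : Tree α) (f : α → Tree β) (g : β → Tree γ) :
    t >>= f >>= g = t >>= fun a => f a >>= g := by
  induction t with
  | ret a => rfl
  | alloc k ih => simp [ih]
  | gate g k ih => simp [ih]
  | meas i k ih => simp [ih]

instance : LawfulMonad Tree := LawfulMonad.mk' _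
  (id_map := bind_ret)
  (pure_bind := fun _ _ => rfl)
  (bind_assoc := bind_bind)

/-- The renaming of the qubits in a computation. -/
def renTree [Ren α] (π : Perm ℕ) : Tree α → Tree α
  | ret a => ret (ren π a)
  -- The name drawn here is a new one; it is translated back before it enters the old continuation,
  -- and the result is renamed again.
  | alloc k => alloc fun i => (k (π.symm i)).renTree π
  | gate g k => gate (g.ren π) (k.renTree π)
  | meas i k => meas (π i) fun b => (k b).renTree π

instance [Ren α] : Ren (Tree α) := ⟨renTree⟩

@[simp] lemma ren_ret [Ren α] (π : Perm ℕ) (a : α) : ren π (ret a) = ret (ren π a) := rfl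
@[simp] lemma ren_pure [Ren α] (π : Perm ℕ) (a : α) :
    ren π (pure a : Tree α) = pure (ren π a) := rfl
lemma ren_alloc [Ren α] (π : Perm ℕ) (k : ℕ → Tree α) :
    ren π (alloc k) = alloc fun i => ren π (k (π.symm i)) := rfl
lemma ren_gate [Ren α] (π : Perm ℕ) (g : Gate) (k : Tree α) :
    ren π (gate g k) = gate (g.ren π) (ren π k) := rfl
lemma ren_meas [Ren α] (π : Perm ℕ) (i : ℕ) (k : Bool → Tree α) :
    ren π (meas i k) = meas (π i) fun b => ren π (k b) := rfl

/-- The continuation may mention qubits besides those in its argument, and `π` renames these too;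
hence two functions `f` and `g`. -/
lemma ren_bind [Ren α] [Ren β] {π : Perm ℕ} (t : Tree α) {f g : α → Tree β}
    (h : ∀ a, ren π (f a) = g (ren π a)) : ren π (t >>= f) = ren π t >>= g := by
  induction t with
  | ret a => exact h a
  | alloc k ih => simp only [alloc_bind, ren_alloc, ih]
  | gate g k ih => simp only [gate_bind, ren_gate, ih]
  | meas i k ih => simp only [meas_bind, ren_meas, ih]

end Tree

/-- `x` involves only the qubits in `S`. -/
def Supp {α : Type} [Ren α] (S : Finset ℕ) (x : α) : Prop :=
  ∀ π : Perm ℕ, (∀ i ∈ S, π i = i) → ren π x = x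

namespace Supp

variable {α β : Type} [Ren α] [Ren β] {S T : Finset ℕ}

lemma mono {x : α} (h : Supp S x) (hST : S ⊆ T) : Supp T x := fun π hπ =>
  h π fun i hi => hπ i (hST hi)

lemma ret {a : α} (h : Supp S (Tree.ret a)) : Supp S a := fun π hπ => by
  have := h π hπ
  rw [Tree.ren_ret] at this
  injection this

lemma alloc_ren {k : ℕ → Tree α} (h : Supp S (Tree.alloc k)) {π : Perm ℕ}
    (hπ : ∀ i ∈ S, π i = i) (i : ℕ) : ren π (k i) = k (π i) := by
  have := h π hπ
  rw [Tree.ren_alloc] at this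
  injection this with this
  have := congrFun this (π i)
  simpa using this

lemma alloc {k : ℕ → Tree α} (h : Supp S (Tree.alloc k)) (i : ℕ) : Supp (insert i S) (k i) :=
  fun π hπ => by
    rw [h.alloc_ren (fun j hj => hπ j (Finset.mem_insert_of_mem hj)),
      hπ i (Finset.mem_insert_self i S)]

lemma gate {g : Gate} {k : Tree α} (h : Supp S (Tree.gate g k)) : Supp S k := fun π hπ => by
  have := h π hπ
  rw [Tree.ren_gate] at this
  injection this

/-- If the gate touched some `i` outside `S`, exchanging `i` with another qubit outside `S` would
fix `S` pointwise but alter the gate. -/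
lemma gate_names {g : Gate} {k : Tree α} (h : Supp S (Tree.gate g k)) : g.names ⊆ S := by
  intro i hi
  by_contra hS
  obtain ⟨j, hj⟩ := Infinite.exists_notMem_finset (insert i S)
  rw [mem_insert, not_or] at hj
  have := h (Equiv.swap i j) (fun x hx => Equiv.swap_apply_of_ne_of_ne
    (fun h => hS (h ▸ hx)) (fun h => hj.2 (h ▸ hx)))
  rw [Tree.ren_gate] at this
  injection this with this
  have key : Equiv.swap i j i ≠ i := by
    rw [Equiv.swap_apply_left]; exact hj.1
  cases g with
  | had l =>
    obtain rfl := Finset.mem_singleton.1 hi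
    exact key (by injection this)
  | t l =>
    obtain rfl := Finset.mem_singleton.1 hi
    exact key (by injection this)
  | cnot l l' =>
    rw [Gate.names, mem_insert, Finset.mem_singleton] at hi
    injection this with h1 h2
    rcases hi with rfl | rfl
    · exact key h1
    · exact key h2

lemma meas {i : ℕ} {k : Bool → Tree α} (h : Supp S (Tree.meas i k)) (b : Bool) :
    Supp S (k b) := fun π hπ => by
  have := h π hπ
  rw [Tree.ren_meas] at this
  injection this with _ this
  exact congrFun this b

lemma meas_mem {i : ℕ} {k : Bool → Tree α} (h : Supp S (Tree.meas i k)) : i ∈ S := by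
  by_contra hS
  obtain ⟨j, hj⟩ := Infinite.exists_notMem_finset (insert i S)
  rw [mem_insert, not_or] at hj
  have := h (Equiv.swap i j) (fun x hx => Equiv.swap_apply_of_ne_of_ne
    (fun h => hS (h ▸ hx)) (fun h => hj.2 (h ▸ hx)))
  rw [Tree.ren_meas] at this
  injection this with this
  rw [Equiv.swap_apply_left] at this
  exact hj.1 this

lemma bind {t : Tree α} {f : α → Tree β} (h : Supp S t)
    (hf : ∀ π : Perm ℕ, (∀ i ∈ S, π i = i) → ∀ a, ren π (f a) = f (ren π a)) :
    Supp S (t >>= f) := fun π hπ => by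
  rw [Tree.ren_bind t (hf π hπ), h π hπ]

end Supp

/-! ### The value of a computation -/

/-- The expectation of the result. -/
def acc : Tree ℝ → ℕ → Ket → ℝ
  | .ret x, _, ψ => x * nsq ψ
  | .alloc k, n, ψ => acc (k n) (n + 1) ψ
  | .gate g k, n, ψ => acc k n (g.op ψ)
  | .meas i k, n, ψ => acc (k false) n (project i false ψ) + acc (k true) n (project i true ψ)

/-- The permutation may move only numbers that are in use, so that fresh qubits receive the same
names on both sides. -/
lemma acc_ren {π : Perm ℕ} (t : Tree ℝ) {n : ℕ} (hπ : ∀ i, n ≤ i → π i = i) (ψ : Ket) :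
    acc (ren π t) n (kren π ψ) = acc t n ψ := by
  induction t generalizing n ψ with
  | ret x => simp [acc, nsq_kren]
  | alloc k ih =>
    have : π.symm n = n := by rw [Equiv.symm_apply_eq, hπ n le_rfl]
    simp only [Tree.ren_alloc, acc, this]
    exact ih n (fun i hi => hπ i (by omega)) ψ
  | gate g k ih =>
    simp only [Tree.ren_gate, acc, Gate.op_ren]
    exact ih hπ _
  | meas i k ih =>
    simp only [Tree.ren_meas, acc, project_kren, ih _ hπ]

variable {α β : Type}

/-- Gates are isometries and the two outcomes of a measurement share the weight, so a computation
with an ignored result multiplies by 1. -/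
lemma acc_bind_ret_const (t : Tree α) (x : ℝ) (n : ℕ) (ψ : Ket) :
    acc (t >>= fun _ => .ret x) n ψ = x * nsq ψ := by
  induction t generalizing n ψ with
  | ret a => rfl
  | alloc k ih => simp only [Tree.alloc_bind, acc, ih]
  | gate g k ih => simp only [Tree.gate_bind, acc, ih, Gate.nsq_op]
  | meas i k ih => simp only [Tree.meas_bind, acc, ih, ← mul_add, nsq_project]

section swap

variable [Ren α] [Ren β]

/-- The gate commutes with every operator in `t` by `LocalOp.commute`; qubits that `t` allocates
have numbers from `n` on and avoid the gate. -/
lemma acc_gate_past (t : Tree β) (f : β → Tree ℝ) (g : Gate) {n : ℕ} {S : Finset ℕ}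
    (ht : Supp S t) (hS : ∀ i ∈ S, i < n) (hg : ∀ i ∈ g.names, i < n) (hd : Disjoint g.names S)
    (ψ : Ket) :
    acc (t >>= f) n (g.op ψ) = acc (t >>= fun b => .gate g (f b)) n ψ := by
  induction t generalizing n ψ S with
  | ret a => rfl
  | alloc k ih =>
    simp only [Tree.alloc_bind, acc]
    refine ih n (ht.alloc n) ?_ ?_ ?_ ψ
    · intro i hi
      rcases Finset.mem_insert.1 hi with rfl | hi
      · omega
      · have := hS i hi; omega
    · intro i hi
      have := hg i hi; omega
    · rw [Finset.disjoint_insert_right]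
      exact ⟨fun h => lt_irrefl _ (hg n h), hd⟩
  | gate g' k ih =>
    simp only [Tree.gate_bind, acc]
    rw [← ih ht.gate hS hg hd, g'.localOp_op.commute g.localOp_op
      (hd.symm.mono_left ht.gate_names)]
  | meas i k ih =>
    simp only [Tree.meas_bind, acc]
    have : Disjoint {i} g.names := hd.symm.mono_left (Finset.singleton_subset_iff.2 ht.meas_mem)
    simp only [← ih _ (ht.meas _) hS hg hd, project_eq_proj,
      (localOp_proj i _).commute g.localOp_op this]

/-- The two outcomes of the earlier measurement run through `t` separately and are collected again
behind it. Each projection is local and commutes with the steps of `t`. -/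
lemma acc_meas_past (t : Tree β) (f : Bool → β → Tree ℝ) {j n : ℕ} {S : Finset ℕ}
    (ht : Supp S t) (hS : ∀ i ∈ S, i < n) (hj : j < n) (hd : j ∉ S) (ψ : Ket) :
    acc (t >>= f false) n (project j false ψ) + acc (t >>= f true) n (project j true ψ) =
      acc (t >>= fun x => .meas j fun b => f b x) n ψ := by
  induction t generalizing n ψ S with
  | ret a => rfl
  | alloc k ih =>
    simp only [Tree.alloc_bind, acc]
    refine ih n (ht.alloc n) ?_ (by omega) ?_ ψ
    · intro i hi
      rcases Finset.mem_insert.1 hi with rfl | hi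
      · omega
      · have := hS i hi; omega
    · rw [mem_insert, not_or]
      exact ⟨by omega, hd⟩
  | gate g' k ih =>
    simp only [Tree.gate_bind, acc]
    have : Disjoint g'.names {j} :=
      Finset.disjoint_singleton_right.2 fun h => hd (ht.gate_names h)
    rw [← ih ht.gate hS hj hd]
    simp only [project_eq_proj, g'.localOp_op.commute (localOp_proj j _) this]
  | meas i k ih =>
    simp only [Tree.meas_bind, acc]
    have : Disjoint {i} ({j} : Finset ℕ) := by
      rw [Finset.disjoint_singleton]
      rintro rfl
      exact hd ht.meas_mem
    simp only [← ih _ (ht.meas _) hS hj hd, project_eq_proj,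
      (localOp_proj i _).commute (localOp_proj j _) this]
    ring

/-- Only names differ. If the qubit is allocated first, it has number `n` and those of `t` follow.
Each allocation in `t` is exchanged with it by the transposition of `n` and `n + 1`, which fixes
everything that existed before. -/
lemma acc_alloc_past (t : Tree β) (f : β → ℕ → Tree ℝ) {n : ℕ} {S : Finset ℕ}
    (ht : Supp S t) (hS : ∀ i ∈ S, i < n)
    (hf : ∀ π : Perm ℕ, (∀ i < n, π i = i) → ∀ b i, ren π (f b i) = f (ren π b) (π i))
    {ψ : Ket} (hψ : Below n ψ) :
    acc (t >>= fun b => f b n) (n + 1) ψ = acc (t >>= fun b => .alloc (f b)) n ψ := by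
  induction t generalizing n ψ S with
  | ret a => rfl
  | alloc k ih =>
    simp only [Tree.alloc_bind, acc]
    rw [← ih n (ht.alloc n) _ (fun π hπ => hf π fun i hi => hπ i (by omega))
      (hψ.mono (Nat.le_succ n))]
    · rw [← acc_ren (π := Equiv.swap n (n + 1)) (k n >>= fun b => f b (n + 1))]
      · have hπ : ∀ i < n, Equiv.swap n (n + 1) i = i := fun i hi =>
          Equiv.swap_apply_of_ne_of_ne (by omega) (by omega)
        rw [kren_of_below hπ hψ, Tree.ren_bind (g := fun b => f b n) _ (fun a => by
          rw [hf _ hπ, Equiv.swap_apply_right]), ht.alloc_ren (fun i hi => hπ i (hS i hi)),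
          Equiv.swap_apply_left]
      · exact fun i hi => Equiv.swap_apply_of_ne_of_ne (by omega) (by omega)
    · intro i hi
      rcases Finset.mem_insert.1 hi with rfl | hi
      · omega
      · have := hS i hi; omega
  | gate g k ih =>
    simp only [Tree.gate_bind, acc]
    exact ih ht.gate hS hf (hψ.gate fun i hi => hS i (ht.gate_names hi))
  | meas i k ih =>
    simp only [Tree.meas_bind, acc]
    rw [ih _ (ht.meas _) hS hf hψ.project, ih _ (ht.meas _) hS hf hψ.project]

/-- Computations on disjoint sets of qubits commute. -/
lemma acc_swap (t1 : Tree α) (t2 : Tree β) (f : α → β → Tree ℝ) {n : ℕ} {S1 S2 : Finset ℕ}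
    (h1 : Supp S1 t1) (h2 : Supp S2 t2) (hS1 : ∀ i ∈ S1, i < n) (hS2 : ∀ i ∈ S2, i < n)
    (hd : Disjoint S1 S2)
    (hf : ∀ π : Perm ℕ, (∀ i < n, π i = i) → ∀ a b, ren π (f a b) = f (ren π a) (ren π b))
    {ψ : Ket} (hψ : Below n ψ) :
    acc (t1 >>= fun a => t2 >>= fun b => f a b) n ψ =
      acc (t2 >>= fun b => t1 >>= fun a => f a b) n ψ := by
  induction t1 generalizing n ψ S1 with
  | ret a => rfl
  | alloc k ih =>
    simp only [Tree.alloc_bind, acc]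
    -- The rest of `t1` is moved behind `t2` by induction; what remains is to move its single first
    -- step.
    rw [ih n (h1.alloc n) (fun i hi => by
      rcases Finset.mem_insert.1 hi with rfl | hi
      · omega
      · have := hS1 i hi; omega) (fun i hi => by have := hS2 i hi; omega)
      (by rw [Finset.disjoint_insert_left]; exact ⟨fun h => lt_irrefl _ (hS2 n h), hd⟩)
      (fun π hπ => hf π fun i hi => hπ i (by omega)) (hψ.mono (Nat.le_succ n))]
    refine acc_alloc_past t2 (fun b i => k i >>= fun a => f a b) h2 hS2 (fun π hπ b i => ?_) hψ
    rw [← h1.alloc_ren (fun i hi => hπ i (hS1 i hi))]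
    exact Tree.ren_bind _ fun a => hf π hπ a b
  | gate g k ih =>
    simp only [Tree.gate_bind, acc]
    have hg : ∀ i ∈ g.names, i < n := fun i hi => hS1 i (h1.gate_names hi)
    rw [ih h1.gate hS1 hS2 hd hf (hψ.gate hg)]
    exact acc_gate_past t2 _ g h2 hS2 hg (hd.mono_left h1.gate_names) ψ
  | meas i k ih =>
    simp only [Tree.meas_bind, acc]
    rw [ih _ (h1.meas _) hS1 hS2 hd hf hψ.project, ih _ (h1.meas _) hS1 hS2 hd hf hψ.project]
    exact acc_meas_past t2 (fun b x => k b >>= fun a => f a x) h2 hS2 (hS1 i h1.meas_mem)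
      (Finset.disjoint_left.1 hd h1.meas_mem) ψ

end swap

open ClassicalData (ren_eq)

/-! ### Comparison of computations -/

variable {α β γ : Type}

/-- `t` has at most the expectation of `t'`, in all situations with at least `n` used qubits. -/
def AccLe (n : ℕ) (t t' : Tree ℝ) : Prop :=
  ∀ m, n ≤ m → ∀ ψ, Below m ψ → acc t m ψ ≤ acc t' m ψ

/-- `t` has the expectation of `t'`, in all situations with at least `n` used qubits. -/
def AccEq (n : ℕ) (t t' : Tree ℝ) : Prop :=
  ∀ m, n ≤ m → ∀ ψ, Below m ψ → acc t m ψ = acc t' m ψ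

lemma AccEq.refl (n : ℕ) (t : Tree ℝ) : AccEq n t t := fun _ _ _ _ => rfl
lemma AccEq.symm {n : ℕ} {t t' : Tree ℝ} (h : AccEq n t t') : AccEq n t' t :=
  fun m hm ψ hψ => (h m hm ψ hψ).symm
lemma AccEq.trans {n : ℕ} {t t' t'' : Tree ℝ} (h : AccEq n t t') (h' : AccEq n t' t'') :
    AccEq n t t'' := fun m hm ψ hψ => (h m hm ψ hψ).trans (h' m hm ψ hψ)
lemma AccEq.le {n : ℕ} {t t' : Tree ℝ} (h : AccEq n t t') : AccLe n t t' :=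
  fun m hm ψ hψ => (h m hm ψ hψ).le
lemma AccLe.refl (n : ℕ) (t : Tree ℝ) : AccLe n t t := fun _ _ _ _ => le_rfl
lemma AccLe.trans {n : ℕ} {t t' t'' : Tree ℝ} (h : AccLe n t t') (h' : AccLe n t' t'') :
    AccLe n t t'' := fun m hm ψ hψ => (h m hm ψ hψ).trans (h' m hm ψ hψ)
lemma AccLe.antisymm {n : ℕ} {t t' : Tree ℝ} (h : AccLe n t t') (h' : AccLe n t' t) :
    AccEq n t t' := fun m hm ψ hψ => (h m hm ψ hψ).antisymm (h' m hm ψ hψ)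

/-- All results of `t` satisfy `Q`. -/
def Tree.Ev (Q : α → Prop) : Tree α → Prop
  | .ret a => Q a
  | .alloc k => ∀ i, (k i).Ev Q
  | .gate _ k => k.Ev Q
  | .meas _ k => ∀ b, (k b).Ev Q

lemma Tree.Ev.bind {Q : α → Prop} {Q' : β → Prop} {t : Tree α} {f : α → Tree β} (h : t.Ev Q)
    (hf : ∀ a, Q a → (f a).Ev Q') : (t >>= f).Ev Q' := by
  induction t with
  | ret a => exact hf a h
  | alloc k ih => exact fun i => ih i (h i)
  | gate g k ih => exact ih h
  | meas i k ih => exact fun b => ih b (h b)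

lemma Tree.ev_true (t : Tree α) : t.Ev fun _ => True := by
  induction t with
  | ret a => trivial
  | alloc k ih => exact ih
  | gate g k ih => exact ih
  | meas i k ih => exact ih

/-- The prefix may allocate qubits, so the continuations have to be compared at every later stage
`m`, and only for results that involve qubits existing by then. -/
lemma AccLe.bind_of_ev [Ren α] {n : ℕ} {t : Tree α} {f g : α → Tree ℝ} {Q : α → Prop}
    (ht : Supp (range n) t) (hQ : t.Ev Q)
    (h : ∀ m, n ≤ m → ∀ a, Q a → Supp (range m) a → AccLe m (f a) (g a)) :
    AccLe n (t >>= f) (t >>= g) := by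
  intro m hm ψ hψ
  replace ht := ht.mono (range_mono hm)
  replace h := fun l (hl : m ≤ l) => h l (hm.trans hl)
  clear hm n
  induction t generalizing m ψ with
  | ret a => exact h m le_rfl a hQ ht.ret m le_rfl ψ hψ
  | alloc k ih =>
    simp only [Tree.alloc_bind, acc]
    refine ih m (hQ m) (m + 1) ψ (hψ.mono (by omega)) ?_ fun l hl => h l (by omega)
    rw [Finset.range_add_one]
    exact ht.alloc m
  | gate g k ih =>
    simp only [Tree.gate_bind, acc]
    exact ih hQ m _ (hψ.gate fun i hi => Finset.mem_range.1 (ht.gate_names hi)) ht.gate h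
  | meas i k ih =>
    simp only [Tree.meas_bind, acc]
    exact add_le_add (ih _ (hQ _) m _ hψ.project (ht.meas _) h)
      (ih _ (hQ _) m _ hψ.project (ht.meas _) h)

lemma AccLe.bind [Ren α] {n : ℕ} {t : Tree α} {f g : α → Tree ℝ}
    (ht : Supp (range n) t)
    (h : ∀ m, n ≤ m → ∀ a, Supp (range m) a → AccLe m (f a) (g a)) :
    AccLe n (t >>= f) (t >>= g) :=
  AccLe.bind_of_ev ht t.ev_true fun m hm a _ => h m hm a

lemma AccEq.bind_of_ev [Ren α] {n : ℕ} {t : Tree α} {f g : α → Tree ℝ} {Q : α → Prop}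
    (ht : Supp (range n) t) (hQ : t.Ev Q)
    (h : ∀ m, n ≤ m → ∀ a, Q a → Supp (range m) a → AccEq m (f a) (g a)) :
    AccEq n (t >>= f) (t >>= g) :=
  (AccLe.bind_of_ev ht hQ fun m hm a hQ ha => (h m hm a hQ ha).le).antisymm
    (AccLe.bind_of_ev ht hQ fun m hm a hQ ha => (h m hm a hQ ha).symm.le)

lemma AccEq.bind [Ren α] {n : ℕ} {t : Tree α} {f g : α → Tree ℝ}
    (ht : Supp (range n) t)
    (h : ∀ m, n ≤ m → ∀ a, Supp (range m) a → AccEq m (f a) (g a)) :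
    AccEq n (t >>= f) (t >>= g) :=
  AccEq.bind_of_ev ht t.ev_true fun m hm a _ => h m hm a

lemma Supp.range_of_closed [Ren α] {x : α} (h : Supp ∅ x) (n : ℕ) : Supp (range n) x :=
  h.mono (Finset.empty_subset _)

/-- Computations that use only qubits of their own commute with all others. -/
lemma AccEq.swap [Ren α] [Ren β] {n : ℕ} {t1 : Tree α} {t2 : Tree β} {f : α → β → Tree ℝ}
    (h1 : Supp ∅ t1) (h2 : Supp (range n) t2)
    (hf : ∀ π : Perm ℕ, (∀ i < n, π i = i) →
      ∀ a b, ren π (f a b) = f (ren π a) (ren π b)) :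
    AccEq n (t1 >>= fun a => t2 >>= fun b => f a b) (t2 >>= fun b => t1 >>= fun a => f a b) :=
  fun m hm ψ hψ => acc_swap t1 t2 f h1 h2 (by simp)
    (fun i hi => (Finset.mem_range.1 hi).trans_le hm) (by simp)
    (fun π hπ => hf π fun i hi => hπ i (hi.trans_le hm)) hψ

/-- Computations on other qubits do not matter. -/
lemma AccEq.discard [Ren α] {n : ℕ} {t : Tree α} {f : Tree ℝ} (ht : Supp ∅ t)
    (hf : Supp (range n) f) : AccEq n (t >>= fun _ => f) f := by
  -- A trivial last step is split off from `f`, so that `t` can be swapped behind the rest of `f`;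
  -- there its result is ignored and only its total weight 1 remains.
  have e : f = f >>= fun x => .ret x := (Tree.bind_ret f).symm
  have h := AccEq.swap (f := fun _ x => Tree.ret x) ht hf (fun π _ a b => rfl)
  rw [← e] at h
  refine h.trans ?_
  conv_rhs => rw [e]
  exact AccEq.bind hf fun m _ x _ l _ ψ _ => acc_bind_ret_const t x l ψ

/-- Linearity of expectation, the source of all union bounds below. -/
lemma acc_bind_sum {ι : Type} (s : Finset ι) (t : Tree α) {f : α → Tree ℝ}
    {g : ι → α → Tree ℝ}
    (h : ∀ a n ψ, acc (f a) n ψ = ∑ i ∈ s, acc (g i a) n ψ) (n : ℕ) (ψ : Ket) :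
    acc (t >>= f) n ψ = ∑ i ∈ s, acc (t >>= g i) n ψ := by
  induction t generalizing n ψ with
  | ret a => exact h a n ψ
  | alloc k ih => simp only [Tree.alloc_bind, acc, ih]
  | gate g k ih => simp only [Tree.gate_bind, acc, ih]
  | meas i k ih => simp only [Tree.meas_bind, acc, ih, Finset.sum_add_distrib]

lemma acc_bind_mul (c : ℝ) (t : Tree ℝ) (n : ℕ) (ψ : Ket) :
    acc (t >>= fun x => .ret (c * x)) n ψ = c * acc t n ψ := by
  induction t generalizing n ψ with
  | ret a => simp only [Tree.ret_bind, acc]; ring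
  | alloc k ih => simp only [Tree.alloc_bind, acc, ih]
  | gate g k ih => simp only [Tree.gate_bind, acc, ih]
  | meas i k ih => simp only [Tree.meas_bind, acc, ih]; ring

lemma acc_mono (t : Tree α) {f g : α → Tree ℝ} (h : ∀ a n ψ, acc (f a) n ψ ≤ acc (g a) n ψ)
    (n : ℕ) (ψ : Ket) : acc (t >>= f) n ψ ≤ acc (t >>= g) n ψ := by
  induction t generalizing n ψ with
  | ret a => exact h a n ψ
  | alloc k ih => exact ih _ _ _
  | gate g k ih => exact ih _ _
  | meas i k ih => exact add_le_add (ih _ _ _) (ih _ _ _)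

/-- A computation whose results all have the same value. -/
lemma acc_bind_of_const (t : Tree α) {f : α → Tree ℝ} {x : ℝ}
    (h : ∀ a n ψ, acc (f a) n ψ = x * nsq ψ) (n : ℕ) (ψ : Ket) :
    acc (t >>= f) n ψ = x * nsq ψ := by
  have e := acc_bind_ret_const t x n ψ
  refine le_antisymm (e ▸ acc_mono t (fun a n ψ => ?_) n ψ) (e ▸ acc_mono t (fun a n ψ => ?_) n ψ)
  · exact (h a n ψ).le
  · exact (h a n ψ).ge

lemma acc_nonneg {t : Tree ℝ} (h : t.Ev fun x => 0 ≤ x) (n : ℕ) (ψ : Ket) : 0 ≤ acc t n ψ := by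
  induction t generalizing n ψ with
  | ret x => exact mul_nonneg h (nsq_nonneg ψ)
  | alloc k ih => exact ih _ (h _) _ _
  | gate g k ih => exact ih h _ _
  | meas i k ih => exact add_nonneg (ih _ (h _) _ _) (ih _ (h _) _ _)

/-! ### Coins -/

/-- A random bit. -/
def coin : Tree Bool := .alloc fun i => .gate (.had i) (.meas i .ret)

lemma supp_coin : Supp ∅ coin := fun π _ => by
  simp only [coin, Tree.ren_alloc, Tree.ren_gate, Tree.ren_meas, Tree.ren_ret, Gate.ren,
    Equiv.apply_symm_apply, ren_eq]

lemma project_false_hadamard {n : ℕ} {ψ : Ket} (hψ : Below n ψ) :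
    project n false (hadamard n ψ) = (Real.sqrt 2 : ℂ)⁻¹ • ψ := by
  conv_lhs => rw [← Finsupp.sum_single ψ, Finsupp.sum, project_eq_proj, map_sum, map_sum]
  conv_rhs => rw [← Finsupp.sum_single ψ, Finsupp.sum, Finset.smul_sum]
  refine sum_congr rfl fun s hs => ?_
  have hn : n ∉ s := fun h => lt_irrefl _ (hψ s hs n h)
  have e : (single s (ψ s) : Ket) = ψ s • single s 1 := by simp
  rw [e, map_smul, map_smul, hadamard, onBasis_single, map_smul, map_add, proj, onBasis_single,
    if_neg hn, onBasis_single, Finset.erase_eq_of_notMem hn, smul_comm]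
  simp [hn]

lemma acc_coin_ret (y : Bool → ℝ) {n : ℕ} {ψ : Ket} (hψ : Below n ψ) :
    acc (coin >>= fun b => .ret (y b)) n ψ = (y false + y true) / 2 * nsq ψ := by
  simp only [coin, Tree.alloc_bind, Tree.gate_bind, Tree.meas_bind, Tree.ret_bind, acc, Gate.op]
  have h1 : nsq (project n false (hadamard n ψ)) = nsq ψ / 2 := by
    rw [project_false_hadamard hψ, nsq_smul, norm_inv, Complex.norm_real, Real.norm_eq_abs,
      abs_of_nonneg (Real.sqrt_nonneg 2), inv_pow, Real.sq_sqrt (by norm_num)]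
    ring
  have h2 := nsq_project n (hadamard n ψ)
  rw [nsq_hadamard, h1] at h2
  have h3 : nsq (project n true (hadamard n ψ)) = nsq ψ / 2 := by linarith
  rw [h1, h3]
  ring

/-- The measured qubit stays in the supply, so after the toss the continuation does not start from
`ψ`. The case distinction on the outcome is written as a sum, and in each summand the toss is
swapped behind the continuation, where only its probabilities matter. -/
lemma acc_coin {f : Bool → Tree ℝ} {n : ℕ} (hf : ∀ b, Supp (range n) (f b)) {m : ℕ}
    (hm : n ≤ m) {ψ : Ket} (hψ : Below m ψ) :
    acc (coin >>= f) m ψ = (acc (f false) m ψ + acc (f true) m ψ) / 2 := by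
  rw [acc_bind_sum (Finset.univ : Finset Bool) coin
    (g := fun b0 b => f b0 >>= fun x => .ret (if b = b0 then x else 0))]
  · have : ∀ b0, acc (coin >>= fun b => f b0 >>= fun x => .ret (if b = b0 then x else 0)) m ψ =
        acc (f b0) m ψ / 2 := by
      intro b0
      rw [AccEq.swap (f := fun b x => Tree.ret (if b = b0 then x else 0)) supp_coin (hf b0)
        (fun π _ a b => rfl) m hm ψ hψ]
      have := (AccEq.bind (n := n) (t := f b0) (f := fun x => coin >>= fun b =>
        .ret (if b = b0 then x else 0)) (g := fun x => .ret (1 / 2 * x)) (hf b0)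
        (fun m _ x _ l _ ψ hψ => by
          rw [acc_coin_ret _ hψ, acc]
          cases b0 <;> norm_num <;> ring_nf <;> simp)) m hm ψ hψ
      rw [this, acc_bind_mul]
      ring
    rw [Fintype.sum_bool, this, this]
    ring
  · intro b n ψ
    cases b <;> simp [Tree.bind_ret, acc_bind_ret_const]

/-! ### Trees as computations -/

/-- Run a computation tree. -/
def interp : Tree α → Comp α
  | .ret a => fun h => [(a, h)]
  | .alloc k => fun h => interp (k h.next) ⟨h.next + 1, h.ket⟩
  | .gate g k => fun h => interp k ⟨h.next, g.op h.ket⟩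
  | .meas i k => fun h => interp (k false) ⟨h.next, project i false h.ket⟩ ++
      interp (k true) ⟨h.next, project i true h.ket⟩

lemma interp_pure (a : α) : interp (pure a) = pure a := rfl

lemma interp_bind (t : Tree α) (f : α → Tree β) :
    interp (t >>= f) = interp t >>= fun a => interp (f a) := by
  induction t with
  | ret a =>
    funext h
    show interp (f a) h = List.flatMap _ [(a, h)]
    simp
  | alloc k ih =>
    funext h
    exact congrFun (ih h.next) _
  | gate g k ih =>
    funext h
    exact congrFun ih _
  | meas i k ih =>
    funext h
    show interp (k false >>= f) _ ++ interp (k true >>= f) _ = List.flatMap _ (_ ++ _)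
    rw [List.flatMap_append, ih, ih]
    rfl

/-- The passage from probabilities in the games, which are sums over branches, to expectations of
trees. -/
lemma prob_interp (t : Tree α) (E : α → Prop) [DecidablePred E] :
    prob (interp t) E = acc (t >>= fun a => .ret (if E a then 1 else 0)) 0
      (single ∅ 1) := by
  have key : ∀ h : Heap,
      ((interp t h).map fun o => if E o.1 then o.2.weight else 0).sum =
        acc (t >>= fun a => .ret (if E a then 1 else 0)) h.next h.ket := by
    induction t with
    | ret a =>
      intro h
      simp [interp, acc, nsq, Heap.weight]
    | alloc k ih =>
      intro h
      exact ih h.next _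
    | gate g k ih =>
      intro h
      exact ih _
    | meas i k ih =>
      intro h
      simp only [interp, List.map_append, List.sum_append, ih, Tree.meas_bind, acc]
  have := key Heap.empty
  rw [show Heap.empty.next = 0 from rfl, show Heap.empty.ket = single ∅ 1 from rfl] at this
  rw [← this, prob]
  congr!

/-- Repeat `f` and add up the numbers of steps. -/
def titer (f : Mem → Tree (Mem × ℕ)) : ℕ → Mem → Tree (Mem × ℕ)
  | 0, μ => pure (μ, 0)
  | k + 1, μ => do
      let o ← f μ
      let o' ← titer f k o.1
      pure (o'.1, o.2 + o'.2)

/-- The computation tree of a program. -/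
def texec : Prog → Mem → Tree (Mem × ℕ)
  | .skip, μ => pure (μ, 1)
  | .push r b, μ => pure (update μ r (.bit b :: μ r), 1)
  | .pop r, μ => pure (update μ r (μ r).tail, 1)
  | .move r s, μ =>
      match μ r with
      | [] => pure (μ, 1)
      | c :: l =>
          let μ' : Mem := update μ r l
          pure (update μ' s (c :: μ' s), 1)
  | .alloc r, μ => .alloc fun i => .ret (update μ r (.qubit i :: μ r), 1)
  | .had r, μ =>
      match μ r with
      | .qubit i :: _ => .gate (.had i) (.ret (μ, 1))
      | _ => pure (μ, 1)
  | .tgate r, μ =>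
      match μ r with
      | .qubit i :: _ => .gate (.t i) (.ret (μ, 1))
      | _ => pure (μ, 1)
  | .cnot r s, μ =>
      match μ r, μ s with
      | .qubit i :: _, .qubit j :: _ => .gate (.cnot i j) (.ret (μ, 1))
      | _, _ => pure (μ, 1)
  | .meas r, μ =>
      match μ r with
      | .qubit i :: l => .meas i fun b => .ret (update μ r (.bit b :: l), 1)
      | _ => pure (μ, 1)
  | .seq P Q, μ => do
      let o ← texec P μ
      let o' ← texec Q o.1
      pure (o'.1, o.2 + o'.2)
  | .test r P0 P1 P2 P3, μ => do
      let o ← (match μ r with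
        | [] => texec P0 μ
        | .bit false :: _ => texec P1 μ
        | .bit true :: _ => texec P2 μ
        | .qubit _ :: _ => texec P3 μ)
      pure (o.1, o.2 + 1)
  | .loop r P, μ => do
      let o ← titer (texec P) (μ r).length μ
      pure (o.1, o.2 + 1)

lemma interp_titer {f : Mem → Tree (Mem × ℕ)} {g : Mem → Comp (Mem × ℕ)}
    (h : ∀ μ, interp (f μ) = g μ) (k : ℕ) (μ : Mem) : interp (titer f k μ) = iter g k μ := by
  induction k generalizing μ with
  | zero => rfl
  | succ k ih => simp only [titer, iter, interp_bind, interp_pure, h, ih]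

lemma interp_texec (P : Prog) (μ : Mem) : interp (texec P μ) = exec P μ := by
  induction P generalizing μ with
  | skip => rfl
  | push => rfl
  | pop => rfl
  | move r s =>
    simp only [texec, exec]
    rcases h : μ r with _ | ⟨_ | i, l⟩ <;> rfl
  | alloc r => rfl
  | had r =>
    simp only [texec, exec]
    rcases h : μ r with _ | ⟨_ | i, l⟩ <;> rfl
  | tgate r =>
    simp only [texec, exec]
    rcases h : μ r with _ | ⟨_ | i, l⟩ <;> rfl
  | cnot r s =>
    simp only [texec, exec]
    rcases h : μ r with _ | ⟨_ | i, l⟩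
    · rfl
    · rfl
    rcases h' : μ s with _ | ⟨_ | j, l'⟩
    · rfl
    · rfl
    -- For equal names the tree still has a gate, but its operator is the identity, in agreement
    -- with `exec`, which does nothing.
    by_cases hij : i = j
    · funext hp
      simp only [interp, Gate.op, hij, if_true]
      rfl
    · funext hp
      simp only [interp, Gate.op, hij, if_false]
      rfl
  | meas r =>
    simp only [texec, exec]
    rcases h : μ r with _ | ⟨_ | i, l⟩ <;> rfl
  | seq P Q hP hQ => simp only [texec, exec, interp_bind, interp_pure, hP, hQ]
  | test r P0 P1 P2 P3 h0 h1 h2 h3 =>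
    rw [texec, exec]
    simp only [interp_bind, interp_pure]
    congr 1
    split <;> simp only [*]
  | loop r P hP => simp only [texec, exec, interp_bind, interp_pure, interp_titer hP]

lemma ren_titer {π : Perm ℕ} {f : Mem → Tree (Mem × ℕ)}
    (h : ∀ μ, ren π (f μ) = f (ren π μ)) (k : ℕ) (μ : Mem) :
    ren π (titer f k μ) = titer f k (ren π μ) := by
  induction k generalizing μ with
  | zero => rfl
  | succ k ih =>
    simp only [titer]
    rw [Tree.ren_bind (g := fun o => titer f k o.1 >>= fun o' => pure (o'.1, o.2 + o'.2)) _
      fun o => ?_, h]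
    rw [Tree.ren_bind (g := fun o' => pure (o'.1, o.2 + o'.2)) _ fun o' => rfl, ih]
    rfl

/-- Instructions use a qubit number only to address the qubit and, for controlled-NOT, to test
equality; both are compatible with a permutation. -/
lemma ren_texec (π : Perm ℕ) (P : Prog) (μ : Mem) :
    ren π (texec P μ) = texec P (ren π μ) := by
  induction P generalizing μ with
  | skip => rfl
  | push r b => simp only [texec, Tree.ren_pure, ren_mk, ren_update]; rfl
  | pop r =>
    simp only [texec, Tree.ren_pure, ren_mk, ren_update, ren_mem_apply]
    have : ren π (μ r).tail = (ren π (μ r)).tail := by cases μ r <;> rfl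
    rw [this]
    rfl
  | move r s =>
    simp only [texec, ren_mem_apply]
    cases h : μ r with
    | nil => rfl
    | cons c l =>
      simp only [ren_cons, Tree.ren_pure, ren_mk, ren_update]
      rw [← ren_mem_apply, ren_update]
      rfl
  | alloc r =>
    simp only [texec, Tree.ren_alloc, Tree.ren_ret, ren_mk, ren_update, ren_cons, ren_qubit,
      Equiv.apply_symm_apply, ren_mem_apply]
    rfl
  | had r =>
    simp only [texec, ren_mem_apply]
    rcases h : μ r with _ | ⟨_ | i, l⟩ <;> rfl
  | tgate r =>
    simp only [texec, ren_mem_apply]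
    rcases h : μ r with _ | ⟨_ | i, l⟩ <;> rfl
  | cnot r s =>
    simp only [texec, ren_mem_apply]
    rcases h : μ r with _ | ⟨_ | i, l⟩ <;> rcases h' : μ s with _ | ⟨_ | j, l'⟩ <;> rfl
  | meas r =>
    simp only [texec, ren_mem_apply]
    rcases h : μ r with _ | ⟨_ | i, l⟩
    · rfl
    · rfl
    · simp only [ren_cons, ren_qubit, Tree.ren_meas, Tree.ren_ret, ren_mk, ren_update, ren_bit]
      rfl
  | seq P Q hP hQ =>
    simp only [texec]
    rw [Tree.ren_bind (g := fun o => texec Q o.1 >>= fun o' => pure (o'.1, o.2 + o'.2)) _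
      fun o => ?_, hP]
    rw [Tree.ren_bind (g := fun o' => pure (o'.1, o.2 + o'.2)) _ fun o' => rfl, hQ]
    rfl
  | test r P0 P1 P2 P3 h0 h1 h2 h3 =>
    simp only [texec, ren_mem_apply]
    rw [Tree.ren_bind (g := fun o => pure (o.1, o.2 + 1)) _ fun o => rfl]
    congr 1
    rcases h : μ r with _ | ⟨_ | i, l⟩
    · exact h0 μ
    · rename_i b
      cases b
      · exact h1 μ
      · exact h2 μ
    · exact h3 μ
  | loop r P hP =>
    simp only [texec, ren_mem_apply, ren_length]
    rw [Tree.ren_bind (g := fun o => pure (o.1, o.2 + 1)) _ fun o => rfl, ren_titer hP]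

/-! ### Computations -/

variable {α β γ : Type}

lemma comp_pure_apply (a : α) (h : Heap) : (pure a : Comp α) h = [(a, h)] := rfl
lemma comp_bind_apply (c : Comp α) (f : α → Comp β) (h : Heap) :
    (c >>= f) h = (c h).flatMap fun o => f o.1 o.2 := rfl

instance : LawfulMonad Comp := LawfulMonad.mk' _
  (id_map := fun c => by
    funext h
    show (c h).flatMap (fun o => [(id o.1, o.2)]) = c h
    simp)
  (pure_bind := fun a f => by
    funext h
    simp [comp_bind_apply, comp_pure_apply])
  (bind_assoc := fun c f g => by
    funext h
    simp [comp_bind_apply, List.flatMap_assoc])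

/-- All results of `c` satisfy `p`. -/
def All (p : α → Prop) (c : Comp α) : Prop := ∀ h, ∀ o ∈ c h, p o.1

namespace All

lemma pure {p : α → Prop} {a : α} (h : p a) : All p (pure a) := by
  intro hp o ho
  rw [comp_pure_apply, List.mem_singleton] at ho
  rwa [ho]

lemma bind {p : α → Prop} {q : β → Prop} {c : Comp α} {f : α → Comp β} (h : All p c)
    (hf : ∀ a, p a → All q (f a)) : All q (c >>= f) := by
  intro hp o ho
  rw [comp_bind_apply, List.mem_flatMap] at ho
  obtain ⟨o', ho', ho⟩ := ho
  exact hf _ (h hp o' ho') _ o ho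

lemma mono {p q : α → Prop} {c : Comp α} (h : All p c) (hpq : ∀ a, p a → q a) : All q c :=
  fun hp o ho => hpq _ (h hp o ho)

lemma and {p q : α → Prop} {c : Comp α} (h : All p c) (h' : All q c) :
    All (fun a => p a ∧ q a) c := fun hp o ho => ⟨h hp o ho, h' hp o ho⟩

lemma true (c : Comp α) : All (fun _ => True) c := fun _ _ _ => trivial

lemma map {q : β → Prop} {c : Comp α} {f : α → β} (h : All (fun a => q (f a)) c) :
    All q (f <$> c) := by
  rw [map_eq_pure_bind]
  exact h.bind fun a ha => All.pure ha

lemma of_map {q : β → Prop} {c : Comp α} {f : α → β} (h : All q (f <$> c)) :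
    All (fun a => q (f a)) c := by
  intro hp o ho
  refine h hp (f o.1, o.2) ?_
  rw [map_eq_pure_bind, comp_bind_apply, List.mem_flatMap]
  exact ⟨o, ho, by simp [comp_pure_apply]⟩

lemma bind_congr {p : α → Prop} {c : Comp α} {f g : α → Comp β} (h : All p c)
    (hfg : ∀ a, p a → f a = g a) : c >>= f = c >>= g := by
  funext hp
  rw [comp_bind_apply, comp_bind_apply]
  refine List.flatMap_congr fun o ho => ?_
  rw [hfg _ (h hp o ho)]

/-- A property that holds after every continuation of a common prefix. -/
lemma of_bind {q : β → Prop} {c : Comp α} {f : α → Comp β} (h : All q (c >>= f)) :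
    ∀ hp, ∀ o ∈ c hp, ∀ o' ∈ f o.1 o.2, q o'.1 := by
  intro hp o ho o' ho'
  refine h hp o' ?_
  rw [comp_bind_apply, List.mem_flatMap]
  exact ⟨o, ho, ho'⟩

end All

/-! ### Programs and their running time -/

/-- The effect of a program on the registers. -/
def run (P : Prog) (μ : Mem) : Comp Mem := Prod.fst <$> exec P μ

/-- Started with the registers `μ`, the program `P` behaves as `c`, and takes at most `T` steps. -/
structure Runs (P : Prog) (μ : Mem) (c : Comp Mem) (T : ℕ) : Prop where
  run_eq : run P μ = c
  time : All (fun o => o.2 ≤ T) (exec P μ)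

lemma run_seq (P Q : Prog) (μ : Mem) : run (P.seq Q) μ = run P μ >>= run Q := by
  simp [run, exec, map_bind]

lemma All.run {p : Mem → Prop} {P : Prog} {μ : Mem} (h : All (fun o => p o.1) (exec P μ)) :
    All p (run P μ) := h.map

namespace Runs

variable {P Q : Prog} {μ μ' : Mem} {c : Comp Mem} {T T' : ℕ}

lemma mono (h : Runs P μ c T) (hT : T ≤ T') : Runs P μ c T' :=
  ⟨h.run_eq, h.time.mono fun _ ho => ho.trans hT⟩

lemma congr {c' : Comp Mem} (h : Runs P μ c T) (hc : c = c') : Runs P μ c' T := hc ▸ h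

lemma of_pure {n : ℕ} (h : exec P μ = pure (μ', n)) : Runs P μ (pure μ') n :=
  ⟨by simp [run, h], by rw [h]; exact All.pure le_rfl⟩

lemma skip : Runs .skip μ (pure μ) 1 := of_pure rfl

lemma push {r : ℕ} {b : Bool} : Runs (.push r b) μ
    (pure (update μ r (.bit b :: μ r))) 1 := of_pure rfl

lemma pop {r : ℕ} : Runs (.pop r) μ (pure (update μ r (μ r).tail)) 1 := of_pure rfl

lemma move {r s : ℕ} {x : Cell} {l : Str} (hr : μ r = x :: l) (hrs : r ≠ s) :
    Runs (.move r s) μ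
      (pure (update (update μ r l) s (x :: μ s))) 1 := of_pure (by
  simp only [exec, hr]
  rw [update_of_ne hrs.symm])

lemma move_nil {r s : ℕ} (hr : μ r = []) : Runs (.move r s) μ (pure μ) 1 := of_pure (by
  simp only [exec, hr])

lemma seq_of_all {p : Mem → Prop} {d : Mem → Comp Mem} (h : Runs P μ c T) (hc : All p c)
    (h' : ∀ μ', p μ' → Runs Q μ' (d μ') T') : Runs (P.seq Q) μ (c >>= d) (T + T') := by
  refine ⟨?_, ?_⟩
  · rw [run_seq, h.run_eq]
    exact hc.bind_congr fun a ha => (h' a ha).run_eq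
  · have hp : All (fun o => p o.1) (exec P μ) := by
      have := hc
      rw [← h.run_eq] at this
      exact this.of_map
    rw [exec]
    exact (h.time.and hp).bind fun o ho => ((h' o.1 ho.2).time).bind fun o' ho' =>
      All.pure (add_le_add ho.1 ho')

lemma seq (h : Runs P μ (pure μ') T) (h' : Runs Q μ' c T') : Runs (P.seq Q) μ c (T + T') := by
  have := h.seq_of_all (p := fun ν => ν = μ') (d := fun _ => c) (All.pure rfl)
    (fun ν hν => hν ▸ h')
  simpa using this

/-- Sequential composition when the intermediate memory depends on a random `x`; the property `p`
passes on what is known about `x`. -/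
lemma seq_bind {f : α → Mem} {d : α → Comp Mem} {c : Comp α} {p : α → Prop}
    (h : Runs P μ (c >>= fun x => pure (f x)) T) (hc : All p c)
    (h' : ∀ x, p x → Runs Q (f x) (d x) T') : Runs (P.seq Q) μ (c >>= d) (T + T') := by
  refine ⟨?_, ?_⟩
  · rw [run_seq, h.run_eq, bind_assoc]
    refine hc.bind_congr fun a ha => ?_
    rw [pure_bind]
    exact (h' a ha).run_eq
  · have hp : All (fun o => ∃ x, p x ∧ o.1 = f x) (exec P μ) := by
      have : All (fun ν => ∃ x, p x ∧ ν = f x) (run P μ) := by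
        rw [h.run_eq]
        exact hc.bind fun x hx => All.pure ⟨x, hx, rfl⟩
      exact this.of_map
    rw [exec]
    refine (h.time.and hp).bind ?_
    rintro o ⟨ho, x, hx, e⟩
    have h'' := h' x hx
    rw [← e] at h''
    exact h''.time.bind fun o' ho' => All.pure (add_le_add ho ho')

lemma test_nil {r : ℕ} {P1 P2 P3 : Prog} (hr : μ r = []) (h : Runs P μ c T) :
    Runs (.test r P P1 P2 P3) μ c (T + 1) := by
  refine ⟨?_, ?_⟩
  · rw [← h.run_eq]
    simp [run, exec, hr]
  · simp only [exec, hr]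
    exact h.time.bind fun o ho => All.pure (Nat.succ_le_succ ho)

lemma test_false {r : ℕ} {P0 P2 P3 : Prog} {l : Str} (hr : μ r = .bit false :: l)
    (h : Runs P μ c T) : Runs (.test r P0 P P2 P3) μ c (T + 1) := by
  refine ⟨?_, ?_⟩
  · rw [← h.run_eq]
    simp [run, exec, hr]
  · simp only [exec, hr]
    exact h.time.bind fun o ho => All.pure (Nat.succ_le_succ ho)

lemma test_true {r : ℕ} {P0 P1 P3 : Prog} {l : Str} (hr : μ r = .bit true :: l)
    (h : Runs P μ c T) : Runs (.test r P0 P1 P P3) μ c (T + 1) := by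
  refine ⟨?_, ?_⟩
  · rw [← h.run_eq]
    simp [run, exec, hr]
  · simp only [exec, hr]
    exact h.time.bind fun o ho => All.pure (Nat.succ_le_succ ho)

lemma test_qubit {r : ℕ} {P0 P1 P2 : Prog} {i : ℕ} {l : Str} (hr : μ r = .qubit i :: l)
    (h : Runs P μ c T) : Runs (.test r P0 P1 P2 P) μ c (T + 1) := by
  refine ⟨?_, ?_⟩
  · rw [← h.run_eq]
    simp [run, exec, hr]
  · simp only [exec, hr]
    exact h.time.bind fun o ho => All.pure (Nat.succ_le_succ ho)

end Runs

/-- `k`-fold iteration. -/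
def iterM {σ : Type} (step : σ → Comp σ) : ℕ → σ → Comp σ
  | 0, x => pure x
  | k + 1, x => step x >>= iterM step k

lemma iterM_add {σ : Type} (step : σ → Comp σ) (k l : ℕ) (x : σ) :
    iterM step (k + l) x = iterM step k x >>= iterM step l := by
  induction k generalizing x with
  | zero => simp [iterM]
  | succ k ih =>
    rw [Nat.succ_add, iterM, iterM, bind_assoc]
    exact congrArg _ (funext ih)

lemma iterM_succ_right {σ : Type} (step : σ → Comp σ) (k : ℕ) (x : σ) :
    iterM step (k + 1) x = iterM step k x >>= step := by
  rw [iterM_add]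
  congr 1
  funext x
  simp [iterM]

lemma All.iterM {σ : Type} {step : σ → Comp σ} {p : σ → Prop}
    (h : ∀ x, p x → All p (step x)) (k : ℕ) {x : σ} (hx : p x) :
    All p (iterM step k x) := by
  induction k generalizing x with
  | zero => exact All.pure hx
  | succ k ih => exact (h x hx).bind fun y hy => ih hy

lemma All.iterM_of_index {σ : Type} {step : σ → Comp σ} (p : ℕ → σ → Prop) {k : ℕ}
    (h : ∀ i < k, ∀ x, p i x → All (p (i + 1)) (step x)) {x : σ} (hx : p 0 x) :
    All (p k) (QDSModel.iterM step k x) := by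
  -- Generalised to a loop that is entered in round `i` with `j` rounds to go.
  have key : ∀ j i x, i + j = k → p i x → All (p k) (QDSModel.iterM step j x) := by
    intro j
    induction j with
    | zero => rintro i x rfl hx; exact All.pure hx
    | succ j ih =>
      intro i x hi hx
      exact (h i (by omega) x hx).bind fun y hy => ih (i + 1) y (by omega) hy
  exact key k 0 x (by omega) hx

/-- Loops whose states are described by the elements of a type `σ`. -/
lemma Runs.loop {σ : Type} {P : Prog} {T r k : ℕ} (st : σ → Mem) (step : σ → Comp σ)
    (p : ℕ → σ → Prop)
    (h : ∀ i < k, ∀ x, p i x →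
      Runs P (st x) (step x >>= fun y => pure (st y)) T ∧ All (p (i + 1)) (step x))
    {x : σ} (hx : p 0 x) (hk : (st x r).length = k) :
    Runs (.loop r P) (st x) (iterM step k x >>= fun y => pure (st y)) (k * T + 1) := by
  have key : ∀ j i x, i + j = k → p i x →
      Prod.fst <$> iter (exec P) j (st x) = iterM step j x >>= (fun y => pure (st y)) ∧
      All (fun o => o.2 ≤ j * T) (iter (exec P) j (st x)) := by
    intro j
    induction j with
    | zero =>
      intro i x _ _
      refine ⟨by simp [iter, iterM], All.pure ?_⟩
      simp
    | succ j ih =>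
      intro i x hi hx
      obtain ⟨h1, h2⟩ := h i (by omega) x hx
      have hp : All (fun o => ∃ y, p (i + 1) y ∧ o.1 = st y) (exec P (st x)) := by
        have : All (fun ν => ∃ y, p (i + 1) y ∧ ν = st y) (run P (st x)) := by
          rw [h1.run_eq]
          exact h2.bind fun y hy => All.pure ⟨y, hy, rfl⟩
        exact this.of_map
      refine ⟨?_, ?_⟩
      · have e : Prod.fst <$> iter (exec P) (j + 1) (st x) =
            run P (st x) >>= fun ν => Prod.fst <$> iter (exec P) j ν := by
          simp [iter, run, map_bind]
        rw [e, h1.run_eq, iterM, bind_assoc, bind_assoc]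
        refine h2.bind_congr fun y hy => ?_
        rw [pure_bind]
        exact (ih (i + 1) y (by omega) hy).1
      · rw [iter]
        refine (h1.time.and hp).bind ?_
        rintro o ⟨ho, y, hy, e⟩
        have := (ih (i + 1) y (by omega) hy).2
        rw [← e] at this
        refine this.bind fun o' ho' => All.pure ?_
        show o.2 + o'.2 ≤ (j + 1) * T
        rw [Nat.succ_mul, add_comm]
        exact add_le_add ho' ho
  obtain ⟨h1, h2⟩ := key k 0 x (by omega) hx
  refine ⟨?_, ?_⟩
  · rw [← h1]
    simp [run, exec, hk]
  · rw [exec, hk]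
    exact h2.bind fun o ho => All.pure (Nat.succ_le_succ ho)

/-- Loops whose states are described by a sequence. -/
lemma Runs.loop_seq {P : Prog} {T r k : ℕ} {μ : Mem} (st : ℕ → Mem) (h0 : st 0 = μ)
    (h : ∀ i < k, Runs P (st i) (pure (st (i + 1))) T) (hk : (μ r).length = k) :
    Runs (.loop r P) μ (pure (st k)) (k * T + 1) := by
  have key : ∀ j i, i + j = k → Prod.fst <$> iter (exec P) j (st i) = pure (st k) ∧
      All (fun o => o.2 ≤ j * T) (iter (exec P) j (st i)) := by
    intro j
    induction j with
    | zero =>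
      rintro i rfl
      refine ⟨by simp [iter], All.pure ?_⟩
      simp
    | succ j ih =>
      intro i hi
      have h1 := h i (by omega)
      have h2 := ih (i + 1) (by omega)
      have hp : All (fun o => o.1 = st (i + 1)) (exec P (st i)) := by
        have : All (fun ν => ν = st (i + 1)) (run P (st i)) := by
          rw [h1.run_eq]
          exact All.pure rfl
        exact this.of_map
      refine ⟨?_, ?_⟩
      · have e : Prod.fst <$> iter (exec P) (j + 1) (st i) =
            run P (st i) >>= fun ν => Prod.fst <$> iter (exec P) j ν := by
          simp [iter, run, map_bind]
        rw [e, h1.run_eq, pure_bind, h2.1]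
      · rw [iter]
        refine (h1.time.and hp).bind ?_
        rintro o ⟨ho, e⟩
        have := h2.2
        rw [← e] at this
        refine this.bind fun o' ho' => All.pure ?_
        show o.2 + o'.2 ≤ (j + 1) * T
        rw [Nat.succ_mul, add_comm]
        exact add_le_add ho' ho
  obtain ⟨h1, h2⟩ := key k 0 (by omega)
  rw [h0] at h1 h2
  refine ⟨?_, ?_⟩
  · rw [← h1]
    simp [run, exec, hk]
  · rw [exec, hk]
    exact h2.bind fun o ho => All.pure (Nat.succ_le_succ ho)

/-- Loops that work through the content of a register, or through another list of the same
length. -/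
lemma Runs.loop_list {P : Prog} {T r : ℕ} {l : Str} {μ : Mem}
    (st : Str → Str → Mem) (h0 : st [] l = μ)
    (h : ∀ pre c post, l = pre ++ c :: post →
      Runs P (st pre (c :: post)) (pure (st (pre ++ [c]) post)) T)
    (hk : (μ r).length = l.length) :
    Runs (.loop r P) μ (pure (st l [])) (l.length * T + 1) := by
  have := Runs.loop_seq (P := P) (T := T) (r := r) (k := l.length) (μ := μ)
    (fun i => st (l.take i) (l.drop i)) (by simpa using h0) (fun i hi => ?_) hk
  · simpa using this
  · have e : l.drop i = l[i] :: l.drop (i + 1) := List.drop_eq_getElem_cons hi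
    have := h (l.take i) l[i] (l.drop (i + 1)) (by rw [← e, List.take_append_drop])
    rw [← e, ← List.take_succ_eq_append_getElem hi] at this
    exact this

/-- A sequence of programs. -/
def block : List Prog → Prog
  | [] => .skip
  | P :: l => .seq P (block l)

/-! ### General bounds -/

/-- A step adds at most one cell to a register. Bounds on running time are thereby also bounds on
the length of keys, signatures and messages. -/
lemma exec_growth (P : Prog) (μ : Mem) :
    All (fun o => ∀ r, (o.1 r).length ≤ (μ r).length + o.2) (exec P μ) := by
  have upd : ∀ (μ : Mem) (r : ℕ) (l : Str), l.length ≤ (μ r).length + 1 →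
      ∀ s, (update μ r l s).length ≤ (μ s).length + 1 := by
    intro μ r l h s
    rw [update_apply]
    split_ifs with hs
    · rwa [hs]
    · omega
  have one : ∀ μ : Mem, All (fun o => ∀ r, (o.1 r).length ≤ (μ r).length + o.2)
      (pure (μ, 1) : Comp (Mem × ℕ)) := fun μ => All.pure fun r => by simp
  induction P generalizing μ with
  | skip => exact one μ
  | push r b => exact All.pure (upd μ r _ (by simp))
  | pop r => exact All.pure (upd μ r _ (by simp; omega))
  | move r s =>
    simp only [exec]
    rcases h : μ r with _ | ⟨c, l⟩
    · exact one μ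
    · refine All.pure fun t => ?_
      simp only [update_apply]
      by_cases h1 : t = s
      · subst h1
        by_cases h2 : t = r
        · subst h2; simp [h]
        · simp [h2]
      · by_cases h2 : t = r
        · subst h2; simp [h1, h]; omega
        · simp [h1, h2]
  | alloc r => exact (All.true _).bind fun i _ => All.pure (upd μ r _ (by simp))
  | had r =>
    simp only [exec]
    rcases h : μ r with _ | ⟨_ | i, l⟩
    · exact one μ
    · exact one μ
    · exact (All.true _).bind fun _ _ => one μ
  | tgate r =>
    simp only [exec]
    rcases h : μ r with _ | ⟨_ | i, l⟩
    · exact one μ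
    · exact one μ
    · exact (All.true _).bind fun _ _ => one μ
  | cnot r s =>
    simp only [exec]
    split
    · split_ifs
      · exact one μ
      · exact (All.true _).bind fun _ _ => one μ
    · exact one μ
  | meas r =>
    simp only [exec]
    rcases h : μ r with _ | ⟨_ | i, l⟩
    · exact one μ
    · exact one μ
    · exact (All.true _).bind fun b _ => All.pure (upd μ r _ (by simp [h]))
  | seq P Q hP hQ =>
    exact (hP μ).bind fun o ho => (hQ o.1).bind fun o' ho' => All.pure fun r => by
      have := ho r
      have := ho' r
      simp only
      omega
  | test r P0 P1 P2 P3 h0 h1 h2 h3 =>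
    simp only [exec]
    refine All.bind (p := fun o => ∀ r, (o.1 r).length ≤ (μ r).length + o.2) ?_
      fun o ho => All.pure fun r => by
        have := ho r
        simp only
        omega
    split
    · exact h0 μ
    · exact h1 μ
    · exact h2 μ
    · exact h3 μ
  | loop r P hP =>
    have key : ∀ k μ, All (fun o => ∀ r, (o.1 r).length ≤ (μ r).length + o.2)
        (iter (exec P) k μ) := by
      intro k
      induction k with
      | zero => exact fun μ => All.pure fun r => by simp
      | succ k ih =>
        exact fun μ => (hP μ).bind fun o ho => (ih o.1).bind fun o' ho' => All.pure fun r => by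
          have := ho r
          have := ho' r
          simp only
          omega
    exact (key _ μ).bind fun o ho => All.pure fun r => by
      have := ho r
      simp only
      omega

/-- All registers that `P` uses are below this bound. -/
def regBound : Prog → ℕ
  | .skip => 0
  | .push r _ => r + 1
  | .pop r => r + 1
  | .move r s => max r s + 1
  | .alloc r => r + 1
  | .had r => r + 1
  | .tgate r => r + 1
  | .cnot r s => max r s + 1
  | .meas r => r + 1
  | .seq P Q => max (regBound P) (regBound Q)
  | .test r P0 P1 P2 P3 =>
      max (r + 1) (max (max (regBound P0) (regBound P1)) (max (regBound P2) (regBound P3)))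
  | .loop r P => max (r + 1) (regBound P)

lemma exec_frame (P : Prog) {k : ℕ} (hk : regBound P ≤ k) (μ : Mem) :
    All (fun o => ∀ r, k ≤ r → o.1 r = μ r) (exec P μ) := by
  have one : ∀ μ : Mem, All (fun o => ∀ r, k ≤ r → o.1 r = μ r)
      (pure (μ, 1) : Comp (Mem × ℕ)) := fun μ => All.pure fun r _ => rfl
  induction P generalizing μ with
  | skip => exact one μ
  | push r b =>
    exact All.pure fun s hs => update_of_ne (by simp [regBound] at hk; omega) _ _
  | pop r => exact All.pure fun s hs => update_of_ne (by simp [regBound] at hk; omega) _ _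
  | move r s =>
    simp only [exec]
    simp only [regBound] at hk
    rcases h : μ r with _ | ⟨c, l⟩
    · exact one μ
    · refine All.pure fun t ht => ?_
      have := le_max_left r s
      have := le_max_right r s
      show update _ _ _ t = _
      rw [update_of_ne (by omega), update_of_ne (by omega)]
  | alloc r =>
    exact (All.true _).bind fun i _ => All.pure fun s hs =>
      update_of_ne (by simp [regBound] at hk; omega) _ _
  | had r =>
    simp only [exec]
    rcases h : μ r with _ | ⟨_ | i, l⟩
    · exact one μ
    · exact one μ
    · exact (All.true _).bind fun _ _ => one μ
  | tgate r =>
    simp only [exec]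
    rcases h : μ r with _ | ⟨_ | i, l⟩
    · exact one μ
    · exact one μ
    · exact (All.true _).bind fun _ _ => one μ
  | cnot r s =>
    simp only [exec]
    split
    · split_ifs
      · exact one μ
      · exact (All.true _).bind fun _ _ => one μ
    · exact one μ
  | meas r =>
    simp only [exec]
    rcases h : μ r with _ | ⟨_ | i, l⟩
    · exact one μ
    · exact one μ
    · exact (All.true _).bind fun b _ => All.pure fun s hs =>
        update_of_ne (by simp [regBound] at hk; omega) _ _
  | seq P Q hP hQ =>
    simp only [regBound, max_le_iff] at hk
    exact (hP hk.1 μ).bind fun o ho => (hQ hk.2 o.1).bind fun o' ho' => All.pure fun r hr =>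
      (ho' r hr).trans (ho r hr)
  | test r P0 P1 P2 P3 h0 h1 h2 h3 =>
    simp only [regBound, max_le_iff] at hk
    simp only [exec]
    refine All.bind (p := fun o => ∀ r, k ≤ r → o.1 r = μ r) ?_ fun o ho => All.pure ho
    split
    · exact h0 hk.2.1.1 μ
    · exact h1 hk.2.1.2 μ
    · exact h2 hk.2.2.1 μ
    · exact h3 hk.2.2.2 μ
  | loop r P hP =>
    simp only [regBound, max_le_iff] at hk
    have key : ∀ j μ, All (fun o => ∀ r, k ≤ r → o.1 r = μ r) (iter (exec P) j μ) := by
      intro j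
      induction j with
      | zero => exact fun μ => All.pure fun r _ => rfl
      | succ j ih =>
        exact fun μ => (hP hk.2 μ).bind fun o ho => (ih o.1).bind fun o' ho' =>
          All.pure fun r hr => (ho' r hr).trans (ho r hr)
    exact (key _ μ).bind fun o ho => All.pure ho

/-! ### Relocation of programs -/

/-- Renumber the registers of a program. -/
def Prog.rename (f : ℕ → ℕ) : Prog → Prog
  | .skip => .skip
  | .push r b => .push (f r) b
  | .pop r => .pop (f r)
  | .move r s => .move (f r) (f s)
  | .alloc r => .alloc (f r)
  | .had r => .had (f r)
  | .tgate r => .tgate (f r)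
  | .cnot r s => .cnot (f r) (f s)
  | .meas r => .meas (f r)
  | .seq P Q => .seq (P.rename f) (Q.rename f)
  | .test r P0 P1 P2 P3 =>
      .test (f r) (P0.rename f) (P1.rename f) (P2.rename f) (P3.rename f)
  | .loop r P => .loop (f r) (P.rename f)

lemma update_extend {f : ℕ → ℕ} (hf : Function.Injective f) (μ e : Mem) (r : ℕ)
    (l : Str) : update (extend f μ e) (f r) l =
      extend f (update μ r l) e := by
  funext t
  by_cases h : ∃ s, f s = t
  · obtain ⟨s, rfl⟩ := h
    rw [hf.extend_apply, update_apply, update_apply, hf.extend_apply]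
    simp [hf.eq_iff]
  · rw [Function.extend_apply' _ _ _ h, update_of_ne (fun h' => h ⟨r, h'.symm⟩),
      Function.extend_apply' _ _ _ h]

/-- `extend f μ e` shows `μ` on the registers in the range of `f` and `e` elsewhere; the renamed
program sees only `μ`. This is what makes subroutines possible. -/
lemma exec_rename {f : ℕ → ℕ} (hf : Function.Injective f) (P : Prog) (μ e : Mem) :
    exec (P.rename f) (extend f μ e) =
      (fun o : Mem × ℕ => (extend f o.1 e, o.2)) <$> exec P μ := by
  have hu := update_extend hf
  induction P generalizing μ with
  | skip => simp [exec, Prog.rename]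
  | push r b => simp [exec, Prog.rename, hf.extend_apply, hu]
  | pop r => simp [exec, Prog.rename, hf.extend_apply, hu]
  | move r s =>
    simp only [exec, Prog.rename, hf.extend_apply]
    rcases h : μ r with _ | ⟨c, l⟩
    · simp
    · simp [hu, hf.extend_apply]
  | alloc r => simp [exec, Prog.rename, hf.extend_apply, hu]
  | had r =>
    simp only [exec, Prog.rename, hf.extend_apply]
    rcases h : μ r with _ | ⟨_ | i, l⟩ <;> simp
  | tgate r =>
    simp only [exec, Prog.rename, hf.extend_apply]
    rcases h : μ r with _ | ⟨_ | i, l⟩ <;> simp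
  | cnot r s =>
    simp only [exec, Prog.rename, hf.extend_apply]
    split
    · split_ifs <;> simp
    · simp
  | meas r =>
    simp only [exec, Prog.rename, hf.extend_apply]
    rcases h : μ r with _ | ⟨_ | i, l⟩ <;> simp [hu]
  | seq P Q hP hQ => simp [exec, Prog.rename, hP, hQ]
  | test r P0 P1 P2 P3 h0 h1 h2 h3 =>
    simp only [exec, Prog.rename, hf.extend_apply]
    split <;> simp [*]
  | loop r P hP =>
    have key : ∀ k μ, iter (exec (P.rename f)) k (extend f μ e) =
        (fun o : Mem × ℕ => (extend f o.1 e, o.2)) <$> iter (exec P) k μ := by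
      intro k
      induction k with
      | zero => intro μ; simp [iter]
      | succ k ih => intro μ; simp [iter, hP, ih]
    simp [exec, Prog.rename, hf.extend_apply, key]

lemma Runs.rename {f : ℕ → ℕ} (hf : Function.Injective f) {P : Prog} {μ : Mem} (e : Mem)
    {c : Comp Mem} {T : ℕ} (h : Runs P μ c T) :
    Runs (P.rename f) (extend f μ e) (c >>= fun ν => pure (extend f ν e)) T := by
  refine ⟨?_, ?_⟩
  · rw [run, exec_rename hf, ← h.run_eq, run]
    simp
  · rw [exec_rename hf]
    exact h.time.map

/-- The registers of a subroutine. -/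
def sReg (i : ℕ) : ℕ := 24 + 2 * i

/-- The registers of an adversary that is run as a subroutine. -/
def aReg (i : ℕ) : ℕ := 25 + 2 * i

/-! ### Basic program fragments -/

def clear (r : ℕ) : Prog := .loop r (.pop r)

/-- Move the content of `r`, in reversed order, to the top of `s`. -/
def moveAll (r s : ℕ) : Prog := .loop r (.move r s)

/-- Push as many copies of `b` onto `s` as `r` has cells. -/
def pushN (r s : ℕ) (b : Bool) : Prog := .loop r (.push s b)

/-- Remove as many cells from `s` as `r` has. -/
def popN (r s : ℕ) : Prog := .loop r (.pop s)

section

variable {μ μ' : Mem}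

lemma runs_clear {r : ℕ} (h : update μ r [] = μ') :
    Runs (clear r) μ (pure μ') ((μ r).length + 1) := by
  have := Runs.loop_seq (P := .pop r) (T := 1) (r := r) (μ := μ)
    (fun i => update μ r ((μ r).drop i)) (by simp) (fun i _ => Runs.pop.congr (by
      simp)) rfl
  rw [mul_one] at this
  refine this.congr ?_
  simp [h]

lemma runs_moveAll {r s : ℕ} (h : update (update μ r []) s ((μ r).reverse ++ μ s) = μ')
    (hrs : r ≠ s := by first | omega | simp [sReg, aReg] <;> omega) :
    Runs (moveAll r s) μ (pure μ') ((μ r).length + 1) := by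
  have := Runs.loop_list (P := .move r s) (T := 1) (r := r) (l := μ r) (μ := μ)
    (fun pre post => update (update μ r post) s (pre.reverse ++ μ s))
    (by simp) (fun pre c post _ => (Runs.move (r := r) (s := s) (x := c) (l := post)
      (by rw [update_of_ne hrs]; simp) hrs).congr (by
      congr 1
      funext x
      simp only [update_apply]
      split_ifs <;> simp_all)) rfl
  rw [mul_one] at this
  exact this.congr (by rw [h])

lemma runs_pushN {r s : ℕ} {b : Bool}
    (h : update μ s (List.replicate (μ r).length (.bit b) ++ μ s) = μ') :
    Runs (pushN r s b) μ (pure μ') ((μ r).length + 1) := by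
  have := Runs.loop_seq (P := .push s b) (T := 1) (r := r) (μ := μ)
    (fun i => update μ s (List.replicate i (.bit b) ++ μ s)) (by simp)
    (fun i _ => Runs.push.congr (by simp [List.replicate_succ])) rfl
  rw [mul_one] at this
  exact this.congr (by rw [h])

lemma runs_popN {r s : ℕ}
    (h : update μ s ((μ s).drop (μ r).length) = μ') :
    Runs (popN r s) μ (pure μ') ((μ r).length + 1) := by
  have := Runs.loop_seq (P := .pop s) (T := 1) (r := r) (μ := μ)
    (fun i => update μ s ((μ s).drop i)) (by simp) (fun i _ => Runs.pop.congr (by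
      simp)) rfl
  rw [mul_one] at this
  exact this.congr (by rw [h])

lemma Runs.block_cons {P : Prog} {l : List Prog} {c : Comp Mem} {T T' : ℕ}
    (h : Runs P μ (pure μ') T) (h' : Runs (block l) μ' c T') :
    Runs (block (P :: l)) μ c (T + T') := h.seq h'

lemma Runs.block_one {P : Prog} {c : Comp Mem} {T : ℕ} (h : Runs P μ c T) :
    Runs (block [P]) μ c (T + 1) := by
  have := h.seq_of_all (All.true c) (d := fun ν => pure ν) (T' := 1) (Q := .skip)
    fun ν _ => Runs.skip
  rwa [bind_pure] at this

@[simp] lemma toBits_ofBits (x : List Bool) : toBits (ofBits x) = x := by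
  induction x with
  | nil => rfl
  | cons b l ih => simp [toBits, ofBits]

@[simp] lemma length_ofBits (x : List Bool) : (ofBits x).length = x.length := by simp [ofBits]

lemma length_toBits_le (x : Str) : (toBits x).length ≤ x.length :=
  List.length_filterMap_le _ _

lemma toBits_append (x y : Str) : toBits (x ++ y) = toBits x ++ toBits y := by
  simp [toBits]

lemma ofBits_append (x y : List Bool) : ofBits (x ++ y) = ofBits x ++ ofBits y := by
  simp [ofBits]

@[simp] lemma toBits_nil : toBits [] = [] := rfl
@[simp] lemma ofBits_nil : ofBits [] = [] := rfl
@[simp] lemma toBits_bit (b : Bool) (l : Str) : toBits (.bit b :: l) = b :: toBits l := rfl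
@[simp] lemma toBits_qubit (i : ℕ) (l : Str) : toBits (.qubit i :: l) = toBits l := rfl
@[simp] lemma ofBits_cons (b : Bool) (l : List Bool) : ofBits (b :: l) = .bit b :: ofBits l := rfl

/-- Put the bits in register `r` on top of `d`; the registers `t` and `t'` are used as scratch
space. -/
def copyBits (r d t t' : ℕ) : Prog :=
  block [.loop r (.seq (.test r .skip (.push t' false) (.push t' true) .skip) (.move r t)),
    moveAll t r, moveAll t' d]

/-- The loop reverses the cells into `t` and the bits into `t'`; the final moves reverse both again,
so that `r` regains its content, qubits included, and `d` receives the bits in their order. -/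
lemma runs_copyBits {r d t t' : ℕ} (ht : μ t = []) (ht' : μ t' = [])
    (h : update μ d (ofBits (toBits (μ r)) ++ μ d) = μ')
    (hn : r ≠ d ∧ r ≠ t ∧ r ≠ t' ∧ d ≠ t ∧ d ≠ t' ∧ t ≠ t' := by first | omega | simp [sReg, aReg] <;> omega) :
    Runs (copyBits r d t t') μ (pure μ') (5 * (μ r).length + 4) := by
  obtain ⟨h1, h2, h3, h4, h5, h6⟩ := hn
  have key : Runs (.loop r (.seq (.test r .skip (.push t' false) (.push t' true) .skip)
      (.move r t))) μ (pure (update (update (update μ r []) t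
        (μ r).reverse) t' (ofBits (toBits (μ r))).reverse)) ((μ r).length * 3 + 1) := by
    refine Runs.loop_list (r := r) (l := μ r) (μ := μ)
      (fun pre post => update (update (update μ r post) t
        pre.reverse) t' (ofBits (toBits pre)).reverse) ?_ (fun pre c post _ => ?_) rfl
    · funext x
      simp only [update_apply]
      split_ifs <;> simp_all
    · set ν : Mem := update (update (update μ r (c :: post)) t
        pre.reverse) t' (ofBits (toBits pre)).reverse with hν
      have hr : ν r = c :: post := by
        rw [hν, update_of_ne h3, update_of_ne h2, update_self]
      have t1 : Runs (.test r .skip (.push t' false) (.push t' true) .skip) ν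
          (pure (update ν t' ((ofBits (toBits (pre ++ [c]))).reverse))) 2 := by
        cases c with
        | qubit i =>
          refine (Runs.test_qubit hr Runs.skip).congr ?_
          simp [hν, toBits_append]
        | bit b =>
          cases b
          · refine (Runs.test_false hr Runs.push).congr ?_
            simp [hν, toBits_append, ofBits_append]
          · refine (Runs.test_true hr Runs.push).congr ?_
            simp [hν, toBits_append, ofBits_append]
      refine t1.seq ((Runs.move (r := r) (s := t) (x := c) (l := post) ?_ h2).congr ?_)
      · rw [update_of_ne h3, hr]
      · congr 1
        funext x
        simp only [hν, update_apply]
        split_ifs <;> simp_all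
  refine (key.block_cons ((runs_moveAll rfl).block_cons
    ((runs_moveAll rfl).congr ?_).block_one)).mono ?_
  · congr 1
    rw [← h]
    grind [update_apply]
  · have := length_toBits_le (μ r)
    simp only [update_apply]
    simp [h3.symm, h6.symm, h6]
    omega

/-- Move the content of `x`, framed, in reversed order to the top of `acc`. -/
def emitFrame (x acc : ℕ) : Prog :=
  .seq (.loop x (.seq (.push acc true) (.move x acc))) (.push acc false)

lemma runs_emitFrame {x acc : ℕ}
    (h : update (update μ x []) acc ((frame (μ x)).reverse ++ μ acc) = μ')
    (hx : x ≠ acc := by first | omega | simp [sReg, aReg] <;> omega) :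
    Runs (emitFrame x acc) μ (pure μ') (2 * (μ x).length + 2) := by
  have key : Runs (.loop x (.seq (.push acc true) (.move x acc))) μ
      (pure (update (update μ x []) acc
        (((μ x).flatMap fun c => [Cell.bit true, c]).reverse ++ μ acc)))
      ((μ x).length * 2 + 1) := by
    refine Runs.loop_list (r := x) (l := μ x) (μ := μ)
      (fun pre post => update (update μ x post) acc
        ((pre.flatMap fun c => [Cell.bit true, c]).reverse ++ μ acc)) (by simp)
      (fun pre c post _ => ?_) rfl
    refine Runs.push.seq ((Runs.move (r := x) (s := acc) (x := c) (l := post) ?_ hx).congr ?_)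
    · rw [update_of_ne hx, update_of_ne hx, update_self]
    · congr 1
      grind [update_apply]
  refine (key.seq (Runs.push.congr ?_)).mono (by omega)
  rw [← h]
  simp [frame]

/-- Read off a framed string: the string, and the rest of the input. -/
def unframe : Str → Str × Str
  | [] => ([], [])
  | .bit true :: c :: l => (c :: (unframe l).1, (unframe l).2)
  -- Strings from an adversary need not be framed: a missing cell, or a qubit in the place of a
  -- marker, ends the frame.
  | .bit true :: [] => ([], [])
  | .bit false :: l => ([], l)
  | .qubit _ :: l => ([], l)

lemma unframe_frame (x l : Str) : unframe (frame x ++ l) = (x, l) := by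
  induction x with
  | nil => simp [frame, unframe]
  | cons c x ih =>
    have : frame (c :: x) ++ l = .bit true :: c :: (frame x ++ l) := by simp [frame]
    rw [this, unframe, ih]

lemma unframe_length (l : Str) :
    (unframe l).1.length + (unframe l).2.length ≤ l.length := by
  induction l using unframe.induct with
  | case1 => simp [unframe]
  | case2 c l ih => simp [unframe]; omega
  | case3 => simp [unframe]
  | case4 l => simp [unframe]
  | case5 i l => simp [unframe]

/-- Move a framed string from the top of `s`, in reversed order, to `y`; the register `f` is used
as scratch space. -/
def readFrame (s y f : ℕ) : Prog :=
  .seq (.loop s (.test f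
    (.test s .skip (.seq (.pop s) (.push f true)) (.seq (.pop s) (.move s y))
      (.seq (.pop s) (.push f true))) .skip .skip .skip)) (clear f)

/-- One step of `readFrame`. -/
def readStep : Str × Str × Bool → Str × Str × Bool
  | (s, y, true) => (s, y, true)
  | ([], y, false) => ([], y, false)
  | (.bit true :: c :: l, y, false) => (l, c :: y, false)
  | (.bit true :: [], y, false) => ([], y, false)
  | (.bit false :: l, y, false) => (l, y, true)
  | (.qubit _ :: l, y, false) => (l, y, true)

lemma readStep_iterate_true (k : ℕ) (s y : Str) :
    readStep^[k] (s, y, true) = (s, y, true) := by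
  induction k with
  | zero => rfl
  | succ k ih => rw [iterate_succ_apply, readStep, ih]

lemma readStep_iterate_nil (k : ℕ) (y : Str) :
    readStep^[k] ([], y, false) = ([], y, false) := by
  induction k with
  | zero => rfl
  | succ k ih => rw [iterate_succ_apply, readStep, ih]

/-- The loop has one round per cell of the whole input, which is more than enough; the flag makes
the surplus rounds idle once the frame has ended. -/
lemma readStep_iterate (s : Str) : ∀ (k : ℕ) (y : Str), s.length ≤ k →
    ∃ b, readStep^[k] (s, y, false) = ((unframe s).2, (unframe s).1.reverse ++ y, b) := by
  induction s using unframe.induct with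
  | case1 => exact fun k y _ => ⟨false, by simp [readStep_iterate_nil, unframe]⟩
  | case2 c l ih =>
    intro k y hk
    obtain ⟨k, rfl⟩ := Nat.exists_eq_succ_of_ne_zero (n := k) (by simp at hk; omega)
    obtain ⟨b, hb⟩ := ih k (c :: y) (by simp at hk; omega)
    refine ⟨b, ?_⟩
    rw [iterate_succ_apply, readStep, hb]
    simp [unframe]
  | case3 =>
    intro k y hk
    obtain ⟨k, rfl⟩ := Nat.exists_eq_succ_of_ne_zero (n := k) (by simp at hk; omega)
    exact ⟨false, by rw [iterate_succ_apply, readStep, readStep_iterate_nil]; rfl⟩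
  | case4 l =>
    intro k y hk
    obtain ⟨k, rfl⟩ := Nat.exists_eq_succ_of_ne_zero (n := k) (by simp at hk; omega)
    exact ⟨true, by rw [iterate_succ_apply, readStep, readStep_iterate_true]; rfl⟩
  | case5 i l =>
    intro k y hk
    obtain ⟨k, rfl⟩ := Nat.exists_eq_succ_of_ne_zero (n := k) (by simp at hk; omega)
    exact ⟨true, by rw [iterate_succ_apply, readStep, readStep_iterate_true]; rfl⟩

lemma runs_readFrame {s y f : ℕ} (hf : μ f = [])
    (h : update (update μ s (unframe (μ s)).2) y ((unframe (μ s)).1.reverse ++ μ y) = μ')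
    (hn : s ≠ y ∧ s ≠ f ∧ y ≠ f := by first | omega | simp [sReg, aReg] <;> omega) :
    Runs (readFrame s y f) μ (pure μ') (4 * (μ s).length + 3) := by
  obtain ⟨h1, h2, h3⟩ := hn
  let st : Str × Str × Bool → Mem := fun x =>
    update (update (update μ s x.1) y x.2.1) f
      (if x.2.2 then [.bit true] else [])
  have hs : ∀ x, st x s = x.1 := fun x => by simp [st, update_of_ne, h1, h2]
  have hff : ∀ x, st x f = if x.2.2 then [.bit true] else [] := fun x => by simp [st]
  have step : ∀ x, Runs (.test f
    (.test s .skip (.seq (.pop s) (.push f true)) (.seq (.pop s) (.move s y))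
      (.seq (.pop s) (.push f true))) .skip .skip .skip) (st x) (pure (st (readStep x))) 4 := by
    rintro ⟨l, z, b⟩
    cases b
    · refine (Runs.test_nil (by simp [hff]) (T := 3) ?_)
      rcases l with _ | ⟨c, l⟩
      · exact (Runs.test_nil (hs _) Runs.skip).mono (by omega)
      · rcases c with b | i
        · cases b
          · refine Runs.test_false (hs _) ((Runs.pop.seq Runs.push).congr ?_)
            congr 1
            funext x
            simp only [st, readStep, update_apply]
            split_ifs <;> simp_all
          · refine Runs.test_true (hs _) (Runs.pop.seq (T' := 1) ?_)
            rcases l with _ | ⟨c, l⟩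
            · refine (Runs.move_nil (by simp [hs])).congr ?_
              congr 1
              funext x
              simp only [st, readStep, update_apply]
              split_ifs <;> simp_all
            · refine (Runs.move (x := c) (l := l) (by simp [hs]) h1).congr ?_
              congr 1
              funext x
              simp only [st, readStep, update_apply]
              split_ifs <;> simp_all
        · refine Runs.test_qubit (hs _) ((Runs.pop.seq Runs.push).congr ?_)
          congr 1
          funext x
          simp only [st, readStep, update_apply]
          split_ifs <;> simp_all
    · have : readStep (l, z, true) = (l, z, true) := rfl
      rw [this]
      exact (Runs.test_true (l := []) (by simp [hff]) Runs.skip).mono (by omega)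
  have h0 : st (μ s, μ y, false) = μ := by
    funext x
    simp only [st, update_apply]
    split_ifs <;> simp_all
  obtain ⟨b, hb⟩ := readStep_iterate (μ s) (μ s).length (μ y) le_rfl
  have lp := Runs.loop_seq (r := s) (μ := μ)
    (fun i => st (readStep^[i] (μ s, μ y, false))) h0 (fun i _ => by
      rw [Function.iterate_succ_apply']
      exact step _) rfl
  rw [hb] at lp
  refine (lp.seq (runs_clear (μ' := μ') ?_)).mono ?_
  · rw [← h]
    funext x
    simp only [st, update_apply]
    split_ifs <;> simp_all
  · rw [hff]
    split_ifs <;> simp <;> omega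

end

/-! ### Numbers in unary -/

@[simp] lemma length_unary (n : ℕ) : (unary n).length = n := by simp [unary]
lemma unary_eq (n : ℕ) : unary n = List.replicate n (.bit true) := by simp [unary, ofBits]
@[simp] lemma unary_zero : unary 0 = [] := rfl
@[simp] lemma unary_append (n m : ℕ) : unary n ++ unary m = unary (n + m) := by
  simp [unary_eq]
@[simp] lemma unary_reverse (n : ℕ) : (unary n).reverse = unary n := by simp [unary_eq]
@[simp] lemma unary_drop (n m : ℕ) : (unary n).drop m = unary (n - m) := by simp [unary_eq]
lemma unary_succ (n : ℕ) : unary (n + 1) = .bit true :: unary n := by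
  simp [unary_eq, List.replicate_succ]
@[simp] lemma replicate_true (n : ℕ) : List.replicate n (Cell.bit true) = unary n :=
  (unary_eq n).symm

/-- Push `k` cells. -/
def pushK (d : ℕ) : ℕ → Prog
  | 0 => .skip
  | k + 1 => .seq (.push d true) (pushK d k)

lemma runs_pushK {μ μ' : Mem} {d k : ℕ} (h : update μ d (unary k ++ μ d) = μ') :
    Runs (pushK d k) μ (pure μ') (k + 1) := by
  induction k generalizing μ with
  | zero => exact Runs.skip.congr (by rw [← h]; simp)
  | succ k ih =>
    refine (Runs.push.seq (ih ?_)).mono (by omega)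
    rw [← h]
    simp only [update_self, update_idem]
    congr 1
    rw [unary_eq, unary_eq, List.replicate_succ', List.append_assoc]
    rfl

/-- The value of the polynomial with the given coefficients. -/
def evalL : List ℕ → ℕ → ℕ
  | [], _ => 0
  | c :: cs, n => c + n * evalL cs n

/-- Horner's scheme, the form in which the programs evaluate polynomials in unary. -/
lemma exists_evalL (p : ℕ[X]) : ∃ cs, ∀ n, evalL cs n = p.eval n := by
  induction p using Polynomial.recOnHorner with
  | M0 => exact ⟨[], fun n => by simp [evalL]⟩
  | MC p a _ _ ih =>
    obtain ⟨cs, h⟩ := ih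
    cases cs with
    | nil => exact ⟨[a], fun n => by have := h n; simp [evalL] at this ⊢; omega⟩
    | cons c cs => exact ⟨(c + a) :: cs, fun n => by
        have := h n; simp only [evalL, Polynomial.eval_add, Polynomial.eval_C] at this ⊢; omega⟩
  | MX p _ ih =>
    obtain ⟨cs, h⟩ := ih
    exact ⟨0 :: cs, fun n => by simp [evalL, h, mul_comm]⟩

/-- Compute the value of a polynomial at the number in register `0`. -/
def polyP (d t : ℕ) : List ℕ → Prog
  | [] => .skip
  | c :: cs => block [polyP d t cs, .loop d (pushN 0 t true), clear d, moveAll t d, pushK d c]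

def polyCost : List ℕ → ℕ → ℕ
  | [], _ => 1
  | c :: cs, n => polyCost cs n + (evalL cs n * (n + 1) + evalL cs n + n * evalL cs n + c + 5)

lemma runs_polyP {d t n : ℕ} (cs : List ℕ)
    {μ μ' : Mem} (h0 : μ 0 = unary n) (h1 : μ d = []) (h2 : μ t = [])
    (h : update μ d (unary (evalL cs n)) = μ')
    (hn : d ≠ 0 ∧ t ≠ 0 ∧ d ≠ t := by first | omega | simp [sReg, aReg] <;> omega) :
    Runs (polyP d t cs) μ (pure μ') (polyCost cs n) := by
  obtain ⟨hd, ht, hdt⟩ := hn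
  induction cs generalizing μ' with
  | nil => exact Runs.skip.congr (by rw [← h, evalL, unary_zero, ← h1]; simp)
  | cons c cs ih =>
    set e := evalL cs n with he
    have lp : Runs (.loop d (pushN 0 t true)) (update μ d (unary e))
        (pure (update (update μ d (unary e)) t (unary (e * n))))
        (e * (n + 1) + 1) := by
      refine Runs.loop_seq (k := e)
        (fun i => update (update μ d (unary e)) t (unary (i * n)))
        ?_ (fun i _ => ?_) (by simp)
      · funext x
        simp only [update_apply]
        split_ifs <;> simp_all
      · have e0 : (update (update μ d (unary e)) t (unary (i * n)) : Mem) 0 =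
            unary n := by
          rw [update_of_ne ht.symm, update_of_ne hd.symm, h0]
        refine (runs_pushN (r := 0) (s := t) (b := true) ?_).mono (by rw [e0]; simp)
        rw [e0]
        simp [Nat.succ_mul, add_comm]
    refine ((ih rfl).block_cons (lp.block_cons ((runs_clear rfl).block_cons
      ((runs_moveAll rfl).block_cons (runs_pushK ?_).block_one)))).mono ?_
    · rw [← h]
      funext x
      simp only [update_apply, evalL]
      split_ifs <;> simp_all [mul_comm]
    · simp only [polyCost, update_apply]
      simp [hdt, hdt.symm, mul_comm n]
      rw [← he]
      omega

/-- From the number `m` in `u`, compute `2 ^ size m` in `k` and `size m` in `z`. -/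
def pow2 (u k z : ℕ) : Prog :=
  .seq (.push k true) (.loop u
    (let B := block [popN k u, pushN k k true, .push z true]
     .test u .skip B B B))

/-- After j effective rounds, `u` has lost 1 + 2 + … + 2^(j-1) = 2^j - 1 cells, `k` has 2^j cells
and `z` has j. The rounds become idle when `u` is empty, that is when m < 2^j, and this first
happens at j = `size m`. -/
lemma runs_pow2 {u k z m : ℕ} {μ μ' : Mem} (hu : μ u = unary m) (hk : μ k = []) (hz : μ z = [])
    (h : update (update (update μ u []) k (unary (2 ^ size m))) z (unary (size m)) = μ')
    (h1 : u ≠ k) (h2 : u ≠ z) (h3 : k ≠ z) :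
    Runs (pow2 u k z) μ (pure μ') (m * (2 * m + 5) + 2) := by
  let st : ℕ → Mem := fun j =>
    update (update (update μ u (unary (m - (2 ^ j - 1)))) k
      (unary (2 ^ j))) z (unary j)
  -- The number of effective rounds grows by one in each round until it is `size m`, and then stays.
  have hst : ∀ i, min (i + 1) (size m) =
      if m - (2 ^ (min i (size m)) - 1) = 0 then min i (size m)
      else min i (size m) + 1 := by
    intro i
    have hpos : 0 < 2 ^ (min i (size m)) := by positivity
    split_ifs with hc
    · have : m < 2 ^ (min i (size m)) := by omega
      rw [← Nat.size_le] at this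
      omega
    · have : ¬ m < 2 ^ (min i (size m)) := by omega
      rw [← Nat.size_le] at this
      omega
  have lp := Runs.loop_seq (r := u) (k := m) (T := 2 * m + 5)
    (μ := update μ k (.bit true :: μ k)) (P :=
    (let B := block [popN k u, pushN k k true, .push z true]
     .test u .skip B B B)) (fun i => st (min i (size m))) ?_ (fun i _ => ?_) ?_
  · refine (Runs.push.seq lp).mono (by omega) |>.congr ?_
    rw [← h]
    have e : min m (size m) = size m := by
      apply min_eq_right
      rw [Nat.size_le]
      exact Nat.lt_two_pow_self
    have e' : m - (2 ^ (size m) - 1) = 0 := by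
      have := Nat.lt_size_self m
      omega
    simp only [st, e, e', unary_zero]
  · funext x
    simp only [st, update_apply]
    split_ifs <;> simp_all [show unary 1 = [Cell.bit true] from rfl]
  · show Runs _ _ (pure (st (min (i + 1) (size m)))) _
    rw [hst i]
    generalize min i (size m) = j
    have hu : st j u = unary (m - (2 ^ j - 1)) := by
      simp [st, update_of_ne, h1, h2]
    split_ifs with hc
    · rw [hc] at hu
      exact (Runs.test_nil hu Runs.skip).mono (by omega)
    · obtain ⟨l, hl⟩ := Nat.exists_eq_succ_of_ne_zero hc
      have hu' := hu
      rw [hl, unary_succ] at hu'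
      have hk : st j k = unary (2 ^ j) := by simp [st, update_of_ne, h3]
      refine (Runs.test_true hu' ((runs_popN rfl).block_cons ((runs_pushN rfl).block_cons
        (Runs.push.congr ?_).block_one))).mono ?_
      · congr 1
        funext x
        have hpos : 0 < 2 ^ j := by positivity
        have e1 : m - (2 ^ (j + 1) - 1) = m - (2 ^ j - 1) - 2 ^ j := by
          rw [pow_succ]; omega
        have e2 : 2 ^ (j + 1) = 2 ^ j + 2 ^ j := by rw [pow_succ]; omega
        clear hc hl hu' hst
        simp only [st, e2, update_apply]
        split_ifs <;> simp_all [unary_succ]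
      · have hle : 2 ^ j ≤ m := by omega
        rw [update_of_ne h1.symm, hk]
        simp
        omega
  · rw [update_of_ne h1, hu]
    simp

/-- From the coefficients of a polynomial, compute `2 ^ s` in `k` and `s` in `z`, where `s` is the
number of binary digits of its value. -/
def sizeP (cs : List ℕ) (u t k z : ℕ) : Prog := .seq (polyP u t cs) (pow2 u k z)

def sizeCost (cs : List ℕ) (n : ℕ) : ℕ :=
  polyCost cs n + (evalL cs n * (2 * evalL cs n + 5) + 2)

lemma runs_sizeP {u t k z n : ℕ} (cs : List ℕ) {μ μ' : Mem} (h0 : μ 0 = unary n)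
    (hu : μ u = []) (ht : μ t = []) (hk : μ k = []) (hz : μ z = [])
    (h : update (update μ k (unary (2 ^ size (evalL cs n)))) z (unary (size (evalL cs n))) = μ')
    (hn : u ≠ 0 ∧ t ≠ 0 ∧ u ≠ t ∧ u ≠ k ∧ u ≠ z ∧ k ≠ z := by first | omega | simp [sReg, aReg] <;> omega) :
    Runs (sizeP cs u t k z) μ (pure μ') (sizeCost cs n) := by
  obtain ⟨hu0, ht0, hut, h1, h2, h3⟩ := hn
  refine (runs_polyP cs h0 hu ht rfl).seq (runs_pow2 (m := evalL cs n) (by simp)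
    (by rw [update_of_ne h1.symm, hk]) (by rw [update_of_ne h2.symm, hz]) ?_ h1 h2 h3)
  rw [← h]
  grind [update_apply]

lemma Runs.block_bind {α : Type} {P : Prog} {l : List Prog} {μ : Mem} {f : α → Mem}
    {d : α → Comp Mem} {c : Comp α} {T T' : ℕ} {p : α → Prop}
    (h : Runs P μ (c >>= fun x => pure (f x)) T) (hc : All p c)
    (h' : ∀ x, p x → Runs (block l) (f x) (d x) T') :
    Runs (block (P :: l)) μ (c >>= d) (T + T') := h.seq_bind hc h'

/-! ### Random numbers -/

/-- A random bit. -/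
def coinC : Comp Bool := do
  let i ← newQubit
  applyGate (hadamard i)
  measureQubit i

/-- A uniformly random number below `2 ^ k`. -/
def unifC (k : ℕ) : Comp ℕ := iterM (fun u => coinC >>= fun b => pure (2 * u + b.toNat)) k 0

lemma all_unifC (k : ℕ) : All (fun u => u < 2 ^ k) (unifC k) :=
  All.iterM_of_index (fun i u => u < 2 ^ i) (fun i _ u hu => (All.true coinC).bind fun b _ =>
    All.pure (by
      have : b.toNat ≤ 1 := Bool.toNat_le b
      rw [pow_succ]
      omega)) (by simp)

/-- Push a random bit. -/
def flipP (c : ℕ) : Prog := .seq (.alloc c) (.seq (.had c) (.meas c))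

lemma runs_flipP {c : ℕ} {μ : Mem} :
    Runs (flipP c) μ (coinC >>= fun b => pure (update μ c (.bit b :: μ c))) 3 := by
  have e : exec (flipP c) μ =
      coinC >>= fun b => pure (update μ c (.bit b :: μ c), 3) := by
    simp [flipP, exec, coinC]
  refine ⟨by simp [run, e], ?_⟩
  rw [e]
  exact (All.true _).bind fun b _ => All.pure le_rfl

/-- Put a random number with as many binary digits as `z` has cells into `u`. -/
def idxP (z u c : ℕ) : Prog :=
  .loop z (block [pushN u u true, flipP c, .test c .skip (.pop c)
    (.seq (.push u true) (.pop c)) .skip])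

/-- Each round doubles the number and adds a random last binary digit. -/
lemma runs_idxP {z u c k : ℕ} {μ : Mem} (hz : (μ z).length = k) (hu : μ u = [])
    (huc : u ≠ c := by first | omega | simp [sReg, aReg] <;> omega) :
    Runs (idxP z u c) μ (unifC k >>= fun x => pure (update μ u (unary x)))
      (k * (2 ^ k + 10) + 1) := by
  have h0 : (update μ u (unary 0) : Mem) = μ := by rw [unary_zero, ← hu]; simp
  have := Runs.loop (r := z) (k := k) (T := 2 ^ k + 10)
    (P := block [pushN u u true, flipP c, .test c .skip (.pop c)
      (.seq (.push u true) (.pop c)) .skip])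
    (fun x : ℕ => (update μ u (unary x) : Mem))
    (fun u => coinC >>= fun b => pure (2 * u + b.toNat)) (fun i u => u < 2 ^ i)
    (fun i hi x hx => ⟨?_, ?_⟩) (x := 0) (by simp) (by rw [h0, hz])
  · rw [h0] at this
    exact this
  · have s1 : Runs (pushN u u true) (update μ u (unary x))
        (pure (update μ u (unary (2 * x)))) (x + 1) :=
      (runs_pushN (by simp [two_mul])).mono (by simp)
    have s2 : Runs (flipP c) (update μ u (unary (2 * x))) (coinC >>= fun b =>
        pure (update (update μ u (unary (2 * x))) c (.bit b :: μ c))) 3 :=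
      runs_flipP.congr (by simp only [update_of_ne huc.symm])
    have s3 : ∀ b, Runs (block [.test c .skip (.pop c) (.seq (.push u true) (.pop c)) .skip])
        (update (update μ u (unary (2 * x))) c (.bit b :: μ c))
        (pure (update μ u (unary (2 * x + b.toNat)))) 4 := by
      intro b
      cases b
      · refine ((Runs.test_false (l := μ c) (by simp) Runs.pop).block_one).mono (by omega)
          |>.congr ?_
        congr 1
        grind [update_apply]
      · refine ((Runs.test_true (l := μ c) (by simp) (Runs.push.seq Runs.pop)).block_one).congr ?_
        congr 1
        funext y
        simp only [update_apply]
        split_ifs <;> simp_all [unary_succ]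
    refine ((s1.block_cons (s2.block_bind (All.true _) fun b _ => s3 b)).mono ?_).congr
      (by rw [bind_assoc]; simp)
    have : 2 ^ i ≤ 2 ^ k := Nat.pow_le_pow_right (by norm_num) hi.le
    omega
  · exact (All.true _).bind fun b _ => All.pure (by
      have : b.toNat ≤ 1 := Bool.toNat_le b
      rw [pow_succ]
      omega)

/-! ### Subroutines -/

lemma sReg_injective : Function.Injective sReg := fun i j h => by simp [sReg] at h; omega
lemma aReg_injective : Function.Injective aReg := fun i j h => by simp [aReg] at h; omega

/-- The registers of a program with subroutines. -/
def mix (d s a : Mem) : Mem := fun r =>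
  if r < 24 then d r else if r % 2 = 0 then s ((r - 24) / 2) else a ((r - 24) / 2)

section mix

variable {d s a e : Mem}

@[simp] lemma mix_sReg (i : ℕ) : mix d s a (sReg i) = s i := by
  have h1 : ¬ sReg i < 24 := by simp [sReg]
  have h2 : sReg i % 2 = 0 := by simp [sReg]
  have h3 : (sReg i - 24) / 2 = i := by simp [sReg]
  simp [mix, h1, h2, h3]

@[simp] lemma mix_aReg (i : ℕ) : mix d s a (aReg i) = a i := by
  have h1 : ¬ aReg i < 24 := by simp [aReg]; omega
  have h2 : ¬ aReg i % 2 = 0 := by simp [aReg]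
  have h3 : (aReg i - 24) / 2 = i := by simp [aReg]; omega
  simp [mix, h1, h2, h3]

@[simp] lemma mix_lt {r : ℕ} (h : r < 24 := by norm_num) : mix d s a r = d r := by simp [mix, h]

lemma extend_sReg : extend sReg e (mix d s a) = mix d e a := by
  funext r
  by_cases h : ∃ i, sReg i = r
  · obtain ⟨i, rfl⟩ := h
    rw [sReg_injective.extend_apply, mix_sReg]
  · rw [Function.extend_apply' _ _ _ h]
    have : ¬ (¬ r < 24 ∧ r % 2 = 0) := fun ⟨h1, h2⟩ => h ⟨(r - 24) / 2, by simp [sReg]; omega⟩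
    simp only [mix]
    split_ifs <;> simp_all

lemma extend_aReg : extend aReg e (mix d s a) = mix d s e := by
  funext r
  by_cases h : ∃ i, aReg i = r
  · obtain ⟨i, rfl⟩ := h
    rw [aReg_injective.extend_apply, mix_aReg]
  · rw [Function.extend_apply' _ _ _ h]
    have : ¬ (¬ r < 24 ∧ ¬ r % 2 = 0) := fun ⟨h1, h2⟩ => h ⟨(r - 24) / 2, by simp [aReg]; omega⟩
    simp only [mix]
    split_ifs <;> simp_all

@[simp] lemma update_mix_sReg (i : ℕ) (v : Str) :
    update (mix d s a) (sReg i) v = mix d (update s i v) a := by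
  rw [← extend_sReg (d := d) (s := s) (a := a) (e := s), update_extend sReg_injective,
    extend_sReg]

@[simp] lemma update_mix_aReg (i : ℕ) (v : Str) :
    update (mix d s a) (aReg i) v = mix d s (update a i v) := by
  rw [← extend_aReg (d := d) (s := s) (a := a) (e := a), update_extend aReg_injective,
    extend_aReg]

@[simp] lemma update_mix {r : ℕ} {v : Str} (h : r < 24 := by norm_num) :
    update (mix d s a) r v = mix (update d r v) s a := by
  funext t
  simp only [update_apply, mix]
  by_cases h1 : t = r
  · simp [h1, h]
  · simp [h1]

lemma Runs.sub {P : Prog} {c : Comp Mem} {T : ℕ} (h : Runs P s c T) :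
    Runs (P.rename sReg) (mix d s a) (c >>= fun ν => pure (mix d ν a)) T := by
  have := h.rename sReg_injective (mix d s a)
  simpa only [extend_sReg] using this

lemma Runs.adv {P : Prog} {c : Comp Mem} {T : ℕ} (h : Runs P a c T) :
    Runs (P.rename aReg) (mix d s a) (c >>= fun ν => pure (mix d s ν)) T := by
  have := h.rename aReg_injective (mix d s a)
  simpa only [extend_aReg] using this

end mix

lemma load_apply (xs : List Str) (r : ℕ) : load xs r = xs.getD r [] := rfl

lemma update_load {xs : List Str} {r : ℕ} (h : r < xs.length) (v : Str) :
    update (load xs) r v = load (xs.set r v) := by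
  funext t
  rw [update_apply, load_apply, load_apply, List.getD_eq_getElem?_getD,
    List.getD_eq_getElem?_getD, List.getElem?_set]
  by_cases h1 : t = r
  · simp [h1, h]
  · simp [h1, Ne.symm h1]

lemma load_append_nil (xs : List Str) : load (xs ++ [[]]) = load xs := by
  funext r
  rw [load_apply, load_apply, List.getD_eq_getElem?_getD, List.getD_eq_getElem?_getD,
    List.getElem?_append]
  split_ifs with h
  · rfl
  · rw [List.getElem?_eq_none (not_lt.1 h)]
    rcases r - xs.length with _ | k <;> simp

lemma load_eq_mix {xs : List Str} (h : xs.length ≤ 24) :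
    load xs = mix (load xs) 𝟎 𝟎 := by
  funext r
  simp only [mix]
  split_ifs with h1
  · rfl
  all_goals
    rw [load_apply, List.getD_eq_default _ _ (by omega)]
    rfl

/-- Empty the registers of a subroutine. -/
def cleanS : ℕ → Prog
  | 0 => .skip
  | k + 1 => .seq (cleanS k) (clear (sReg k))

lemma runs_cleanS {d s a : Mem} {L : ℕ} (k : ℕ) (h : ∀ r < k, (s r).length ≤ L) :
    Runs (cleanS k) (mix d s a) (pure (mix d (fun r => if r < k then [] else s r) a))
      (k * (L + 1) + 1) := by
  induction k with
  | zero => exact Runs.skip.mono (by omega) |>.congr (by simp)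
  | succ k ih =>
    refine ((ih fun r hr => h r (by omega)).seq (runs_clear ?_)).mono ?_
    · rw [update_mix_sReg]
      congr 1
      funext r
      rw [update_apply]
      split_ifs <;> first | rfl | omega
    · simp only [mix_sReg, lt_irrefl, if_false]
      have := h k (by omega)
      have e : (k + 1) * (L + 1) = k * (L + 1) + (L + 1) := by ring
      omega

lemma load_length_le (xs : List Str) (r : ℕ) :
    (load xs r).length ≤ (xs.map List.length).sum := by
  rw [load_apply, List.getD_eq_getElem?_getD]
  rcases h : xs[r]? with _ | x
  · simp
  · have := List.mem_of_getElem? h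
    exact List.single_le_sum (by simp) _ (List.mem_map_of_mem this)

lemma all_run_growth {P : Prog} {μ : Mem} {T : ℕ} (h : All (fun o => o.2 ≤ T) (exec P μ)) :
    All (fun ν => ∀ r, (ν r).length ≤ (μ r).length + T) (run P μ) :=
  All.run (((exec_growth P μ).and h).mono fun o ho r => (ho.1 r).trans (by omega))

lemma runOn_eq (P : Prog) (n : ℕ) (xs : List Str) :
    runOn P n xs = run P (load (unary n :: xs)) >>= fun ν => pure (ν outReg) := by
  simp [runOn, run]

lemma all_runOn_length {P : Prog} {n : ℕ} {xs : List Str} {T : ℕ} (hxs : xs.length ≤ 3)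
    (h : All (fun o => o.2 ≤ T) (exec P (load (unary n :: xs)))) :
    All (fun x => x.length ≤ T) (runOn P n xs) := by
  rw [runOn_eq]
  refine (all_run_growth h).bind fun ν hν => All.pure ?_
  have := hν outReg
  have e : load (unary n :: xs) outReg = [] := List.getD_eq_default _ _ (by simp [outReg]; omega)
  rw [e] at this
  simpa using this

/-- Run `P` as a subroutine, with the inputs that have been put into its registers `1`, `2`, …,
and move its output to `y`. -/
def call (P : Prog) (t y : ℕ) : Prog :=
  block [pushN 0 (sReg 0) true, P.rename sReg, moveAll (sReg 4) t, moveAll t y,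
    cleanS (max (regBound P) 5)]

def callCost (P : Prog) (L : ℕ) : ℕ := (max (regBound P) 5 + 8) * (L + 1)

/-- The output is moved twice to keep its order, and every register that may be non-empty is
cleared, so that the next call again finds a fresh memory. The bound on these registers is at least
5 so that the inputs and the output are below it even if `P` never mentions them. -/
lemma runs_call {P : Prog} {t y n T L : ℕ} {xs : List Str} {d a : Mem} (hd0 : d 0 = unary n)
    (hdt : d t = []) (hdy : d y = []) (hT : All (fun o => o.2 ≤ T) (exec P (load (unary n :: xs))))
    (hL : n + (xs.map List.length).sum + T ≤ L) (hxs : xs.length ≤ 3 := by simp)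
    (hn : t < 24 ∧ y < 24 ∧ t ≠ y := by omega) :
    Runs (call P t y) (mix d (load ([] :: xs)) a)
      (runOn P n xs >>= fun x => pure (mix (update d y x) 𝟎 a))
      (callCost P L) := by
  obtain ⟨ht, hy, hty⟩ := hn
  set k := max (regBound P) 5 with hk
  have h1 : Runs (pushN 0 (sReg 0) true) (mix d (load ([] :: xs)) a)
      (pure (mix d (load (unary n :: xs)) a)) (n + 1) := by
    refine (runs_pushN ?_).mono (by simp [hd0])
    rw [update_mix_sReg, mix_lt, hd0, update_load (by simp), mix_sReg,
      load_apply]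
    simp
  have h2 : Runs (P.rename sReg) (mix d (load (unary n :: xs)) a)
      (run P (load (unary n :: xs)) >>= fun ν => pure (mix d ν a)) T :=
    Runs.sub ⟨rfl, hT⟩
  have hp : All (fun ν : Mem => (∀ r, k ≤ r → ν r = []) ∧ ∀ r, (ν r).length ≤ L)
      (run P (load (unary n :: xs))) := by
    refine ((All.run (p := fun ν : Mem => ∀ r, k ≤ r → ν r = load (unary n :: xs) r)
      (exec_frame P (le_max_left _ 5) _)).and (all_run_growth hT)).mono
      fun ν hν => ⟨fun r hr => ?_, fun r => ?_⟩
    · rw [hν.1 r hr, load_apply, List.getD_eq_default]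
      have : 5 ≤ k := le_max_right _ _
      simp
      omega
    · have := hν.2 r
      have := load_length_le (unary n :: xs) r
      simp at this
      omega
  rw [runOn_eq, bind_assoc]
  refine (h1.seq (T' := T + (2 * L + 3 + (k * (L + 1) + 2))) (Runs.seq_bind h2 hp
    fun ν hν => ?_)).mono ?_
  · rw [pure_bind]
    have s1 : Runs (moveAll (sReg 4) t) (mix d ν a)
        (pure (mix (update d t (ν 4).reverse) (update ν 4 []) a)) (L + 1) := by
      refine (runs_moveAll ?_).mono (by simpa using hν.2 4)
      rw [update_mix_sReg, update_mix ht, mix_lt ht, hdt, mix_sReg, List.append_nil]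
    have s2 : Runs (moveAll t y) (mix (update d t (ν 4).reverse) (update ν 4 [])
        a) (pure (mix (update d y (ν outReg)) (update ν 4 []) a)) (L + 1) := by
      refine (runs_moveAll ?_).mono (by simpa [mix_lt ht] using hν.2 4)
      rw [update_mix ht, update_mix hy, mix_lt ht, mix_lt hy,
        update_self, update_idem, update_of_ne hty.symm, hdy,
        ← hdt, update_eq_self, List.reverse_reverse, hdt, List.append_nil]
      rfl
    have s3 : Runs (cleanS k) (mix (update d y (ν outReg)) (update ν 4 []) a)
        (pure (mix (update d y (ν outReg)) 𝟎 a)) (k * (L + 1) + 1) := by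
      refine (runs_cleanS k fun r _ => ?_).congr ?_
      · rw [update_apply]
        split_ifs
        · simp
        · exact hν.2 r
      · congr 2
        funext r
        split_ifs with hr
        · rfl
        · have := le_max_right (regBound P) 5
          rw [update_apply, if_neg (by omega), hν.1 r (by omega)]
          rfl
    exact (s1.block_cons (s2.block_cons s3.block_one)).mono (by omega)
  · rw [callCost, ← hk]
    have e : (k + 8) * (L + 1) = k * (L + 1) + 8 * (L + 1) := by ring
    omega

/-! ### Polynomial bounds -/

/-- Functions with a polynomial upper bound. -/
@[fun_prop] def PolyB (f : ℕ → ℕ) : Prop := ∃ p : ℕ[X], ∀ n, f n ≤ p.eval n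

lemma eval_mono (p : ℕ[X]) {a b : ℕ} (h : a ≤ b) : p.eval a ≤ p.eval b := by
  simp only [eval_eq_sum_range]
  gcongr

namespace PolyB

variable {f g : ℕ → ℕ}

lemma mono (hg : PolyB g) (h : ∀ n, f n ≤ g n) : PolyB f :=
  hg.imp fun _ hp n => (h n).trans (hp n)
@[fun_prop] theorem const (c : ℕ) : PolyB fun _ => c := ⟨C c, fun _ => by simp⟩
@[fun_prop] theorem id : PolyB fun n => n := ⟨X, fun _ => by simp⟩
@[fun_prop] theorem eval (p : ℕ[X]) : PolyB fun n => p.eval n := ⟨p, fun _ => le_rfl⟩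
@[fun_prop] theorem comp (hf : PolyB f) (hg : PolyB g) : PolyB fun n => f (g n) := by
  obtain ⟨p, hp⟩ := hf
  obtain ⟨p', hp'⟩ := hg
  exact ⟨p.comp p', fun n => (hp _).trans (by rw [eval_comp]; exact eval_mono p (hp' n))⟩
@[fun_prop] theorem add (hf : PolyB f) (hg : PolyB g) : PolyB fun n => f n + g n := by
  obtain ⟨p, hp⟩ := hf
  obtain ⟨p', hp'⟩ := hg
  exact ⟨p + p', fun n => by rw [eval_add]; exact add_le_add (hp n) (hp' n)⟩
@[fun_prop] theorem mul (hf : PolyB f) (hg : PolyB g) : PolyB fun n => f n * g n := by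
  obtain ⟨p, hp⟩ := hf
  obtain ⟨p', hp'⟩ := hg
  exact ⟨p * p', fun n => by rw [eval_mul]; exact Nat.mul_le_mul (hp n) (hp' n)⟩

end PolyB

/-- Coins give exactly uniform numbers only below a power of two, so the dimensions of the table and
the range of the guesses are rounded up to such powers. They remain polynomial. -/
lemma two_pow_size_le (m : ℕ) : 2 ^ size m ≤ 2 * m + 1 := by
  rcases Nat.eq_zero_or_pos m with rfl | hm
  · simp
  · obtain ⟨k, hk⟩ := Nat.exists_eq_succ_of_ne_zero (Nat.size_pos.2 hm).ne'
    have : 2 ^ k ≤ m := Nat.lt_size.1 (by omega)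
    rw [hk, pow_succ]
    omega

lemma size_le_self (m : ℕ) : size m ≤ m := Nat.size_le.2 Nat.lt_two_pow_self

lemma evalL_mono (cs : List ℕ) {a b : ℕ} (h : a ≤ b) : evalL cs a ≤ evalL cs b := by
  induction cs with
  | nil => exact le_rfl
  | cons c cs ih => exact Nat.add_le_add_left (Nat.mul_le_mul h ih) c

@[fun_prop] theorem polyB_evalL (cs : List ℕ) : PolyB fun n => evalL cs n := by
  induction cs <;> simp only [evalL] <;> fun_prop

@[fun_prop] theorem polyB_polyCost (cs : List ℕ) : PolyB fun n => polyCost cs n := by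
  induction cs <;> simp only [polyCost] <;> fun_prop

@[fun_prop] theorem polyB_sizeCost (cs : List ℕ) : PolyB fun n => sizeCost cs n := by
  simp only [sizeCost]; fun_prop

@[fun_prop] theorem polyB_two_pow_size {f : ℕ → ℕ} (hf : PolyB f) : PolyB fun n => 2 ^ size (f n) :=
  PolyB.mono (g := fun n => 2 * f n + 1) (by fun_prop) fun n => two_pow_size_le _

@[fun_prop] theorem polyB_size : PolyB fun n => size n := PolyB.id.mono size_le_self

@[fun_prop] theorem polyB_callCost (P : Prog) : PolyB fun n => callCost P n := by
  simp only [callCost]; fun_prop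

lemma callCost_mono (P : Prog) {a b : ℕ} (h : a ≤ b) : callCost P a ≤ callCost P b :=
  Nat.mul_le_mul_left _ (by omega)

/-! ### The dimensions of the table of one-time keys -/

/-- The number of rows. -/
def rows (n : ℕ) : ℕ := 2 ^ size n

/-- The number of columns. -/
def cols (cs : List ℕ) (n : ℕ) : ℕ := 2 ^ size (evalL cs n)

/-- Compute the dimensions of the table. -/
def setup (cs : List ℕ) : Prog := .seq (sizeP [0, 1] 10 6 11 12) (sizeP cs 10 6 13 14)

def setupCost (cs : List ℕ) (n : ℕ) : ℕ := sizeCost [0, 1] n + sizeCost cs n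

lemma runs_setup {cs : List ℕ} {n : ℕ} {μ μ' : Mem} (h0 : μ 0 = unary n) (h6 : μ 6 = [])
    (h10 : μ 10 = []) (h11 : μ 11 = []) (h12 : μ 12 = []) (h13 : μ 13 = []) (h14 : μ 14 = [])
    (h : update (update (update (update μ 11
      (unary (rows n))) 12 (unary (size n))) 13 (unary (cols cs n))) 14
      (unary (size (evalL cs n))) = μ') :
    Runs (setup cs) μ (pure μ') (setupCost cs n) := by
  -- `[0, 1]` are the coefficients of the polynomial `X`: the number of rows comes from the security
  -- parameter itself.
  refine (runs_sizeP (n := n) [0, 1] h0 h10 h6 h11 h12 rfl).seq (runs_sizeP cs ?_ ?_ ?_ ?_ ?_ ?_)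
  all_goals try solve | simp [h0, h10, h6, h13, h14]
  rw [← h]
  simp [evalL, rows, cols]

/-! ### Slots -/

/-- An entry of the secret key: a one-time key, or the place of a key that is not known. -/
abbrev Slot : Type := Option (List Bool)

/-- A marker bit followed, for a key, by the frame of the key; the routine for framed strings can
then read it. -/
def encSlot : Slot → List Bool
  | none => [false]
  | some x => true :: (x.flatMap fun b => [true, b]) ++ [false]

def encSlots (l : List Slot) : List Bool := l.flatMap encSlot

lemma frame_ofBits (x : List Bool) :
    frame (ofBits x) = ofBits ((x.flatMap fun b => [true, b]) ++ [false]) := by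
  simp only [frame, ofBits_append]
  congr 1
  induction x with
  | nil => rfl
  | cons b l ih => simp_all

lemma ofBits_encSlot_some (x : List Bool) :
    ofBits (encSlot (some x)) = .bit true :: frame (ofBits x) := by
  simp [encSlot, frame_ofBits]

lemma ofBits_encSlots_cons (s : Slot) (l : List Slot) :
    ofBits (encSlots (s :: l)) = ofBits (encSlot s) ++ ofBits (encSlots l) := by
  rw [encSlots, List.flatMap_cons, ofBits_append, encSlots]

lemma length_frame (x : Str) : (frame x).length = 2 * x.length + 1 := by
  induction x with
  | nil => rfl
  | cons c l ih => simp [frame] at ih ⊢; omega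

/-- Is the top cell the bit `1`? -/
def topTrue : Str → Bool
  | .bit true :: _ => true
  | _ => false

/-- Anything but a bit `1` on top is treated as an empty slot, so malformed input needs no case of
its own. -/
lemma Runs.test_top {r : ℕ} {P Q : Prog} {μ : Mem} {c : Comp Mem} {T : ℕ}
    (hf : topTrue (μ r) = false → Runs P μ c T) (ht : topTrue (μ r) = true → Runs Q μ c T) :
    Runs (.test r P P Q P) μ c (T + 1) := by
  rcases h : μ r with _ | ⟨b | i, l⟩
  · exact test_nil h (hf (by rw [h]; rfl))
  · cases b
    · exact test_false h (hf (by rw [h]; rfl))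
    · exact test_true h (ht (by rw [h]; rfl))
  · exact test_qubit h (hf (by rw [h]; rfl))

/-! ### Fragments with a subroutine -/

section fragments

variable {d s a : Mem}

/-- Append, in reversed order, the framed bits of `r` to the output. -/
def emitBits (r : ℕ) : Prog := block [.push 5 true, copyBits r 9 6 7, emitFrame 9 5]

lemma runs_emitBits {r : ℕ} (d6 : d 6 = []) (d7 : d 7 = []) (d9 : d 9 = [])
    (hn : r < 24 ∧ r ≠ 5 ∧ r ≠ 6 ∧ r ≠ 7 ∧ r ≠ 9 := by omega) :
    Runs (emitBits r) (mix d s a)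
      (pure (mix (update d 5 ((ofBits (encSlot (some (toBits (d r))))).reverse ++ d 5))
        s a)) (7 * (d r).length + 8) := by
  obtain ⟨hr, h5, h6, h7, h9⟩ := hn
  have s1 : Runs (.push 5 true) (mix d s a)
      (pure (mix (update d 5 (.bit true :: d 5)) s a)) 1 :=
    Runs.push.congr (by rw [update_mix, mix_lt])
  have s2 : Runs (copyBits r 9 6 7) (mix (update d 5 (.bit true :: d 5)) s a)
      (pure (mix (update (update d 5 (.bit true :: d 5)) 9
        (ofBits (toBits (d r)))) s a)) (5 * (d r).length + 4) := by
    refine (runs_copyBits ?_ ?_ ?_).mono ?_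
    · rw [mix_lt, update_of_ne (by norm_num), d6]
    · rw [mix_lt, update_of_ne (by norm_num), d7]
    · rw [update_mix, mix_lt hr, mix_lt,
        update_of_ne h5, update_of_ne (by norm_num), d9, List.append_nil]
    · rw [mix_lt hr, update_of_ne h5]
  have s3 : Runs (emitFrame 9 5) (mix (update (update d 5 (.bit true :: d 5)) 9
        (ofBits (toBits (d r)))) s a)
      (pure (mix (update d 5 ((ofBits (encSlot (some (toBits (d r))))).reverse ++ d 5))
        s a)) (2 * (d r).length + 2) := by
    refine (runs_emitFrame ?_).mono ?_
    · rw [update_mix, update_mix, mix_lt,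
        mix_lt, ofBits_encSlot_some]
      congr 1
      funext x
      simp only [update_apply]
      split_ifs <;> simp_all
    · rw [mix_lt, update_self, length_ofBits]
      have := length_toBits_le (d r)
      omega
  exact (s1.block_cons (s2.block_cons s3.block_one)).mono (by omega)

/-- Run `P` as a subroutine, and append its classical output to the output. -/
def callEmit (P : Prog) : Prog := block [call P 6 8, emitBits 8, clear 8]

lemma runs_callEmit {P : Prog} {n T L : ℕ} {xs : List Str} (hxs : xs.length ≤ 3)
    (d0 : d 0 = unary n) (d6 : d 6 = []) (d7 : d 7 = []) (d8 : d 8 = []) (d9 : d 9 = [])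
    (hT : All (fun o => o.2 ≤ T) (exec P (load (unary n :: xs))))
    (hL : n + (xs.map List.length).sum + T ≤ L) :
    Runs (callEmit P) (mix d (load ([] :: xs)) a)
      (runOn P n xs >>= fun x => pure (mix (update d 5
        ((ofBits (encSlot (some (toBits x)))).reverse ++ d 5)) 𝟎 a))
      (callCost P L + 8 * L + 10) := by
  refine ((runs_call d0 d6 d8 hT hL hxs).block_bind
    (all_runOn_length hxs hT) fun x hx => ?_).mono (T := callCost P L + (8 * L + 10)) (by omega)
  have s1 : Runs (emitBits 8) (mix (update d 8 x) 𝟎 a)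
      (pure (mix (update (update d 8 x) 5
        ((ofBits (encSlot (some (toBits x)))).reverse ++ d 5)) 𝟎 a)) (7 * x.length + 8) := by
    have := runs_emitBits (d := update d 8 x) (s := load []) (a := a) (r := 8)
      (by simp [d6]) (by simp [d7]) (by simp [d9])
    simpa using this
  have s2 : Runs (clear 8) (mix (update (update d 8 x) 5
      ((ofBits (encSlot (some (toBits x)))).reverse ++ d 5)) 𝟎 a)
      (pure (mix (update d 5 ((ofBits (encSlot (some (toBits x)))).reverse ++ d 5))
        𝟎 a)) (x.length + 1) := by
    refine (runs_clear ?_).mono (by simp)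
    rw [update_mix]
    congr 1
    funext y
    simp only [update_apply]
    split_ifs <;> simp_all
  exact (s1.block_cons s2.block_one).mono (by omega)

/-- Run `P` as a subroutine, and append its output, which may contain qubits, to the output. -/
def callEmitQ (P : Prog) : Prog := block [call P 6 8, emitFrame 8 5]

lemma runs_callEmitQ {P : Prog} {n T L : ℕ} {xs : List Str} (hxs : xs.length ≤ 3)
    (d0 : d 0 = unary n) (d6 : d 6 = []) (d8 : d 8 = [])
    (hT : All (fun o => o.2 ≤ T) (exec P (load (unary n :: xs))))
    (hL : n + (xs.map List.length).sum + T ≤ L) :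
    Runs (callEmitQ P) (mix d (load ([] :: xs)) a)
      (runOn P n xs >>= fun x => pure (mix (update d 5 ((frame x).reverse ++ d 5))
        𝟎 a)) (callCost P L + 2 * L + 3) := by
  refine ((runs_call d0 d6 d8 hT hL hxs).block_bind
    (all_runOn_length hxs hT) fun x hx => ?_).mono (T := callCost P L + (2 * L + 3)) (by omega)
  have s1 : Runs (emitFrame 8 5) (mix (update d 8 x) 𝟎 a)
      (pure (mix (update d 5 ((frame x).reverse ++ d 5)) 𝟎 a))
      (2 * x.length + 2) := by
    refine (runs_emitFrame ?_).mono ?_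
    · rw [update_mix, update_mix, mix_lt,
        mix_lt]
      congr 1
      funext y
      simp only [update_apply]
      split_ifs <;> simp_all
    · rw [mix_lt, update_self]
  exact s1.block_one.mono (by omega)

/-- Read a frame off `r` into the register `i` of the subroutine. -/
def readArg (r i : ℕ) : Prog := block [readFrame r 8 9, moveAll 8 (sReg i)]

lemma runs_readArg {r i : ℕ} {d' s' : Mem} (d8 : d 8 = []) (d9 : d 9 = []) (hs : s i = [])
    (hd : update d r (unframe (d r)).2 = d') (h : update s i (unframe (d r)).1 = s')
    (hn : r < 24 ∧ r ≠ 8 ∧ r ≠ 9 := by omega) :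
    Runs (readArg r i) (mix d s a) (pure (mix d' s' a)) (5 * (d r).length + 5) := by
  obtain ⟨hr, h8, h9⟩ := hn
  have hl := unframe_length (d r)
  have s1 : Runs (readFrame r 8 9) (mix d s a)
      (pure (mix (update d' 8 (unframe (d r)).1.reverse) s a))
      (4 * (d r).length + 3) := by
    refine (runs_readFrame ?_ ?_).mono ?_
    · rw [mix_lt, d9]
    · rw [update_mix hr, update_mix, mix_lt hr,
        mix_lt, hd, d8, List.append_nil]
    · rw [mix_lt hr]
  have s2 : Runs (moveAll 8 (sReg i)) (mix (update d' 8 (unframe (d r)).1.reverse) s a)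
      (pure (mix d' s' a)) ((d r).length + 1) := by
    refine (runs_moveAll ?_).mono ?_
    · rw [update_mix, update_mix_sReg, mix_sReg, mix_lt, hs,
        update_self, update_idem, List.append_nil, List.reverse_reverse, h]
      congr 1
      rw [← hd]
      funext y
      simp only [update_apply]
      split_ifs <;> simp_all
    · rw [mix_lt, update_self, List.length_reverse]
      omega
  exact (s1.block_cons s2.block_one).mono (by omega)

/-- Copy the classical string in `r` to the register `i` of the subroutine. -/
def copyArg (r i : ℕ) : Prog := copyBits r (sReg i) 6 7

lemma runs_copyArg {r i : ℕ} {s' : Mem} (d6 : d 6 = []) (d7 : d 7 = []) (hs : s i = [])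
    (h : update s i (ofBits (toBits (d r))) = s')
    (hn : r < 24 ∧ r ≠ 6 ∧ r ≠ 7 := by omega) :
    Runs (copyArg r i) (mix d s a) (pure (mix d s' a)) (5 * (d r).length + 4) := by
  obtain ⟨hr, h6, h7⟩ := hn
  refine (runs_copyBits ?_ ?_ ?_).mono ?_
  · rw [mix_lt, d6]
  · rw [mix_lt, d7]
  · rw [update_mix_sReg, mix_sReg, mix_lt hr, hs, List.append_nil, h]
  · rw [mix_lt hr]

end fragments

lemma Runs.growth {α : Type} {P : Prog} {μ : Mem} {c : Comp α} {f : α → Mem} {T : ℕ}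
    (h : Runs P μ (c >>= fun x => pure (f x)) T) :
    All (fun x => ∀ r, (f x r).length ≤ (μ r).length + T) c := by
  have h1 := all_run_growth h.time
  rw [h.run_eq] at h1
  intro hp o ho
  exact h1.of_bind hp o ho _ (List.mem_singleton_self _)

/-- Move the accumulated output to the output register. -/
lemma Runs.block_output {α : Type} {P : Prog} {μ : Mem} {c : Comp α} {f : α → Mem} {T : ℕ}
    (h : Runs P μ (c >>= fun x => pure (f x)) T) (h5 : μ 5 = []) :
    Runs (block [P, moveAll 5 4]) μ (c >>= fun x => pure (update
      (update (f x) 5 []) 4 ((f x 5).reverse ++ f x 4))) (2 * T + 2) := by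
  refine (h.block_bind h.growth fun x hx => ?_).mono (T := T + (T + 1 + 1)) (by omega)
  refine ((runs_moveAll rfl).block_one).mono ?_
  have := hx 5
  rw [h5] at this
  simpa using this

lemma Runs.runOn_eq {α : Type} {P : Prog} {n T : ℕ} {xs : List Str} {c : Comp α}
    {f : α → Mem} (h : Runs P (load (unary n :: xs)) (c >>= fun x => pure (f x)) T) :
    runOn P n xs = c >>= fun x => pure (f x outReg) := by
  rw [QDSModel.runOn_eq, h.run_eq]
  simp

/-! ### The table -/

/-- The number of one-time keys. -/
def tsize (cs : List ℕ) (n : ℕ) : ℕ := rows n * cols cs n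

/-- The registers after the dimensions have been computed. -/
def tbl (cs : List ℕ) (n : ℕ) (xs : List Str) : Mem := fun r =>
  if r = 11 then unary (rows n) else if r = 12 then unary (size n) else
  if r = 13 then unary (cols cs n) else if r = 14 then unary (size (evalL cs n)) else
  load (unary n :: xs) r

lemma runs_setup_load {cs : List ℕ} {n : ℕ} {xs : List Str} (hxs : xs.length ≤ 3) :
    Runs (setup cs) (load (unary n :: xs)) (pure (mix (tbl cs n xs) 𝟎 𝟎))
      (setupCost cs n) := by
  have h : ∀ r, 4 ≤ r → load (unary n :: xs) r = [] := fun r hr =>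
    List.getD_eq_default _ _ (by simp; omega)
  refine runs_setup rfl (h _ (by norm_num)) (h _ (by norm_num)) (h _ (by norm_num))
    (h _ (by norm_num)) (h _ (by norm_num)) (h _ (by norm_num)) ?_
  rw [load_eq_mix (by simp; omega), update_mix, update_mix,
    update_mix, update_mix]
  congr 1
  funext r
  simp only [update_apply, tbl]
  split_ifs <;> first | rfl | omega

/-- Write the number of keys, in unary, to register `15`. -/
def tsizeP : Prog := .loop 11 (pushN 13 15 true)

lemma runs_tsizeP {cs : List ℕ} {n : ℕ} {d s a : Mem} (h11 : d 11 = unary (rows n))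
    (h13 : d 13 = unary (cols cs n)) (h15 : d 15 = []) :
    Runs tsizeP (mix d s a) (pure (mix (update d 15 (unary (tsize cs n))) s a))
      (rows n * (cols cs n + 1) + 1) := by
  refine Runs.loop_seq (fun i => mix (update d 15 (unary (i * cols cs n))) s a)
    (by rw [zero_mul, unary_zero, ← h15, update_eq_self]) (fun i _ => ?_)
    (by rw [mix_lt, h11, length_unary])
  refine (runs_pushN ?_).mono ?_
  · rw [update_mix, mix_lt, mix_lt,
      update_of_ne (by norm_num), h13, update_self, update_idem,
      replicate_true, length_unary, unary_append, add_mul, one_mul, add_comm]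
  · rw [mix_lt, update_of_ne (by norm_num), h13, length_unary]

/-! ### Key generation -/

/-- A slot of the secret key: a new key, unless the mask says otherwise. -/
def slotC (P : Prog) (n : ℕ) (mask : Str) : Comp Slot :=
  if topTrue mask then pure none else runOn P n [] >>= fun x => pure (some (toBits x))

def slotsC (P : Prog) (n : ℕ) : ℕ → Str → Comp (List Slot)
  | 0, _ => pure []
  | k + 1, mask => do
      let s ← slotC P n mask
      let l ← slotsC P n k mask.tail
      pure (s :: l)

def skGenBody (P : Prog) : Prog :=
  block [.test 1 (callEmit P) (callEmit P) (.push 5 false) (callEmit P), .pop 1]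

/-- The secret key: a table of one-time keys. The slots that are marked in register `1` stay
empty. -/
def skGenP (cs : List ℕ) (P : Prog) : Prog :=
  block [block [setup cs, tsizeP, .loop 15 (skGenBody P)], moveAll 5 4]

def skStep (P : Prog) (n : ℕ) (x : Str × Str) : Comp (Str × Str) :=
  slotC P n x.1 >>= fun s => pure (x.1.tail, (ofBits (encSlot s)).reverse ++ x.2)

lemma iterM_skStep (P : Prog) (n k : ℕ) (mask acc : Str) :
    iterM (skStep P n) k (mask, acc) = slotsC P n k mask >>= fun l =>
      pure (mask.drop k, (ofBits (encSlots l)).reverse ++ acc) := by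
  induction k generalizing mask acc with
  | zero => simp [iterM, slotsC, encSlots]
  | succ k ih =>
    simp [iterM, slotsC, skStep, ih, ofBits_encSlots_cons]

lemma runs_skGenBody {P : Prog} {n T L : ℕ} {d a : Mem} (d0 : d 0 = unary n) (d6 : d 6 = [])
    (d7 : d 7 = []) (d8 : d 8 = []) (d9 : d 9 = [])
    (hT : All (fun o => o.2 ≤ T) (exec P (load [unary n]))) (hL : n + T ≤ L) :
    Runs (skGenBody P) (mix d 𝟎 a)
      (slotC P n (d 1) >>= fun s => pure (mix (update (update d 1 (d 1).tail) 5
        ((ofBits (encSlot s)).reverse ++ d 5)) 𝟎 a)) (callCost P L + 8 * L + 13) := by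
  have s1 : Runs (.test 1 (callEmit P) (callEmit P) (.push 5 false) (callEmit P))
      (mix d 𝟎 a) (slotC P n (d 1) >>= fun s => pure (mix (update d 5
        ((ofBits (encSlot s)).reverse ++ d 5)) 𝟎 a)) (callCost P L + 8 * L + 10 + 1) := by
    refine Runs.test_top (fun h => ?_) fun h => ?_
    · rw [mix_lt] at h
      have := runs_callEmit (a := a) (P := P) (xs := []) (by simp) d0 d6 d7 d8 d9 hT (by simpa)
      simpa [slotC, h, show load [[]] = load [] from load_append_nil []] using this
    · rw [mix_lt] at h
      refine (Runs.push.mono (by omega)).congr ?_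
      simp [slotC, h, encSlot]
  refine ((s1.block_bind (All.true _) fun s _ => Runs.block_one ?_).mono (T' := _)
    (T := callCost P L + 8 * L + 10 + 1 + (1 + 1)) (by omega))
  refine Runs.pop.congr ?_
  rw [update_mix, mix_lt, update_of_ne (by norm_num),
    update_comm (by norm_num)]

def skGenCost (cs : List ℕ) (P : Prog) (n T : ℕ) : ℕ :=
  2 * (setupCost cs n + (rows n * (cols cs n + 1) + 1 +
    (tsize cs n * (callCost P (n + T) + 8 * (n + T) + 13) + 2))) + 2

lemma runs_skGenP {cs : List ℕ} {P : Prog} {n T : ℕ} {mask : Str}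
    (hT : All (fun o => o.2 ≤ T) (exec P (load [unary n]))) :
    ∃ f : List Slot → Mem, (∀ l, f l 4 = ofBits (encSlots l)) ∧
    Runs (skGenP cs P) (load [unary n, mask])
      (slotsC P n (tsize cs n) mask >>= fun l => pure (f l))
      (skGenCost cs P n T) := by
  set d := update (tbl cs n [mask]) 15 (unary (tsize cs n)) with hd
  have e : ∀ r, r = 0 ∨ r = 1 ∨ r = 4 ∨ r = 5 ∨ r = 6 ∨ r = 7 ∨ r = 8 ∨ r = 9 →
      d r = load [unary n, mask] r := by
    rintro r (rfl | rfl | rfl | rfl | rfl | rfl | rfl | rfl) <;> simp [hd, tbl]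
  have s1 := runs_setup_load (cs := cs) (n := n) (xs := [mask]) (by simp)
  have s2 : Runs tsizeP (mix (tbl cs n [mask]) 𝟎 𝟎)
      (pure (mix d 𝟎 𝟎)) _ :=
    runs_tsizeP (by simp [tbl]) (by simp [tbl]) (by simp [tbl, load_apply])
  have s3 := Runs.loop (r := 15) (k := tsize cs n) (P := skGenBody P)
    (T := callCost P (n + T) + 8 * (n + T) + 13)
    (fun x : Str × Str => mix (update (update d 1 x.1) 5 x.2)
      𝟎 𝟎) (skStep P n) (fun _ _ => True)
    (fun i _ x _ => ⟨?_, All.true _⟩) (x := (mask, [])) trivial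
    (by simp [hd])
  · have e' : update (update d 1 mask) 5 [] = d := by
      rw [show mask = d 1 by rw [e] <;> simp [load_apply], update_eq_self,
        show [] = d 5 by rw [e] <;> simp [load_apply], update_eq_self]
    simp only [e', iterM_skStep, bind_assoc, pure_bind] at s3
    have h := (s1.block_cons (s2.block_cons s3.block_one)).block_output (by simp [load_apply])
    refine ⟨_, fun l => ?_, h⟩
    simp [update_of_ne, e, load_apply]
  · have := runs_skGenBody (P := P) (n := n) (T := T) (L := n + T)
      (d := update (update d 1 x.1) 5 x.2) (a := load [])
      (by simp [e, load_apply]) (by simp [e, load_apply]) (by simp [e, load_apply])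
      (by simp [e, load_apply]) (by simp [e, load_apply]) hT le_rfl
    refine this.congr ?_
    simp only [skStep, bind_assoc, pure_bind]
    congr 1
    funext s
    congr 2
    funext r
    simp only [update_apply]
    split_ifs <;> simp_all

lemma runOn_skGenP {cs : List ℕ} {P : Prog} (hP : IsQPT 0 P) (n : ℕ) (mask : Str) :
    runOn (skGenP cs P) n [mask] =
      slotsC P n (tsize cs n) mask >>= fun l => pure (ofBits (encSlots l)) := by
  obtain ⟨p, hp⟩ := hP
  obtain ⟨f, hf, h⟩ := runs_skGenP (cs := cs) (n := n) (mask := mask) (hp n [] rfl)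
  rw [h.runOn_eq]
  congr 1
  funext l
  rw [show outReg = 4 from rfl, hf]

@[fun_prop] theorem polyB_rows : PolyB fun n => rows n := polyB_two_pow_size PolyB.id

@[fun_prop] theorem polyB_cols (cs : List ℕ) : PolyB fun n => cols cs n :=
  polyB_two_pow_size (polyB_evalL cs)

@[fun_prop] theorem polyB_tsize (cs : List ℕ) : PolyB fun n => tsize cs n :=
  polyB_rows.mul (polyB_cols cs)

@[fun_prop] theorem polyB_setupCost (cs : List ℕ) : PolyB fun n => setupCost cs n :=
  (polyB_sizeCost _).add (polyB_sizeCost _)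

lemma isQPT_skGenP (cs : List ℕ) {P : Prog} (hP : IsQPT 0 P) : IsQPT 1 (skGenP cs P) := by
  obtain ⟨p, hp⟩ := hP
  obtain ⟨r, hr⟩ : PolyB fun n => skGenCost cs P n (p.eval n) := by simp only [skGenCost]; fun_prop
  refine ⟨r, fun n xs hxs => ?_⟩
  obtain ⟨mask, rfl⟩ := List.length_eq_one_iff.1 hxs
  obtain ⟨f, hf, h⟩ := runs_skGenP (cs := cs) (n := n) (mask := mask) (hp n [] rfl)
  exact h.time.mono fun o ho => (ho.trans (hr n)).trans (eval_mono r (by omega))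

/-- A missing input is an empty register. The same program thus serves the scheme, without its last
input, and the reduction, which passes a mask, a foreign public key or a foreign signature there. -/
lemma IsQPT.of_succ {k : ℕ} {P : Prog} (hP : IsQPT (k + 1) P) : IsQPT k P := by
  obtain ⟨p, hp⟩ := hP
  refine ⟨p, fun n xs hxs => ?_⟩
  have := hp n (xs ++ [[]]) (by simp [hxs])
  rw [← List.cons_append, load_append_nil] at this
  simpa using this

/-! ### Public keys -/

lemma update_load_length (xs : List Str) (v : Str) :
    update (load xs) xs.length v = load (xs ++ [v]) := by
  rw [← load_append_nil, update_load (by simp)]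
  simp

lemma IsQPT.bound {k : ℕ} {P : Prog} (hP : IsQPT k P) : ∃ p : ℕ[X], ∀ (n : ℕ)
    (xs : List Str) (B : ℕ), xs.length = k → n + (xs.map List.length).sum ≤ B →
    All (fun o => o.2 ≤ p.eval B) (exec P (load (unary n :: xs))) := by
  obtain ⟨p, hp⟩ := hP
  exact ⟨p, fun n xs B hk hB h o ho => (hp n xs hk h o ho).trans (eval_mono p hB)⟩

/-- The public keys for a list of slots; the string `x` takes the place of the key for the first
empty slot. -/
def slotPKs (P : Prog) (n : ℕ) : List Slot → Str → Comp Str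
  | [], _ => pure []
  | none :: l, x => do
      let r ← slotPKs P n l []
      pure (frame x ++ r)
  | some sk :: l, x => do
      let y ← runOn P n [ofBits sk]
      let r ← slotPKs P n l x
      pure (frame y ++ r)

def pkGenBody (P : Prog) : Prog :=
  .test 1 .skip (block [.pop 1, emitFrame 2 5]) (block [.pop 1, readArg 1 1, callEmitQ P])
    (block [.pop 1, emitFrame 2 5])

def pkGenP (P : Prog) : Prog := block [.loop 1 (pkGenBody P), moveAll 5 4]

def pkStep (P : Prog) (n : ℕ) :
    Str × Str × Str → Comp (Str × Str × Str)
  | ([], x, acc) => pure ([], x, acc)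
  | (.bit true :: l, x, acc) => runOn P n [(unframe l).1] >>= fun y =>
      pure ((unframe l).2, x, (frame y).reverse ++ acc)
  | (.bit false :: l, x, acc) => pure (l, [], (frame x).reverse ++ acc)
  | (.qubit _ :: l, x, acc) => pure (l, [], (frame x).reverse ++ acc)

/-- The loop counts cells, not slots. Surplus rounds find the key exhausted and do nothing, so any
number of rounds that is at least the number of slots gives the same result. -/
lemma iterM_pkStep (P : Prog) (n : ℕ) (l : List Slot) : ∀ (k : ℕ) (x acc : Str),
    l.length ≤ k →
    (iterM (pkStep P n) k (ofBits (encSlots l), x, acc) >>= fun z => pure z.2.2) =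
      slotPKs P n l x >>= fun y => pure (y.reverse ++ acc) := by
  induction l with
  | nil =>
    intro k x acc _
    have : ∀ k, iterM (pkStep P n) k (ofBits (encSlots []), x, acc) =
        pure (ofBits (encSlots []), x, acc) := by
      intro k
      induction k with
      | zero => rfl
      | succ k ih => rw [iterM, show pkStep P n (ofBits (encSlots []), x, acc) =
          pure (ofBits (encSlots []), x, acc) from rfl, pure_bind, ih]
    rw [this]
    simp [slotPKs]
  | cons s l ih =>
    intro k x acc hk
    obtain ⟨k, rfl⟩ := Nat.exists_eq_succ_of_ne_zero (n := k) (by simp at hk; omega)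
    have hk' : l.length ≤ k := by simpa using hk
    rw [Nat.succ_eq_add_one, iterM, bind_assoc]
    cases s with
    | none =>
      rw [show ofBits (encSlots (none :: l)) = .bit false :: ofBits (encSlots l) from rfl]
      simp only [pkStep, pure_bind, slotPKs, bind_assoc]
      rw [ih _ _ _ hk']
      simp
    | some sk =>
      rw [ofBits_encSlots_cons, ofBits_encSlot_some, List.cons_append]
      simp only [pkStep, unframe_frame, slotPKs, bind_assoc, pure_bind]
      congr 1
      funext y
      rw [ih _ _ _ hk']
      simp

lemma unframe_fst_length (l : Str) : (unframe l).1.length ≤ l.length := by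
  have := unframe_length l
  omega

lemma unframe_snd_length (l : Str) : (unframe l).2.length ≤ l.length := by
  have := unframe_length l
  omega

lemma runs_pkGenBody {P : Prog} {n T B : ℕ} {d a : Mem} (d0 : d 0 = unary n) (d6 : d 6 = [])
    (d8 : d 8 = []) (d9 : d 9 = []) (h1 : (d 1).length ≤ B)
    (h2 : (d 2).length ≤ B)
    (hT : ∀ x : Str, x.length ≤ B → All (fun o => o.2 ≤ T) (exec P (load [unary n, x]))) :
    Runs (pkGenBody P) (mix d 𝟎 a)
      (pkStep P n (d 1, d 2, d 5) >>= fun z => pure (mix (update (update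
        (update d 1 z.1) 2 z.2.1) 5 z.2.2) 𝟎 a))
      (callCost P (n + B + T) + 7 * (n + B + T) + 11) := by
  have hQ : ∀ c l, d 1 = c :: l → Runs (block [.pop 1, emitFrame 2 5]) (mix d 𝟎 a)
      (pure (mix (update (update (update d 1 l) 2 []) 5
        ((frame (d 2)).reverse ++ d 5)) 𝟎 a)) (2 * B + 4) := by
    intro c l h
    have s1 : Runs (.pop 1) (mix d 𝟎 a)
        (pure (mix (update d 1 l) 𝟎 a)) 1 := by
      refine Runs.pop.congr ?_
      rw [update_mix, mix_lt, h, List.tail_cons]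
    refine (s1.block_cons ((runs_emitFrame ?_).block_one)).mono ?_
    · simp
    · simp
      omega
  have hnil : ∀ (k : ℕ), Runs .skip (mix d 𝟎 a) (pure (mix d 𝟎 a)) (k + 1) :=
    fun k => Runs.skip.mono (by omega)
  rcases h : d 1 with _ | ⟨b | i, l⟩
  · refine (Runs.test_nil (by rw [mix_lt, h]) ?_).mono le_rfl
    refine (hnil _).congr ?_
    rw [pkStep, pure_bind, ← h, update_eq_self, update_eq_self,
      update_eq_self]
  · cases b
    · refine (Runs.test_false (by rw [mix_lt, h]) (hQ _ _ h)).mono ?_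
      omega
    · rw [h, List.length_cons] at h1
      have hl := unframe_fst_length l
      have s1 : Runs (.pop 1) (mix d 𝟎 a)
          (pure (mix (update d 1 l) 𝟎 a)) 1 := by
        refine Runs.pop.congr ?_
        rw [update_mix, mix_lt, h, List.tail_cons]
      have s2 : Runs (readArg 1 1) (mix (update d 1 l) 𝟎 a)
          (pure (mix (update d 1 (unframe l).2) (load [[], (unframe l).1]) a))
          (5 * B + 5) := by
        refine (runs_readArg (by simp [d8])
          (by simp [d9]) rfl ?_ ?_).mono ?_
        · simp
        · rw [update_self, ← load_append_nil]
          exact update_load_length [[]] _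
        · rw [update_self]
          omega
      have s3 := runs_callEmitQ (d := update d 1 (unframe l).2) (a := a) (P := P)
        (xs := [(unframe l).1]) (n := n) (T := T) (L := n + B + T) (by simp) (by simp [d0])
        (by simp [d6]) (by simp [d8]) (hT _ (by omega)) (by simp; omega)
      refine (Runs.test_true (by rw [mix_lt, h])
        (s1.block_cons (s2.block_cons s3.block_one))).mono (T' := _) ?_ |>.congr ?_
      · omega
      · simp only [pkStep, bind_assoc, pure_bind]
        congr 1
        funext y
        congr 2
        funext r
        simp only [update_apply]
        split_ifs <;> simp_all
  · exact (Runs.test_qubit (by rw [mix_lt, h]) (hQ _ _ h)).mono (by omega)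

lemma pkStep_length (P : Prog) (n B : ℕ) (z : Str × Str × Str)
    (h : z.1.length ≤ B ∧ z.2.1.length ≤ B) :
    All (fun z => z.1.length ≤ B ∧ z.2.1.length ≤ B) (pkStep P n z) := by
  obtain ⟨s, x, acc⟩ := z
  rcases s with _ | ⟨b | i, l⟩
  · exact All.pure h
  · have := unframe_snd_length l
    simp only [List.length_cons] at h
    cases b
    · exact All.pure ⟨by simp; omega, by simp⟩
    · exact (All.true _).bind fun y _ => All.pure ⟨by simp; omega, h.2⟩
  · simp only [List.length_cons] at h
    exact All.pure ⟨by simp; omega, by simp⟩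

def pkGenCost (P : Prog) (n B T : ℕ) : ℕ :=
  2 * (B * (callCost P (n + B + T) + 7 * (n + B + T) + 11) + 1) + 2

lemma runs_pkGenP {P : Prog} {n T B : ℕ} {s x : Str} (h1 : s.length ≤ B)
    (h2 : x.length ≤ B)
    (hT : ∀ x : Str, x.length ≤ B → All (fun o => o.2 ≤ T) (exec P (load [unary n, x]))) :
    ∃ f : Str × Str × Str → Mem, (∀ z, f z 4 = z.2.2.reverse) ∧
    Runs (pkGenP P) (load [unary n, s, x])
      (iterM (pkStep P n) s.length (s, x, []) >>= fun z => pure (f z))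
      (pkGenCost P n B T) := by
  set d := load [unary n, s, x] with hd
  have e : ∀ r, 3 ≤ r → d r = [] := fun r hr => List.getD_eq_default _ _ (by simpa)
  have hmem : mix (update (update (update d 1 s) 2 x) 5 []) 𝟎
      𝟎 = d := by
    have h5 : [] = d 5 := (e 5 (by norm_num)).symm
    rw [show s = d 1 from rfl, update_eq_self, show x = d 2 from rfl,
      update_eq_self, h5, update_eq_self]
    exact (load_eq_mix (by simp)).symm
  have s3 := Runs.loop (r := 1) (k := s.length) (P := pkGenBody P)
    (T := callCost P (n + B + T) + 7 * (n + B + T) + 11)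
    (fun x : Str × Str × Str => mix (update (update
      (update d 1 x.1) 2 x.2.1) 5 x.2.2)
      𝟎 𝟎) (pkStep P n) (fun _ z => z.1.length ≤ B ∧ z.2.1.length ≤ B)
    (fun i _ z hz => ⟨?_, pkStep_length _ _ _ z hz⟩) (x := (s, x, [])) ⟨h1, h2⟩
    (by simp)
  · rw [hmem] at s3
    have h := (s3.block_output (e 5 (by norm_num))).mono (T' :=
      2 * (B * (callCost P (n + B + T) + 7 * (n + B + T) + 11) + 1) + 2) (by gcongr)
    exact ⟨_, fun z => by simp [e], h⟩
  · have := runs_pkGenBody (P := P) (n := n) (T := T) (B := B)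
      (d := update (update (update d 1 z.1) 2 z.2.1) 5 z.2.2)
      (a := load []) rfl (by simp [e]) (by simp [e]) (by simp [e])
      (by simpa using hz.1) (by simpa using hz.2) hT
    refine this.congr ?_
    congr 1
    funext z'
    congr 2
    funext r
    simp only [update_apply]
    split_ifs <;> simp_all

lemma encSlots_length (l : List Slot) : l.length ≤ (encSlots l).length := by
  induction l with
  | nil => simp
  | cons s l ih =>
    have : 1 ≤ (encSlot s).length := by cases s <;> simp [encSlot]
    simp [encSlots] at ih ⊢
    omega

lemma runOn_pkGenP {P : Prog} (hP : IsQPT 1 P) (n : ℕ) (l : List Slot) (x : Str) :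
    runOn (pkGenP P) n [ofBits (encSlots l), x] = slotPKs P n l x := by
  obtain ⟨p, hp⟩ := hP.bound
  obtain ⟨f, hf, h⟩ := runs_pkGenP (P := P) (n := n)
    (B := (ofBits (encSlots l)).length + x.length) (s := ofBits (encSlots l)) (x := x)
    (T := p.eval (n + ((ofBits (encSlots l)).length + x.length))) (by omega) (by omega)
    (fun y hy => hp n [y] _ rfl (by simpa using hy))
  rw [h.runOn_eq]
  have := iterM_pkStep P n l (ofBits (encSlots l)).length x [] (by simpa using encSlots_length l)
  have e : ∀ z, f z outReg = z.2.2.reverse := hf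
  simp only [e]
  have h2 := congrArg (fun c => c >>= fun y => pure (List.reverse y)) this
  simpa using h2

lemma isQPT_pkGenP {P : Prog} (hP : IsQPT 1 P) : IsQPT 2 (pkGenP P) := by
  obtain ⟨p, hp⟩ := hP.bound
  obtain ⟨r, hr⟩ : PolyB fun B => pkGenCost P B B (p.eval (B + B)) := by
    simp only [pkGenCost]; fun_prop
  refine ⟨r, fun n xs hxs => ?_⟩
  obtain ⟨s, x, rfl⟩ := List.length_eq_two.1 hxs
  have hn : (n + ([s, x].map List.length).sum) = n + (s.length + x.length) := by simp
  rw [hn]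
  set B := n + (s.length + x.length) with hB
  obtain ⟨f, hf, h⟩ := runs_pkGenP (P := P) (n := n) (B := B) (s := s) (x := x)
    (T := p.eval (B + B)) (by omega) (by omega)
    (fun y hy => hp n [y] _ rfl (by simp; omega))
  refine h.time.mono fun o ho => (ho.trans ?_).trans (hr B)
  have := callCost_mono P (show n + B + p.eval (B + B) ≤ B + B + p.eval (B + B) by omega)
  simp only [pkGenCost]
  gcongr <;> omega

/-! ### The choice of the columns -/

/-- The selection of one entry of a row of length `C`. -/
def rowSel (C u : ℕ) : List Bool :=
  -- The number `u` selects column `C - 1 - u`: the row is assembled on a stack by `selRow`,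
  -- beginning with the `u` cells at its far end.
  List.replicate (C - 1 - u) false ++ true :: List.replicate u false

/-- Choose `k` independent random numbers below `2 ^ z`. -/
def selC (k z : ℕ) : Comp (List ℕ) :=
  iterM (fun us => unifC z >>= fun u => pure (u :: us)) k []

def selRow : Prog :=
  block [idxP 14 10 17, pushN 13 16 true, popN 10 16, pushN 10 15 false, .push 15 true, .pop 16,
    pushN 16 15 false, clear 16, clear 10]

lemma runs_selRow {μ : Mem} {z C : ℕ} (hC : C = 2 ^ z) (h10 : μ 10 = [])
    (h13 : μ 13 = unary C) (h14 : μ 14 = unary z) (h16 : μ 16 = []) :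
    Runs selRow μ (unifC z >>= fun u =>
      pure (update μ 15 (ofBits (rowSel C u) ++ μ 15))) (z * (C + 10) + 7 * C + 20) := by
  have s0 := runs_idxP (z := 14) (u := 10) (c := 17) (k := z) (μ := μ)
    (by rw [h14, length_unary]) h10
  rw [← hC] at s0
  refine (s0.block_bind (all_unifC z) (T' := 7 * C + 19) fun u hu => ((runs_pushN rfl).block_cons
    ((runs_popN rfl).block_cons ((runs_pushN rfl).block_cons (Runs.push.block_cons
    (Runs.pop.block_cons ((runs_pushN rfl).block_cons ((runs_clear rfl).block_cons
    (runs_clear ?_).block_one))))))).mono ?_).mono (by omega)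
  all_goals rw [← hC] at hu
  · obtain ⟨k, rfl⟩ : ∃ k, C = u + k + 1 := ⟨C - 1 - u, by omega⟩
    have h : u + k + 1 - u = k + 1 := by omega
    funext r
    by_cases h1 : r = 15
    · simp [h1, h13, h16, rowSel, ofBits, h]
    · by_cases h2 : r = 16 <;> by_cases h3 : r = 10 <;> simp [h1, h2, h3, h10, h16]
  · simp [h13, h16]
    omega

def selP : Prog := .loop 11 selRow

lemma runs_selP {cs : List ℕ} {n : ℕ} {μ : Mem} (h10 : μ 10 = [])
    (h11 : μ 11 = unary (rows n)) (h13 : μ 13 = unary (cols cs n))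
    (h14 : μ 14 = unary (size (evalL cs n))) (h15 : μ 15 = []) (h16 : μ 16 = []) :
    Runs selP μ (selC (rows n) (size (evalL cs n)) >>= fun us =>
      pure (update μ 15 (ofBits (us.flatMap (rowSel (cols cs n))))))
      (rows n * (size (evalL cs n) * (cols cs n + 10) + 7 * cols cs n + 20) + 1) := by
  have := Runs.loop (r := 11) (k := rows n) (P := selRow)
    (T := size (evalL cs n) * (cols cs n + 10) + 7 * cols cs n + 20)
    (fun us : List ℕ => update μ 15 (ofBits (us.flatMap (rowSel (cols cs n)))))
    (fun us => unifC (size (evalL cs n)) >>= fun u => pure (u :: us)) (fun _ _ => True)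
    (fun i _ us _ => ⟨?_, All.true _⟩) (x := []) trivial (by simp [h11])
  · have e : update μ 15 (ofBits (([] : List ℕ).flatMap (rowSel (cols cs n)))) = μ := by
      rw [List.flatMap_nil, ofBits_nil, ← h15, update_eq_self]
    rw [e] at this
    exact this
  · refine (runs_selRow (z := size (evalL cs n)) (C := cols cs n) rfl (by simp [h10])
      (by simp [h13]) (by simp [h14]) (by simp [h16])).congr ?_
    simp [ofBits_append]

/-! ### Signatures -/

/-- The component of a signature for one slot. -/
def sigC (P : Prog) (n : ℕ) (m σ : List Bool) : Bool → Slot → Comp Slot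
  | false, _ => pure none
  | true, none => pure (some σ)
  | true, some sk => runOn P n [ofBits sk, ofBits m] >>= fun x => pure (some (toBits x))

def sigsC (P : Prog) (n : ℕ) (m σ : List Bool) : List Bool → List Slot → Comp (List Slot)
  | b :: bs, s :: l => do
      let c ← sigC P n m σ b s
      let r ← sigsC P n m σ bs l
      pure (c :: r)
  | _, _ => pure []

/-- Read a slot from a secret key. -/
def readSlot (s : Str) : Option Str × Str :=
  if topTrue s then (some (unframe s.tail).1, (unframe s.tail).2) else (none, s.tail)

def sigRaw (P : Prog) (n : ℕ) (m σ : List Bool) : Bool → Option Str → Comp Slot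
  | false, _ => pure none
  | true, none => pure (some σ)
  | true, some sk => runOn P n [sk, ofBits m] >>= fun x => pure (some (toBits x))

def signStep (P : Prog) (n : ℕ) (m σ : List Bool) (x : List Bool × Str × Str) :
    Comp (List Bool × Str × Str) :=
  sigRaw P n m σ (x.1.headD false) (readSlot x.2.1).1 >>= fun c =>
    pure (x.1.tail, (readSlot x.2.1).2, (ofBits (encSlot c)).reverse ++ x.2.2)

lemma readSlot_encSlots (s : Slot) (l : List Slot) :
    readSlot (ofBits (encSlots (s :: l))) = (s.map ofBits, ofBits (encSlots l)) := by
  cases s with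
  | none => rfl
  | some sk =>
    rw [ofBits_encSlots_cons, ofBits_encSlot_some, List.cons_append]
    simp [readSlot, topTrue, unframe_frame]

lemma iterM_signStep (P : Prog) (n : ℕ) (m σ : List Bool) (bs : List Bool) :
    ∀ (l : List Slot) (acc : Str), l.length = bs.length →
    (iterM (signStep P n m σ) bs.length (bs, ofBits (encSlots l), acc) >>=
      fun z => pure z.2.2) =
    sigsC P n m σ bs l >>= fun r => pure ((ofBits (encSlots r)).reverse ++ acc) := by
  induction bs with
  | nil =>
    intro l acc hl
    obtain rfl := List.length_eq_zero_iff.1 hl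
    simp [iterM, sigsC, encSlots]
  | cons b bs ih =>
    intro l acc hl
    obtain ⟨s, l, rfl⟩ := List.exists_cons_of_length_eq_add_one hl
    have hl' : l.length = bs.length := by simpa using hl
    have hc : sigRaw P n m σ b (s.map ofBits) = sigC P n m σ b s := by
      cases b <;> cases s <;> rfl
    rw [List.length_cons, iterM, bind_assoc]
    simp only [signStep, readSlot_encSlots, List.headD_cons, List.tail_cons, bind_assoc, pure_bind,
      hc, sigsC]
    congr 1
    funext c
    rw [ih _ _ hl']
    simp [ofBits_encSlots_cons]

def skipSlot : Prog :=
  block [.push 5 false, .test 1 (.pop 1) (.pop 1) (block [.pop 1, readFrame 1 8 9, clear 8])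
    (.pop 1)]

def emptySlot : Prog := block [.pop 1, emitBits 3]

def fullSlot (P : Prog) : Prog := block [.pop 1, readArg 1 1, copyArg 2 2, callEmit P]

def signSlot (P : Prog) : Prog :=
  .test 15 skipSlot skipSlot (.test 1 emptySlot emptySlot (fullSlot P) emptySlot) skipSlot

def signBody (P : Prog) : Prog := block [signSlot P, .pop 15]

lemma runs_signBody {P : Prog} {n T B : ℕ} {d a : Mem} {bs : List Bool} {m σ : Str}
    (d0 : d 0 = unary n)
    (d2 : d 2 = m) (d3 : d 3 = σ) (d6 : d 6 = [])
    (d7 : d 7 = []) (d8 : d 8 = []) (d9 : d 9 = []) (d15 : d 15 = ofBits bs)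
    (h1 : (d 1).length ≤ B) (h2 : m.length ≤ B) (h3 : σ.length ≤ B)
    (hT : ∀ x y : Str, x.length ≤ B → y.length ≤ B →
      All (fun o => o.2 ≤ T) (exec P (load [unary n, x, y]))) :
    Runs (signBody P) (mix d 𝟎 a)
      (signStep P n (toBits m) (toBits σ) (bs, d 1, d 5) >>= fun z =>
        pure (mix (update (update
        (update d 15 (ofBits z.1)) 1 z.2.1) 5 z.2.2) 𝟎 a))
      (callCost P (n + 2 * B + T) + 20 * (n + 2 * B + T) + 40) := by
  set L := n + 2 * B + T with hL
  have step : ∀ μ, Runs (.pop 15) (mix μ 𝟎 a)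
      (pure (mix (update μ 15 (μ 15).tail) 𝟎 a)) 1 := fun μ =>
    Runs.pop.congr (by rw [update_mix, mix_lt])
  have pop1 : ∀ μ, Runs (.pop 1) (mix μ 𝟎 a)
      (pure (mix (update μ 1 (μ 1).tail) 𝟎 a)) 1 := fun μ =>
    Runs.pop.congr (by rw [update_mix, mix_lt])
  have htail : (d 1).tail.length ≤ B := by rw [List.length_tail]; omega
  have hu := unframe_fst_length (d 1).tail
  have key : Runs (signSlot P) (mix d 𝟎 a)
      (sigRaw P n (toBits m) (toBits σ) (bs.headD false) (readSlot (d 1)).1 >>= fun c =>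
        pure (mix (update (update d 1 (readSlot (d 1)).2) 5
          ((ofBits (encSlot c)).reverse ++ d 5)) 𝟎 a))
      (callCost P L + 20 * L + 36) := by
    refine Runs.test_top (T := callCost P L + 20 * L + 35) (fun h => ?_) (fun h => ?_)
    all_goals rw [mix_lt, d15] at h
    · have hb : bs.headD false = false := by rcases bs with _ | ⟨_ | _, _⟩ <;> simp_all [topTrue]
      have s1 : Runs (.push 5 false) (mix d 𝟎 a)
          (pure (mix (update d 5 (.bit false :: d 5)) 𝟎 a)) 1 :=
        Runs.push.congr (by rw [update_mix, mix_lt])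
      have s2 : Runs (.test 1 (.pop 1) (.pop 1) (block [.pop 1, readFrame 1 8 9, clear 8]) (.pop 1))
          (mix (update d 5 (.bit false :: d 5)) 𝟎 a)
          (pure (mix (update (update d 1 (readSlot (d 1)).2) 5
            (.bit false :: d 5)) 𝟎 a)) (5 * B + 6 + 1) := by
        refine Runs.test_top (fun h' => ?_) (fun h' => ?_)
        all_goals rw [mix_lt, update_of_ne (by norm_num)] at h'
        · refine ((pop1 _).mono (by omega)).congr ?_
          rw [readSlot, h', update_of_ne (by norm_num),
            update_comm (by norm_num)]
          rfl
        · have t1 := pop1 (update d 5 (.bit false :: d 5))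
          have t2 : Runs (readFrame 1 8 9) (mix (update (update d 5
              (.bit false :: d 5)) 1 ((update d 5 (.bit false :: d 5)) 1).tail)
                𝟎 a)
              (pure (mix (update (update (update d 1
              (readSlot (d 1)).2) 5 (.bit false :: d 5)) 8 (unframe (d 1).tail).1.reverse)
              𝟎 a)) (4 * B + 3) := by
            refine (runs_readFrame ?_ ?_).mono ?_
            · rw [mix_lt]
              simp [d9]
            · rw [update_mix, update_mix]
              congr 1
              rw [readSlot, h']
              funext r
              simp only [update_apply, mix_lt (show 1 < 24 by norm_num),
                mix_lt (show 8 < 24 by norm_num)]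
              split_ifs <;> simp_all
            · simp
              omega
          have t3 : Runs (clear 8) (mix (update (update (update d 1
              (readSlot (d 1)).2) 5 (.bit false :: d 5)) 8 (unframe (d 1).tail).1.reverse)
              𝟎 a) (pure (mix (update (update d 1 (readSlot (d 1)).2) 5
            (.bit false :: d 5)) 𝟎 a)) (B + 1) := by
            refine (runs_clear ?_).mono ?_
            · rw [update_mix]
              congr 1
              funext r
              simp only [update_apply]
              split_ifs <;> simp_all
            · simp
              omega
          exact (t1.block_cons (t2.block_cons t3.block_one)).mono (by omega)
      refine ((s1.block_cons s2.block_one).mono (by omega)).congr ?_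
      rw [hb, sigRaw, pure_bind]
      simp [encSlot]
    · have hb : bs.headD false = true := by rcases bs with _ | ⟨_ | _, _⟩ <;> simp_all [topTrue]
      refine (Runs.test_top (T := callCost P L + 20 * L + 34) (fun h' => ?_) (fun h' => ?_)).mono
        le_rfl
      all_goals rw [mix_lt] at h'
      · have s1 := pop1 d
        have s2 := runs_emitBits (d := update d 1 (d 1).tail) (s := load []) (a := a)
          (r := 3)
          (by simp [d6]) (by simp [d7]) (by simp [d9])
        refine ((s1.block_cons s2.block_one).mono ?_).congr ?_
        · rw [update_of_ne (by norm_num), d3]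
          omega
        · rw [hb, readSlot, h']
          simp [sigRaw, d3]
      · have s1 := pop1 d
        have s2 : Runs (readArg 1 1) (mix (update d 1 (d 1).tail) 𝟎 a)
            (pure (mix (update d 1 (readSlot (d 1)).2)
              (load [[], (unframe (d 1).tail).1]) a)) (5 * B + 5) := by
          refine (runs_readArg (by simp [d8])
            (by simp [d9]) rfl ?_ ?_).mono ?_
          · simp [readSlot, h']
          · rw [update_self, ← load_append_nil]
            exact update_load_length [[]] _
          · rw [update_self]
            omega
        have s3 : Runs (copyArg 2 2) (mix (update d 1 (readSlot (d 1)).2)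
              (load [[], (unframe (d 1).tail).1]) a)
            (pure (mix (update d 1 (readSlot (d 1)).2)
              (load [[], (unframe (d 1).tail).1, ofBits (toBits m)]) a)) (5 * B + 4) := by
          refine (runs_copyArg (by simp [d6])
            (by simp [d7]) rfl ?_).mono ?_
          · rw [update_of_ne (by norm_num), d2]
            exact update_load_length [[], (unframe (d 1).tail).1] _
          · rw [update_of_ne (by norm_num), d2]
            omega
        have hm := length_toBits_le m
        have s4 := runs_callEmit (d := update d 1 (readSlot (d 1)).2) (a := a) (P := P)
          (xs := [(unframe (d 1).tail).1, ofBits (toBits m)]) (n := n) (T := T) (L := L) (by simp)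
          (by simp [d0]) (by simp [d6]) (by simp [d7]) (by simp [d8]) (by simp [d9])
          (hT _ _ (by omega) (by rw [length_ofBits]; omega)) (by simp; omega)
        refine ((s1.block_cons (s2.block_cons (s3.block_cons s4.block_one))).mono ?_).congr ?_
        · omega
        · rw [hb]
          simp [readSlot, h', sigRaw]
  refine ((key.block_bind (All.true _) fun c _ => (step _).block_one).mono (by omega)).congr ?_
  simp only [signStep, bind_assoc, pure_bind]
  congr 1
  funext c
  congr 2
  have : (ofBits bs).tail = ofBits bs.tail := by cases bs <;> rfl
  funext r
  simp only [update_apply]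
  split_ifs <;> simp_all

lemma sigRaw_all (P : Prog) (n : ℕ) (m σ : List Bool) (B : ℕ)
    (x : List Bool × Str × Str) (h : x.2.1.length ≤ B) :
    All (fun x => x.2.1.length ≤ B) (signStep P n m σ x) := by
  refine (All.true _).bind fun c _ => All.pure ?_
  have := unframe_snd_length x.2.1.tail
  have h' : x.2.1.tail.length ≤ B := by rw [List.length_tail]; omega
  simp only [readSlot]
  split_ifs
  · exact this.trans h'
  · exact h'

/-- Sign the message in register `2` with a random key of each row of the table in register `1`.
The string in register `3` takes the place of the signatures for empty slots. -/
def signP (cs : List ℕ) (P : Prog) : Prog :=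
  block [block [setup cs, selP, .loop 15 (signBody P)], moveAll 5 4]

def signCost (cs : List ℕ) (P : Prog) (n B T : ℕ) : ℕ :=
  2 * (setupCost cs n +
    (rows n * (size (evalL cs n) * (cols cs n + 10) + 7 * cols cs n + 20) + 1 +
    (tsize cs n * (callCost P (n + 2 * B + T) + 20 * (n + 2 * B + T) + 40) + 2))) + 2

lemma length_rowSel {C u : ℕ} (h : u < C) : (rowSel C u).length = C := by
  simp [rowSel]
  omega

lemma all_selC (k z : ℕ) : All (fun us => us.length = k ∧ ∀ u ∈ us, u < 2 ^ z) (selC k z) := by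
  refine All.iterM_of_index (fun (i : ℕ) (us : List ℕ) => us.length = i ∧ ∀ u ∈ us, u < 2 ^ z)
    (fun i _ us hus => (all_unifC z).bind fun u hu => All.pure ⟨by simp [hus.1], ?_⟩) (by simp)
  simpa using ⟨hu, hus.2⟩

lemma length_flatMap_rowSel {C : ℕ} {us : List ℕ} (h : ∀ u ∈ us, u < C) :
    (us.flatMap (rowSel C)).length = us.length * C := by
  induction us with
  | nil => simp
  | cons u us ih =>
    rw [List.flatMap_cons, List.length_append, ih fun v hv => h v (List.mem_cons_of_mem _ hv),
      length_rowSel (h u List.mem_cons_self), List.length_cons]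
    ring

lemma runs_signP {cs : List ℕ} {P : Prog} {n T B : ℕ} {s m σ : Str} (h1 : s.length ≤ B)
    (h2 : m.length ≤ B) (h3 : σ.length ≤ B)
    (hT : ∀ x y : Str, x.length ≤ B → y.length ≤ B →
      All (fun o => o.2 ≤ T) (exec P (load [unary n, x, y]))) :
    ∃ f : List Bool × Str × Str → Mem, (∀ z, f z 4 = z.2.2.reverse) ∧
    Runs (signP cs P) (load [unary n, s, m, σ])
      ((selC (rows n) (size (evalL cs n)) >>= fun us =>
        iterM (signStep P n (toBits m) (toBits σ)) (us.flatMap (rowSel (cols cs n))).length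
        (us.flatMap (rowSel (cols cs n)), s, [])) >>= fun z => pure (f z))
      (signCost cs P n B T) := by
  set d := tbl cs n [s, m, σ] with hd
  have e : ∀ r, r ≤ 10 ∨ 15 ≤ r → d r = load [unary n, s, m, σ] r := by
    rintro r hr
    simp only [hd, tbl]
    split_ifs <;> first | rfl | omega
  have e' : ∀ r, (4 ≤ r ∧ r ≤ 10) ∨ 15 ≤ r → d r = [] := fun r hr => by
    rw [e r (by omega)]
    exact List.getD_eq_default _ _ (by simp; omega)
  have e0 : d 0 = unary n := e 0 (by norm_num)
  have e1 : d 1 = s := e 1 (by norm_num)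
  have e2 : d 2 = m := e 2 (by norm_num)
  have e3 : d 3 = σ := e 3 (by norm_num)
  have s1 := runs_setup_load (cs := cs) (n := n) (xs := [s, m, σ]) (by simp)
  have s2 := runs_selP (cs := cs) (n := n) (μ := mix d 𝟎 𝟎)
    (by rw [mix_lt, e' _ (by norm_num)])
    (by simp [hd, tbl]) (by simp [hd, tbl]) (by simp [hd, tbl])
    (by rw [mix_lt, e' _ (by norm_num)])
    (by rw [mix_lt, e' _ (by norm_num)])
  have s3 : ∀ bs : List Bool, bs.length = tsize cs n → Runs (.loop 15 (signBody P))
      (update (mix d 𝟎 𝟎) 15 (ofBits bs))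
      (iterM (signStep P n (toBits m) (toBits σ)) bs.length (bs, s, []) >>= fun z =>
        pure (mix (update (update (update d 15 (ofBits z.1)) 1 z.2.1) 5
          z.2.2) 𝟎 𝟎))
      (tsize cs n * (callCost P (n + 2 * B + T) + 20 * (n + 2 * B + T) + 40) + 1) := by
    intro bs hbs
    have := Runs.loop (r := 15) (k := bs.length) (P := signBody P)
      (T := callCost P (n + 2 * B + T) + 20 * (n + 2 * B + T) + 40)
      (fun z : List Bool × Str × Str => mix (update (update
        (update d 15 (ofBits z.1)) 1 z.2.1) 5 z.2.2) 𝟎 𝟎)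
      (signStep P n (toBits m) (toBits σ)) (fun _ z => z.2.1.length ≤ B)
      (fun i _ z hz => ⟨?_, sigRaw_all _ _ _ _ _ z hz⟩) (x := (bs, s, [])) h1
      (by simp)
    · have hst : mix (update (update (update d 15 (ofBits bs)) 1 s) 5 [])
          𝟎 𝟎 =
          update (mix d 𝟎 𝟎) 15 (ofBits bs) := by
        rw [update_mix]
        congr 1
        funext r
        have := e' 5 (by norm_num)
        simp only [update_apply]
        split_ifs <;> simp_all
      rw [hst, hbs] at this
      rw [hbs]
      exact this
    · have := runs_signBody (P := P) (n := n) (T := T) (B := B) (bs := z.1) (m := m) (σ := σ)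
        (d := update (update (update d 15 (ofBits z.1)) 1 z.2.1) 5 z.2.2)
        (a := load []) (by simpa) (by simpa) (by simpa)
        (by simpa using e' 6 (by norm_num)) (by simpa using e' 7 (by norm_num))
        (by simpa using e' 8 (by norm_num)) (by simpa using e' 9 (by norm_num)) (by simp)
        (by simpa using hz) h2 h3 hT
      refine this.congr ?_
      rw [update_of_ne (by norm_num), update_self, update_self]
      congr 1
      funext z'
      congr 2
      funext r
      simp only [update_apply]
      split_ifs <;> simp_all
  have s23 := s2.block_bind (all_selC _ _) fun us hus => (s3 (us.flatMap (rowSel (cols cs n)))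
    (by rw [length_flatMap_rowSel (C := cols cs n) hus.2, hus.1]; rfl)).block_one
  rw [← bind_assoc] at s23
  have h := (s1.block_cons s23).block_output
    (List.getD_eq_default _ _ (by simp))
  refine ⟨_, fun z => ?_, h⟩
  have h4 := e' 4 (by norm_num)
  simp [h4]

lemma runOn_signP {cs : List ℕ} {P : Prog} (hP : IsQPT 2 P) (n : ℕ) (l : List Slot)
    (hl : l.length = tsize cs n) (m σ : List Bool) :
    runOn (signP cs P) n [ofBits (encSlots l), ofBits m, ofBits σ] =
      selC (rows n) (size (evalL cs n)) >>= fun us =>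
        sigsC P n m σ (us.flatMap (rowSel (cols cs n))) l >>= fun r =>
          pure (ofBits (encSlots r)) := by
  obtain ⟨p, hp⟩ := hP.bound
  set B := (ofBits (encSlots l)).length + m.length + σ.length with hB
  obtain ⟨f, hf, h⟩ := runs_signP (cs := cs) (P := P) (n := n) (B := B)
    (s := ofBits (encSlots l)) (m := ofBits m) (σ := ofBits σ) (T := p.eval (n + (B + B)))
    (by omega) (by rw [length_ofBits]; omega) (by rw [length_ofBits]; omega)
    (fun x y hx hy => hp n [x, y] _ rfl (by simp; omega))
  rw [h.runOn_eq]
  have e : ∀ z, f z outReg = z.2.2.reverse := hf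
  simp only [e, bind_assoc, toBits_ofBits]
  refine (all_selC _ _).bind_congr fun us hus => ?_
  have := iterM_signStep P n m σ (us.flatMap (rowSel (cols cs n))) l []
    (by rw [length_flatMap_rowSel (C := cols cs n) hus.2, hus.1, hl]; rfl)
  have h2 := congrArg (fun c => c >>= fun y => pure (List.reverse y)) this
  simpa using h2

lemma polyCost_mono (cs : List ℕ) {a b : ℕ} (h : a ≤ b) : polyCost cs a ≤ polyCost cs b := by
  induction cs with
  | nil => exact le_rfl
  | cons c cs ih =>
    have := evalL_mono cs h
    simp only [polyCost]
    gcongr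

lemma sizeCost_mono (cs : List ℕ) {a b : ℕ} (h : a ≤ b) : sizeCost cs a ≤ sizeCost cs b := by
  have := evalL_mono cs h
  have := polyCost_mono cs h
  simp only [sizeCost]
  gcongr

lemma cols_mono (cs : List ℕ) {a b : ℕ} (h : a ≤ b) : cols cs a ≤ cols cs b :=
  Nat.pow_le_pow_right (by norm_num) (Nat.size_le_size (evalL_mono cs h))

lemma rows_mono {a b : ℕ} (h : a ≤ b) : rows a ≤ rows b :=
  Nat.pow_le_pow_right (by norm_num) (Nat.size_le_size h)

lemma signCost_mono (cs : List ℕ) (P : Prog) {n n' B T : ℕ} (h : n ≤ n') :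
    signCost cs P n B T ≤ signCost cs P n' B T := by
  have h1 := rows_mono h
  have h2 := cols_mono cs h
  have h3 := Nat.size_le_size (evalL_mono cs h)
  have h4 := callCost_mono P (show n + 2 * B + T ≤ n' + 2 * B + T by omega)
  have h5 := sizeCost_mono cs h
  have h6 := sizeCost_mono [0, 1] h
  simp only [signCost, setupCost, tsize]
  gcongr

lemma isQPT_signP (cs : List ℕ) {P : Prog} (hP : IsQPT 2 P) : IsQPT 3 (signP cs P) := by
  obtain ⟨p, hp⟩ := hP.bound
  obtain ⟨r, hr⟩ : PolyB fun B => signCost cs P B B (p.eval (B + (B + B))) := by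
    simp only [signCost]; fun_prop
  refine ⟨r, fun n xs hxs => ?_⟩
  obtain ⟨s, m, σ, rfl⟩ := List.length_eq_three.1 hxs
  have hn : (n + ([s, m, σ].map List.length).sum) = n + (s.length + (m.length + σ.length)) := by
    simp
  rw [hn]
  set B := n + (s.length + (m.length + σ.length)) with hB
  obtain ⟨f, hf, h⟩ := runs_signP (cs := cs) (P := P) (n := n) (B := B) (s := s) (m := m) (σ := σ)
    (T := p.eval (B + (B + B))) (by omega) (by omega) (by omega)
    (fun x y hx hy => hp n [x, y] _ rfl (by simp; omega))
  exact h.time.mono fun o ho => (ho.trans (signCost_mono cs P (by omega))).trans (hr B)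

/-! ### Verification -/

/-- Verify one component of a signature. -/
def compV (P : Prog) (n : ℕ) (m : List Bool) (pk : Str) : Option Str → Comp Bool
  | none => pure false
  | some s => runOn P n [pk, ofBits m, s] >>= fun x => pure ((toBits x).head? == some true)

/-- Verify the next `k` components. -/
def compsC (P : Prog) (n : ℕ) (m : List Bool) : ℕ → Str → Str → Comp (List Bool)
  | 0, _, _ => pure []
  | k + 1, pk, σ => do
      let b ← compV P n m (unframe pk).1 (readSlot σ).1
      let r ← compsC P n m k (unframe pk).2 (readSlot σ).2
      pure (b :: r)

/-- The number of rows without a valid component. -/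
def failC (C : ℕ) : ℕ → List Bool → ℕ
  | 0, _ => 0
  | k + 1, bs => (if (bs.take C).count true = 0 then 1 else 0) + failC C k (bs.drop C)

def verComp (P : Prog) : Prog :=
  block [.pop 3, readArg 3 3, copyArg 2 2, call P 6 8, copyBits 8 20 6 7,
    .test 20 .skip .skip (.push 18 true) .skip, clear 8, clear 20]

def verSkip : Prog := block [.pop 3, clear (sReg 1)]

def verBody (P : Prog) : Prog :=
  block [readArg 1 1, .test 3 verSkip verSkip (verComp P) verSkip]

def verRow (P : Prog) : Prog :=
  block [.loop 13 (verBody P), .test 18 (.push 19 true) (clear 18) (clear 18) (clear 18)]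

/-- Verify all components; in each row at least one has to be valid. -/
def verP (cs : List ℕ) (P : Prog) : Prog :=
  block [setup cs, .loop 11 (verRow P),
    .test 19 (.push 4 true) (.push 4 false) (.push 4 false) (.push 4 false)]

abbrev VState : Type := Str × Str × ℕ

def verStep (P : Prog) (n : ℕ) (m : List Bool) (z : VState) : Comp VState :=
  compV P n m (unframe z.1).1 (readSlot z.2.1).1 >>= fun b =>
    pure ((unframe z.1).2, (readSlot z.2.1).2, z.2.2 + b.toNat)

def rowStep (P : Prog) (n C : ℕ) (m : List Bool) (z : VState) : Comp VState :=
  iterM (verStep P n m) C (z.1, z.2.1, 0) >>= fun y =>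
    pure (y.1, y.2.1, z.2.2 + if y.2.2 = 0 then 1 else 0)

def dropFrame (s : Str) : Str := (unframe s).2

def dropSlot (s : Str) : Str := (readSlot s).2

lemma iterM_verStep (P : Prog) (n : ℕ) (m : List Bool) (k : ℕ) (pk σ : Str) (c : ℕ) :
    iterM (verStep P n m) k (pk, σ, c) = compsC P n m k pk σ >>= fun bs =>
      pure (dropFrame^[k] pk, dropSlot^[k] σ, c + bs.count true) := by
  induction k generalizing pk σ c with
  | zero => simp [iterM, compsC]
  | succ k ih =>
    simp only [iterM, compsC, verStep, bind_assoc, pure_bind, ih]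
    congr 1
    funext b
    congr 1
    funext bs
    have h : c + b.toNat + bs.count true = c + (b :: bs).count true := by
      cases b
      · simp
      · rw [List.count_cons_self, Bool.toNat_true]
        omega
    rw [← h]
    rfl

lemma compsC_add (P : Prog) (n : ℕ) (m : List Bool) (k l : ℕ) (pk σ : Str) :
    compsC P n m (k + l) pk σ = compsC P n m k pk σ >>= fun bs =>
      compsC P n m l (dropFrame^[k] pk) (dropSlot^[k] σ) >>= fun bs' => pure (bs ++ bs') := by
  induction k generalizing pk σ with
  | zero => simp [compsC]
  | succ k ih =>
    rw [Nat.succ_add]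
    simp [compsC, ih, bind_assoc, dropFrame, dropSlot]

lemma all_compsC (P : Prog) (n : ℕ) (m : List Bool) (k : ℕ) (pk σ : Str) :
    All (fun bs => bs.length = k) (compsC P n m k pk σ) := by
  induction k generalizing pk σ with
  | zero => exact All.pure rfl
  | succ k ih => exact (All.true _).bind fun b _ => (ih _ _).bind fun bs h => All.pure (by simp [h])

/-- The program works row by row. For the analysis all verdicts are collected in one list first, and
the failed rows are counted by `failC` afterwards. -/
lemma iterM_rowStep (P : Prog) (n C : ℕ) (m : List Bool) (k : ℕ) (pk σ : Str) (f : ℕ) :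
    iterM (rowStep P n C m) k (pk, σ, f) = compsC P n m (k * C) pk σ >>= fun bs =>
      pure (dropFrame^[k * C] pk, dropSlot^[k * C] σ, f + failC C k bs) := by
  induction k generalizing pk σ f with
  | zero => simp [iterM, compsC, failC]
  | succ k ih =>
    have e : (k + 1) * C = C + k * C := by ring
    simp only [iterM, rowStep, iterM_verStep, e, compsC_add, bind_assoc, pure_bind, ih]
    refine (all_compsC P n m C pk σ).bind_congr fun bs hbs => ?_
    congr 1
    funext bs'
    rw [failC, ← hbs, List.take_left, List.drop_left, iterate_add_apply,
      iterate_add_apply, ← iterate_add_apply, ← iterate_add_apply,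
      ← iterate_add_apply, ← iterate_add_apply,
      add_comm (k * bs.length) bs.length]
    simp [add_assoc]

lemma topTrue_ofBits_toBits (x : Str) :
    topTrue (ofBits (toBits x)) = ((toBits x).head? == some true) := by
  rcases toBits x with _ | ⟨_ | _, l⟩ <;> rfl

def vmem (d a : Mem) (z : VState) : Mem :=
  mix (update (update (update d 1 z.1) 3 z.2.1) 18 (unary z.2.2))
    𝟎 a

lemma readSlot_snd_length (s : Str) : (readSlot s).2.length ≤ s.length := by
  have := unframe_snd_length s.tail
  have h : s.tail.length ≤ s.length := by simp
  simp only [readSlot]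
  split_ifs
  · exact this.trans h
  · exact h

lemma runs_verBody {P : Prog} {n T B : ℕ} {d a : Mem} {m : Str} {z : VState}
    (d0 : d 0 = unary n) (d2 : d 2 = m) (d6 : d 6 = []) (d7 : d 7 = []) (d8 : d 8 = [])
    (d9 : d 9 = []) (d20 : d 20 = []) (h1 : z.1.length ≤ B) (h2 : m.length ≤ B)
    (h3 : z.2.1.length ≤ B)
    (hT : ∀ x y s : Str, x.length ≤ B → y.length ≤ B → s.length ≤ B →
      All (fun o => o.2 ≤ T) (exec P (load [unary n, x, y, s]))) :
    Runs (verBody P) (vmem d a z) (verStep P n (toBits m) z >>= fun z' => pure (vmem d a z'))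
      (callCost P (n + 3 * B + T) + 30 * (n + 3 * B + T) + 60) := by
  obtain ⟨pk, σ, c⟩ := z
  simp only at h1 h3
  set L := n + 3 * B + T with hL
  set d1 := update (update (update d 1 (unframe pk).2) 3 σ) 18
    (unary c) with hd1
  have hu := unframe_fst_length pk
  have s1 : Runs (readArg 1 1) (vmem d a (pk, σ, c))
      (pure (mix d1 (load [[], (unframe pk).1]) a)) (5 * B + 5) := by
    refine (runs_readArg (by simp [d8])
      (by simp [d9]) rfl ?_ ?_).mono ?_
    · rw [hd1]
      funext r
      simp only [update_apply]
      split_ifs <;> simp_all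
    · rw [← load_append_nil]
      simpa using update_load_length [[]] (unframe pk).1
    · simp
      omega
  have pop3 : ∀ s : Mem, Runs (.pop 3) (mix d1 s a)
      (pure (mix (update d1 3 σ.tail) s a)) 1 := fun s =>
    Runs.pop.congr (by rw [update_mix, mix_lt]; simp [hd1])
  have s2 : Runs (.test 3 verSkip verSkip (verComp P) verSkip)
      (mix d1 (load [[], (unframe pk).1]) a)
      (compV P n (toBits m) (unframe pk).1 (readSlot σ).1 >>= fun b =>
        pure (vmem d a ((unframe pk).2, (readSlot σ).2, c + b.toNat)))
      (callCost P L + 25 * L + 53 + 1) := by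
    refine Runs.test_top (fun h => ?_) (fun h => ?_)
    all_goals
      rw [mix_lt, hd1, update_of_ne (by norm_num),
        update_self] at h
    · have t : Runs (clear (sReg 1)) (mix (update d1 3 σ.tail)
          (load [[], (unframe pk).1]) a) (pure (mix (update d1 3 σ.tail) 𝟎 a))
          (B + 1) := by
        refine (runs_clear ?_).mono ?_
        · rw [update_mix_sReg, update_load (by simp)]
          congr 1
          exact (load_append_nil [[]]).trans (load_append_nil [])
        · rw [mix_sReg, load_apply]
          simp
          omega
      refine (((pop3 _).block_cons t.block_one).mono (by omega)).congr ?_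
      simp only [readSlot, h, compV, pure_bind, vmem, Bool.false_eq_true, if_false, Bool.toNat_false,
        add_zero]
      congr 2
      rw [hd1]
      funext r
      simp only [update_apply]
      split_ifs <;> simp_all
    · have ht : σ.tail.length ≤ B := by rw [List.length_tail]; omega
      have hu3 := unframe_fst_length σ.tail
      have hm := length_toBits_le m
      set d2' := update d1 3 (unframe σ.tail).2 with hd2
      have t1 : Runs (readArg 3 3) (mix (update d1 3 σ.tail)
          (load [[], (unframe pk).1]) a)
          (pure (mix d2' (load [[], (unframe pk).1, [], (unframe σ.tail).1]) a)) (5 * B + 5) := by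
        refine (runs_readArg (by simp [hd1, d8])
          (by simp [hd1, d9]) rfl ?_ ?_).mono ?_
        · simp [hd2]
        · rw [update_self, ← load_append_nil]
          exact update_load_length [[], (unframe pk).1, []] _
        · rw [update_self]
          omega
      have t2 : Runs (copyArg 2 2) (mix d2' (load [[], (unframe pk).1, [], (unframe σ.tail).1]) a)
          (pure (mix d2' (load [[], (unframe pk).1, ofBits (toBits m), (unframe σ.tail).1]) a))
          (5 * B + 4) := by
        refine (runs_copyArg (by simp [hd2, hd1, d6])
          (by simp [hd2, hd1, d7]) rfl ?_).mono ?_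
        · rw [update_load (by simp)]
          simp [hd2, hd1, d2]
        · simp [hd2, hd1, d2]
          omega
      have hT' := hT (unframe pk).1 (ofBits (toBits m)) (unframe σ.tail).1 (by omega)
        (by rw [length_ofBits]; omega) (by omega)
      have t3 := runs_call (P := P) (t := 6) (y := 8) (n := n) (T := T) (d := d2') (a := a)
        (xs := [(unframe pk).1, ofBits (toBits m), (unframe σ.tail).1]) (by simp [hd2, hd1, d0])
        (by simp [hd2, hd1, d6])
        (by simp [hd2, hd1, d8]) hT' (L := L) (by simp; omega)
      have t4 : ∀ x : Str, x.length ≤ T → Runs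
          (block [copyBits 8 20 6 7, .test 20 .skip .skip (.push 18 true) .skip, clear 8, clear 20])
          (mix (update d2' 8 x) 𝟎 a)
          (pure (vmem d a ((unframe pk).2, (readSlot σ).2,
            c + ((toBits x).head? == some true).toNat))) (7 * L + 20) := by
        intro x hx
        have hx' := length_toBits_le x
        have v2 : ∀ μ : Mem, μ 20 = ofBits (toBits x) →
            Runs (.test 20 .skip .skip (.push 18 true) .skip) μ (pure (update μ 18
              (unary ((toBits x).head? == some true).toNat ++ μ 18))) (1 + 1) := by
          intro μ hμ
          refine Runs.test_top (fun h => ?_) (fun h => ?_) <;>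
            rw [hμ, topTrue_ofBits_toBits] at h <;> rw [h]
          · exact Runs.skip.congr (by simp)
          · exact Runs.push
        refine ((runs_copyBits ?_ ?_ rfl).block_cons ((v2 _ ?_).block_cons
          ((runs_clear rfl).block_cons (runs_clear ?last).block_one))).mono ?time
        case last =>
          rw [update_mix, update_mix, update_mix, update_mix, vmem]
          congr 1
          rw [hd2, hd1, readSlot, h]
          funext r
          simp only [update_apply]
          split_ifs <;> simp_all [add_comm]
        case time =>
          simp [hd2, hd1, d20]
          omega
        all_goals simp [hd2, hd1, d6, d7, d20]
      refine (((pop3 _).block_cons (t1.block_cons (t2.block_cons (t3.block_bind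
        (all_runOn_length (by simp) hT') t4)))).mono ?_).congr ?_
      · omega
      · simp [readSlot, h, compV]
  refine ((s1.block_cons s2.block_one).mono (by omega)).congr ?_
  simp [verStep]

lemma all_verStep {P : Prog} {n : ℕ} {m : List Bool} {B i : ℕ} {z : VState}
    (h : z.1.length ≤ B ∧ z.2.1.length ≤ B ∧ z.2.2 ≤ i) :
    All (fun z : VState => z.1.length ≤ B ∧ z.2.1.length ≤ B ∧ z.2.2 ≤ i + 1)
      (verStep P n m z) := by
  refine (All.true _).bind fun b _ => All.pure ⟨(unframe_snd_length _).trans h.1,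
    (readSlot_snd_length _).trans h.2.1, ?_⟩
  have := Bool.toNat_le b
  have := h.2.2
  simp only
  omega

def wmem (d a : Mem) (z : VState) : Mem :=
  mix (update (update (update d 1 z.1) 3 z.2.1) 19 (unary z.2.2))
    𝟎 a

/-- Register 18 counts the valid components of the current row and is empty again at its end;
register 19 counts the rows without any. -/
lemma runs_verRow {P : Prog} {n T B C : ℕ} {d a : Mem} {m : Str} {z : VState}
    (d0 : d 0 = unary n) (d2 : d 2 = m) (d6 : d 6 = []) (d7 : d 7 = []) (d8 : d 8 = [])
    (d9 : d 9 = []) (d13 : d 13 = unary C) (d18 : d 18 = []) (d20 : d 20 = [])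
    (h1 : z.1.length ≤ B) (h2 : m.length ≤ B) (h3 : z.2.1.length ≤ B)
    (hT : ∀ x y s : Str, x.length ≤ B → y.length ≤ B → s.length ≤ B →
      All (fun o => o.2 ≤ T) (exec P (load [unary n, x, y, s]))) :
    Runs (verRow P) (wmem d a z) (rowStep P n C (toBits m) z >>= fun z' => pure (wmem d a z'))
      (C * (callCost P (n + 3 * B + T) + 30 * (n + 3 * B + T) + 60) + C + 4) ∧
    All (fun z : VState => z.1.length ≤ B ∧ z.2.1.length ≤ B) (rowStep P n C (toBits m) z) := by
  set d' := update d 19 (unary z.2.2) with hd'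
  have hi := All.iterM_of_index (step := verStep P n (toBits m)) (k := C)
    (fun i (z : VState) => z.1.length ≤ B ∧ z.2.1.length ≤ B ∧ z.2.2 ≤ i)
    (fun i _ z hz => all_verStep hz) (x := (z.1, z.2.1, 0)) ⟨h1, h3, le_rfl⟩
  refine ⟨?_, hi.bind fun y hy => All.pure ⟨hy.1, hy.2.1⟩⟩
  have s1 := Runs.loop (r := 13) (k := C) (P := verBody P) (vmem d' a)
    (verStep P n (toBits m)) (fun i z => z.1.length ≤ B ∧ z.2.1.length ≤ B ∧ z.2.2 ≤ i)
    (fun i _ z hz => ⟨runs_verBody (P := P) (by simp [hd', d0]) (by simp [hd', d2])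
      (by simp [hd', d6]) (by simp [hd', d7]) (by simp [hd', d8]) (by simp [hd', d9])
      (by simp [hd', d20]) hz.1 h2 hz.2.1 hT, all_verStep hz⟩) (x := (z.1, z.2.1, 0))
    ⟨h1, h3, le_rfl⟩ (by simp [vmem, hd', d13])
  have e : vmem d' a (z.1, z.2.1, 0) = wmem d a z := by
    simp only [vmem, wmem]
    congr 1
    funext r
    simp only [hd', update_apply]
    split_ifs <;> simp_all
  rw [e] at s1
  refine ((s1.block_bind hi (T' := C + 3) fun y hy => ?_).mono (by omega)).congr
    (by rw [rowStep, bind_assoc])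
  rw [pure_bind]
  refine Runs.block_one (T := C + 2) ?_
  rcases hy2 : y.2.2 with _ | c
  · refine (Runs.test_nil ?_ Runs.push).mono (by omega) |>.congr ?_
    · simp [vmem, hy2]
    · simp only [vmem, wmem]
      rw [update_mix, mix_lt, hy2]
      congr 2
      funext r
      simp only [hd', update_apply]
      split_ifs <;> simp_all [unary_succ]
  · refine (Runs.test_true (T := C + 1) (l := unary c) ?_ ((runs_clear ?_).mono ?_)).mono
      (by omega)
    · simp [vmem, hy2, unary_succ]
    · simp only [vmem, wmem]
      rw [update_mix]
      congr 1
      funext r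
      simp only [hd', update_apply]
      split_ifs <;> simp_all
    · have := hy.2.2
      simp [vmem]
      omega

def verCost (cs : List ℕ) (P : Prog) (n B T : ℕ) : ℕ :=
  setupCost cs n + (rows n * (cols cs n * (callCost P (n + 3 * B + T) + 30 * (n + 3 * B + T) + 60)
    + cols cs n + 4) + 4)

lemma runs_verP {cs : List ℕ} {P : Prog} {n T B : ℕ} {pk m σ : Str} (h1 : pk.length ≤ B)
    (h2 : m.length ≤ B) (h3 : σ.length ≤ B)
    (hT : ∀ x y s : Str, x.length ≤ B → y.length ≤ B → s.length ≤ B →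
      All (fun o => o.2 ≤ T) (exec P (load [unary n, x, y, s]))) :
    ∃ f : VState → Mem, (∀ z, f z 4 = [.bit (decide (z.2.2 = 0))]) ∧
    Runs (verP cs P) (load [unary n, pk, m, σ])
      (iterM (rowStep P n (cols cs n) (toBits m)) (rows n) (pk, σ, 0) >>= fun z => pure (f z))
      (verCost cs P n B T) := by
  set d := tbl cs n [pk, m, σ] with hd
  have e' : ∀ r, (4 ≤ r ∧ r ≤ 10) ∨ 15 ≤ r → d r = [] := by
    intro r hr
    simp only [hd, tbl]
    rw [if_neg (by omega), if_neg (by omega), if_neg (by omega), if_neg (by omega)]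
    exact List.getD_eq_default _ _ (by simp; omega)
  have e0 : d 0 = unary n := rfl
  have e1 : d 1 = pk := rfl
  have e2 : d 2 = m := rfl
  have e3 : d 3 = σ := rfl
  have e11 : d 11 = unary (rows n) := rfl
  have e13 : d 13 = unary (cols cs n) := rfl
  have s1 := runs_setup_load (cs := cs) (n := n) (xs := [pk, m, σ]) (by simp)
  have s2 := Runs.loop (r := 11) (k := rows n) (P := verRow P) (wmem d 𝟎)
    (rowStep P n (cols cs n) (toBits m)) (fun _ z => z.1.length ≤ B ∧ z.2.1.length ≤ B)
    (fun i _ z hz => runs_verRow (P := P) e0 e2 (e' _ (by norm_num)) (e' _ (by norm_num))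
      (e' _ (by norm_num)) (e' _ (by norm_num)) e13 (e' _ (by norm_num)) (e' _ (by norm_num))
      hz.1 h2 hz.2 hT) (x := (pk, σ, 0)) ⟨h1, h3⟩ (by simp [wmem, e11])
  have e : wmem d 𝟎 (pk, σ, 0) = mix d 𝟎 𝟎 := by
    have := e' 19 (by norm_num)
    simp only [wmem]
    congr 1
    funext r
    simp only [update_apply]
    split_ifs <;> simp_all
  rw [e] at s2
  have s3 : ∀ z, Runs (.test 19 (.push 4 true) (.push 4 false) (.push 4 false) (.push 4 false))
      (wmem d 𝟎 z) (pure (update (wmem d 𝟎 z) 4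
        [.bit (decide (z.2.2 = 0))])) 2 := by
    intro z
    have h4 : wmem d 𝟎 z 4 = [] := by
      simp [wmem]
      exact e' 4 (by norm_num)
    rcases hz : z.2.2 with _ | c
    · refine (Runs.test_nil ?_ Runs.push).congr ?_
      · simp [wmem, hz]
      · rw [h4]
        simp
    · refine (Runs.test_true (l := unary c) ?_ Runs.push).congr ?_
      · simp [wmem, hz, unary_succ]
      · rw [h4]
        simp
  refine ⟨fun z => update (wmem d 𝟎 z) 4 [.bit (decide (z.2.2 = 0))],
    fun z => by simp, ?_⟩
  exact (s1.block_cons (s2.block_bind (All.true _) fun z _ => (s3 z).block_one)).mono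
    le_rfl

lemma runOn_verP {cs : List ℕ} {P : Prog} (hP : IsQPT 3 P) (n : ℕ) (pk m σ : Str) :
    runOn (verP cs P) n [pk, m, σ] =
      compsC P n (toBits m) (tsize cs n) pk σ >>= fun bs =>
        pure [.bit (decide (failC (cols cs n) (rows n) bs = 0))] := by
  obtain ⟨p, hp⟩ := hP.bound
  set B := pk.length + m.length + σ.length with hB
  obtain ⟨f, hf, h⟩ := runs_verP (cs := cs) (P := P) (n := n) (B := B) (pk := pk) (m := m)
    (σ := σ) (T := p.eval (n + (B + B + B))) (by omega) (by omega) (by omega)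
    (fun x y s hx hy hs => hp n [x, y, s] _ rfl (by simp; omega))
  rw [h.runOn_eq]
  have e : ∀ z, f z outReg = [.bit (decide (z.2.2 = 0))] := hf
  simp only [e, iterM_rowStep, bind_assoc, pure_bind, zero_add]
  rfl

lemma isQPT_verP (cs : List ℕ) {P : Prog} (hP : IsQPT 3 P) : IsQPT 3 (verP cs P) := by
  obtain ⟨p, hp⟩ := hP.bound
  obtain ⟨r, hr⟩ : PolyB fun B => verCost cs P B B (p.eval (B + (B + B + B))) := by
    simp only [verCost]; fun_prop
  refine ⟨r, fun n xs hxs => ?_⟩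
  obtain ⟨pk, m, σ, rfl⟩ := List.length_eq_three.1 hxs
  have hn : (n + ([pk, m, σ].map List.length).sum) = n + (pk.length + (m.length + σ.length)) := by
    simp
  rw [hn]
  set B := n + (pk.length + (m.length + σ.length)) with hB
  obtain ⟨f, hf, h⟩ := runs_verP (cs := cs) (P := P) (n := n) (B := B) (pk := pk) (m := m) (σ := σ)
    (T := p.eval (B + (B + B + B))) (by omega) (by omega) (by omega)
    (fun x y s hx hy hs => hp n [x, y, s] _ rfl (by simp; omega))
  refine h.time.mono fun o ho => (ho.trans ?_).trans (hr B)
  have hnB : n ≤ B := by omega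
  have h1 := rows_mono hnB
  have h2 := cols_mono cs hnB
  have h4 := callCost_mono P (show n + 3 * B + p.eval (B + (B + B + B)) ≤
    B + 3 * B + p.eval (B + (B + B + B)) by omega)
  have h5 := sizeCost_mono cs hnB
  have h6 := sizeCost_mono [0, 1] hnB
  simp only [verCost, setupCost]
  gcongr

/-! ### The branches of a computation do not depend on the state of the qubits -/

/-- Forget the name of a qubit. -/
def Cell.skel : Cell → Option Bool
  | .bit b => some b
  | .qubit _ => none

def skel (μ : Mem) : ℕ → List (Option Bool) := fun r => (μ r).map Cell.skel

lemma skel_update (μ : Mem) (r : ℕ) (l : Str) :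
    skel (update μ r l) = update (skel μ) r (l.map Cell.skel) := by
  funext t
  simp only [skel, update_apply]
  split_ifs <;> rfl

/-- Every branch of `c` corresponds to a branch of `c'`. -/
def Sim {α β : Type} (R : α → β → Prop) (c : Comp α) (c' : Comp β) : Prop :=
  ∀ h h', ∀ o ∈ c h, ∃ o' ∈ c' h', R o.1 o'.1

lemma Sim.pure {α β : Type} {R : α → β → Prop} {a : α} {b : β} (h : R a b) :
    Sim R (pure a) (pure b) := by
  intro h1 h2 o ho
  obtain rfl := List.mem_singleton.1 ho
  exact ⟨_, List.mem_singleton_self _, h⟩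

lemma Sim.bind {α β α' β' : Type} {R : α → β → Prop} {R' : α' → β' → Prop} {c : Comp α}
    {c' : Comp β} {f : α → Comp α'} {f' : β → Comp β'} (h : Sim R c c')
    (hf : ∀ a b, R a b → Sim R' (f a) (f' b)) : Sim R' (c >>= f) (c' >>= f') := by
  intro h1 h2 o ho
  rw [comp_bind_apply, List.mem_flatMap] at ho
  obtain ⟨o1, ho1, ho⟩ := ho
  obtain ⟨o2, ho2, hR⟩ := h h1 h2 o1 ho1
  obtain ⟨o', ho', hR'⟩ := hf _ _ hR _ o2.2 o ho
  exact ⟨o', by rw [comp_bind_apply, List.mem_flatMap]; exact ⟨o2, ho2, ho'⟩, hR'⟩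

lemma Sim.newQubit : Sim (fun _ _ => True) newQubit newQubit := fun _ _ _ _ =>
  ⟨_, List.mem_singleton_self _, trivial⟩

lemma Sim.applyGate (U V : Ket →ₗ[ℂ] Ket) :
    Sim (fun _ _ => True) (applyGate U) (applyGate V) := fun _ _ _ _ =>
  ⟨_, List.mem_singleton_self _, trivial⟩

lemma Sim.applyGate_left {α : Type} {R : Unit → α → Prop} (U : Ket →ₗ[ℂ] Ket) {a : α}
    (h : R () a) : Sim R (QDSModel.applyGate U) (Pure.pure a) := fun _ _ o ho =>
  ⟨_, List.mem_singleton_self _, by obtain rfl := List.mem_singleton.1 ho; exact h⟩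

lemma Sim.applyGate_right {α : Type} {R : α → Unit → Prop} (U : Ket →ₗ[ℂ] Ket) {a : α}
    (h : R a ()) : Sim R (Pure.pure a) (QDSModel.applyGate U) := fun _ _ o ho =>
  ⟨_, List.mem_singleton_self _, by obtain rfl := List.mem_singleton.1 ho; exact h⟩

lemma Sim.measureQubit (i j : ℕ) : Sim (fun a b => a = b) (measureQubit i) (measureQubit j) := by
  intro h1 h2 o ho
  simp only [QDSModel.measureQubit, List.mem_cons, List.not_mem_nil, or_false] at ho ⊢
  rcases ho with rfl | rfl
  · exact ⟨_, Or.inl rfl, rfl⟩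
  · exact ⟨_, Or.inr rfl, rfl⟩

/-- The same content up to the names of qubits, after the same number of steps. -/
def SkelEq (o o' : Mem × ℕ) : Prop := skel o.1 = skel o'.1 ∧ o.2 = o'.2

lemma SkelEq.add {o o' p p' : Mem × ℕ} (h : SkelEq o o') (h' : SkelEq p p') :
    SkelEq (p.1, o.2 + p.2) (p'.1, o'.2 + p'.2) := ⟨h'.1, by simp only [h.2, h'.2]⟩

lemma skel_map_eq {μ μ' : Mem} (h : skel μ = skel μ') (r : ℕ) :
    (μ r).map Cell.skel = (μ' r).map Cell.skel := congrFun h r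

lemma skel_cons_cases {l l' : Str} (h : l.map Cell.skel = l'.map Cell.skel) :
    (l = [] ∧ l' = []) ∨
    (∃ b t t', l = .bit b :: t ∧ l' = .bit b :: t' ∧ t.map Cell.skel = t'.map Cell.skel) ∨
    (∃ i j t t', l = .qubit i :: t ∧ l' = .qubit j :: t' ∧
      t.map Cell.skel = t'.map Cell.skel) := by
  rcases l with _ | ⟨_ | _, t⟩ <;> rcases l' with _ | ⟨_ | _, t'⟩ <;>
    simp_all [Cell.skel]

/-- Both outcomes of a measurement are always listed as branches, even with weight zero, and control
flow depends only on classical bits and on where qubits lie. The possible runs and their lengths are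
therefore independent of the quantum state and of names. This carries the time bound of an adversary
over to its use as a subroutine. -/
lemma exec_sim (P : Prog) : ∀ μ μ' : Mem, skel μ = skel μ' →
    Sim SkelEq (exec P μ) (exec P μ') := by
  have one : ∀ μ μ' : Mem, skel μ = skel μ' →
      Sim SkelEq (Pure.pure (μ, 1) : Comp (Mem × ℕ)) (Pure.pure (μ', 1)) :=
    fun μ μ' h => Sim.pure ⟨h, rfl⟩
  have gate : ∀ (U V : Ket →ₗ[ℂ] Ket) (μ μ' : Mem), skel μ = skel μ' →
      Sim SkelEq (applyGate U >>= fun _ => Pure.pure (μ, 1))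
        (applyGate V >>= fun _ => Pure.pure (μ', 1)) :=
    fun U V μ μ' h => (Sim.applyGate U V).bind fun _ _ _ => one μ μ' h
  induction P with
  | skip => exact one
  | push r b => exact fun μ μ' h => one _ _ (by
      rw [skel_update, skel_update, h, List.map_cons, List.map_cons, skel_map_eq h])
  | pop r => exact fun μ μ' h => one _ _ (by
      rw [skel_update, skel_update, h, List.map_tail, List.map_tail, skel_map_eq h])
  | move r s =>
    intro μ μ' h
    have key : ∀ c c' t t', Cell.skel c = Cell.skel c' → t.map Cell.skel = t'.map Cell.skel →
        skel (update (update μ r t) s (c :: update μ r t s)) =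
        skel (update (update μ' r t') s (c' :: update μ' r t' s)) := by
      intro c c' t t' hc ht
      have e : skel (update μ r t) = skel (update μ' r t') := by
        rw [skel_update, skel_update, h, ht]
      rw [skel_update _ s, skel_update _ s, e, List.map_cons, List.map_cons, hc, skel_map_eq e]
    rcases skel_cons_cases (skel_map_eq h r) with ⟨h1, h2⟩ | ⟨b, t, t', h1, h2, ht⟩ |
      ⟨i, j, t, t', h1, h2, ht⟩ <;> simp only [exec, h1, h2]
    · exact one _ _ h
    · exact one _ _ (key _ _ _ _ rfl ht)
    · exact one _ _ (key _ _ _ _ rfl ht)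
  | alloc r => exact fun μ μ' h => Sim.newQubit.bind fun i j _ => one _ _ (by
      rw [skel_update, skel_update, h, List.map_cons, List.map_cons, skel_map_eq h]; rfl)
  | had r =>
    intro μ μ' h
    rcases skel_cons_cases (skel_map_eq h r) with ⟨h1, h2⟩ | ⟨b, t, t', h1, h2, ht⟩ |
      ⟨i, j, t, t', h1, h2, ht⟩ <;> simp only [exec, h1, h2]
    · exact one _ _ h
    · exact one _ _ h
    · exact gate _ _ _ _ h
  | tgate r =>
    intro μ μ' h
    rcases skel_cons_cases (skel_map_eq h r) with ⟨h1, h2⟩ | ⟨b, t, t', h1, h2, ht⟩ |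
      ⟨i, j, t, t', h1, h2, ht⟩ <;> simp only [exec, h1, h2]
    · exact one _ _ h
    · exact one _ _ h
    · exact gate _ _ _ _ h
  | cnot r s =>
    intro μ μ' h
    rcases skel_cons_cases (skel_map_eq h r) with ⟨h1, h2⟩ | ⟨b, t, t', h1, h2, ht⟩ |
      ⟨i, j, t, t', h1, h2, ht⟩ <;>
    rcases skel_cons_cases (skel_map_eq h s) with ⟨h3, h4⟩ | ⟨b', v, v', h3, h4, hv⟩ |
      ⟨i', j', v, v', h3, h4, hv⟩ <;> simp only [exec, h1, h2, h3, h4]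
    any_goals exact one _ _ h
    -- The two names may coincide in one memory and not in the other. Then only one side applies a
    -- gate, which changes neither the registers nor the number of steps.
    split_ifs
    · exact one _ _ h
    · have : (Pure.pure (μ, 1) : Comp (Mem × ℕ)) = Pure.pure () >>= fun _ => Pure.pure (μ, 1) := by
        rw [pure_bind]
      rw [this]
      exact (Sim.applyGate_right (R := fun _ _ => True) _ trivial).bind fun _ _ _ => one _ _ h
    · have : (Pure.pure (μ', 1) : Comp (Mem × ℕ)) =
          Pure.pure () >>= fun _ => Pure.pure (μ', 1) := by rw [pure_bind]
      rw [this]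
      exact (Sim.applyGate_left (R := fun _ _ => True) _ trivial).bind fun _ _ _ => one _ _ h
    · exact gate _ _ _ _ h
  | meas r =>
    intro μ μ' h
    rcases skel_cons_cases (skel_map_eq h r) with ⟨h1, h2⟩ | ⟨b, t, t', h1, h2, ht⟩ |
      ⟨i, j, t, t', h1, h2, ht⟩ <;> simp only [exec, h1, h2]
    · exact one _ _ h
    · exact one _ _ h
    · refine (Sim.measureQubit i j).bind fun b b' hb => one _ _ ?_
      rw [skel_update, skel_update, h, List.map_cons, List.map_cons, ht, hb]
  | seq P Q ihP ihQ =>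
    exact fun μ μ' h => (ihP μ μ' h).bind fun o o' ho => (ihQ _ _ ho.1).bind fun p p' hp =>
      Sim.pure (ho.add hp)
  | test r P0 P1 P2 P3 ih0 ih1 ih2 ih3 =>
    intro μ μ' h
    have fin : ∀ P : Prog, Sim SkelEq (exec P μ) (exec P μ') →
        Sim SkelEq (exec P μ >>= fun o => Pure.pure (o.1, o.2 + 1))
          (exec P μ' >>= fun o => Pure.pure (o.1, o.2 + 1)) := fun P hP =>
      hP.bind fun o o' ho => Sim.pure ⟨ho.1, congrArg (· + 1) ho.2⟩
    rcases skel_cons_cases (skel_map_eq h r) with ⟨h1, h2⟩ | ⟨b, t, t', h1, h2, ht⟩ |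
      ⟨i, j, t, t', h1, h2, ht⟩ <;> simp only [exec, h1, h2]
    · exact fin _ (ih0 _ _ h)
    · cases b
      · exact fin _ (ih1 _ _ h)
      · exact fin _ (ih2 _ _ h)
    · exact fin _ (ih3 _ _ h)
  | loop r P ih =>
    have key : ∀ k μ μ', skel μ = skel μ' → Sim SkelEq (iter (exec P) k μ)
        (iter (exec P) k μ') := by
      intro k
      induction k with
      | zero => exact fun μ μ' h => Sim.pure ⟨h, rfl⟩
      | succ k ihk =>
        exact fun μ μ' h => (ih μ μ' h).bind fun o o' ho => (ihk _ _ ho.1).bind fun p p' hp =>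
          Sim.pure (ho.add hp)
    intro μ μ' h
    have hl : (μ r).length = (μ' r).length := by
      have := congrArg List.length (skel_map_eq h r)
      simpa using this
    simp only [exec, hl]
    exact (key _ _ _ h).bind fun o o' ho => Sim.pure ⟨ho.1, congrArg (· + 1) ho.2⟩

/-! ### Reachable states of an adversary -/

/-- Up to the names of qubits, `μ` is reached by `A` after `j` activations. -/
def AReach (A : Prog) (n j : ℕ) (μ : Mem) : Prop :=
  ∃ xs h, xs.length = j ∧ ∃ o ∈ activations A (load [unary n]) xs h, skel o.1.1 = skel μ

lemma aReach_zero (A : Prog) (n : ℕ) : AReach A n 0 (load [unary n]) :=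
  ⟨[], Heap.empty, rfl, _, List.mem_singleton_self _, rfl⟩

lemma mem_activations_concat {A : Prog} {x : Str} : ∀ {xs : List Str} {μ : Mem}
    {h : Heap} {o o' : (Mem × ℕ) × Heap}, o ∈ activations A μ xs h →
    o' ∈ activate A o.1.1 x o.2 →
    ((o'.1.1, o.1.2 + o'.1.2), o'.2) ∈ activations A μ (xs ++ [x]) h := by
  intro xs
  induction xs with
  | nil =>
    intro μ h o o' ho ho'
    obtain rfl := List.mem_singleton.1 ho
    rw [List.nil_append, activations, comp_bind_apply, List.mem_flatMap]
    refine ⟨o', ho', ?_⟩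
    rw [comp_bind_apply, List.mem_flatMap]
    refine ⟨((o'.1.1, 0), o'.2), List.mem_singleton_self _, ?_⟩
    simp [comp_pure_apply]
  | cons y ys ih =>
    intro μ h o o' ho ho'
    rw [activations, comp_bind_apply, List.mem_flatMap] at ho
    obtain ⟨a, ha, ho⟩ := ho
    rw [comp_bind_apply, List.mem_flatMap] at ho
    obtain ⟨b, hb, ho⟩ := ho
    obtain rfl := List.mem_singleton.1 ho
    rw [List.cons_append, activations, comp_bind_apply, List.mem_flatMap]
    refine ⟨a, ha, ?_⟩
    rw [comp_bind_apply, List.mem_flatMap]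
    exact ⟨_, ih hb ho', by simp [comp_pure_apply, add_assoc]⟩

/-- The input register is excluded because each activation overwrites it with a string of arbitrary
length. -/
lemma activations_growth (A : Prog) (xs : List Str) : ∀ (μ : Mem),
    All (fun o => ∀ r, r ≠ inReg → (o.1 r).length ≤ (μ r).length + o.2) (activations A μ xs) := by
  induction xs with
  | nil => exact fun μ => All.pure fun r _ => by simp
  | cons x xs ih =>
    intro μ
    refine (exec_growth A _).bind fun o ho => (ih o.1).bind fun o' ho' => All.pure fun r hr => ?_
    have h1 := ho r
    have h2 := ho' r hr
    rw [update_of_ne hr] at h1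
    simp only
    omega

section

variable {A : Prog} {n j Q b : ℕ} {μ : Mem}

lemma AReach.length (hA : ∀ xs : List Str, xs.length ≤ Q →
      All (fun o => o.2 ≤ b) (activations A (load [unary n]) xs))
    (h : AReach A n j μ) (hj : j ≤ Q) {r : ℕ} (hr : 2 ≤ r) : (μ r).length ≤ b := by
  obtain ⟨xs, hp, rfl, o, ho, hs⟩ := h
  have h1 := activations_growth A xs _ hp o ho r (by simp [inReg]; omega)
  have h2 := hA xs hj hp o ho
  have h3 := congrArg List.length (skel_map_eq hs r)
  have h4 : load [unary n] r = [] := List.getD_eq_default _ _ (by simp; omega)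
  rw [h4] at h1
  simp at h1 h3
  omega

lemma AReach.activate (h : AReach A n j μ) (x : Str) :
    All (fun o => AReach A n (j + 1) o.1) (activate A μ x) := by
  obtain ⟨xs, hp, rfl, o, ho, hs⟩ := h
  intro hp' o' ho'
  have e : skel (update μ inReg x) = skel (update o.1.1 inReg x) := by
    rw [skel_update, skel_update, hs]
  obtain ⟨o2, ho2, hR⟩ := exec_sim A _ _ e hp' o.2 o' ho'
  exact ⟨xs ++ [x], hp, by simp, _, mem_activations_concat ho ho2, hR.1.symm⟩

/-- The total time of the sequence extended by `x` bounds its last activation, and `exec_sim`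
transfers this bound to the present heap and names. -/
lemma AReach.time (hA : ∀ xs : List Str, xs.length ≤ Q →
      All (fun o => o.2 ≤ b) (activations A (load [unary n]) xs))
    (h : AReach A n j μ) (hj : j < Q) (x : Str) :
    All (fun o => o.2 ≤ b) (QDSModel.activate A μ x) := by
  obtain ⟨xs, hp, rfl, o, ho, hs⟩ := h
  intro hp' o' ho'
  have e : skel (update μ inReg x) = skel (update o.1.1 inReg x) := by
    rw [skel_update, skel_update, hs]
  obtain ⟨o2, ho2, hR⟩ := exec_sim A _ _ e hp' o.2 o' ho'
  have := hA (xs ++ [x]) (by simp; omega) hp _ (mem_activations_concat ho ho2)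
  have h2 := hR.2
  simp only at this
  omega

end

/-! ### Fragments of the reduction -/

section

variable {A : Prog} {n Q b W V T : ℕ} {d a : Mem}

/-- The public keys of the whole table, for one public key of the challenger. -/
def extendPK (P : Prog) : Prog := block [readArg 3 2, copyArg 2 1, callEmitQ P]

def extendStep (P : Prog) (n : ℕ) (sk : List Bool) :
    Str × Str → Comp (Str × Str)
  | ([], acc) => pure ([], acc)
  | (c :: s, acc) => runOn P n [ofBits sk, (unframe (c :: s)).1] >>= fun y =>
      pure ((unframe (c :: s)).2, (frame y).reverse ++ acc)

def extendPKs (P : Prog) : Prog :=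
  .loop 3 (.test 3 .skip (extendPK P) (extendPK P) (extendPK P))

def extendCost (P : Prog) (n W T : ℕ) : ℕ :=
  W * (callCost P (n + 2 * W + T) + 20 * (n + 2 * W + T) + 40) + 1

lemma runs_extendPKs {P : Prog} {sk : Str} {x : Str} (d0 : d 0 = unary n)
    (d2 : d 2 = sk) (d5 : d 5 = [])
    (d6 : d 6 = []) (d7 : d 7 = []) (d8 : d 8 = []) (d9 : d 9 = []) (h1 : sk.length ≤ W)
    (h2 : x.length ≤ W)
    (hT : ∀ x y : Str, x.length ≤ W → y.length ≤ W →
      All (fun o => o.2 ≤ T) (exec P (load [unary n, x, y]))) :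
    Runs (extendPKs P) (mix (update d 3 x) 𝟎 a)
      (iterM (extendStep P n (toBits sk)) x.length (x, []) >>= fun z =>
        pure (mix (update (update d 3 z.1) 5 z.2) 𝟎 a))
      (extendCost P n W T) := by
  have hstep : ∀ z : Str × Str, z.1.length ≤ W →
      All (fun z => z.1.length ≤ W) (extendStep P n (toBits sk) z) := by
    rintro ⟨_ | ⟨c, s⟩, acc⟩ hz
    · exact All.pure hz
    · exact (All.true _).bind fun y _ => All.pure ((unframe_snd_length (c :: s)).trans hz)
  have := Runs.loop (r := 3) (k := x.length)
    (P := .test 3 .skip (extendPK P) (extendPK P) (extendPK P))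
    (T := callCost P (n + 2 * W + T) + 20 * (n + 2 * W + T) + 40)
    (fun z : Str × Str =>
      mix (update (update d 3 z.1) 5 z.2) 𝟎 a)
    (extendStep P n (toBits sk)) (fun _ z => z.1.length ≤ W)
    (fun i _ z hz => ⟨?_, hstep z hz⟩) (x := (x, [])) h2 (by simp)
  · have e : update (update d 3 x) 5 [] = update d 3 x := by
      have h5 : [] = update d 3 x 5 := by simp [d5]
      rw [h5, update_eq_self]
    simp only [e] at this
    exact this.mono (by rw [extendCost]; gcongr)
  · obtain ⟨s, acc⟩ := z
    set L := n + 2 * W + T with hL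
    set d' := update (update d 3 s) 5 acc with hd'
    have hm := length_toBits_le sk
    have hu := unframe_fst_length s
    simp only at hz
    have s1 : Runs (readArg 3 2) (mix d' 𝟎 a)
        (pure (mix (update d' 3 (unframe s).2) (load [[], [], (unframe s).1]) a))
        (5 * W + 5) := by
      refine (runs_readArg (by simp [hd', d8])
        (by simp [hd', d9]) rfl (by simp [hd']) ?_).mono ?_
      · rw [← load_append_nil, ← load_append_nil]
        simpa [hd'] using update_load_length [[], []] (unframe s).1
      · simp [hd', hz]
    have s2 : Runs (copyArg 2 1) (mix (update d' 3 (unframe s).2)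
          (load [[], [], (unframe s).1]) a)
        (pure (mix (update d' 3 (unframe s).2)
          (load [[], ofBits (toBits sk), (unframe s).1]) a)) (5 * W + 4) := by
      refine (runs_copyArg (by simp [hd', d6])
        (by simp [hd', d7]) rfl ?_).mono ?_
      · rw [update_load (by simp)]
        simp [hd', d2]
      · simp [hd', d2, h1]
    have s3 := runs_callEmitQ (d := update d' 3 (unframe s).2) (a := a) (P := P)
      (xs := [ofBits (toBits sk), (unframe s).1]) (n := n) (T := T) (L := L) (by simp)
      (by simp [hd', d0]) (by simp [hd', d6]) (by simp [hd', d8])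
      (hT _ _ (by rw [length_ofBits]; omega) (by omega)) (by simp; omega)
    have s4 := s1.block_cons (s2.block_cons s3.block_one)
    rcases s with _ | ⟨c, s⟩
    · refine (Runs.test_nil (T := 1) (by simp [hd']) Runs.skip).mono (by omega)
        |>.congr ?_
      simp [extendStep, hd']
    · have key : Runs (extendPK P) (mix d' 𝟎 a)
          (extendStep P n (toBits sk) (c :: s, acc) >>= fun z =>
            pure (mix (update (update d 3 z.1) 5 z.2) 𝟎 a))
          (callCost P L + 20 * L + 39) := by
        refine (s4.mono (by omega)).congr ?_
        simp only [extendStep, bind_assoc, pure_bind]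
        congr 1
        funext y
        congr 2
        funext r
        simp only [hd', update_apply]
        split_ifs <;> simp_all
      rcases c with ⟨_ | _⟩ | i
      · exact Runs.test_false (T := callCost P L + 20 * L + 39) (l := s)
          (by simp [hd']) key
      · exact Runs.test_true (T := callCost P L + 20 * L + 39) (l := s)
          (by simp [hd']) key
      · exact Runs.test_qubit (i := i) (T := callCost P L + 20 * L + 39) (l := s)
          (by simp [hd']) key

/-- Answer a query of the adversary with the signing algorithm `P`. -/
def queryP (P A : Prog) : Prog :=
  block [copyBits (aReg 4) (sReg 2) 6 7, copyArg 2 1, copyArg 3 3, call P 6 8, clear (aReg 1),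
    moveAll 8 9, moveAll 9 (aReg 1), A.rename aReg]

def queryC (P A : Prog) (n : ℕ) (sk σ : List Bool) (a : Mem) : Comp Mem :=
  runOn P n [ofBits sk, ofBits (toBits (a 4)), ofBits σ] >>= fun x =>
    run A (update a inReg x)

/-- A state of the adversary after `j` activations. -/
def AInv (A : Prog) (n V j : ℕ) (a : Mem) : Prop := AReach A n j a ∧ (a 1).length ≤ V

lemma AInv.run {j : ℕ} {x : Str} (hA : ∀ xs : List Str, xs.length ≤ Q →
      All (fun o => o.2 ≤ b) (activations A (load [unary n]) xs)) (hj : j < Q)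
    (h : AReach A n j a) (hV : x.length + b ≤ V) :
    All (AInv A n V (j + 1)) (run A (update a inReg x)) := by
  refine (All.run (h.activate x)).and ((all_run_growth (h.time hA hj x)).mono fun ν hν => ?_)
  have := hν 1
  rw [show (1 : ℕ) = inReg from rfl, update_self] at this
  exact this.trans hV

lemma all_queryC {P : Prog} {j : ℕ} {sk σ : List Bool} (hA : ∀ xs : List Str,
      xs.length ≤ Q → All (fun o => o.2 ≤ b) (activations A (load [unary n]) xs)) (hj : j < Q)
    (h : AReach A n j a) (hV : T + b ≤ V)
    (h1 : sk.length ≤ W) (h3 : σ.length ≤ W) (hb : b ≤ W)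
    (hT : ∀ x y z : Str, x.length ≤ W → y.length ≤ W → z.length ≤ W →
      All (fun o => o.2 ≤ T) (exec P (load [unary n, x, y, z]))) :
    All (AInv A n V (j + 1)) (queryC P A n sk σ a) := by
  have ha := h.length hA hj.le (r := 4) (by norm_num)
  have := length_toBits_le (a 4)
  refine (all_runOn_length (by simp) (hT _ _ _ (by rwa [length_ofBits])
    (by rw [length_ofBits]; omega) (by rwa [length_ofBits]))).bind fun x hx =>
    AInv.run hA hj h (by omega)

def queryCost (P : Prog) (n b W V T : ℕ) : ℕ :=
  callCost P (n + 3 * W + T) + 20 * (n + 3 * W + T) + V + b + 40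

lemma runs_queryP {P : Prog} {j : ℕ} {sk σ : Str} (hA : ∀ xs : List Str,
      xs.length ≤ Q → All (fun o => o.2 ≤ b) (activations A (load [unary n]) xs)) (hj : j < Q)
    (h : AInv A n V j a)
    (d0 : d 0 = unary n) (d2 : d 2 = sk) (d3 : d 3 = σ)
    (d6 : d 6 = []) (d7 : d 7 = []) (d8 : d 8 = []) (d9 : d 9 = []) (h1 : sk.length ≤ W)
    (h3 : σ.length ≤ W) (hb : b ≤ W)
    (hT : ∀ x y z : Str, x.length ≤ W → y.length ≤ W → z.length ≤ W →
      All (fun o => o.2 ≤ T) (exec P (load [unary n, x, y, z]))) :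
    Runs (queryP P A) (mix d 𝟎 a)
      (queryC P A n (toBits sk) (toBits σ) a >>= fun a' => pure (mix d 𝟎 a'))
      (queryCost P n b W V T) := by
  have ha := h.1.length hA hj.le (r := 4) (by norm_num)
  have hm := length_toBits_le (a 4)
  have hsk := length_toBits_le sk
  have hσ := length_toBits_le σ
  have s1 : Runs (copyBits (aReg 4) (sReg 2) 6 7) (mix d 𝟎 a)
      (pure (mix d (load [[], [], ofBits (toBits (a 4))]) a)) (5 * W + 4) := by
    refine (runs_copyBits ?_ ?_ ?_).mono ?_
    · rw [mix_lt, d6]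
    · rw [mix_lt, d7]
    · rw [update_mix_sReg, mix_sReg, mix_aReg, ← load_append_nil, ← load_append_nil]
      congr 1
      simpa [load_apply] using update_load_length [[], []] (ofBits (toBits (a 4)))
    · rw [mix_aReg]
      omega
  have s2 : Runs (copyArg 2 1) (mix d (load [[], [], ofBits (toBits (a 4))]) a)
      (pure (mix d (load [[], ofBits (toBits sk), ofBits (toBits (a 4))]) a)) (5 * W + 4) := by
    refine (runs_copyArg d6 d7 rfl ?_).mono ?_
    · rw [update_load (by simp)]
      simp [d2]
    · rw [d2]
      omega
  have s3 : Runs (copyArg 3 3) (mix d (load [[], ofBits (toBits sk), ofBits (toBits (a 4))]) a)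
      (pure (mix d (load [[], ofBits (toBits sk), ofBits (toBits (a 4)), ofBits (toBits σ)]) a))
      (5 * W + 4) := by
    refine (runs_copyArg d6 d7 rfl ?_).mono ?_
    · rw [d3]
      exact update_load_length [[], ofBits (toBits sk), ofBits (toBits (a 4))] _
    · rw [d3]
      omega
  have hT' := hT (ofBits (toBits sk)) (ofBits (toBits (a 4))) (ofBits (toBits σ))
    (by rw [length_ofBits]; omega) (by rw [length_ofBits]; omega) (by rw [length_ofBits]; omega)
  have s4 := runs_call (P := P) (t := 6) (y := 8) (n := n) (T := T) (d := d) (a := a)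
    (xs := [ofBits (toBits sk), ofBits (toBits (a 4)), ofBits (toBits σ)]) d0
    d6 d8 hT' (L := n + 3 * W + T) (by simp; omega)
  have s5 : ∀ x : Str, x.length ≤ T →
      Runs (block [clear (aReg 1), moveAll 8 9, moveAll 9 (aReg 1), A.rename aReg])
      (mix (update d 8 x) 𝟎 a)
      (run A (update a inReg x) >>= fun a' => pure (mix d 𝟎 a'))
      (V + 1 + (T + 1 + (T + 1 + (b + 1)))) := by
    intro x hx
    have t1 : Runs (clear (aReg 1)) (mix (update d 8 x) 𝟎 a)
        (pure (mix (update d 8 x) 𝟎 (update a 1 []))) (V + 1) :=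
      (runs_clear (by rw [update_mix_aReg])).mono (by rw [mix_aReg]; exact Nat.succ_le_succ h.2)
    have t2 : Runs (moveAll 8 9) (mix (update d 8 x) 𝟎 (update a 1 []))
        (pure (mix (update d 9 x.reverse) 𝟎 (update a 1 []))) (T + 1) := by
      refine (runs_moveAll ?_).mono ?_
      · rw [update_mix, update_mix,
          mix_lt, mix_lt]
        congr 1
        funext r
        simp only [update_apply]
        split_ifs <;> simp_all
      · rw [mix_lt, update_self]
        omega
    have t3 : Runs (moveAll 9 (aReg 1)) (mix (update d 9 x.reverse) 𝟎
        (update a 1 [])) (pure (mix d 𝟎 (update a inReg x))) (T + 1) := by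
      refine (runs_moveAll ?_).mono ?_
      · rw [update_mix, update_mix_aReg, mix_aReg, mix_lt]
        simp only [update_self, update_idem, List.reverse_reverse,
          List.append_nil]
        rw [← d9, update_eq_self]
        rfl
      · rw [mix_lt, update_self, List.length_reverse]
        omega
    have t4 : Runs (A.rename aReg) (mix d 𝟎 (update a inReg x)) _ b :=
      Runs.adv ⟨rfl, h.1.time hA hj x⟩
    exact t1.block_cons (t2.block_cons (t3.block_cons t4.block_one))
  refine ((s1.block_cons (s2.block_cons (s3.block_cons (s4.block_bind
    (all_runOn_length (by simp) hT') s5)))).mono ?_).congr ?_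
  · rw [queryCost]
    omega
  · simp [queryC]

end

section

variable {A P : Prog} {n q b W V T : ℕ} {d a : Mem}

/-! ### The queries -/

/-- Answer the next query, if there is one. -/
def answerFirst (P A : Prog) : Prog :=
  .loop 16 (let B := block [.pop 20, queryP P A]
    .test 20 .skip B B B)

def firstStep (P A : Prog) (n : ℕ) (sk : List Bool) : ℕ × Mem → Comp (ℕ × Mem)
  | (0, a) => pure (0, a)
  | (q + 1, a) => queryC P A n sk [] a >>= fun a' => pure (q, a')

lemma all_firstStep {sk : List Bool} (hA : ∀ xs : List Str, xs.length ≤ q + 1 →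
      All (fun o => o.2 ≤ b) (activations A (load [unary n]) xs))
    (hV : T + b ≤ V) (h1 : sk.length ≤ W) (hb : b ≤ W)
    (hT : ∀ x y z : Str, x.length ≤ W → y.length ≤ W → z.length ≤ W →
      All (fun o => o.2 ≤ T) (exec P (load [unary n, x, y, z]))) (z : ℕ × Mem)
    (hz : z.1 ≤ q ∧ AInv A n V (1 + q - z.1) z.2) :
    All (fun z => z.1 ≤ q ∧ AInv A n V (1 + q - z.1) z.2) (firstStep P A n sk z) := by
  obtain ⟨_ | q', a⟩ := z
  · exact All.pure hz
  · simp only at hz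
    refine (all_queryC hA (by omega) hz.2.1 hV h1 (by simp) hb hT).bind fun a' ha' =>
      All.pure ⟨by simp only; omega, ?_⟩
    simp only
    rwa [show 1 + q - (q' + 1) + 1 = 1 + q - q' by omega] at ha'

/-- The guess `k` comes from a range whose size is a power of two and may exceed the number of
queries; register 20 counts the queries that are left and makes the surplus rounds idle. -/
lemma runs_answerFirst {k : ℕ} {sk : Str} (hA : ∀ xs : List Str,
      xs.length ≤ q + 1 → All (fun o => o.2 ≤ b) (activations A (load [unary n]) xs))
    (hV : T + b ≤ V) (h : AInv A n V 1 a)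
    (d0 : d 0 = unary n) (d2 : d 2 = sk) (d3 : d 3 = [])
    (d6 : d 6 = []) (d7 : d 7 = []) (d8 : d 8 = []) (d9 : d 9 = []) (d16 : d 16 = unary k)
    (d20 : d 20 = unary q) (h1 : sk.length ≤ W) (hb : b ≤ W)
    (hT : ∀ x y z : Str, x.length ≤ W → y.length ≤ W → z.length ≤ W →
      All (fun o => o.2 ≤ T) (exec P (load [unary n, x, y, z]))) :
    Runs (answerFirst P A) (mix d 𝟎 a)
      (iterM (firstStep P A n (toBits sk)) k (q, a) >>= fun z =>
        pure (mix (update d 20 (unary z.1)) 𝟎 z.2))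
      (k * (queryCost P n b W V T + 3) + 1) ∧
    All (fun z => z.1 ≤ q ∧ AInv A n V (1 + q - z.1) z.2)
      (iterM (firstStep P A n (toBits sk)) k (q, a)) := by
  have hsk := length_toBits_le sk
  have hs := all_firstStep (sk := toBits sk) hA hV (by omega) hb hT
  have h0 : q ≤ q ∧ AInv A n V (1 + q - q) a := ⟨le_rfl, by simpa using h⟩
  refine ⟨?_, All.iterM hs k h0⟩
  have := Runs.loop (r := 16) (k := k) (P := .test 20 .skip (block [.pop 20, queryP P A])
    (block [.pop 20, queryP P A]) (block [.pop 20, queryP P A]))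
    (T := queryCost P n b W V T + 3)
    (fun z : ℕ × Mem => mix (update d 20 (unary z.1)) 𝟎 z.2)
    (firstStep P A n (toBits sk)) (fun _ z => z.1 ≤ q ∧ AInv A n V (1 + q - z.1) z.2)
    (fun i _ z hz => ⟨?_, hs z hz⟩) (x := (q, a)) h0 (by simp [d16])
  · rw [show update d 20 (unary (q, a).1) = d by
      rw [← d20, update_eq_self]] at this
    exact this
  · obtain ⟨_ | q', a⟩ := z
    · refine (Runs.test_nil (T := 1) (by simp) Runs.skip).mono (by omega) |>.congr ?_
      simp [firstStep]
    · simp only at hz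
      have s1 : Runs (.pop 20) (mix (update d 20 (unary (q' + 1))) 𝟎 a)
          (pure (mix (update d 20 (unary q')) 𝟎 a)) 1 :=
        Runs.pop.congr (by
          rw [update_mix, mix_lt]
          simp [unary_succ])
      have s2 := runs_queryP (P := P) (σ := []) (d := update d 20 (unary q')) hA
        (by omega) hz.2 (by simp [d0]) (by simp [d2]) (by simp [d3]) (by simp [d6])
        (by simp [d7]) (by simp [d8]) (by simp [d9]) h1 (by simp) hb hT
      refine (Runs.test_true (T := 1 + (queryCost P n b W V T + 1)) (l := unary q')
        (by simp [unary_succ]) (s1.block_cons s2.block_one)).mono (by omega) |>.congr ?_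
      simp [firstStep]

/-- Answer the remaining queries. -/
def answerRest (P A : Prog) : Prog := .loop 20 (block [queryP P A, clear 3])

/-- The challenger's signature serves only the first of these queries; afterwards the empty string
takes its place. -/
def restStep (P A : Prog) (n : ℕ) (sk : List Bool) (z : Str × Mem) :
    Comp (Str × Mem) :=
  queryC P A n sk (toBits z.1) z.2 >>= fun a' => pure ([], a')

lemma runs_answerRest {q' : ℕ} {sk σ : Str} (hA : ∀ xs : List Str,
      xs.length ≤ q + 1 → All (fun o => o.2 ≤ b) (activations A (load [unary n]) xs))
    (hV : T + b ≤ V) (hq : q' ≤ q) (h : AInv A n V (1 + q - q') a)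
    (d0 : d 0 = unary n) (d2 : d 2 = sk) (d3 : d 3 = σ)
    (d6 : d 6 = []) (d7 : d 7 = []) (d8 : d 8 = []) (d9 : d 9 = [])
    (d20 : d 20 = unary q') (h1 : sk.length ≤ W) (h3 : σ.length ≤ W) (hb : b ≤ W)
    (hT : ∀ x y z : Str, x.length ≤ W → y.length ≤ W → z.length ≤ W →
      All (fun o => o.2 ≤ T) (exec P (load [unary n, x, y, z]))) :
    Runs (answerRest P A) (mix d 𝟎 a)
      (iterM (restStep P A n (toBits sk)) q' (σ, a) >>= fun z =>
        pure (mix (update d 3 z.1) 𝟎 z.2))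
      (q' * (queryCost P n b W V T + W + 2) + 1) ∧
    All (fun z => AInv A n V (1 + q) z.2)
      (iterM (restStep P A n (toBits sk)) q' (σ, a)) := by
  have hsk := length_toBits_le sk
  have hs : ∀ i < q', ∀ z : Str × Mem,
      z.1.length ≤ W ∧ AInv A n V (1 + q - q' + i) z.2 →
      All (fun z => z.1.length ≤ W ∧ AInv A n V (1 + q - q' + (i + 1)) z.2)
        (restStep P A n (toBits sk) z) := by
    intro i hi z hz
    have := length_toBits_le z.1
    exact (all_queryC hA (by omega) hz.2.1 hV (by omega) (by omega) hb hT).bind fun a' ha' =>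
      All.pure ⟨by simp, ha'⟩
  have h0 : σ.length ≤ W ∧ AInv A n V (1 + q - q' + 0) a := ⟨h3, h⟩
  refine ⟨?_, (All.iterM_of_index (fun i (z : Str × Mem) =>
    z.1.length ≤ W ∧ AInv A n V (1 + q - q' + i) z.2) hs (x := (σ, a)) h0).mono fun z hz => ?_⟩
  · have := Runs.loop (r := 20) (k := q') (P := block [queryP P A, clear 3])
      (T := queryCost P n b W V T + W + 2)
      (fun z : Str × Mem => mix (update d 3 z.1) 𝟎 z.2)
      (restStep P A n (toBits sk)) (fun i z => z.1.length ≤ W ∧ AInv A n V (1 + q - q' + i) z.2)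
      (fun i hi z hz => ⟨?_, hs i hi z hz⟩) (x := (σ, a)) h0 (by simp [d20])
    · rw [show update d 3 (σ, a).1 = d by
        rw [← d3, update_eq_self]] at this
      exact this
    · have s1 := runs_queryP (P := P) (d := update d 3 z.1) hA
        (by omega) hz.2 (by simp [d0]) (by simp [d2]) (by simp) (by simp [d6])
        (by simp [d7]) (by simp [d8]) (by simp [d9]) h1 hz.1 hb hT
      have s2 : ∀ a' : Mem, Runs (clear 3) (mix (update d 3 z.1) 𝟎 a')
          (pure (mix (update d 3 []) 𝟎 a')) (W + 1 - 1 + 1) := fun a' =>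
        (runs_clear (by rw [update_mix, update_idem])).mono (by
          rw [mix_lt, update_self]
          have := hz.1
          omega)
      refine ((s1.block_bind (All.true _) fun a' _ => (s2 a').block_one).mono (by omega)).congr ?_
      simp [restStep]
  · have := hz.2
    rwa [show 1 + q - q' + q' = 1 + q by omega] at this

end

/-! ### Small fragments -/

/-- Move at most as many cells as register `10` has from register `1` to register `3`. -/
def clipP : Prog := block [.loop 10 (.move 1 8), moveAll 8 3]

/-- The time bound of an adversary must hold for arbitrary incoming strings, so the reduction looks
only at a prefix of polynomial length. Everything an honest challenger sends fits into it. -/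
lemma runs_clipP {μ μ' : Mem} {c : ℕ} {x : Str} (h1 : μ 1 = x) (h3 : μ 3 = [])
    (h8 : μ 8 = []) (h10 : μ 10 = unary c)
    (h : update (update μ 1 (x.drop c)) 3 (x.take c) = μ') :
    Runs clipP μ (pure μ') (2 * c + 3) := by
  have s1 := Runs.loop_seq (r := 10) (k := c) (P := .move 1 8) (T := 1) (μ := μ)
    (fun i => update (update μ 1 (x.drop i)) 8 (x.take i).reverse)
    (by
      funext r
      simp only [update_apply]
      split_ifs <;> simp_all)
    (fun i _ => by
      rcases hx : x.drop i with _ | ⟨y, t⟩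
      · refine (Runs.move_nil (by simp)).congr ?_
        have hl : x.length ≤ i := List.drop_eq_nil_iff.1 hx
        rw [List.drop_eq_nil_of_le (by omega), List.take_of_length_le hl,
          List.take_of_length_le (by omega)]
      · refine (Runs.move (x := y) (l := t) (by simp) (by norm_num)).congr ?_
        have hl : i < x.length := by
          by_contra h
          rw [List.drop_eq_nil_of_le (by omega)] at hx
          cases hx
        have hy : x[i] = y ∧ x.drop (i + 1) = t := by
          rw [List.drop_eq_getElem_cons hl] at hx
          exact ⟨(List.cons.inj hx).1, (List.cons.inj hx).2⟩
        congr 1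
        rw [List.take_add_one, hy.2, List.getElem?_eq_getElem hl, hy.1]
        funext r
        simp only [update_apply]
        split_ifs <;> simp_all)
    (by rw [h10, length_unary])
  have s2 : Runs (moveAll 8 3) (update (update μ 1 (x.drop c)) 8
      (x.take c).reverse) (pure μ') (c + 1) := by
    refine (runs_moveAll ?_).mono (by simp)
    rw [← h]
    funext r
    simp only [update_apply]
    split_ifs <;> simp_all
  exact (s1.block_cons s2.block_one).mono (by omega)

def dropSlotP : Prog :=
  .test 8 (.pop 8) (.pop 8) (block [.pop 8, readFrame 8 9 6, clear 9]) (.pop 8)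

lemma runs_dropSlotP {μ μ' : Mem} {s : Str} (h6 : μ 6 = []) (h8 : μ 8 = s) (h9 : μ 9 = [])
    (h : update μ 8 (dropSlot s) = μ') :
    Runs dropSlotP μ (pure μ') (5 * s.length + 8) := by
  refine Runs.test_top (T := 5 * s.length + 7) (fun ht => ?_) (fun ht => ?_)
  all_goals rw [h8] at ht
  · refine (Runs.pop.mono (by omega)).congr ?_
    rw [← h, h8]
    simp [dropSlot, readSlot, ht]
  · have hl : s.tail.length ≤ s.length := by simp
    have hu := unframe_fst_length s.tail
    have s1 : Runs (.pop 8) μ (pure (update μ 8 s.tail)) 1 :=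
      Runs.pop.congr (by rw [h8])
    have s2 : Runs (readFrame 8 9 6) (update μ 8 s.tail) (pure (update
        (update μ 8 (unframe s.tail).2) 9 (unframe s.tail).1.reverse))
        (4 * s.length + 3) := by
      refine (runs_readFrame (by simp [h6]) ?_).mono ?_
      · simp [h9]
      · simp
    have s3 : Runs (clear 9) (update
        (update μ 8 (unframe s.tail).2) 9 (unframe s.tail).1.reverse) (pure μ')
        (s.length + 1) := by
      refine (runs_clear ?_).mono ?_
      · rw [← h]
        funext r
        simp only [update_apply, dropSlot, readSlot, ht]
        split_ifs <;> simp_all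
      · simp
        omega
    exact (s1.block_cons (s2.block_cons s3.block_one)).mono (by omega)

/-- Write the entry whose index is the length of register `15` of the list of slots in register
`8` to register `5`. -/
def pickP : Prog :=
  block [.loop 15 dropSlotP,
    .test 8 .skip .skip (block [.pop 8, readFrame 8 9 6, moveAll 9 5]) .skip]

lemma dropSlot_iterate_length (i : ℕ) (s : Str) : (dropSlot^[i] s).length ≤ s.length := by
  induction i with
  | zero => exact le_rfl
  | succ i ih =>
    rw [Function.iterate_succ_apply']
    exact (readSlot_snd_length _).trans ih

lemma runs_pickP {μ : Mem} {s : Str} {e : ℕ} (h5 : μ 5 = []) (h6 : μ 6 = []) (h8 : μ 8 = s)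
    (h9 : μ 9 = []) (h15 : μ 15 = unary e) :
    ∃ μ', μ' 4 = μ 4 ∧ μ' 5 = ((readSlot (dropSlot^[e] s)).1).getD [] ∧
      Runs pickP μ (pure μ') (e * (5 * s.length + 8) + 5 * s.length + 10) := by
  have s1 := Runs.loop_seq (r := 15) (k := e) (P := dropSlotP) (T := 5 * s.length + 8) (μ := μ)
    (fun i => update μ 8 (dropSlot^[i] s))
    (by rw [Function.iterate_zero, id, ← h8, update_eq_self])
    (fun i _ => (runs_dropSlotP (s := dropSlot^[i] s) (by simp [h6]) (by simp) (by simp [h9])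
      (by rw [update_idem, Function.iterate_succ_apply'])).mono
      (by have := dropSlot_iterate_length i s; omega))
    (by rw [h15, length_unary])
  set t := dropSlot^[e] s with ht
  have hl : t.length ≤ s.length := dropSlot_iterate_length e s
  have key : ∃ μ', μ' 4 = μ 4 ∧ μ' 5 = ((readSlot t).1).getD [] ∧
      Runs (.test 8 .skip .skip (block [.pop 8, readFrame 8 9 6, moveAll 9 5]) .skip)
        (update μ 8 t) (pure μ') (5 * s.length + 7 + 1) := by
    rcases h : topTrue t with _ | _
    · refine ⟨update μ 8 t, by simp, by simp [readSlot, h, h5], ?_⟩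
      refine Runs.test_top (T := 5 * s.length + 7) (fun _ => Runs.skip.mono (by omega))
        (fun h' => ?_)
      rw [update_self, h] at h'
      cases h'
    · refine ⟨update (update μ 8 (unframe t.tail).2) 5 (unframe t.tail).1,
        by simp, by simp [readSlot, h], ?_⟩
      refine Runs.test_top (T := 5 * s.length + 7) (fun h' => ?_) (fun _ => ?_)
      · rw [update_self, h] at h'
        cases h'
      · have hl' : t.tail.length ≤ s.length := by rw [List.length_tail]; omega
        have hu := unframe_fst_length t.tail
        have s1 : Runs (.pop 8) (update μ 8 t) (pure (update μ 8 t.tail)) 1 :=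
          Runs.pop.congr (by simp)
        have s2 : Runs (readFrame 8 9 6) (update μ 8 t.tail) (pure (update
            (update μ 8 (unframe t.tail).2) 9 (unframe t.tail).1.reverse))
            (4 * s.length + 3) := by
          refine (runs_readFrame (by simp [h6]) ?_).mono
            ?_
          · simp [h9]
          · simp only [update_self]
            omega
        have s3 : Runs (moveAll 9 5) (update
            (update μ 8 (unframe t.tail).2) 9 (unframe t.tail).1.reverse)
            (pure (update (update μ 8 (unframe t.tail).2) 5
              (unframe t.tail).1)) (s.length + 1) := by
          refine (runs_moveAll ?_).mono ?_
          · funext r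
            simp only [update_apply]
            split_ifs <;> simp_all
          · simp
            omega
        exact (s1.block_cons (s2.block_cons s3.block_one)).mono (by omega)
  obtain ⟨μ', h4, h5, s2⟩ := key
  exact ⟨μ', h4, h5, (s1.block_cons s2.block_one).mono (by omega)⟩

/-! ### The first activation of the reduction -/

def setupB (cs qs cl : List ℕ) : Prog :=
  block [setup cs, sizeP qs 10 6 18 19, polyP 20 6 qs, polyP 10 6 cl, pushN 12 14 true]

/-- The registers of the reduction after the computation of the parameters. -/
def paramMem (cs qs cl : List ℕ) (n : ℕ) (x : Str) : Mem := fun r =>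
  if r = 10 then unary (evalL cl n) else
  if r = 14 then unary (size n + size (evalL cs n)) else
  if r = 18 then unary (2 ^ size (evalL qs n)) else
  if r = 19 then unary (size (evalL qs n)) else
  if r = 20 then unary (evalL qs n) else tbl cs n [x] r

def setupBCost (cs qs cl : List ℕ) (n : ℕ) : ℕ :=
  setupCost cs n + (sizeCost qs n + (polyCost qs n + (polyCost cl n + (n + 2))))

lemma runs_setupB {cs qs cl : List ℕ} {n : ℕ} {x : Str} :
    Runs (setupB cs qs cl) (load [unary n, x])
      (pure (mix (paramMem cs qs cl n x) 𝟎 𝟎)) (setupBCost cs qs cl n) := by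
  have s1 := runs_setup_load (cs := cs) (n := n) (xs := [x]) (by simp)
  set d := tbl cs n [x] with hd
  have e : ∀ r, (2 ≤ r ∧ r ≤ 10) ∨ 15 ≤ r → d r = [] := by
    intro r hr
    simp only [hd, tbl]
    rw [if_neg (by omega), if_neg (by omega), if_neg (by omega), if_neg (by omega)]
    exact List.getD_eq_default _ _ (by simp; omega)
  have d0 : d 0 = unary n := rfl
  have d12 : d 12 = unary (size n) := rfl
  have d14 : d 14 = unary (size (evalL cs n)) := rfl
  have d6 := e 6 (by simp)
  have d10 := e 10 (by simp)
  have d18 := e 18 (by simp)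
  have d19 := e 19 (by simp)
  have d20 := e 20 (by simp)
  refine s1.block_cons ((runs_sizeP (n := n) qs ?_ ?_ ?_ ?_ ?_ rfl).block_cons
    ((runs_polyP (n := n) qs ?_ ?_ ?_ rfl).block_cons ((runs_polyP (n := n) cl ?_ ?_ ?_ rfl).block_cons
    ((runs_pushN ?last).mono (T' := n + 1) ?time).block_one)))
  case last =>
    rw [update_mix, update_mix, update_mix, update_mix, update_mix]
    congr 1
    funext r
    simp [update_apply, paramMem, ← hd, d12, d14]
    split_ifs <;> simp_all
  case time =>
    have := size_le_self n
    simp [d12]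
    omega
  all_goals simp [d0, d6, d10, d18, d19, d20]

/-- The registers that the first activation of the reduction changes. -/
def phMem (d : Mem) (x1 x2 x3 x5 : Str) (e k : ℕ) : Mem := fun r =>
  if r = 1 then x1 else if r = 2 then x2 else if r = 3 then x3 else if r = 5 then x5 else
  if r = 15 then unary e else if r = 16 then unary k else d r

@[simp] lemma update_phMem (d : Mem) (x1 x2 x3 x5 y : Str) (e k : ℕ) :
    update (phMem d x1 x2 x3 x5 e k) 1 y = phMem d y x2 x3 x5 e k ∧
    update (phMem d x1 x2 x3 x5 e k) 2 y = phMem d x1 y x3 x5 e k ∧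
    update (phMem d x1 x2 x3 x5 e k) 3 y = phMem d x1 x2 y x5 e k ∧
    update (phMem d x1 x2 x3 x5 e k) 5 y = phMem d x1 x2 x3 y e k := by
  refine ⟨?_, ?_, ?_, ?_⟩ <;> funext r <;> simp only [update_apply, phMem] <;> grind

@[simp] lemma update_phMem_unary (d : Mem) (x1 x2 x3 x5 : Str) (e k l : ℕ) :
    update (phMem d x1 x2 x3 x5 e k) 15 (unary l) = phMem d x1 x2 x3 x5 l k ∧
    update (phMem d x1 x2 x3 x5 e k) 16 (unary l) = phMem d x1 x2 x3 x5 e l := by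
  refine ⟨?_, ?_⟩ <;> funext r <;> simp only [update_apply, phMem] <;> grind

@[simp] lemma phMem_apply (d : Mem) (x1 x2 x3 x5 : Str) (e k r : ℕ) :
    phMem d x1 x2 x3 x5 e k r = if r = 1 then x1 else if r = 2 then x2 else if r = 3 then x3 else
      if r = 5 then x5 else if r = 15 then unary e else if r = 16 then unary k else d r := rfl

/-- The mask ends with its mark: once it is exhausted, key generation fills all further slots with
keys. -/
def maskOf (e : ℕ) : Str := List.replicate e (.bit false) ++ [.bit true]

def maskP : Prog := block [.push (sReg 1) true, pushN 15 (sReg 1) false]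

def startA (A : Prog) : Prog :=
  block [moveAll 5 (aReg 1), pushN 0 (aReg 0) true, A.rename aReg]

/-- The bit in register 21 tells the next activation that the first one is over. -/
def finishP : Prog := block [copyBits (aReg 4) 4 6 7, .push 21 true]

/-- The registers of the reduction after its first activation. -/
def firstMem (cs qs cl : List ℕ) (n : ℕ) (x : Str) (e k : ℕ) (s : Str) (q' : ℕ)
    (a : Mem) : Mem := mix (fun r =>
    if r = 1 then x.drop (evalL cl n) else if r = 2 then s else
    if r = 4 then ofBits (toBits (a 4)) else if r = 15 then unary e else
    if r = 16 then unary k else if r = 20 then unary q' else if r = 21 then [.bit true] else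
    paramMem cs qs cl n x r) 𝟎 a

section

variable (cs qs cl : List ℕ) (G K P A : Prog)

def phaseOne : Prog :=
  block [setupB cs qs cl, idxP 14 15 17, idxP 19 16 17, maskP, call G 6 2, clipP, extendPKs K,
    clear 3, startA A, answerFirst P A, finishP]

/-- What the reduction does in its first activation. -/
def phaseOneC (n : ℕ) (x : Str) : Comp (ℕ × ℕ × Str × ℕ × Mem) := do
  let e ← unifC (size n + size (evalL cs n))
  let k ← unifC (size (evalL qs n))
  let s ← runOn G n [maskOf e]
  let z ← iterM (extendStep K n (toBits s)) (x.take (evalL cl n)).length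
    (x.take (evalL cl n), [])
  let a ← run A (update (load [unary n]) inReg z.2.reverse)
  let y ← iterM (firstStep P A n (toBits s)) k (evalL qs n, a)
  pure (e, k, s, y.1, y.2)

end

lemma two_pow_size_add (cs : List ℕ) (n : ℕ) :
    2 ^ (size n + size (evalL cs n)) = tsize cs n := by rw [pow_add]; rfl

section

variable {cs qs cl : List ℕ} {G K P A : Prog} {n b W V T1 T2 T3 : ℕ} {x : Str}

/-- The bounds for the subroutines of the reduction. -/
structure Bounds (cs qs cl : List ℕ) (G K P A : Prog) (n b W V T1 T2 T3 : ℕ) : Prop where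
  adv : ∀ xs : List Str, xs.length ≤ evalL qs n + 1 →
    All (fun o => o.2 ≤ b) (activations A (load [unary n]) xs)
  sk : ∀ x : Str, x.length ≤ tsize cs n →
    All (fun o => o.2 ≤ T1) (exec G (load [unary n, x]))
  pk : ∀ x y : Str, x.length ≤ W → y.length ≤ W →
    All (fun o => o.2 ≤ T2) (exec K (load [unary n, x, y]))
  sign : ∀ x y z : Str, x.length ≤ W → y.length ≤ W → z.length ≤ W →
    All (fun o => o.2 ≤ T3) (exec P (load [unary n, x, y, z]))
  sk_le : T1 ≤ W
  clock_le : evalL cl n ≤ W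
  adv_le : b ≤ W
  pk_le : extendCost K n W T2 + b ≤ V
  sign_le : T3 + b ≤ V

def phaseOneCost (cs qs cl : List ℕ) (G K P : Prog) (n b W V T1 T2 T3 : ℕ) : ℕ :=
  setupBCost cs qs cl n + (((size n + size (evalL cs n)) * (tsize cs n + 10) + 1) +
  ((size (evalL qs n) * (2 ^ size (evalL qs n) + 10) + 1) +
  (tsize cs n + 10 + (callCost G (n + tsize cs n + T1) + (2 * evalL cl n + 3 +
  (extendCost K n W T2 + (W + 1 + (extendCost K n W T2 + n + b + 10 +
  ((2 ^ size (evalL qs n) * (queryCost P n b W V T3 + 3) + 1) + (5 * W + 10))))))))))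

-- Apart from register 20, the driver registers between the fragments have the form `phMem d …`, and
-- each fragment changes only its arguments. The second claim collects the invariants that the
-- second activation relies on.
set_option maxHeartbeats 1600000 in
lemma runs_phaseOne (B : Bounds cs qs cl G K P A n b W V T1 T2 T3) :
    Runs (phaseOne cs qs cl G K P A) (load [unary n, x])
      (phaseOneC cs qs cl G K P A n x >>= fun y =>
        pure (firstMem cs qs cl n x y.1 y.2.1 y.2.2.1 y.2.2.2.1 y.2.2.2.2))
      (phaseOneCost cs qs cl G K P n b W V T1 T2 T3) ∧
    All (fun y => y.1 < tsize cs n ∧ y.2.2.1.length ≤ T1 ∧ y.2.2.2.1 ≤ evalL qs n ∧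
      AInv A n V (1 + evalL qs n - y.2.2.2.1) y.2.2.2.2) (phaseOneC cs qs cl G K P A n x) := by
  set d := paramMem cs qs cl n x with hd
  have dn : ∀ r, 2 ≤ r ∧ r ≤ 9 ∨ 15 ≤ r ∧ r ≤ 17 ∨ 21 ≤ r → d r = [] := by
    intro r hr
    simp only [hd, paramMem, tbl]
    iterate 9 rw [if_neg (by omega)]
    exact List.getD_eq_default _ _ (by simp; omega)
  have d0 : d 0 = unary n := rfl
  have d10 : d 10 = unary (evalL cl n) := rfl
  have d14 : d 14 = unary (size n + size (evalL cs n)) := rfl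
  have d19 : d 19 = unary (size (evalL qs n)) := rfl
  have d20 : d 20 = unary (evalL qs n) := rfl
  have d3 := dn 3 (by simp)
  have d5 := dn 5 (by simp)
  have d6 := dn 6 (by simp)
  have d7 := dn 7 (by simp)
  have d8 := dn 8 (by simp)
  have d9 := dn 9 (by simp)
  set U := x.drop (evalL cl n)
  set Y := x.take (evalL cl n)
  have hst : d = phMem d x [] [] [] 0 0 := by
    funext r
    simp only [phMem]
    split_ifs with h1 h2 h3 h5 h15 h16 <;> first | rfl | (subst_vars; rfl)
  have s1 : Runs (setupB cs qs cl) (load [unary n, x])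
      (pure (mix (phMem d x [] [] [] 0 0) 𝟎 𝟎)) (setupBCost cs qs cl n) := by
    rw [← hst]; exact runs_setupB
  have s2 : Runs (idxP 14 15 17) (mix (phMem d x [] [] [] 0 0) 𝟎 𝟎)
      (unifC (size n + size (evalL cs n)) >>= fun e =>
        pure (mix (phMem d x [] [] [] e 0) 𝟎 𝟎))
      ((size n + size (evalL cs n)) * (tsize cs n + 10) + 1) := by
    rw [← two_pow_size_add]
    refine (runs_idxP (by simp [d14]) (by simp)).congr (by simp)
  have s3 : ∀ e, Runs (idxP 19 16 17) (mix (phMem d x [] [] [] e 0) 𝟎 𝟎)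
      (unifC (size (evalL qs n)) >>= fun k =>
        pure (mix (phMem d x [] [] [] e k) 𝟎 𝟎))
      (size (evalL qs n) * (2 ^ size (evalL qs n) + 10) + 1) := by
    intro e
    refine (runs_idxP (by simp [d19]) (by simp)).congr (by simp)
  have s4 : ∀ e k, e < tsize cs n →
      Runs maskP (mix (phMem d x [] [] [] e k) 𝟎 𝟎)
      (pure (mix (phMem d x [] [] [] e k) (load [[], maskOf e]) 𝟎))
      (tsize cs n + 10) := by
    intro e k he
    have t1 : Runs (.push (sReg 1) true) (mix (phMem d x [] [] [] e k) 𝟎 𝟎) (pure (mix (phMem d x [] [] [] e k) (load [[], [.bit true]])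
          𝟎)) 1 := by
      refine Runs.push.congr ?_
      rw [update_mix_sReg, mix_sReg, ← load_append_nil]
      congr 2
      exact update_load_length [[]] _
    have t2 : Runs (pushN 15 (sReg 1) false) (mix (phMem d x [] [] [] e k)
        (load [[], [.bit true]]) 𝟎) (pure (mix (phMem d x [] [] [] e k)
        (load [[], maskOf e]) 𝟎)) (e + 1) := by
      refine (runs_pushN ?_).mono ?_
      · rw [update_mix_sReg, mix_sReg, mix_lt, update_load (by simp)]
        simp [load_apply, maskOf]
      · simp
    exact (t1.block_cons t2.block_one).mono (by omega)
  have hmask : ∀ e, e < tsize cs n → (maskOf e).length ≤ tsize cs n := fun e he => by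
    simp [maskOf]
    omega
  have s5 : ∀ e k, e < tsize cs n →
      Runs (call G 6 2) (mix (phMem d x [] [] [] e k) (load [[], maskOf e]) 𝟎)
      (runOn G n [maskOf e] >>= fun s =>
        pure (mix (phMem d x s [] [] e k) 𝟎 𝟎))
      (callCost G (n + tsize cs n + T1)) := by
    intro e k he
    have := hmask e he
    refine (runs_call (xs := [maskOf e]) (T := T1) (by simp [d0]) (by simp [d6]) (by simp) (B.sk _ this)
      (by simp; omega)).congr (by simp)
  have s6 : ∀ e k s, Runs clipP (mix (phMem d x s [] [] e k) 𝟎 𝟎)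
      (pure (mix (phMem d U s Y [] e k)
        𝟎 𝟎)) (2 * evalL cl n + 3) := by
    intro e k s
    refine runs_clipP (x := x) (c := evalL cl n) (by simp) (by simp)
      (by simp [d8]) (by simp [d10]) ?_
    simp [U, Y]
  have s7 : ∀ e k s, s.length ≤ T1 → Runs (extendPKs K)
      (mix (phMem d U s Y [] e k)
        𝟎 𝟎)
      (iterM (extendStep K n (toBits s)) Y.length
        (Y, []) >>= fun z =>
        pure (mix (phMem d U s z.1 z.2 e k) 𝟎 𝟎))
      (extendCost K n W T2) := by
    intro e k s hs
    have ht : Y.length ≤ W := (List.length_take_le _ _).trans B.clock_le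
    have := runs_extendPKs (P := K) (n := n) (W := W) (T := T2) (a := load []) (sk := s)
      (x := Y) (d := phMem d U s [] [] e k)
      (by simp [d0]) (by simp) (by simp) (by simp [d6]) (by simp [d7])
      (by simp [d8]) (by simp [d9]) (hs.trans B.sk_le) ht B.pk
    have e1 : update (phMem d U s [] [] e k) 3
        Y =
        phMem d U s Y [] e k := by
      simp
    rw [e1] at this
    exact this.congr (by simp)
  have h7 : ∀ s : Str, s.length ≤ T1 →
      All (fun z => z.1.length ≤ W ∧ z.2.length ≤ extendCost K n W T2)
      (iterM (extendStep K n (toBits s)) Y.length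
        (Y, [])) := by
    intro s hs
    refine (All.iterM (p := fun z : Str × Str => z.1.length ≤ W) ?_ _ ?_).and
      ((s7 0 0 s hs).growth.mono fun z hz => ?_)
    · rintro ⟨_ | ⟨c, s⟩, acc⟩ hz
      · exact All.pure hz
      · exact (All.true _).bind fun y _ => All.pure ((unframe_snd_length (c :: s)).trans hz)
    · exact (List.length_take_le _ _).trans B.clock_le
    · have := hz 5
      simpa using this
  have s8 : ∀ e k s (z : Str × Str), z.1.length ≤ W → Runs (clear 3)
      (mix (phMem d U s z.1 z.2 e k) 𝟎 𝟎)
      (pure (mix (phMem d U s [] z.2 e k) 𝟎 𝟎))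
      (W + 1) := by
    intro e k s z hz
    exact (runs_clear (by simp)).mono (by simp [hz])
  have s9 : ∀ e k s (z : Str), z.length ≤ extendCost K n W T2 → Runs (startA A)
      (mix (phMem d U s [] z e k) 𝟎 𝟎)
      (run A (update (load [unary n]) inReg z.reverse) >>= fun a =>
      pure (mix (phMem d U s [] [] e k) 𝟎 a))
      (extendCost K n W T2 + n + b + 10) := by
    intro e k s z hz
    have t1 : Runs (moveAll 5 (aReg 1))
        (mix (phMem d U s [] z e k) 𝟎 𝟎)
        (pure (mix (phMem d U s [] [] e k) 𝟎 (load [[], z.reverse]))) (extendCost K n W T2 + 1) := by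
      refine (runs_moveAll ?_).mono (by simp [hz])
      rw [update_mix, update_mix_aReg, mix_aReg, mix_lt]
      congr 1
      · simp
      · rw [← load_append_nil]
        simpa [load_apply] using update_load_length [[]] z.reverse
    have t2 : Runs (pushN 0 (aReg 0) true)
        (mix (phMem d U s [] [] e k) 𝟎 (load [[], z.reverse]))
        (pure (mix (phMem d U s [] [] e k) 𝟎 (update (load [unary n]) inReg z.reverse))) (n + 1) := by
      refine (runs_pushN ?_).mono (by simp [d0])
      rw [update_mix_aReg, mix_aReg, mix_lt, update_load (by simp)]
      congr 1
      refine Eq.trans ?_ (update_load_length [unary n] z.reverse).symm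
      simp [load_apply, d0]
    have t3 : Runs (A.rename aReg) (mix (phMem d U s [] [] e k)
        𝟎 (update (load [unary n]) inReg z.reverse)) _ b :=
      Runs.adv ⟨rfl, (aReach_zero A n).time B.adv (by omega) z.reverse⟩
    exact (t1.block_cons (t2.block_cons t3.block_one)).mono (by omega)
  have h9 : ∀ z : Str, z.length ≤ extendCost K n W T2 → All (AInv A n V 1)
      (run A (update (load [unary n]) inReg z.reverse)) := by
    intro z hz
    have := B.pk_le
    exact AInv.run (j := 0) B.adv (by omega) (aReach_zero A n)
      (by rw [List.length_reverse]; omega)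
  have s10 : ∀ (e k : ℕ) (s : Str) (a : Mem), s.length ≤ T1 → AInv A n V 1 a → _ := fun e k s a hs ha =>
    runs_answerFirst (P := P) (k := k) (sk := s) (W := W) (T := T3)
      (d := phMem d U s [] [] e k) B.adv B.sign_le ha
      (by simp [d0]) (by simp) (by simp) (by simp [d6]) (by simp [d7])
      (by simp [d8]) (by simp [d9]) (by simp) (by simp [d20])
      (hs.trans B.sk_le) B.adv_le B.sign
  have s11 : ∀ e k s q' a, AInv A n V (1 + evalL qs n - q') a → q' ≤ evalL qs n → Runs finishP
      (mix (update (phMem d U s [] [] e k) 20 (unary q'))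
        𝟎 a)
      (pure (firstMem cs qs cl n x e k s q' a)) (5 * W + 9) := by
    intro e k s q' a ha hq
    have hl := ha.1.length B.adv (by omega) (r := 4) (by norm_num)
    have := B.adv_le
    have t1 : Runs (copyBits (aReg 4) 4 6 7)
        (mix (update (phMem d U s [] [] e k) 20 (unary q'))
        𝟎 a) (pure (mix (update (update (phMem d U s [] [] e k) 20 (unary q')) 4 (ofBits (toBits (a 4)))) 𝟎 a))
        (5 * W + 4) := by
      refine (runs_copyBits ?_ ?_ ?_).mono ?_
      · simp [d6]
      · simp [d7]
      · rw [update_mix, mix_aReg, mix_lt]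
        simp [dn 4]
      · rw [mix_aReg]
        omega
    refine (t1.block_cons (Runs.push.congr ?_).block_one).mono (by omega)
    rw [update_mix, mix_lt, firstMem, ← hd]
    have h21 : update (update (phMem d U s [] [] e k) 20 (unary q')) 4 (ofBits (toBits (a 4))) 21 = [] := by simp [dn 21]
    rw [h21]
    congr 2
    clear_value d
    clear * - d3 d5
    funext r
    simp only [update_apply, phMem]
    split_ifs <;> first | rfl | omega | (subst_vars; simp only [d3, d5])
  refine ⟨?_, ?_⟩
  · refine ((s1.block_cons (s2.block_bind (all_unifC _) fun e he =>
      (s3 e).block_bind (all_unifC _) fun k hk =>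
      (s4 e k (by rwa [two_pow_size_add] at he)).block_cons
      ((s5 e k (by rwa [two_pow_size_add] at he)).block_bind
        (all_runOn_length (by simp) (B.sk _ (hmask e (by rwa [two_pow_size_add] at he))))
        fun s hs => (s6 e k s).block_cons ((s7 e k s hs).block_bind (h7 s hs) fun z hz =>
        (s8 e k s z hz.1).block_cons ((s9 e k s z.2 hz.2).block_bind (h9 z.2 hz.2) fun a ha =>
        ((s10 e k s a hs ha).1.mono
          (T' := 2 ^ size (evalL qs n) * (queryCost P n b W V T3 + 3) + 1)
          (by gcongr)).block_bind (s10 e k s a hs ha).2 fun y hy =>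
        (s11 e k s y.1 y.2 hy.2 hy.1).block_one))))).mono ?_).congr ?_
    · rw [phaseOneCost]
    · simp [phaseOneC, Y]
  · refine (all_unifC _).bind fun e he => (all_unifC _).bind fun k hk => ?_
    rw [two_pow_size_add] at he
    refine (all_runOn_length (by simp) (B.sk _ (hmask e he))).bind fun s hs =>
      (h7 s hs).bind fun z hz => (h9 z.2 hz.2).bind fun a ha =>
      (s10 0 k s a hs ha).2.bind fun y hy => All.pure ⟨he, hs, hy⟩

end

/-! ### The second activation of the reduction -/

def phaseTwo (P A : Prog) : Prog :=
  block [clear 4, clipP, answerRest P A, copyBits (aReg 4) 4 6 7, copyBits (aReg 5) 8 6 7, pickP]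

section

variable {cs qs cl : List ℕ} {G K P A : Prog} {n b W V T1 T2 T3 : ℕ}

def phaseTwoCost (qs cl cs : List ℕ) (P : Prog) (n b W V T : ℕ) : ℕ :=
  b + 1 + (2 * evalL cl n + 3 + ((evalL qs n * (queryCost P n b W V T + W + 2) + 1) +
    (5 * b + 4 + (5 * b + 4 + (tsize cs n * (5 * b + 8) + 5 * b + 11)))))

lemma runs_phaseTwo (B : Bounds cs qs cl G K P A n b W V T1 T2 T3) {d a : Mem}
    {s y : Str} {e q' : ℕ} (d0 : d 0 = unary n) (d1 : d 1 = y) (d2 : d 2 = s)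
    (d3 : d 3 = []) (d4 : (d 4).length ≤ b) (d5 : d 5 = []) (d6 : d 6 = []) (d7 : d 7 = [])
    (d8 : d 8 = []) (d9 : d 9 = []) (d10 : d 10 = unary (evalL cl n)) (d15 : d 15 = unary e)
    (d20 : d 20 = unary q') (he : e < tsize cs n) (hs : s.length ≤ T1) (hq : q' ≤ evalL qs n)
    (ha : AInv A n V (1 + evalL qs n - q') a) :
    ∃ f : Str × Mem → Mem, (∀ z, f z 4 = ofBits (toBits (z.2 4)) ∧
      f z 5 = ((readSlot (dropSlot^[e] (ofBits (toBits (z.2 5))))).1).getD []) ∧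
    Runs (phaseTwo P A) (mix d 𝟎 a)
      (iterM (restStep P A n (toBits s)) q' (y.take (evalL cl n), a) >>= fun z => pure (f z))
      (phaseTwoCost qs cl cs P n b W V T3) := by
  let D2 : Mem := update (update (update d 4 []) 1
    (y.drop (evalL cl n))) 3 (y.take (evalL cl n))
  let D3 (z : Str × Mem) : Mem := update D2 3 z.1
  let D4 (z : Str × Mem) : Mem := update (D3 z) 4 (ofBits (toBits (z.2 4)))
  let D5 (z : Str × Mem) : Mem := update (D4 z) 8 (ofBits (toBits (z.2 5)))
  have s1 : Runs (clear 4) (mix d 𝟎 a)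
      (pure (mix (update d 4 []) 𝟎 a)) (b + 1) :=
    (runs_clear (by rw [update_mix])).mono
      (by rw [mix_lt]; omega)
  have s2 : Runs clipP (mix (update d 4 []) 𝟎 a)
      (pure (mix D2 𝟎 a)) (2 * evalL cl n + 3) := by
    refine runs_clipP (x := y) (by simp [d1]) (by simp [d3])
      (by simp [d8]) (by simp [d10]) ?_
    rw [update_mix, update_mix]
  have s3 := runs_answerRest (P := P) (A := A) (d := D2) (sk := s) (σ := y.take (evalL cl n))
    (W := W) B.adv B.sign_le hq ha
    (by simp [D2, d0]) (by simp [D2, d2]) (by simp [D2]) (by simp [D2, d6]) (by simp [D2, d7])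
    (by simp [D2, d8]) (by simp [D2, d9]) (by simp [D2, d20]) (hs.trans B.sk_le)
    ((List.length_take_le _ _).trans B.clock_le) B.adv_le B.sign
  have s4 : ∀ z : Str × Mem, (z.2 4).length ≤ b → Runs (copyBits (aReg 4) 4 6 7)
      (mix (D3 z) 𝟎 z.2) (pure (mix (D4 z) 𝟎 z.2)) (5 * b + 4) := fun z hz => by
    refine (runs_copyBits
      (by simp [D3, D2, d6]) (by simp [D3, D2, d7]) ?_).mono
      (by rw [mix_aReg]; omega)
    rw [update_mix, mix_aReg, mix_lt]
    simp [D3, D2, D4]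
  have s5 : ∀ z : Str × Mem, (z.2 5).length ≤ b → Runs (copyBits (aReg 5) 8 6 7)
      (mix (D4 z) 𝟎 z.2) (pure (mix (D5 z) 𝟎 z.2)) (5 * b + 4) := fun z hz => by
    refine (runs_copyBits
      (by simp [D4, D3, D2, d6]) (by simp [D4, D3, D2, d7]) ?_).mono
      (by rw [mix_aReg]; omega)
    rw [update_mix, mix_aReg, mix_lt]
    simp [D3, D2, D4, D5, d8]
  have s6 := fun z : Str × Mem => runs_pickP (μ := mix (D5 z) 𝟎 z.2) (e := e)
    (s := ofBits (toBits (z.2 5)))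
    (by simp [D5, D4, D3, D2, d5]) (by simp [D5, D4, D3, D2, d6])
    (by simp [D5]) (by simp [D5, D4, D3, D2, d9])
    (by simp [D5, D4, D3, D2, d15])
  choose f hf4 hf5 hf using s6
  refine ⟨f, fun z => ⟨by rw [hf4]; simp [D5, D4], hf5 z⟩, ?_⟩
  refine (s1.block_cons (s2.block_cons ((s3.1.mono (T' := evalL qs n *
    (queryCost P n b W V T3 + W + 2) + 1) (by gcongr)).block_bind s3.2 fun z hz => ?_)))
  have h4 := hz.1.length B.adv (by omega) (r := 4) (by norm_num)
  have h5 := hz.1.length B.adv (by omega) (r := 5) (by norm_num)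
  refine (s4 z h4).block_cons ((s5 z h5).block_cons ((hf z).mono ?_).block_one)
  rw [length_ofBits]
  have := (length_toBits_le (z.2 5)).trans h5
  gcongr

/-- The reduction. -/
def reduction (cs qs cl : List ℕ) (G K P A : Prog) : Prog :=
  .test 21 (phaseOne cs qs cl G K P A) (phaseTwo P A) (phaseTwo P A) (phaseTwo P A)

def reductionCost (cs qs cl : List ℕ) (G K P : Prog) (n b W V T1 T2 T3 : ℕ) : ℕ :=
  phaseOneCost cs qs cl G K P n b W V T1 T2 T3 + 1 + (phaseTwoCost qs cl cs P n b W V T3 + 1)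

lemma activate_reduction_one (B : Bounds cs qs cl G K P A n b W V T1 T2 T3) (x : Str) :
    Runs (reduction cs qs cl G K P A) (update (load [unary n]) inReg x)
      (phaseOneC cs qs cl G K P A n x >>= fun y =>
        pure (firstMem cs qs cl n x y.1 y.2.1 y.2.2.1 y.2.2.2.1 y.2.2.2.2))
      (phaseOneCost cs qs cl G K P n b W V T1 T2 T3 + 1) := by
  have h : update (load [unary n]) inReg x = load [unary n, x] :=
    update_load_length [unary n] x
  rw [h]
  exact Runs.test_nil (by rfl) (runs_phaseOne B).1

lemma activate_reduction_two (B : Bounds cs qs cl G K P A n b W V T1 T2 T3) {a : Mem}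
    {x s : Str} {e k q' : ℕ} (he : e < tsize cs n) (hs : s.length ≤ T1)
    (hq : q' ≤ evalL qs n) (ha : AInv A n V (1 + evalL qs n - q') a) (y : Str) :
    ∃ f : Str × Mem → Mem, (∀ z, f z 4 = ofBits (toBits (z.2 4)) ∧
      f z 5 = ((readSlot (dropSlot^[e] (ofBits (toBits (z.2 5))))).1).getD []) ∧
    Runs (reduction cs qs cl G K P A)
      (update (firstMem cs qs cl n x e k s q' a) inReg y)
      (iterM (restStep P A n (toBits s)) q' (y.take (evalL cl n), a) >>= fun z => pure (f z))
      (phaseTwoCost qs cl cs P n b W V T3 + 1) := by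
  have h4 := ha.1.length B.adv (by omega) (r := 4) (by norm_num)
  have h4' := (length_toBits_le (a 4)).trans h4
  have h1 : ∀ r, paramMem cs qs cl n x r = [] ∨ r < 2 ∨ 9 < r := by
    intro r
    by_cases hr : r < 2 ∨ 9 < r
    · exact Or.inr hr
    · left
      simp only [paramMem, tbl]
      iterate 9 rw [if_neg (by omega)]
      exact List.getD_eq_default _ _ (by simp; omega)
  have hz : ∀ r, 2 ≤ r → r ≤ 9 → paramMem cs qs cl n x r = [] := fun r h h' =>
    (h1 r).resolve_right (by omega)
  rw [firstMem, update_mix (by norm_num [inReg])]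
  obtain ⟨f, hf, hR⟩ := runs_phaseTwo B (y := y) (d := update (fun r =>
    if r = 1 then x.drop (evalL cl n) else if r = 2 then s else
    if r = 4 then ofBits (toBits (a 4)) else if r = 15 then unary e else
    if r = 16 then unary k else if r = 20 then unary q' else if r = 21 then [.bit true] else
    paramMem cs qs cl n x r) inReg y) (by rfl) (by rfl) (by rfl) (hz 3 (by norm_num) (by norm_num))
    (by simpa [inReg] using h4') (hz 5 (by norm_num) (by norm_num))
    (hz 6 (by norm_num) (by norm_num)) (hz 7 (by norm_num) (by norm_num))
    (hz 8 (by norm_num) (by norm_num)) (hz 9 (by norm_num) (by norm_num)) (by rfl) (by rfl) (by rfl)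
    he hs hq ha
  exact ⟨f, hf, Runs.test_true (l := []) (by rw [mix_lt]; rfl) hR⟩

lemma all_activations_reduction (B : Bounds cs qs cl G K P A n b W V T1 T2 T3)
    (xs : List Str) (hxs : xs.length ≤ 2) :
    All (fun o => o.2 ≤ reductionCost cs qs cl G K P n b W V T1 T2 T3)
      (activations (reduction cs qs cl G K P A) (load [unary n]) xs) := by
  rcases xs with _ | ⟨x, xs⟩
  · exact All.pure (Nat.zero_le _)
  have s1 := activate_reduction_one B x
  have h1 : All (fun o => o.2 ≤ phaseOneCost cs qs cl G K P n b W V T1 T2 T3 + 1 ∧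
      ∃ e k s q' a, o.1 = firstMem cs qs cl n x e k s q' a ∧ e < tsize cs n ∧ s.length ≤ T1 ∧
      q' ≤ evalL qs n ∧ AInv A n V (1 + evalL qs n - q') a)
      (activate (reduction cs qs cl G K P A) (load [unary n]) x) := by
    have key : All (fun μ => ∃ e k s q' a, μ = firstMem cs qs cl n x e k s q' a ∧
        e < tsize cs n ∧ s.length ≤ T1 ∧ q' ≤ evalL qs n ∧ AInv A n V (1 + evalL qs n - q') a)
        (run (reduction cs qs cl G K P A) (update (load [unary n]) inReg x)) := by
      rw [s1.run_eq]
      exact (runs_phaseOne B).2.bind fun y hy => All.pure ⟨_, _, _, _, _, rfl, hy⟩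
    exact s1.time.and key.of_map
  rw [reductionCost]
  refine h1.bind fun o ho => ?_
  obtain ⟨ho, e, k, s, q', a, hm, he, hs, hq, ha⟩ := ho
  rcases xs with _ | ⟨y, xs⟩
  · exact All.bind (All.pure (p := fun o : Mem × ℕ => o.2 = 0) rfl) fun z hz =>
      All.pure (by simp only [hz]; omega)
  obtain rfl : xs = [] := by simpa using hxs
  obtain ⟨f, -, hR⟩ := activate_reduction_two B (x := x) (k := k) he hs hq ha y
  rw [← hm] at hR
  have h2 : All (fun o' : Mem × ℕ => o'.2 ≤ phaseTwoCost qs cl cs P n b W V T3 + 1)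
      (activations (reduction cs qs cl G K P A) o.1 [y]) :=
    All.bind hR.time fun o' ho' => All.bind (All.pure (p := fun o => o.2 = 0) rfl) fun z hz =>
      All.pure (by simpa [hz] using ho')
  exact h2.bind fun o' ho' => All.pure (add_le_add ho ho')

lemma exists_bounds (cs : List ℕ) {qs : List ℕ} (cl : List ℕ) (hG : IsQPT 1 G)
    (hK : IsQPT 2 K) (hP : IsQPT 3 P) (hA : IsQPTAdversary (evalL qs) A) :
    ∃ b W V T1 T2 T3 : ℕ → ℕ,
      (∀ n, Bounds cs qs cl G K P A n (b n) (W n) (V n) (T1 n) (T2 n) (T3 n)) ∧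
      PolyB fun n =>
        reductionCost cs qs cl G K P n (b n) (W n) (V n) (T1 n) (T2 n) (T3 n) := by
  obtain ⟨pG, hpG⟩ := hG.bound
  obtain ⟨pK, hpK⟩ := hK.bound
  obtain ⟨pP, hpP⟩ := hP.bound
  obtain ⟨pA, hpA⟩ := hA
  -- The order of the choices matters. `W` bounds every string handed to a subroutine: the secret
  -- key, a clipped string from the challenger, or a message of the adversary. The running times
  -- `T2` and `T3` depend on it, and `V`, the bound for the input register of the adversary, depends
  -- on these.
  let b (n : ℕ) := pA.eval n
  let T1 (n : ℕ) := pG.eval (n + tsize cs n)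
  let W (n : ℕ) := T1 n + evalL cl n + b n
  let T2 (n : ℕ) := pK.eval (n + 2 * W n)
  let T3 (n : ℕ) := pP.eval (n + 3 * W n)
  let V (n : ℕ) := extendCost K n (W n) (T2 n) + T3 n + b n
  refine ⟨b, W, V, T1, T2, T3, fun n => ?_, ?_⟩
  · refine ⟨fun xs hxs => hpA n xs hxs, fun x hx => hpG n [x] _ rfl (by simpa using hx),
      fun x y hx hy => hpK n [x, y] _ rfl ?_, fun x y z hx hy hz => hpP n [x, y, z] _ rfl ?_,
      ?_, ?_, ?_, ?_, ?_⟩ <;>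
    simp only [W, V, List.map_cons, List.map_nil, List.sum_cons, List.sum_nil] at * <;> omega
  · simp only [V, W, T1, T2, T3, b, reductionCost, phaseOneCost, phaseTwoCost, setupBCost,
      extendCost, queryCost]
    fun_prop

lemma isQPTAdversary_reduction (cs : List ℕ) {qs : List ℕ} (cl : List ℕ) (hG : IsQPT 1 G)
    (hK : IsQPT 2 K) (hP : IsQPT 3 P) (hA : IsQPTAdversary (evalL qs) A) :
    IsQPTAdversary (fun _ => 1) (reduction cs qs cl G K P A) := by
  obtain ⟨b, W, V, T1, T2, T3, hB, r, hr⟩ := exists_bounds cs cl hG hK hP hA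
  exact ⟨r, fun n xs hxs h o ho => (all_activations_reduction (hB n) xs hxs h o ho).trans (hr n)⟩

end

/-! ### Computation trees of the parties -/

section

variable {α β γ : Type}

lemma Tree.ren_bind_eq [Ren α] [Ren β] {π : Perm ℕ} {t t' : Tree α} {f g : α → Tree β}
    (ht : ren π t = t') (h : ∀ a, ren π (f a) = g (ren π a)) : ren π (t >>= f) = t' >>= g := by
  rw [Tree.ren_bind t h, ht]

lemma Tree.ren_bind_closed [Ren α] [Ren β] {π : Perm ℕ} {t : Tree α} {f g : α → Tree β}
    (ht : Supp ∅ t) (h : ∀ a, ren π (f a) = g (ren π a)) : ren π (t >>= f) = t >>= g :=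
  Tree.ren_bind_eq (ht π (by simp)) h

lemma Supp.of_ren [Ren α] {x : α} {S : Finset ℕ} (h : ∀ π : Perm ℕ, ren π x = x) :
    Supp S x := fun π _ => h π

lemma Supp.closed_bind [Ren α] [Ren β] {t : Tree α} {f : α → Tree β} (h : Supp ∅ t)
    (hf : ∀ (π : Perm ℕ) a, ren π (f a) = f (ren π a)) : Supp ∅ (t >>= f) :=
  h.bind fun π _ => hf π

lemma supp_pure [ClassicalData α] (S : Finset ℕ) (a : α) : Supp S (pure a : Tree α) := fun π _ => by
  rw [Tree.ren_pure, ren_eq]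

lemma interp_map (f : α → β) (t : Tree α) : interp (f <$> t) = f <$> interp t := by
  rw [map_eq_pure_bind, map_eq_pure_bind, interp_bind]
  rfl

lemma ren_flatMap_frame (π : Perm ℕ) (x : List Str) :
    ren π (x.flatMap frame) = (ren π x).flatMap frame := by
  induction x with
  | nil => rfl
  | cons c x ih => simp [ren_frame, ih]

def runT (P : Prog) (μ : Mem) : Tree Mem := texec P μ >>= fun o => pure o.1

lemma interp_runT (P : Prog) (μ : Mem) : interp (runT P μ) = run P μ := by
  rw [runT, interp_bind, interp_texec, run, map_eq_pure_bind]
  rfl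

lemma ren_runT (π : Perm ℕ) (P : Prog) (μ : Mem) : ren π (runT P μ) = runT P (ren π μ) :=
  Tree.ren_bind_eq (ren_texec π P μ) fun _ => rfl

def runOnT (P : Prog) (n : ℕ) (xs : List Str) : Tree Str :=
  runT P (load (unary n :: xs)) >>= fun ν => pure (ν outReg)

lemma interp_runOnT (P : Prog) (n : ℕ) (xs : List Str) :
    interp (runOnT P n xs) = runOn P n xs := by
  simp [runOnT, interp_map, interp_runT, runOn_eq]

lemma ren_runOnT (π : Perm ℕ) (P : Prog) (n : ℕ) (xs : List Str) :
    ren π (runOnT P n xs) = runOnT P n (ren π xs) := by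
  refine Tree.ren_bind_eq ?_ fun _ => rfl
  rw [ren_runT, ren_load, ren_cons, unary, ren_ofBits]

lemma interp_coin : interp coin = coinC := by
  funext h
  rfl

def unifT : ℕ → Tree ℕ
  | 0 => pure 0
  | k + 1 => unifT k >>= fun u => coin >>= fun b => pure (2 * u + b.toNat)

lemma interp_unifT (k : ℕ) : interp (unifT k) = unifC k := by
  induction k with
  | zero => rfl
  | succ k ih =>
    rw [unifC, iterM_succ_right, unifT]
    simp [interp_bind, interp_map, interp_coin, ih, unifC]

lemma supp_unifT (k : ℕ) : Supp ∅ (unifT k) := by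
  induction k with
  | zero => exact supp_pure _ _
  | succ k ih =>
    exact ih.closed_bind fun π u => Tree.ren_bind_closed supp_coin fun b => rfl

def selT (z : ℕ) : ℕ → Tree (List ℕ)
  | 0 => pure []
  | k + 1 => selT z k >>= fun us => unifT z >>= fun u => pure (u :: us)

lemma interp_selT (z k : ℕ) : interp (selT z k) = selC k z := by
  induction k with
  | zero => rfl
  | succ k ih =>
    rw [selC, iterM_succ_right, selT]
    simp [interp_bind, interp_map, interp_unifT, ih, selC]

lemma supp_selT (z k : ℕ) : Supp ∅ (selT z k) := by
  induction k with
  | zero => exact supp_pure _ _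
  | succ k ih =>
    exact ih.closed_bind fun π us => by
      rw [ren_eq]
      exact Tree.ren_bind_closed (supp_unifT z) fun b => by
        rw [Tree.ren_pure, ren_eq, ren_eq]

def mapT (f : α → Tree β) : List α → Tree (List β)
  | [] => pure []
  | a :: l => f a >>= fun b => mapT f l >>= fun r => pure (b :: r)

lemma ren_mapT [Ren α] [Ren β] {π : Perm ℕ} {f : α → Tree β}
    (h : ∀ a, ren π (f a) = f (ren π a)) (l : List α) : ren π (mapT f l) = mapT f (ren π l) := by
  induction l with
  | nil => rfl
  | cons a l ih =>
    exact Tree.ren_bind_eq (h a) fun b => Tree.ren_bind_eq ih fun r => rfl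

/-- `k` independent runs. -/
def repeatedT (c : Tree α) (k : ℕ) : Tree (List α) := mapT (fun _ => c) (List.replicate k ())

lemma repeatedT_succ (c : Tree α) (k : ℕ) :
    repeatedT c (k + 1) = c >>= fun b => repeatedT c k >>= fun r => pure (b :: r) := rfl

lemma interp_repeatedT (c : Tree α) (k : ℕ) : interp (repeatedT c k) = repeated (interp c) k := by
  induction k with
  | zero => rfl
  | succ k ih => simp [repeatedT_succ, interp_bind, interp_map, ih, repeated]

lemma supp_repeatedT [Ren α] {c : Tree α} (h : Supp ∅ c) (k : ℕ) : Supp ∅ (repeatedT c k) :=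
  Supp.of_ren fun π => by
    rw [repeatedT, ren_mapT (fun _ => h π (by simp))]
    congr 1
    exact ren_eq π _

end

/-! ### The algorithms of the two schemes as computation trees -/

namespace QDS

section

variable (S : QDS) (n : ℕ)

def keyT : Tree (List Bool) := runOnT S.skGen n [] >>= fun x => pure (toBits x)

def pkT (sk : List Bool) : Tree Str := runOnT S.pkGen n [ofBits sk]

def sigT (sk m : List Bool) : Tree (List Bool) :=
  runOnT S.sign n [ofBits sk, ofBits m] >>= fun x => pure (toBits x)

def verT (m : List Bool) (pk : Str) : Option Str → Tree Bool
  | none => pure false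
  | some s => runOnT S.ver n [pk, ofBits m, s] >>= fun x => pure ((toBits x).head? == some true)

lemma interp_keyT : interp (S.keyT n) = S.SKGen n := by
  simp only [keyT, interp_bind, interp_runOnT, interp_pure, SKGen]

lemma supp_keyT : Supp ∅ (S.keyT n) :=
  Supp.of_ren fun π => Tree.ren_bind_eq (ren_runOnT π _ _ _) fun x => by
    rw [Tree.ren_pure, ren_eq, toBits_ren]

lemma interp_pkT (sk : List Bool) : interp (S.pkT n sk) = S.PKGen n sk := interp_runOnT _ _ _

lemma supp_pkT (sk : List Bool) : Supp ∅ (S.pkT n sk) := Supp.of_ren fun π => by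
  rw [pkT, ren_runOnT, ren_cons, ren_ofBits, ren_nil]

lemma interp_sigT (sk m : List Bool) : interp (S.sigT n sk m) = S.Sign n sk m := by
  simp only [sigT, interp_bind, interp_runOnT, interp_pure, Sign]

lemma supp_sigT (sk m : List Bool) : Supp ∅ (S.sigT n sk m) :=
  Supp.of_ren fun π => Tree.ren_bind_eq
    (by rw [ren_runOnT, ren_cons, ren_ofBits, ren_cons, ren_ofBits, ren_nil]) fun x => by
    rw [Tree.ren_pure, ren_eq, toBits_ren]

lemma interp_verT (m : List Bool) (pk : Str) (o : Option Str) :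
    interp (S.verT n m pk o) = compV S.ver n m pk o := by
  cases o <;> simp only [verT, compV, interp_bind, interp_runOnT, interp_pure]

lemma ren_verT (π : Perm ℕ) (m : List Bool) (pk : Str) (o : Option Str) :
    ren π (S.verT n m pk o) = S.verT n m (ren π pk) (ren π o) := by
  cases o with
  | none => rfl
  | some s =>
    refine Tree.ren_bind_eq (by
      rw [ren_runOnT, ren_cons, ren_cons, ren_cons, ren_ofBits, ren_nil]) fun x => ?_
    rw [Tree.ren_pure, ren_eq, toBits_ren]

/-- The public key of a table of secret keys. -/
def framesT : List (List Bool) → Tree Str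
  | [] => pure []
  | sk :: l => S.pkT n sk >>= fun y => framesT l >>= fun r => pure (frame y ++ r)

lemma supp_framesT (l : List (List Bool)) : Supp ∅ (S.framesT n l) := by
  induction l with
  | nil => exact Supp.of_ren fun π => rfl
  | cons sk l ih =>
    refine (S.supp_pkT n sk).closed_bind fun π y => Tree.ren_bind_closed ih fun r => ?_
    rw [Tree.ren_pure, ren_append, ren_frame]

lemma interp_framesT (l : List (List Bool)) (x : Str) :
    interp (S.framesT n l) = slotPKs S.pkGen n (l.map some) x := by
  induction l with
  | nil => rfl
  | cons sk l ih =>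
    simp only [framesT, interp_bind, interp_pure, ih, List.map_cons, slotPKs, interp_pkT, PKGen]

/-- A public key with one component from outside. -/
def extT (l1 l2 : List (List Bool)) (x : Str) : Tree Str :=
  S.framesT n l1 >>= fun a => S.framesT n l2 >>= fun b => pure (a ++ (frame x ++ b))

lemma ren_extT (π : Perm ℕ) (l1 l2 : List (List Bool)) (x : Str) :
    ren π (S.extT n l1 l2 x) = S.extT n l1 l2 (ren π x) :=
  Tree.ren_bind_closed (S.supp_framesT n l1) fun a =>
    Tree.ren_bind_closed (S.supp_framesT n l2) fun b => by
      rw [Tree.ren_pure, ren_append, ren_append, ren_frame]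

lemma framesT_append (l1 l2 : List (List Bool)) :
    S.framesT n (l1 ++ l2) = S.framesT n l1 >>= fun a => S.framesT n l2 >>= fun b =>
      pure (a ++ b) := by
  induction l1 with
  | nil => simp [framesT]
  | cons sk l1 ih => simp only [framesT, List.cons_append, ih, bind_assoc, pure_bind, List.append_assoc]

lemma interp_extT (l1 l2 : List (List Bool)) (x : Str) :
    interp (S.extT n l1 l2 x) =
      slotPKs S.pkGen n (l1.map some ++ none :: l2.map some) x := by
  induction l1 with
  | nil =>
    simp [extT, framesT, slotPKs, interp_map, S.interp_framesT n l2 []]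
  | cons sk l1 ih =>
    simp only [extT, framesT, interp_bind, interp_pure, List.map_cons, List.cons_append,
      slotPKs, ← ih, bind_assoc, pure_bind, List.append_assoc, interp_pkT, PKGen]

/-- The selected signatures of a table of secret keys. -/
def sigsT (m : List Bool) : List Bool → List (List Bool) → Tree (List Slot)
  | false :: bs, _ :: l => sigsT m bs l >>= fun r => pure (none :: r)
  | true :: bs, sk :: l => S.sigT n sk m >>= fun σ => sigsT m bs l >>= fun r => pure (some σ :: r)
  | _, _ => pure []

lemma supp_sigsT (m bs : List Bool) (l : List (List Bool)) : Supp ∅ (S.sigsT n m bs l) := by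
  have p : ∀ (π : Perm ℕ) (s : Slot) (r : List Slot),
      ren π (pure (s :: r) : Tree (List Slot)) = pure (s :: ren π r) := fun π s r => by
    rw [Tree.ren_pure, ren_cons, ren_eq π s]
  induction bs generalizing l with
  | nil => exact Supp.of_ren fun π => by cases l <;> rfl
  | cons b bs ih =>
    cases l with
    | nil => exact Supp.of_ren fun π => by cases b <;> rfl
    | cons sk l =>
      cases b with
      | false => exact (ih l).closed_bind fun π r => p π _ r
      | true =>
        refine (S.supp_sigT n sk m).closed_bind fun π σ =>
          Tree.ren_bind_closed (ih l) fun r => ?_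
        rw [p, ren_eq π σ]

/-- No slot of the table is empty, so the foreign signature `σ` never enters. -/
lemma interp_sigsT (m σ bs : List Bool) (l : List (List Bool)) :
    interp (S.sigsT n m bs l) = sigsC S.sign n m σ bs (l.map some) := by
  induction bs generalizing l with
  | nil => cases l <;> rfl
  | cons b bs ih =>
    cases l with
    | nil => cases b <;> rfl
    | cons sk l =>
      cases b <;> simp [sigsT, interp_bind, interp_map, ih, sigsC, sigC, interp_sigT, Sign]

/-- The selected signatures of a table of secret keys, with one component from outside. -/
def simSigsT (l1 l2 : List (List Bool)) (σ m bs : List Bool) : Tree (List Slot) :=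
  S.sigsT n m bs l1 >>= fun r1 => S.sigsT n m (bs.drop (l1.length + 1)) l2 >>= fun r2 =>
    pure (r1 ++ (if bs.getD l1.length false then some σ else none) :: r2)

lemma supp_simSigsT (l1 l2 : List (List Bool)) (σ m bs : List Bool) :
    Supp ∅ (S.simSigsT n l1 l2 σ m bs) :=
  (S.supp_sigsT n m bs l1).closed_bind fun π r1 =>
    Tree.ren_bind_closed (S.supp_sigsT n m _ l2) fun r2 => by
      rw [Tree.ren_pure, ren_append, ren_cons, ren_eq π (ite _ _ _)]

lemma interp_simSigsT (l1 l2 : List (List Bool)) (σ m bs : List Bool)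
    (h : l1.length < bs.length) :
    interp (S.simSigsT n l1 l2 σ m bs) =
      sigsC S.sign n m σ bs (l1.map some ++ none :: l2.map some) := by
  induction l1 generalizing bs with
  | nil =>
    obtain ⟨b, bs, rfl⟩ := List.exists_cons_of_length_pos h
    cases b <;>
      simp [simSigsT, sigsT, sigsC, sigC, interp_map, S.interp_sigsT n m σ]
  | cons sk l1 ih =>
    obtain ⟨b, bs, rfl⟩ := List.exists_cons_of_length_pos (Nat.zero_lt_of_lt h)
    have := ih bs (by simpa using h)
    simp only [simSigsT, interp_bind, interp_pure] at this
    cases b <;>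
      simp [simSigsT, sigsT, sigsC, sigC, interp_bind, interp_map, ← this, interp_sigT, Sign]

end

end QDS

section

variable {α β γ : Type}

/-! ### The query phase -/

/-- The queried messages, the last one first, with the selected columns. -/
abbrev Hist : Type := List (List Bool × List ℕ)

/-- The query phase, followed by `F`; the signing algorithm `st` knows the number of the query. -/
def queriesT (st : ℕ → List Bool → Tree (List ℕ × List Slot)) (A : Prog)
    (F : Hist → Mem → Tree β) : ℕ → Hist → Mem → Tree β
  | 0, h, μ => F h μ
  | j + 1, h, μ => st h.length (toBits (μ outReg)) >>= fun z =>
      runT A (update μ inReg (ofBits (encSlots z.2))) >>= fun μ' =>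
        queriesT st A F j ((toBits (μ outReg), z.1) :: h) μ'

variable {st st' : ℕ → List Bool → Tree (List ℕ × List Slot)} {A : Prog}

lemma queriesT_bind (F : Hist → Mem → Tree β) (G : β → Tree γ) (j : ℕ) (h : Hist) (μ : Mem) :
    queriesT st A F j h μ >>= G = queriesT st A (fun h μ => F h μ >>= G) j h μ := by
  induction j generalizing h μ with
  | zero => rfl
  | succ j ih => simp only [queriesT, bind_assoc, ih]

lemma queriesT_add (F : Hist → Mem → Tree β) (i j : ℕ) (h : Hist) (μ : Mem) :
    queriesT st A F (i + j) h μ = queriesT st A (queriesT st A F j) i h μ := by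
  induction i generalizing h μ with
  | zero => rw [Nat.zero_add]; rfl
  | succ i ih => simp only [Nat.succ_add, queriesT, ih]

lemma queriesT_congr {F F' : Hist → Mem → Tree β} (j : ℕ) (h : Hist) (μ : Mem)
    (hst : ∀ i, h.length ≤ i → i < h.length + j → st i = st' i)
    (hF : ∀ h' μ, h'.length = h.length + j → F h' μ = F' h' μ) :
    queriesT st A F j h μ = queriesT st' A F' j h μ := by
  induction j generalizing h μ with
  | zero => exact hF h μ rfl
  | succ j ih =>
    simp only [queriesT, hst _ le_rfl (Nat.lt_add_of_pos_right j.succ_pos)]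
    congr 1
    funext z
    congr 1
    funext μ'
    exact ih _ _ (fun i hi hi' => hst i (by simp at hi; omega) (by simp at hi'; omega))
      fun h' μ hh => hF h' μ (by simp at hh; omega)

lemma ev_queriesT {Q : β → Prop} {F : Hist → Mem → Tree β} (j : ℕ) (h : Hist) (μ : Mem)
    (hF : ∀ h' μ, h'.length = h.length + j → (F h' μ).Ev Q) : (queriesT st A F j h μ).Ev Q := by
  induction j generalizing h μ with
  | zero => exact hF h μ rfl
  | succ j ih =>
    exact (Tree.ev_true _).bind fun z _ => (Tree.ev_true _).bind fun μ' _ =>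
      ih _ _ fun h' μ hh => hF h' μ (by simp at hh; omega)

lemma ren_queriesT [Ren β] {π : Perm ℕ} {F F' : Hist → Mem → Tree β}
    (hst : ∀ j m, Supp ∅ (st j m)) (hF : ∀ h μ, ren π (F h μ) = F' h (ren π μ)) (j : ℕ) (h : Hist)
    (μ : Mem) : ren π (queriesT st A F j h μ) = queriesT st A F' j h (ren π μ) := by
  induction j generalizing h μ with
  | zero => exact hF h μ
  | succ j ih =>
    simp only [queriesT, ren_mem_apply, toBits_ren]
    refine Tree.ren_bind_closed (hst _ _) fun z => Tree.ren_bind_eq ?_ fun μ' => ?_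
    · rw [ren_runT, ren_update, ren_ofBits, ren_eq π z]
    · rw [ren_eq π z, ih]

lemma Supp.update_ofBits {S : Finset ℕ} {μ : Mem} (h : Supp S μ) (r : ℕ) (x : List Bool) :
    Supp S (update μ r (ofBits x) : Mem) := fun π hπ => by
  rw [ren_update, h π hπ, ren_ofBits]

lemma Supp.runT {S : Finset ℕ} {μ : Mem} (h : Supp S μ) (P : Prog) : Supp S (runT P μ) :=
  fun π hπ => by rw [ren_runT, h π hπ]

/-- Move the computation of something that is used only after the queries. -/
lemma queriesT_swap [Ren α] {t : Tree α} (ht : Supp ∅ t) {F : α → Hist → Mem → Tree ℝ}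
    (hst : ∀ j m, Supp ∅ (st j m))
    (hF : ∀ π a h μ, ren π (F a h μ) = F (ren π a) h (ren π μ)) (j : ℕ) (h : Hist) {n : ℕ} {μ : Mem}
    (hμ : Supp (range n) μ) :
    AccEq n (t >>= fun a => queriesT st A (F a) j h μ)
      (queriesT st A (fun h μ => t >>= fun a => F a h μ) j h μ) := by
  induction j generalizing h μ n with
  | zero => exact AccEq.refl _ _
  | succ j ih =>
    simp only [queriesT]
    refine (AccEq.swap ht ((hst _ _).range_of_closed n) fun π hπ a z => ?_).trans
      (AccEq.bind ((hst _ _).range_of_closed n) fun m hm z _ =>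
        (AccEq.swap ht (((hμ.mono (range_mono hm)).update_ofBits _ _).runT A)
          fun π _ a μ' => ren_queriesT hst (hF π a) _ _ _).trans
        (AccEq.bind (((hμ.mono (range_mono hm)).update_ofBits _ _).runT A)
          fun l _ μ' hμ' => ih _ hμ'))
    refine Tree.ren_bind_eq ?_ fun μ' => ?_
    · rw [ren_runT, ren_update, ren_ofBits, ren_eq π z,
        hμ π fun i hi => hπ i (Finset.mem_range.1 hi)]
    · rw [ren_eq π z]
      exact ren_queriesT hst (hF π a) _ _ _

/-- The expectation is zero. -/
def AccZero (t : Tree ℝ) : Prop := ∀ n ψ, acc t n ψ = 0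

lemma AccZero.bind {t : Tree α} {f : α → Tree ℝ} (h : ∀ a, AccZero (f a)) : AccZero (t >>= f) :=
  fun n ψ => by
  rw [acc_bind_of_const t (x := 0) fun a n ψ => by rw [h a n ψ, zero_mul], zero_mul]

/-- Later queries are put in front of the history, so a bad entry stays in it. The entries behind it
are the earlier queries, whence `s.length` is the number of the bad query. -/
lemma queriesT_zero {F : Hist → Mem → Tree ℝ} {bad : ℕ → List ℕ → Prop} {h : Hist}
    (hF : ∀ p m us s, bad s.length us → ∀ μ, AccZero (F (p ++ (m, us) :: s) μ))
    {p s : Hist} {m : List Bool} {us : List ℕ} (hb : bad s.length us)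
    (hh : h = p ++ (m, us) :: s) (j : ℕ) (μ : Mem) : AccZero (queriesT st A F j h μ) := by
  induction j generalizing h p μ with
  | zero => rw [hh]; exact hF p m us s hb μ
  | succ j ih =>
    exact AccZero.bind fun z => AccZero.bind fun μ' =>
      ih (p := (toBits (μ outReg), z.1) :: p) (by rw [hh]; rfl) μ'

/-- Replace the signing algorithm, if the two differ only where the result is zero anyway. -/
lemma queriesT_le {F : Hist → Mem → Tree ℝ} {bad : ℕ → List ℕ → Prop}
    (hst : ∀ j m, Supp ∅ (st j m)) (hst' : ∀ j m, Supp ∅ (st' j m))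
    (hF : ∀ p m us s, bad s.length us → ∀ μ, AccZero (F (p ++ (m, us) :: s) μ))
    (hR : ∀ π h μ, ren π (F h μ) = F h (ren π μ))
    (hstep : ∀ (j : ℕ) (m : List Bool) (n : ℕ) (G : List ℕ × List Slot → Tree ℝ),
      (∀ z, Supp (range n) (G z)) → (∀ us r, bad j us → AccZero (G (us, r))) →
      AccLe n (st j m >>= G) (st' j m >>= G)) (j : ℕ) (h : Hist) {n : ℕ} {μ : Mem}
    (hμ : Supp (range n) μ) :
    AccLe n (queriesT st A F j h μ) (queriesT st' A F j h μ) := by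
  induction j generalizing h μ n with
  | zero => exact AccLe.refl _ _
  | succ j ih =>
    simp only [queriesT]
    -- The earliest query is replaced while all later ones still use `st`; induction then replaces
    -- these.
    refine AccLe.trans (hstep _ _ n (fun z => runT A (update μ inReg
      (ofBits (encSlots z.2))) >>= fun μ' => queriesT st A F j ((toBits (μ outReg), z.1) :: h) μ')
      (fun z => ((hμ.update_ofBits _ _).runT A).bind fun π _ μ' => ren_queriesT hst (hR π) _ _ _)
      fun us r hb => AccZero.bind fun μ' => queriesT_zero hF hb (p := []) rfl _ _)
      (AccLe.bind ((hst' _ _).range_of_closed n) fun m hm z _ =>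
        AccLe.bind (((hμ.mono (range_mono hm)).update_ofBits _ _).runT A)
          fun l _ μ' hμ' => ih _ hμ')

/-- Compare the end of the query phase. -/
lemma queriesT_mono {F F' : Hist → Mem → Tree ℝ} (hst : ∀ j m, Supp ∅ (st j m)) (j : ℕ)
    (h : Hist) {n : ℕ} {μ : Mem} (hμ : Supp (range n) μ)
    (hF : ∀ p : Hist, p.length = j → ∀ m, n ≤ m → ∀ μ, Supp (range m) μ →
      AccLe m (F (p ++ h) μ) (F' (p ++ h) μ)) :
    AccLe n (queriesT st A F j h μ) (queriesT st A F' j h μ) := by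
  induction j generalizing h μ n with
  | zero => exact hF [] rfl n le_rfl μ hμ
  | succ j ih =>
    exact AccLe.bind ((hst _ _).range_of_closed n) fun m hm z _ =>
      AccLe.bind (((hμ.mono (range_mono hm)).update_ofBits _ _).runT A)
        fun l hl μ' hμ' => ih _ hμ' fun p hp k hk ν hν => by
          have := hF (p ++ [(toBits (μ outReg), z.1)]) (by simp [hp]) k (by omega) ν hν
          rwa [List.append_assoc] at this

end

namespace QDS

section

variable (S : QDS) (n : ℕ)

/-! ### One query -/

/-- Was the position `e` selected? -/
def used (C e : ℕ) (us : List ℕ) : Prop := us[e / C]? = some (C - 1 - e % C)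

/-- Signing with a table of secret keys. -/
def stepT (z R : ℕ) (l : List (List Bool)) (m : List Bool) : Tree (List ℕ × List Slot) :=
  selT z R >>= fun us => S.sigsT n m (us.flatMap (rowSel (2 ^ z))) l >>= fun r => pure (us, r)

/-- Signing with a table of secret keys, one of which is unknown. -/
def simStepT (z R : ℕ) (l1 l2 : List (List Bool)) (σ m : List Bool) :
    Tree (List ℕ × List Slot) :=
  selT z R >>= fun us => S.simSigsT n l1 l2 σ m (us.flatMap (rowSel (2 ^ z))) >>= fun r =>
    pure (us, r)

/-- Only for query number `k`, the unknown key is used. -/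
def hybridT (z R : ℕ) (l1 l2 : List (List Bool)) (sk : List Bool) (k j : ℕ) (m : List Bool) :
    Tree (List ℕ × List Slot) :=
  if j = k then S.sigT n sk m >>= fun σ => S.simStepT n z R l1 l2 σ m
  else S.simStepT n z R l1 l2 [] m

variable {z R : ℕ} {l1 l2 : List (List Bool)}

lemma supp_stepT (l : List (List Bool)) (m : List Bool) : Supp ∅ (S.stepT n z R l m) :=
  (supp_selT z R).closed_bind fun π us => by
    rw [ren_eq π us]
    exact Tree.ren_bind_closed (S.supp_sigsT n m _ l) fun r => by
      rw [Tree.ren_pure, ren_eq, ren_eq]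

lemma supp_simStepT (σ m : List Bool) : Supp ∅ (S.simStepT n z R l1 l2 σ m) :=
  (supp_selT z R).closed_bind fun π us => by
    rw [ren_eq π us]
    exact Tree.ren_bind_closed (S.supp_simSigsT n l1 l2 σ m _) fun r => by
      rw [Tree.ren_pure, ren_eq, ren_eq]

lemma supp_hybridT (sk : List Bool) (k j : ℕ) (m : List Bool) :
    Supp ∅ (S.hybridT n z R l1 l2 sk k j m) := by
  rw [hybridT]
  split_ifs
  · exact (S.supp_sigT n sk m).closed_bind fun π σ => by
      rw [ren_eq π σ]
      exact S.supp_simStepT n σ m π (by simp)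
  · exact S.supp_simStepT n [] m

/-- The key `sk` matters only if its position is selected. Otherwise its slot of the signature is
empty, and the table with a hole gives the same computation. -/
lemma sigsT_split (m bs : List Bool) (sk : List Bool) (h : l1.length < bs.length) :
    S.sigsT n m bs (l1 ++ sk :: l2) =
      if bs.getD l1.length false then S.sigsT n m bs l1 >>= fun r => S.sigT n sk m >>= fun σ =>
        S.sigsT n m (bs.drop (l1.length + 1)) l2 >>= fun r' => pure (r ++ some σ :: r')
      else S.simSigsT n l1 l2 [] m bs := by
  induction l1 generalizing bs with
  | nil =>
    obtain ⟨b, bs, rfl⟩ := List.exists_cons_of_length_pos h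
    cases b <;> simp [simSigsT, sigsT]
  | cons x l1 ih =>
    obtain ⟨b, bs, rfl⟩ := List.exists_cons_of_length_pos (Nat.zero_lt_of_lt h)
    have := ih bs (by simpa using h)
    simp only [simSigsT] at this ⊢
    cases b <;>
    simp only [List.cons_append, sigsT, this, List.length_cons, List.getD_cons_succ,
      List.drop_succ_cons] <;> split_ifs <;> simp_all [bind_assoc]

lemma rowSel_getD {C u c : ℕ} (hu : u < C) (hc : c < C) :
    (rowSel C u).getD c false = decide (u = C - 1 - c) := by
  simp only [rowSel, List.getD_eq_getElem?_getD, List.getElem?_append, List.length_replicate]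
  split_ifs with h
  · simp [h]; omega
  · obtain h' | h' := Nat.eq_or_lt_of_not_lt h
    · simp [h']; omega
    · obtain ⟨i, hi⟩ := Nat.exists_eq_add_of_lt h'
      have : c - (C - 1 - u) = i + 1 := by omega
      rw [this, List.getElem?_cons_succ, List.getElem?_replicate]
      split_ifs <;> simp <;> omega

/-- The position `e` lies in row `e / C` and column `e % C`; the subtraction in `used` undoes the
reversal in `rowSel`. -/
lemma flatMap_rowSel_getD {C : ℕ} {us : List ℕ} (hus : ∀ u ∈ us, u < C) {e : ℕ}
    (he : e < us.length * C) :
    (us.flatMap (rowSel C)).getD e false = true ↔ used C e us := by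
  induction us generalizing e with
  | nil => simp at he
  | cons u us ih =>
    have hu := hus u List.mem_cons_self
    rw [List.flatMap_cons, List.getD_eq_getElem?_getD, List.getElem?_append, length_rowSel hu]
    split_ifs with h
    · rw [← List.getD_eq_getElem?_getD, rowSel_getD hu h, used, Nat.div_eq_of_lt h,
        Nat.mod_eq_of_lt h]
      simp
    · obtain ⟨i, rfl⟩ := Nat.exists_eq_add_of_le' (not_lt.1 h)
      rw [← List.getD_eq_getElem?_getD, Nat.add_sub_cancel,
        ih (fun v hv => hus v (List.mem_cons_of_mem _ hv))
          (by rw [List.length_cons, Nat.succ_mul] at he; omega), used, used,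
        Nat.add_div_right _ (by omega), Nat.add_mod_right, List.getElem?_cons_succ]

lemma ev_unifT (k : ℕ) : (unifT k).Ev fun u => u < 2 ^ k := by
  induction k with
  | zero => exact Nat.one_pos
  | succ k ih =>
    refine ih.bind fun u hu => (Tree.ev_true _).bind fun b _ => ?_
    have := Bool.toNat_le b
    show 2 * u + b.toNat < 2 ^ (k + 1)
    rw [pow_succ]
    omega

lemma ev_selT (z R : ℕ) : (selT z R).Ev fun us => us.length = R ∧ ∀ u ∈ us, u < 2 ^ z := by
  induction R with
  | zero => exact ⟨rfl, by simp⟩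
  | succ R ih => exact ih.bind fun us hus => (ev_unifT z).bind fun u hu =>
      ⟨by simp [hus.1], by simpa using ⟨hu, hus.2⟩⟩

/-- Signing with an unknown key is perfect, unless this key is needed for another query. -/
lemma stepT_le_hybridT {sk m : List Bool} {k j N : ℕ} {G : List ℕ × List Slot → Tree ℝ}
    (he : l1.length < R * 2 ^ z) (hG : ∀ z, Supp (range N) (G z))
    (h0 : ∀ us r, j ≠ k ∧ used (2 ^ z) l1.length us → AccZero (G (us, r))) :
    AccLe N (S.stepT n z R (l1 ++ sk :: l2) m >>= G)
      (S.hybridT n z R l1 l2 sk k j m >>= G) := by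
  have hGc : ∀ (π : Perm ℕ), (∀ i < N, π i = i) → ∀ us (r : List Slot),
      ren π (G (us, r)) = G (us, ren π r) := fun π hπ us r => by
    rw [ren_eq π r, hG _ π fun i hi => hπ i (Finset.mem_range.1 hi)]
  have hcl : ∀ us : List ℕ, (us.length = R ∧ ∀ u ∈ us, u < 2 ^ z) → l1.length <
      (us.flatMap (rowSel (2 ^ z))).length := fun us hus => by
    rw [length_flatMap_rowSel hus.2, hus.1]
    exact he
  simp only [stepT, hybridT, simStepT, bind_assoc, pure_bind]
  by_cases hjk : j = k
  · rw [if_pos hjk]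
    simp only [bind_assoc, pure_bind]
    -- The hybrid has the signature of the challenger before any column is drawn; it may as well be
    -- made afterwards.
    refine AccLe.trans ?_ (AccEq.swap (S.supp_sigT n sk m) ((supp_selT z R).range_of_closed N)
      fun π hπ σ us => ?_).symm.le
    · refine AccLe.bind_of_ev ((supp_selT z R).range_of_closed N) (ev_selT z R)
        fun M hM us hus _ => ?_
      have hMπ : ∀ {π : Perm ℕ}, (∀ i < M, π i = i) → ∀ i < N, π i = i := fun h i hi =>
        h i (hi.trans_le hM)
      rw [S.sigsT_split n m _ sk (hcl us hus)]
      split_ifs with hb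
      -- The unknown key is selected: its signature only has to be moved past those of the keys in
      -- front of it.
      · simp only [bind_assoc, pure_bind, simSigsT, hb, if_true]
        refine (AccEq.swap (S.supp_sigT n sk m) ((S.supp_sigsT n m _ l1).range_of_closed M)
          fun π hπ σ r => ?_).symm.le
        rw [ren_eq π σ, ren_eq π r]
        exact Tree.ren_bind_closed (S.supp_sigsT n m _ l2) fun r' => by
          rw [hGc π (hMπ hπ), ren_eq, ren_eq]
      -- The unknown key is not selected: the signature of the challenger is thrown away.
      · simp only [bind_assoc, pure_bind, simSigsT, hb]
        refine (AccEq.discard (S.supp_sigT n sk m) ?_).symm.le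
        refine Supp.bind ((S.supp_sigsT n m _ l1).range_of_closed M) fun π hπ r => ?_
        rw [ren_eq π r]
        exact Tree.ren_bind_closed (S.supp_sigsT n m _ l2) fun r' => by
          rw [hGc π (hMπ fun i hi => hπ i (Finset.mem_range.2 hi)), ren_eq,
            ren_eq]
    · rw [ren_eq π σ, ren_eq π us]
      exact Tree.ren_bind_closed (S.supp_simSigsT n l1 l2 σ m _) fun r => hGc π hπ us r
  · rw [if_neg hjk]
    simp only [bind_assoc, pure_bind]
    refine AccLe.bind_of_ev ((supp_selT z R).range_of_closed N) (ev_selT z R)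
      fun M hM us hus _ => ?_
    rw [S.sigsT_split n m _ sk (hcl us hus)]
    split_ifs with hb
    -- The unknown key is selected in a query other than `k`. The simulation is wrong here, but both
    -- continuations are worth zero.
    · have hz := h0 us
      rw [flatMap_rowSel_getD hus.2 (by rwa [hus.1])] at hb
      intro l _ ψ _
      rw [AccZero.bind fun r => hz r ⟨hjk, hb⟩, AccZero.bind fun r => hz r ⟨hjk, hb⟩]
    · exact AccLe.refl _ _

end

end QDS

/-! ### Reading signatures -/

/-- A string without qubits. -/
def IsBits (l : Str) : Prop := ∀ c ∈ l, ∃ b, c = .bit b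

lemma isBits_ofBits (x : List Bool) : IsBits (ofBits x) := fun c hc => by
  obtain ⟨b, -, rfl⟩ := List.mem_map.1 hc
  exact ⟨b, rfl⟩

lemma IsBits.ofBits_toBits {l : Str} (h : IsBits l) : ofBits (toBits l) = l := by
  induction l with
  | nil => rfl
  | cons c l ih =>
    obtain ⟨b, rfl⟩ := h c List.mem_cons_self
    rw [toBits_bit, ofBits_cons, ih fun c hc => h c (List.mem_cons_of_mem _ hc)]

lemma unframe_subset (l : Str) : (unframe l).1 ⊆ l ∧ (unframe l).2 ⊆ l := by
  induction l using unframe.induct with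
  | case2 c l ih =>
    simp only [unframe]
    exact ⟨List.cons_subset.2 ⟨by simp, fun x hx => by simp [ih.1 hx]⟩, fun x hx => by
      simp [ih.2 hx]⟩
  | _ => simp [unframe]

/-- On strings without qubits, passing from cells to bits and back loses nothing, so a component can
be treated as a classical `Slot`. -/
lemma IsBits.readSlot {s : Str} (h : IsBits s) :
    ((readSlot s).1.map toBits).map ofBits = (readSlot s).1 ∧ IsBits (readSlot s).2 := by
  have ht : IsBits s.tail := fun c hc => h c (List.mem_of_mem_tail hc)
  rw [QDSModel.readSlot]
  split_ifs
  · refine ⟨?_, fun c hc => ht c ((unframe_subset _).2 hc)⟩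
    simp only [map_some, Option.some.injEq]
    exact IsBits.ofBits_toBits fun c hc => ht c ((unframe_subset _).1 hc)
  · exact ⟨rfl, ht⟩

lemma IsBits.dropSlot_iterate {s : Str} (h : IsBits s) (e : ℕ) :
    IsBits (dropSlot^[e] s) := by
  induction e with
  | zero => exact h
  | succ e ih =>
    rw [Function.iterate_succ_apply']
    exact ih.readSlot.2

/-- The entry number `e` of a list of slots. -/
def slotAt (e : ℕ) (s : Str) : Slot := (readSlot (dropSlot^[e] s)).1.map toBits

lemma ren_unframe (π : Perm ℕ) (l : Str) :
    (ren π (unframe l).1, ren π (unframe l).2) = unframe (ren π l) := by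
  induction l using unframe.induct with
  | case2 c l ih =>
    rw [Prod.mk.injEq] at ih
    simp only [unframe, ren_cons, ren_bit, ← ih.1, ← ih.2]
  | _ => simp [unframe]

lemma ren_unframe_fst (π : Perm ℕ) (l : Str) :
    ren π (unframe l).1 = (unframe (ren π l)).1 := by rw [← ren_unframe]

lemma ren_unframe_snd (π : Perm ℕ) (l : Str) :
    ren π (unframe l).2 = (unframe (ren π l)).2 := by rw [← ren_unframe]

/-! ### Verification component by component, and the game for the table as a tree -/

namespace QDS

section

variable (S : QDS) (n : ℕ)

/-- Verification of one component. -/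
def compT (m : List Bool) (pk : Str) (o : Slot) : Tree Bool := S.verT n m pk (o.map ofBits)

lemma ren_compT (π : Perm ℕ) (m : List Bool) (pk : Str) (o : Slot) :
    ren π (S.compT n m pk o) = S.compT n m (ren π pk) o := by
  rw [compT, ren_verT, compT]
  congr 1
  cases o
  · rfl
  · rw [map_some, ren_some, ren_ofBits]

def compsT (m : List Bool) : ℕ → Str → Str → Tree (List Bool)
  | 0, _, _ => pure []
  | k + 1, pk, s => S.compT n m (unframe pk).1 ((readSlot s).1.map toBits) >>= fun b =>
      compsT m k (unframe pk).2 (readSlot s).2 >>= fun r => pure (b :: r)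

lemma interp_compsT (m : List Bool) (k : ℕ) (pk : Str) {s : Str} (hs : IsBits s) :
    interp (S.compsT n m k pk s) = compsC S.ver n m k pk s := by
  induction k generalizing pk s with
  | zero => rfl
  | succ k ih =>
    simp only [compsT, compT, interp_bind, interp_pure, compsC, interp_verT, hs.readSlot.1,
      ih _ hs.readSlot.2]

lemma ren_compsT (π : Perm ℕ) (m : List Bool) (k : ℕ) (pk s : Str) :
    ren π (S.compsT n m k pk s) = S.compsT n m k (ren π pk) s := by
  induction k generalizing pk s with
  | zero => rfl
  | succ k ih =>
    refine Tree.ren_bind_eq (by rw [ren_compT, ren_unframe_fst]) fun b =>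
      Tree.ren_bind_eq (by rw [ih, ren_unframe_snd]) fun r => rfl

/-- Verification with the public keys computed when they are needed. -/
def versT (m : List Bool) : List (List Bool) → Str → Tree (List Bool)
  | [], _ => pure []
  | sk :: l, s => S.pkT n sk >>= fun y => S.compT n m y ((readSlot s).1.map toBits) >>= fun b =>
      versT m l (readSlot s).2 >>= fun r => pure (b :: r)

lemma supp_versT (m : List Bool) (l : List (List Bool)) (s : Str) :
    Supp ∅ (S.versT n m l s) := by
  induction l generalizing s with
  | nil => exact Supp.of_ren fun π => rfl
  | cons sk l ih =>
    exact (S.supp_pkT n sk).closed_bind fun π y => Tree.ren_bind_eq (S.ren_compT n π _ _ _)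
      fun b => Tree.ren_bind_closed (ih _) fun r => rfl

lemma supp_compT {N : ℕ} {y : Str} (m : List Bool) (o : Slot)
    (hy : Supp (range N) y) : Supp (range N) (S.compT n m y o) := fun π hπ => by
  rw [ren_compT, hy π hπ]

/-- The public keys of the later slots are on other qubits than the first component, so their
generation can wait until that component has been verified; and so on along the list. -/
lemma framesT_compsT (m : List Bool) (l : List (List Bool)) (s : Str)
    (g : List Bool → ℝ) (N : ℕ) :
    AccEq N (S.framesT n l >>= fun pk => S.compsT n m l.length pk s >>= fun bs => .ret (g bs))
      (S.versT n m l s >>= fun bs => .ret (g bs)) := by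
  induction l generalizing s g N with
  | nil => exact AccEq.refl _ _
  | cons sk l ih =>
    simp only [framesT, versT, bind_assoc, pure_bind, List.length_cons, compsT, unframe_frame]
    refine AccEq.bind ((S.supp_pkT n sk).range_of_closed N) fun M hM y hy => ?_
    have hc := S.supp_compT n m ((readSlot s).1.map toBits) hy
    exact (AccEq.swap (S.supp_framesT n l) hc fun π _ r b =>
      Tree.ren_bind_eq (S.ren_compsT n π _ _ _ _) fun bs => by
        simp only [Tree.ren_ret, ren_eq]).trans
      (AccEq.bind hc fun K _ b _ => ih _ (fun bs => g (b :: bs)) K)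

/-- With separate public keys, the verification of the other components can be discarded when only
one verdict is needed. -/
lemma versT_single (m : List Bool) (l1 l2 : List (List Bool)) (sk : List Bool) (s : Str)
    (g : Bool → ℝ) (N : ℕ) :
    AccEq N (S.versT n m (l1 ++ sk :: l2) s >>= fun bs => .ret (g (bs.getD l1.length false)))
      (S.pkT n sk >>= fun y => S.compT n m y (slotAt l1.length s) >>= fun b => .ret (g b)) := by
  induction l1 generalizing s N with
  | nil =>
    simp only [List.nil_append, versT, bind_assoc, pure_bind]
    refine AccEq.bind ((S.supp_pkT n sk).range_of_closed N) fun M hM y hy =>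
      AccEq.bind (S.supp_compT n m _ hy) fun K _ b _ k _ ψ _ => ?_
    exact acc_bind_ret_const (S.versT n m l2 (readSlot s).2) (g b) k ψ
  | cons x l1 ih =>
    simp only [List.cons_append, versT, bind_assoc, pure_bind]
    have := AccEq.discard (n := N) (t := S.pkT n x >>= fun y =>
      S.compT n m y ((readSlot s).1.map toBits)) (f := S.versT n m (l1 ++ sk :: l2) (readSlot s).2
        >>= fun bs => .ret (g (bs.getD l1.length false)))
      ((S.supp_pkT n x).closed_bind fun π y => S.ren_compT n π _ _ _)
      (Supp.range_of_closed ((S.supp_versT n m _ _).closed_bind fun π bs => by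
        simp only [Tree.ren_ret, ren_eq]) N)
    rw [bind_assoc] at this
    exact this.trans (ih _ _)

/-! ### The game for the table scheme -/

/-- The scheme with a table of keys. -/
def table (S : QDS) (cs : List ℕ) : QDS :=
  ⟨skGenP cs S.skGen, pkGenP S.pkGen, signP cs S.sign, verP cs S.ver⟩

/-- The part of the game that the adversary takes part in. -/
def advT {β : Type} (st : ℕ → List Bool → Tree (List ℕ × List Slot)) (A : Prog)
    (F : Hist → Mem → Tree β) (q : ℕ) (pks : List Str) : Tree β :=
  runT A (update (load [unary n]) inReg (pks.flatMap frame)) >>= queriesT st A F q []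

/-- The game for a table of `2 ^ z` columns and `R` rows, with the public key for the verification
computed at the end. -/
def coreT (z R : ℕ) (A : Prog) (t q : ℕ) : Tree (Hist × List Bool × List Bool) :=
  repeatedT (S.keyT n) (R * 2 ^ z) >>= fun l => repeatedT (S.framesT n l) t >>= fun pks =>
    advT n (fun _ => S.stepT n z R l) A (fun h μ => S.versT n (toBits (μ outReg)) l
      (ofBits (toBits (μ sigReg))) >>= fun bs => pure (h, toBits (μ outReg), bs)) q pks

variable {n}

/-- The game lists the messages in the order of the queries, the history lists the last one first;
hence the reversal. -/
lemma interp_queriesT {β : Type} {S : QDS} {sk : List Bool}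
    {st : ℕ → List Bool → Tree (List ℕ × List Slot)} {A : Prog}
    (F : List (List Bool) → Mem → Tree β)
    (hst : ∀ j m, (interp (st j m) >>= fun z => pure (encSlots z.2)) = S.Sign n sk m)
    (j : ℕ) (h : Hist) (μ : Mem) :
    interp (queriesT st A (fun h μ => F (h.map Prod.fst) μ) j h μ) =
      S.queries A n sk j μ >>= fun o => interp (F (o.1.reverse ++ h.map Prod.fst) o.2) := by
  induction j generalizing h μ with
  | zero => simp [queriesT, queries]
  | succ j ih =>
    simp only [queriesT, queries, interp_bind, interp_runT, ih, bind_assoc, ← hst h.length, run,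
      map_eq_pure_bind, pure_bind, activate, List.map_cons, List.reverse_cons, List.append_assoc,
      List.cons_append, List.nil_append]

section

variable {S} {cs : List ℕ}

lemma runOn_append_nil (P : Prog) (xs : List Str) :
    runOn P n (xs ++ [[]]) = runOn P n xs := by
  rw [runOn, runOn, ← List.cons_append, load_append_nil]

lemma slotsC_nil (k : ℕ) : slotsC S.skGen n k [] =
    interp (repeatedT (S.keyT n) k) >>= fun l => pure (l.map some) := by
  induction k with
  | zero => rfl
  | succ k ih =>
    simp only [slotsC, slotC, topTrue, ih, repeatedT_succ, interp_bind, interp_pure, interp_keyT,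
      SKGen, bind_assoc, pure_bind, List.map_cons, List.tail_nil, Bool.false_eq_true, if_false]

lemma table_SKGen (hS : S.Efficient) : (S.table cs).SKGen n =
    interp (repeatedT (S.keyT n) (tsize cs n)) >>= fun l => pure (encSlots (l.map some)) := by
  have := runOn_skGenP (cs := cs) hS.1 n []
  rw [SKGen, table, ← runOn_append_nil, List.nil_append, this, slotsC_nil]
  simp

lemma table_PKGen (hS : S.Efficient) (l : List (List Bool)) :
    (S.table cs).PKGen n (encSlots (l.map some)) = interp (S.framesT n l) := by
  have := runOn_pkGenP hS.2.1 n (l.map some) []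
  rw [PKGen, table, ← runOn_append_nil, S.interp_framesT n l []]
  exact this

lemma table_Sign (hS : S.Efficient) {l : List (List Bool)} (hl : l.length = tsize cs n)
    (m : List Bool) : (S.table cs).Sign n (encSlots (l.map some)) m =
      interp (S.stepT n (size (evalL cs n)) (rows n) l m) >>= fun z =>
        pure (encSlots z.2) := by
  have := runOn_signP (cs := cs) hS.2.2.1 n (l.map some) (by simpa using hl) m []
  rw [ofBits_nil] at this
  rw [Sign, table, ← runOn_append_nil]
  simp only [List.cons_append, List.nil_append, this, stepT, interp_bind, interp_pure,
    interp_selT, S.interp_sigsT n m [], bind_assoc, pure_bind, toBits_ofBits]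
  rfl

lemma table_Ver (hS : S.Efficient) (pk : Str) (m σ : List Bool) :
    (S.table cs).Ver n pk m σ = interp (S.compsT n m (tsize cs n) pk (ofBits σ)) >>= fun bs =>
      pure (decide (failC (cols cs n) (rows n) bs = 0)) := by
  rw [Ver, table, runOn_verP hS.2.2.2, toBits_ofBits,
    S.interp_compsT n m _ pk (isBits_ofBits σ)]
  simp

end

end

end QDS

/-! ### Combinatorics of the columns -/

/-- In each of the first `k` rows, a column was selected twice. -/
def Collide : ℕ → List (List ℕ) → Prop
  | 0, _ => True
  | k + 1, H => ¬ (H.map List.head?).Nodup ∧ Collide k (H.map List.tail)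

/-- The position `e` was selected at most by query number `k`. -/
def OnlyAt (C e k : ℕ) (h : Hist) : Prop :=
  ∀ p m us s, h = p ++ (m, us) :: s → ¬ (s.length ≠ k ∧ QDS.used C e us)

/-- In a row without collision no column is selected by two queries, and an accepted signature has a
valid component in this row as in every other. -/
lemma exists_valid_of_not_collide {C k : ℕ} {bs : List Bool} {H : List (List ℕ)}
    (hf : failC C k bs = 0) (h : ¬ Collide k H) :
    ∃ e < k * C, bs.getD e false = true ∧
      H.Pairwise fun a b => ¬ (QDS.used C e a ∧ QDS.used C e b) := by
  induction k generalizing bs H with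
  | zero => exact absurd trivial h
  | succ k ih =>
    rw [failC, Nat.add_eq_zero_iff] at hf
    rw [Collide, not_and_or, not_not] at h
    rcases h with h | h
    · have hc : true ∈ bs.take C := by
        rw [← List.count_pos_iff]
        by_contra h0
        rw [if_pos (by omega)] at hf
        omega
      obtain ⟨e, he, hbe⟩ := List.mem_iff_getElem.1 hc
      have he' := he
      rw [List.length_take, lt_min_iff] at he'
      refine ⟨e, by rw [Nat.succ_mul]; omega, ?_, ?_⟩
      · rw [List.getElem_take] at hbe
        rw [List.getD_eq_getElem _ _ he'.2, hbe]
      · rw [List.Nodup, List.pairwise_map] at h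
        refine h.imp fun {a b} hab hu => hab ?_
        simp only [QDS.used, Nat.div_eq_of_lt he'.1] at hu
        rw [List.head?_eq_getElem?, List.head?_eq_getElem?, hu.1, hu.2]
    · obtain ⟨e, he, hbe, hp⟩ := ih hf.2 h
      -- The position was found in the table without its first row.
      refine ⟨e + C, by rw [Nat.succ_mul]; omega, ?_, ?_⟩
      · rw [← hbe, List.getD_eq_getElem?_getD, List.getD_eq_getElem?_getD, List.getElem?_drop,
          add_comm]
      · have hC : 0 < C := Nat.pos_of_ne_zero (by rintro rfl; simp at he)
        rw [List.pairwise_map] at hp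
        refine hp.imp fun {a b} hab hu => hab ?_
        simpa only [QDS.used, Nat.add_div_right _ hC, Nat.add_mod_right, List.getElem?_tail] using hu

/-- `k` is the number of the query that used `e`. If there is none, 0 serves, even for an empty
history; this is the reason for the maximum. -/
lemma exists_onlyAt {C e : ℕ} {h : Hist}
    (hp : (h.map Prod.snd).Pairwise fun a b => ¬ (QDS.used C e a ∧ QDS.used C e b)) :
    ∃ k < max 1 h.length, OnlyAt C e k h := by
  induction h with
  | nil => exact ⟨0, by simp, fun p m us s hs => by simp at hs⟩
  | cons x h ih =>
    rw [List.map_cons, List.pairwise_cons] at hp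
    by_cases hx : QDS.used C e x.2
    · refine ⟨h.length, by simp, fun p m us s hs hu => ?_⟩
      rcases p with _ | ⟨y, p⟩
      · rw [List.nil_append, List.cons.injEq] at hs
        exact hu.1 (by rw [hs.2])
      · rw [List.cons_append, List.cons.injEq] at hs
        exact hp.1 us (by rw [hs.2]; simp) ⟨hx, hu.2⟩
    · obtain ⟨k, hk, ho⟩ := ih hp.2
      refine ⟨k, by simp at hk ⊢; omega, fun p m us s hs hu => ?_⟩
      rcases p with _ | ⟨y, p⟩
      · rw [List.nil_append, List.cons.injEq] at hs
        exact hx (by rw [hs.1]; exact hu.2)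
      · rw [List.cons_append, List.cons.injEq] at hs
        exact ho p m us s hs.2 hu

section

open Classical in
/-- The game is won. -/
def winR (M : Set (List Bool)) (C R : ℕ) (h : Hist) (m : List Bool) (bs : List Bool) : ℝ :=
  if Wins M (h.map Prod.fst, m, decide (failC C R bs = 0)) then 1 else 0

open Classical in
def collR (R : ℕ) (h : Hist) : ℝ := if Collide R (h.map Prod.snd) then 1 else 0

/-- The game is won and the position `e` helps in the reduction. -/
def Hits (M : Set (List Bool)) (C e k : ℕ) (h : Hist) (m : List Bool) : Prop :=
  ((∀ m ∈ h.map Prod.fst, m ∈ M) ∧ m ∈ M ∧ m ∉ h.map Prod.fst) ∧ OnlyAt C e k h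

open Classical in
def hitR (M : Set (List Bool)) (C e k : ℕ) (h : Hist) (m : List Bool) (b : Bool) : ℝ :=
  if Hits M C e k h m ∧ b = true then 1 else 0

/-- If some row has no collision, a win is counted by the term of at least one guess (e, k); all
other terms are nonnegative. -/
lemma winR_le (M : Set (List Bool)) {C R q : ℕ} (hq : 1 ≤ q) {h : Hist} (hh : h.length = q)
    (m : List Bool) (bs : List Bool) : winR M C R h m bs ≤ collR R h +
      ∑ i ∈ range (R * C) ×ˢ range q, hitR M C i.1 i.2 h m (bs.getD i.1 false) := by
  have h0 : ∀ i ∈ range (R * C) ×ˢ range q,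
      0 ≤ hitR M C i.1 i.2 h m (bs.getD i.1 false) := fun i _ => by
    rw [hitR]; split_ifs <;> norm_num
  have hs := Finset.sum_nonneg h0
  by_cases hw : Wins M (h.map Prod.fst, m, decide (failC C R bs = 0))
  · rw [winR, if_pos hw]
    by_cases hc : Collide R (h.map Prod.snd)
    · rw [collR, if_pos hc]
      linarith
    · obtain ⟨e, he, hb, hp⟩ := exists_valid_of_not_collide (of_decide_eq_true hw.2.2.2) hc
      obtain ⟨k, hk, ho⟩ := exists_onlyAt hp
      have := Finset.single_le_sum h0 (a := (e, k)) (by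
        rw [Finset.mem_product, Finset.mem_range, Finset.mem_range]
        exact ⟨he, by omega⟩)
      rw [hitR, if_pos ⟨⟨⟨hw.1, hw.2.1, hw.2.2.1⟩, ho⟩, hb⟩] at this
      rw [collR, if_neg hc]
      linarith
  · rw [winR, if_neg hw, collR]
    split_ifs <;> linarith

end

/-! ### The probability of collisions -/

section

variable {α β : Type}

lemma acc_unifT {z : ℕ} {f : ℕ → Tree ℝ} {n : ℕ} (hf : ∀ u, Supp (range n) (f u)) {m : ℕ}
    (hm : n ≤ m) {ψ : Ket} (hψ : Below m ψ) :
    acc (unifT z >>= f) m ψ = (∑ u ∈ range (2 ^ z), acc (f u) m ψ) / 2 ^ z := by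
  induction z generalizing f with
  | zero => simp [unifT]
  | succ z ih =>
    rw [unifT, bind_assoc]
    simp only [bind_assoc, pure_bind]
    rw [ih fun u => (supp_coin.range_of_closed n).bind fun π hπ b => hf _ π hπ]
    have e : ∀ u, acc (coin >>= fun b => f (2 * u + b.toNat)) m ψ =
        (acc (f (2 * u)) m ψ + acc (f (2 * u + 1)) m ψ) / 2 := fun u =>
      acc_coin (f := fun b => f (2 * u + b.toNat)) (fun b => hf _) hm hψ
    -- The sum is grouped by all binary digits but the last.
    have e' : ∀ k, ∑ u ∈ range (2 * k), acc (f u) m ψ =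
        ∑ u ∈ range k, (acc (f (2 * u)) m ψ + acc (f (2 * u + 1)) m ψ) := by
      intro k
      induction k with
      | zero => rfl
      | succ k ih => rw [Nat.mul_succ, Finset.sum_range_succ, Finset.sum_range_succ,
          Finset.sum_range_succ, ih, add_assoc]
    rw [pow_succ' (2 : ℕ), e']
    simp only [e, ← Finset.sum_div]
    rw [pow_succ']
    field_simp

lemma AccLe.bind_const [Ren α] {n : ℕ} {t : Tree α} {f : α → Tree ℝ} {x : ℝ}
    (ht : Supp (range n) t)
    (h : ∀ m, n ≤ m → ∀ a, Supp (range m) a → AccLe m (f a) (.ret x)) :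
    AccLe n (t >>= f) (.ret x) :=
  (AccLe.bind ht h).trans fun m _ ψ _ => (acc_bind_ret_const t x m ψ).le

lemma accLe_ret {x y : ℝ} (h : x ≤ y) (n : ℕ) : AccLe n (.ret x) (.ret y) := fun _ _ ψ _ =>
  mul_le_mul_of_nonneg_right h (nsq_nonneg ψ)

open Classical in
/-- A bound for the probability that a row with the selected columns `L` collides after `j` more
queries. -/
def rowBound (Q C j : ℕ) (L : List (Option ℕ)) : ℝ := if L.Nodup then j * Q / C else 1

def collBound (Q C j : ℕ) : ℕ → List (List ℕ) → ℝ
  | 0, _ => 1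
  | k + 1, H => rowBound Q C j (H.map List.head?) * collBound Q C j k (H.map List.tail)

lemma rowBound_nonneg (Q C j : ℕ) (L : List (Option ℕ)) : 0 ≤ rowBound Q C j L := by
  rw [rowBound]; split_ifs <;> positivity

lemma collBound_nonneg (Q C j k : ℕ) (H : List (List ℕ)) : 0 ≤ collBound Q C j k H := by
  induction k generalizing H with
  | zero => exact zero_le_one
  | succ k ih => exact mul_nonneg (rowBound_nonneg _ _ _ _) (ih _)

lemma collR_le (Q C R : ℕ) (h : Hist) : collR R h ≤ collBound Q C 0 R (h.map Prod.snd) := by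
  rw [collR]
  split_ifs with hc
  · refine le_of_eq ?_
    generalize h.map Prod.snd = H at hc
    induction R generalizing H with
    | zero => rfl
    | succ R ih => rw [collBound, rowBound, if_neg hc.1, one_mul, ← ih _ hc.2]
  · exact collBound_nonneg _ _ _ _ _

lemma collBound_nil (Q C k : ℕ) : collBound Q C Q k [] = (Q * Q / C : ℝ) ^ k := by
  induction k with
  | zero => simp [collBound]
  | succ k ih =>
    rw [collBound, List.map_nil, List.map_nil, ih, rowBound, if_pos List.nodup_nil, pow_succ']

/-- A new uniform column meets one of the at most `Q` columns already used with probability at most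
Q / C; each of the `j` queries still to come contributes the same amount. -/
lemma sum_rowBound_le {Q C j : ℕ} (hC : 0 < C) {L : List (Option ℕ)} (hL : L.length ≤ Q) :
    ∑ u ∈ range C, rowBound Q C j (some u :: L) ≤ C * rowBound Q C (j + 1) L := by
  classical
  have hC' : (0 : ℝ) < C := by exact_mod_cast hC
  by_cases h : L.Nodup
  · have h1 : ∀ u ∈ range C, rowBound Q C j (some u :: L) ≤
        (if some u ∈ L then 1 else 0) + j * Q / C := fun u _ => by
      have : (0 : ℝ) ≤ j * Q / C := by positivity
      by_cases hu : some u ∈ L <;> simp [rowBound, List.nodup_cons, hu, h, this]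
    have h2 : ∑ u ∈ range C, (if some u ∈ L then 1 else 0 : ℝ) ≤ L.length := by
      rw [Finset.sum_boole]
      have : ((range C).filter fun u => some u ∈ L).card ≤ L.length := by
        rw [← Finset.card_image_of_injective _ (Option.some_injective ℕ)]
        refine (Finset.card_le_card fun x hx => ?_).trans L.toFinset_card_le
        obtain ⟨u, hu, rfl⟩ := Finset.mem_image.1 hx
        exact List.mem_toFinset.2 (Finset.mem_filter.1 hu).2
      exact_mod_cast this
    have h3 : (L.length : ℝ) ≤ Q := by exact_mod_cast hL
    refine (Finset.sum_le_sum h1).trans ?_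
    rw [Finset.sum_add_distrib, Finset.sum_const, Finset.card_range, rowBound, if_pos h,
      nsmul_eq_mul, mul_div_cancel₀ _ hC'.ne', mul_div_cancel₀ _ hC'.ne']
    push_cast
    linarith
  · refine (Finset.sum_le_sum (g := fun _ => (1 : ℝ)) fun u _ => ?_).trans ?_
    · rw [rowBound, if_neg fun h' => h (List.nodup_cons.1 h').2]
    · rw [rowBound, if_neg h]
      simp

/-- A supermartingale property: averaged over the columns of one query, the bound after the query is
at most the bound before it. The rows are drawn independently, so the product can be treated one
factor at a time. -/
lemma selT_collBound {Q z j : ℕ} (k : ℕ) {H : List (List ℕ)} (hH : H.length ≤ Q) (n : ℕ) :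
    AccLe n (selT z k >>= fun us => .ret (collBound Q (2 ^ z) j k (us :: H)))
      (.ret (collBound Q (2 ^ z) (j + 1) k H)) := by
  induction k generalizing H n with
  | zero => exact AccLe.refl _ _
  | succ k ih =>
    simp only [selT, bind_assoc, pure_bind, collBound, List.map_cons, List.head?_cons,
      List.tail_cons]
    set L := H.map List.head?
    set w := fun us => collBound Q (2 ^ z) j k (us :: H.map List.tail)
    -- The column of the first row is averaged out with the other rows fixed; its factor then no
    -- longer depends on the choice and can be taken out.
    have h1 : AccLe n (selT z k >>= fun us => unifT z >>= fun u =>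
        .ret (rowBound Q (2 ^ z) j (some u :: L) * w us))
        (selT z k >>= fun us => .ret (w us) >>= fun x =>
          .ret (rowBound Q (2 ^ z) (j + 1) L * x)) := by
      refine AccLe.bind ((supp_selT z k).range_of_closed n) fun m hm us _ l hl ψ hψ => ?_
      rw [acc_unifT (n := 0) (fun u => Supp.of_ren fun π => rfl) (Nat.zero_le _) hψ]
      simp only [acc, Tree.ret_bind]
      rw [← Finset.sum_mul, ← Finset.sum_mul, div_le_iff₀ (by positivity)]
      have := mul_le_mul_of_nonneg_right (sum_rowBound_le (j := j) (Nat.two_pow_pos z)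
        (L := L) (Q := Q) (by simpa [L] using hH)) (mul_nonneg (collBound_nonneg Q (2 ^ z) j k
          (us :: H.map List.tail)) (nsq_nonneg ψ))
      push_cast at this
      calc _ = _ := by rw [mul_assoc]
        _ ≤ _ := this
        _ = _ := by simp only [w]; ring
    refine h1.trans fun m hm ψ hψ => ?_
    rw [← bind_assoc, acc_bind_mul, acc, mul_assoc]
    exact mul_le_mul_of_nonneg_left (ih (by simpa using hH) n m hm ψ hψ) (rowBound_nonneg _ _ _ _)

end

namespace QDS

section

variable (S : QDS) (n : ℕ)

/-- The columns of a query are drawn independently of all that happened before, so `selT_collBound`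
applies query by query, whatever the adversary does. -/
lemma queriesT_collBound {z R Q : ℕ} {l : List (List Bool)} {A : Prog} {F : Hist → Mem → Tree ℝ}
    (hF : ∀ h N μ, AccLe N (F h μ) (.ret (collR R h))) (j : ℕ) {h : Hist} (hj : h.length + j ≤ Q)
    {N : ℕ} {μ : Mem} (hμ : Supp (range N) μ) :
    AccLe N (queriesT (fun _ => S.stepT n z R l) A F j h μ)
      (.ret (collBound Q (2 ^ z) j R (h.map Prod.snd))) := by
  induction j generalizing h μ N with
  | zero => exact (hF h N μ).trans (accLe_ret (collR_le _ _ _ _) _)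
  | succ j ih =>
    simp only [queriesT, stepT, bind_assoc, pure_bind]
    refine AccLe.trans (AccLe.bind ((supp_selT z R).range_of_closed N) fun m hm us _ => ?_)
      (selT_collBound R (by rw [List.length_map]; omega) N)
    refine AccLe.bind_const ((S.supp_sigsT n _ _ l).range_of_closed m) fun m' hm' r _ =>
      AccLe.bind_const (((hμ.mono (range_mono (hm.trans hm'))).update_ofBits _ _).runT A)
        fun k _ μ' hμ' => ih (h := (toBits (μ outReg), us) :: h) (by rw [List.length_cons]; omega) hμ'

lemma supp_init {N : ℕ} {pks : List Str} (h : Supp (range N) pks) :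
    Supp (range N) (update (load [unary n]) inReg (pks.flatMap frame) : Mem) :=
  fun π hπ => by
    rw [ren_update, ren_load, ren_flatMap_frame, h π hπ, ren_cons, unary, ren_ofBits, ren_nil]

lemma ren_advT {β : Type} [Ren β] {π : Perm ℕ} {st : ℕ → List Bool →
    Tree (List ℕ × List Slot)} {A : Prog} {F F' : Hist → Mem → Tree β}
    (hst : ∀ j m, Supp ∅ (st j m)) (hF : ∀ h μ, ren π (F h μ) = F' h (ren π μ)) (q : ℕ)
    (pks : List Str) : ren π (advT n st A F q pks) = advT n st A F' q (ren π pks) := by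
  refine Tree.ren_bind_eq ?_ fun μ => ren_queriesT hst hF _ _ _
  rw [ren_runT, ren_update, ren_load, ren_flatMap_frame, ren_cons, unary, ren_ofBits, ren_nil]

/-- At the start no column has been selected, and each row contributes a factor q² / 2^z, which is
at most 1/2. -/
lemma coreT_coll {z R q t : ℕ} {A : Prog} (hq : 2 * (q * q) ≤ 2 ^ z) (N : ℕ) :
    AccLe N (S.coreT n z R A t q >>= fun o => .ret (collR R o.1)) (.ret ((1 / 2) ^ R)) := by
  simp only [coreT, advT, bind_assoc, pure_bind, queriesT_bind]
  refine AccLe.bind_const ((supp_repeatedT (S.supp_keyT n) _).range_of_closed N) fun N1 h1 l _ =>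
    AccLe.bind_const ((supp_repeatedT (S.supp_framesT n l) _).range_of_closed N1) fun N2 h2 pks hp =>
    AccLe.bind_const ((supp_init n hp).runT A) fun N3 h3 μ hμ =>
    (S.queriesT_collBound n (Q := q) (fun h K μ m _ ψ _ => (acc_bind_ret_const _ _ m ψ).le) q
      (by simp) hμ).trans (accLe_ret ?_ N3)
  rw [List.map_nil, collBound_nil]
  refine pow_le_pow_left₀ (by positivity) ?_ R
  have : (2 * (q * q) : ℝ) ≤ 2 ^ z := by exact_mod_cast hq
  push_cast
  rw [div_le_div_iff₀ (by positivity) (by norm_num)]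
  linarith

end

end QDS

namespace QDS

section

variable (S : QDS) (n : ℕ)

/-! ### The game with one unknown key -/

/-- A table of secret keys without the entry number `e`. -/
def tabT (N e : ℕ) : Tree (List (List Bool) × List (List Bool)) :=
  repeatedT (S.keyT n) e >>= fun l1 => repeatedT (S.keyT n) (N - 1 - e) >>= fun l2 => pure (l1, l2)

lemma supp_tabT (N e : ℕ) : Supp ∅ (S.tabT n N e) :=
  (supp_repeatedT (S.supp_keyT n) e).closed_bind fun π l1 =>
    Tree.ren_bind_closed (supp_repeatedT (S.supp_keyT n) _) fun l2 => rfl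

lemma ev_repeatedT {α : Type} (c : Tree α) (k : ℕ) :
    (repeatedT c k).Ev fun l => l.length = k := by
  induction k with
  | zero => exact rfl
  | succ k ih =>
    exact (Tree.ev_true c).bind fun a _ => ih.bind fun r hr => by
      show (a :: r).length = k + 1
      rw [List.length_cons, hr]

lemma ev_tabT (N e : ℕ) : (S.tabT n N e).Ev fun p => p.1.length = e :=
  (ev_repeatedT _ e).bind fun l1 h1 => (Tree.ev_true _).bind fun l2 _ => h1

lemma repeatedT_add {α : Type} (c : Tree α) (k l : ℕ) : repeatedT c (k + l) =
    repeatedT c k >>= fun a => repeatedT c l >>= fun b => pure (a ++ b) := by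
  induction k with
  | zero =>
    rw [Nat.zero_add]
    exact (bind_pure _).symm
  | succ k ih =>
    simp only [Nat.succ_add, repeatedT_succ, ih, bind_assoc, pure_bind, List.cons_append]

/-- The table can be completed by any key. -/
lemma repeatedT_keyT {N e : ℕ} (he : e < N) {f : List (List Bool) → Tree ℝ}
    (hf : ∀ l, Supp ∅ (f l)) (m : ℕ) : AccEq m (repeatedT (S.keyT n) N >>= f)
      (S.keyT n >>= fun sk => S.tabT n N e >>= fun p => f (p.1 ++ sk :: p.2)) := by
  obtain ⟨k, rfl⟩ := Nat.exists_eq_add_of_lt he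
  rw [add_assoc, repeatedT_add, repeatedT_succ]
  simp only [tabT, bind_assoc, pure_bind, show e + (k + 1) - 1 - e = k by omega]
  refine (AccEq.swap (S.supp_keyT n)
    ((supp_repeatedT (S.supp_keyT n) e).range_of_closed m) fun π _ sk l1 => ?_).symm
  rw [ren_eq π sk, ren_eq π l1]
  exact Tree.ren_bind_closed (supp_repeatedT (S.supp_keyT n) _) fun l2 => by
    rw [ren_eq π l2, hf _ π (by simp)]

lemma framesT_split (l1 l2 : List (List Bool)) (sk : List Bool) {N : ℕ}
    {f : Str → Tree ℝ} (hf : ∀ π : Perm ℕ, (∀ i < N, π i = i) →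
      ∀ a, ren π (f a) = f (ren π a)) :
    AccEq N (S.framesT n (l1 ++ sk :: l2) >>= f)
      (S.pkT n sk >>= fun y => S.extT n l1 l2 y >>= f) := by
  simp only [framesT_append, framesT, extT, bind_assoc, pure_bind]
  refine AccEq.swap (S.supp_framesT n l1) ((S.supp_pkT n sk).range_of_closed N)
    fun π hπ a y => Tree.ren_bind_closed (S.supp_framesT n l2) fun r => ?_
  rw [hf π hπ, ren_append, ren_append, ren_frame]

/-- The public keys of the table are extensions of those of one key. -/
lemma repeatedT_framesT (l1 l2 : List (List Bool)) (sk : List Bool) (t : ℕ) {N : ℕ}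
    {f : List Str → Tree ℝ} (hf : ∀ π : Perm ℕ, (∀ i < N, π i = i) →
      ∀ a, ren π (f a) = f (ren π a)) :
    AccEq N (repeatedT (S.framesT n (l1 ++ sk :: l2)) t >>= f)
      (repeatedT (S.pkT n sk) t >>= fun xs => mapT (S.extT n l1 l2) xs >>= f) := by
  have hrep : ∀ (π : Perm ℕ) xs, ren π (mapT (S.extT n l1 l2) xs) =
      mapT (S.extT n l1 l2) (ren π xs) := fun π => ren_mapT fun a => S.ren_extT n π _ _ a
  induction t generalizing N f with
  | zero => exact AccEq.refl _ _
  | succ t ih =>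
    simp only [repeatedT_succ, bind_assoc, pure_bind, mapT]
    refine (S.framesT_split n l1 l2 sk fun π hπ b => ?_).trans
      (AccEq.bind ((S.supp_pkT n sk).range_of_closed N) fun m hm y hy => ?_)
    · exact Tree.ren_bind_closed (supp_repeatedT (S.supp_framesT n _) t) fun r => hf π hπ _
    · have hy' : Supp (range m) (S.extT n l1 l2 y) := fun π hπ => by
        rw [ren_extT, hy π hπ]
      -- Induction treats the remaining public keys; then the extension of `y` is moved behind the
      -- generation of all other keys of the challenger.
      refine (AccEq.bind hy' fun m' hm' b hb => ih (N := m') fun π hπ r => ?_).trans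
        (AccEq.swap (supp_repeatedT (S.supp_pkT n sk) t) hy' fun π hπ xs b => ?_).symm
      · rw [hf π fun i hi => hπ i (by omega), ren_cons,
          hb π fun i hi => hπ i (Finset.mem_range.1 hi)]
      · exact Tree.ren_bind_eq (hrep π xs) fun r => hf π (fun i hi => hπ i (by omega)) _

/-- What the reduction does for the position `e` and the query number `k`; the result consists of
the message for the challenger, the message of the forgery, and the verdict of the challenger. -/
def redT (z R : ℕ) (A : Prog) (q e k : ℕ) (sk : List Bool) (xs : List Str)
    (x : Str) : Tree (List (List Bool) × List Bool × Bool) :=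
  S.tabT n (R * 2 ^ z) e >>= fun p => mapT (S.extT n p.1 p.2) xs >>= fun pks =>
    advT n (fun _ => S.simStepT n z R p.1 p.2 []) A (fun h μ =>
      S.sigT n sk (toBits (μ outReg)) >>= fun σ =>
      queriesT (fun j => S.simStepT n z R p.1 p.2 (if j = k then σ else [])) A (fun _ μ' =>
        S.compT n (toBits (μ' outReg)) x (slotAt e (ofBits (toBits (μ' sigReg)))) >>= fun b =>
          pure ([toBits (μ outReg)], toBits (μ' outReg), b)) (q - k) h μ) (min k q) pks

open Classical in
/-- The reward of the one-time game. -/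
def oneR (M : Set (List Bool)) (r : List (List Bool) × List Bool × Bool) : ℝ :=
  if Wins M r then 1 else 0

variable {S n}

lemma hitR_zero {M : Set (List Bool)} {C e k : ℕ} {h : Hist} (hh : ¬ OnlyAt C e k h)
    (m : List Bool) (b : Bool) : hitR M C e k h m b = 0 := by
  rw [hitR, if_neg fun h' => hh h'.1.2]

/-- The message of the forgery differs from all queried messages, in particular from the only one
that reached the challenger. -/
lemma hitR_le_oneR {M : Set (List Bool)} {C e k : ℕ} {p s : Hist} {m : List Bool} {us : List ℕ}
    (m' : List Bool) (b : Bool) :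
    hitR M C e k (p ++ (m, us) :: s) m' b ≤ oneR M ([m], m', b) := by
  rw [hitR, oneR]
  split_ifs with h1 h2
  · exact le_rfl
  · refine absurd ⟨?_, h1.1.1.2.1, ?_, h1.2⟩ h2
    · intro m1 hm1
      rw [List.mem_singleton.1 hm1]
      exact h1.1.1.1 m (by simp)
    · intro hm
      exact h1.1.1.2.2 (by simp [show m' = m from List.mem_singleton.1 hm])
  · norm_num
  · exact le_rfl

section

variable {z R : ℕ} {A : Prog} {l1 l2 : List (List Bool)} {sk : List Bool}

/-- From the hybrid game to the one-time game. -/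
lemma hybridT_le_oneR {M : Set (List Bool)} {C e k q : ℕ} (hk : k < q) {x : Str} {N : ℕ}
    {μ : Mem} (hμ : Supp (range N) μ) (hx : Supp (range N) x) :
    AccLe N (queriesT (S.hybridT n z R l1 l2 sk k) A (fun h μ =>
        S.compT n (toBits (μ outReg)) x (slotAt e (ofBits (toBits (μ sigReg)))) >>= fun b =>
          .ret (hitR M C e k h (toBits (μ outReg)) b)) q [] μ)
      (queriesT (fun _ => S.simStepT n z R l1 l2 []) A (fun h μ =>
        S.sigT n sk (toBits (μ outReg)) >>= fun σ =>
        queriesT (fun j => S.simStepT n z R l1 l2 (if j = k then σ else [])) A (fun _ μ' =>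
          S.compT n (toBits (μ' outReg)) x (slotAt e (ofBits (toBits (μ' sigReg)))) >>= fun b =>
            .ret (oneR M ([toBits (μ outReg)], toBits (μ' outReg), b))) (q - k) h μ) k [] μ) := by
  -- The queries split into `k` before the critical one, the critical one, and `r` after it.
  obtain ⟨r, rfl⟩ := Nat.exists_eq_add_of_lt hk
  rw [add_assoc, queriesT_add, show k + (r + 1) - k = r + 1 by omega,
    queriesT_congr (st' := fun _ => S.simStepT n z R l1 l2 []) k [] μ (fun i _ hi => by
      funext m
      rw [hybridT, if_neg (by simp at hi; omega)]) (fun _ _ _ => rfl)]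
  have hle : ∀ {h : Hist} {μ : Mem}, h.length = k → ∀ {K}, N ≤ K → Supp (range K) μ →
      AccLe K (queriesT (S.hybridT n z R l1 l2 sk k) A (fun h μ =>
        S.compT n (toBits (μ outReg)) x (slotAt e (ofBits (toBits (μ sigReg)))) >>= fun b =>
          .ret (hitR M C e k h (toBits (μ outReg)) b)) (r + 1) h μ)
        (S.sigT n sk (toBits (μ outReg)) >>= fun σ =>
        queriesT (fun j => S.simStepT n z R l1 l2 (if j = k then σ else [])) A (fun _ μ' =>
          S.compT n (toBits (μ' outReg)) x (slotAt e (ofBits (toBits (μ' sigReg)))) >>= fun b =>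
            .ret (oneR M ([toBits (μ outReg)], toBits (μ' outReg), b))) (r + 1) h μ) := by
    intro h μ hh K hK hμ
    simp only [queriesT, hh, hybridT, if_true, bind_assoc]
    refine AccLe.bind ((S.supp_sigT n _ _).range_of_closed K) fun K1 h1 σ _ =>
      AccLe.bind ((S.supp_simStepT n σ _).range_of_closed K1) fun K2 h2 w _ =>
      AccLe.bind (((hμ.mono (range_mono (h1.trans h2))).update_ofBits _ _).runT A)
        fun K3 h3 μ' hμ' => ?_
    -- The histories now have more than `k` entries, so neither signing algorithm uses the foreign
    -- signature any more.
    rw [queriesT_congr (st' := fun j => S.simStepT n z R l1 l2 (if j = k then σ else [])) r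
      _ μ' (fun i hi _ => by
        funext m
        simp only [List.length_cons, hh] at hi
        rw [hybridT, if_neg (by omega), if_neg (by omega)]) (fun _ _ _ => rfl)]
    refine queriesT_mono (fun j m => S.supp_simStepT n _ m) r _ hμ' fun p _ K4 h4 ν hν =>
      AccLe.bind (S.supp_compT n _ _ (hx.mono (range_mono (by omega))))
        fun K5 _ b _ => accLe_ret ?_ K5
    rw [← hh]
    exact hitR_le_oneR _ b
  exact queriesT_mono (fun j m => S.supp_simStepT n _ m) k [] hμ fun p hp K hK ν hν =>
    hle (by simpa using hp) hK hν

end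

end

end QDS

/-! ### From the game for the table to the one-time game, for a fixed guess -/

namespace QDS

section

variable (S : QDS) (n : ℕ)

/-- The queries of the reduction, with the reward of the one-time game. -/
def endT (M : Set (List Bool)) (z R : ℕ) (A : Prog) (q e k : ℕ) (sk : List Bool)
    (p : List (List Bool) × List (List Bool)) (x : Str) (μ : Mem) : Tree ℝ :=
  queriesT (fun _ => S.simStepT n z R p.1 p.2 []) A (fun h μ =>
    S.sigT n sk (toBits (μ outReg)) >>= fun σ =>
    queriesT (fun j => S.simStepT n z R p.1 p.2 (if j = k then σ else [])) A (fun _ μ' =>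
      S.compT n (toBits (μ' outReg)) x (slotAt e (ofBits (toBits (μ' sigReg)))) >>= fun b =>
        .ret (oneR M ([toBits (μ outReg)], toBits (μ' outReg), b))) (q - k) h μ) k [] μ

variable {z R : ℕ} {A : Prog} {q e k t : ℕ} {M : Set (List Bool)}

lemma ren_endT (π : Perm ℕ) (sk : List Bool) (p : List (List Bool) × List (List Bool))
    (x : Str) (μ : Mem) : ren π (S.endT n M z R A q e k sk p x μ) =
      S.endT n M z R A q e k sk p (ren π x) (ren π μ) := by
  refine ren_queriesT (fun j m => S.supp_simStepT n _ m) (fun h μ => ?_) _ _ _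
  simp only [ren_mem_apply, toBits_ren]
  refine Tree.ren_bind_closed (S.supp_sigT n _ _) fun σ => ?_
  rw [ren_eq π σ]
  refine ren_queriesT (fun j m => S.supp_simStepT n _ m) (fun h μ => ?_) _ _ _
  simp only [ren_mem_apply, toBits_ren]
  exact Tree.ren_bind_eq (S.ren_compT n π _ _ _) fun b => by
    rw [Tree.ren_ret, ren_eq, ren_eq]

lemma ren_mapT_extT (π : Perm ℕ) (l1 l2 : List (List Bool)) (xs : List Str) :
    ren π (mapT (S.extT n l1 l2) xs) = mapT (S.extT n l1 l2) (ren π xs) :=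
  ren_mapT (fun a => S.ren_extT n π _ _ a) xs

lemma redT_oneR (hk : k < q) (sk : List Bool) (xs : List Str) (x : Str) :
    (S.redT n z R A q e k sk xs x >>= fun r => .ret (oneR M r)) =
      S.tabT n (R * 2 ^ z) e >>= fun p => mapT (S.extT n p.1 p.2) xs >>= fun pks =>
        runT A (update (load [unary n]) inReg (pks.flatMap frame)) >>= fun μ =>
          S.endT n M z R A q e k sk p x μ := by
  simp only [redT, advT, endT, bind_assoc, queriesT_bind, pure_bind, min_eq_left hk.le]

/-- The queries of the game for the table and those of the reduction. -/
lemma queriesT_le_endT (hk : k < q) {p : List (List Bool) × List (List Bool)}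
    (he : p.1.length < R * 2 ^ z) (sk : List Bool) {N : ℕ} {μ : Mem}
    (hμ : Supp (range N) μ) :
    AccLe N (queriesT (fun _ => S.stepT n z R (p.1 ++ sk :: p.2)) A (fun h μ =>
        S.versT n (toBits (μ outReg)) (p.1 ++ sk :: p.2) (ofBits (toBits (μ sigReg))) >>= fun bs =>
          .ret (hitR M (2 ^ z) p.1.length k h (toBits (μ outReg))
            (bs.getD p.1.length false))) q [] μ)
      (S.pkT n sk >>= fun x => S.endT n M z R A q p.1.length k sk p x μ) := by
  have hF : ∀ (π : Perm ℕ) (y : Str) (h : Hist) (μ : Mem),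
      ren π (S.compT n (toBits (μ outReg)) y (slotAt p.1.length (ofBits (toBits (μ sigReg)))) >>=
        fun b => .ret (hitR M (2 ^ z) p.1.length k h (toBits (μ outReg)) b)) =
      (S.compT n (toBits (ren π μ outReg)) (ren π y)
        (slotAt p.1.length (ofBits (toBits (ren π μ sigReg)))) >>=
        fun b => .ret (hitR M (2 ^ z) p.1.length k h (toBits (ren π μ outReg)) b)) := by
    intro π y h μ
    simp only [ren_mem_apply, toBits_ren]
    exact Tree.ren_bind_eq (S.ren_compT n π _ _ _) fun b => by
      rw [Tree.ren_ret, ren_eq, ren_eq]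
  -- Only the verdict at the place of the unknown key enters the reward, so the verification reduces
  -- to this component.
  refine (queriesT_mono (F' := fun h μ => S.pkT n sk >>= fun y => S.compT n (toBits (μ outReg)) y
      (slotAt p.1.length (ofBits (toBits (μ sigReg)))) >>= fun b =>
      .ret (hitR M (2 ^ z) p.1.length k h (toBits (μ outReg)) b))
    (fun j m => S.supp_stepT n _ m) q [] hμ fun h _ K _ ν _ =>
    (S.versT_single n (toBits (ν outReg)) p.1 p.2 sk (ofBits (toBits (ν sigReg)))
      (fun b => hitR M (2 ^ z) p.1.length k (h ++ []) (toBits (ν outReg)) b) K).le).trans ?_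
  -- The signing algorithm is replaced by the hybrid. They differ only if the unknown key is
  -- selected in a query other than `k`, and then `OnlyAt` fails and the reward is zero.
  refine (queriesT_le (bad := fun j us => j ≠ k ∧ used (2 ^ z) p.1.length us)
    (st' := fun j m => S.hybridT n z R p.1 p.2 sk k j m) (fun j m => S.supp_stepT n _ m)
    (fun j m => S.supp_hybridT n sk k j m) ?_ ?_ ?_ q [] hμ).trans ?_
  · intro s m us r hb μ
    refine AccZero.bind fun y => AccZero.bind fun b n ψ => ?_
    rw [hitR_zero fun ho => ho s m us r rfl hb, acc, zero_mul]
  · intro π h μ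
    exact Tree.ren_bind_closed (S.supp_pkT n sk) fun y => hF π y h μ
  · intro j m K G hG h0
    exact S.stepT_le_hybridT n he hG h0
  -- The public key for the verification is moved in front of the queries, as the one-time
  -- challenger prepares it early.
  · refine (queriesT_swap (S.supp_pkT n sk) (fun j m => S.supp_hybridT n sk k j m)
      (F := fun y h μ => S.compT n (toBits (μ outReg)) y
        (slotAt p.1.length (ofBits (toBits (μ sigReg)))) >>= fun b =>
        .ret (hitR M (2 ^ z) p.1.length k h (toBits (μ outReg)) b)) hF q [] hμ).symm.le.trans ?_
    exact AccLe.bind ((S.supp_pkT n sk).range_of_closed N) fun K hK y hy =>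
      hybridT_le_oneR hk (hμ.mono (range_mono hK)) hy

/-- A forgery in the game for the table yields a forgery in the game for one key. -/
lemma coreT_hit_le (he : e < R * 2 ^ z) (hk : k < q) (N : ℕ) :
    AccLe N (S.coreT n z R A t q >>= fun o =>
        .ret (hitR M (2 ^ z) e k o.1 o.2.1 (o.2.2.getD e false)))
      (S.keyT n >>= fun sk => repeatedT (S.pkT n sk) t >>= fun xs => S.pkT n sk >>= fun x =>
        S.redT n z R A q e k sk xs x >>= fun r => .ret (oneR M r)) := by
  simp only [coreT, advT, bind_assoc, pure_bind, queriesT_bind, S.redT_oneR n hk]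
  have hadv : ∀ (l : List (List Bool)) (π : Perm ℕ) (pks : List Str),
      ren π (advT n (fun _ => S.stepT n z R l) A (fun h μ =>
        S.versT n (toBits (μ outReg)) l (ofBits (toBits (μ sigReg))) >>= fun bs =>
          .ret (hitR M (2 ^ z) e k h (toBits (μ outReg)) (bs.getD e false))) q pks) =
      advT n (fun _ => S.stepT n z R l) A (fun h μ =>
        S.versT n (toBits (μ outReg)) l (ofBits (toBits (μ sigReg))) >>= fun bs =>
          .ret (hitR M (2 ^ z) e k h (toBits (μ outReg)) (bs.getD e false))) q (ren π pks) := by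
    refine fun l π pks => ren_advT n (fun j m => S.supp_stepT n l m) (fun h μ => ?_) q pks
    simp only [ren_mem_apply, toBits_ren]
    exact Tree.ren_bind_closed (S.supp_versT n _ _ _) fun bs => by
      rw [Tree.ren_ret, ren_eq, ren_eq]
  simp only [advT] at hadv
  -- The key at position `e` is drawn first; it becomes the key of the challenger.
  refine (S.repeatedT_keyT n he (fun l => (supp_repeatedT (S.supp_framesT n l) t).closed_bind
    (hadv l)) N).le.trans ?_
  refine AccLe.bind ((S.supp_keyT n).range_of_closed N) fun N1 h1 sk _ => ?_
  have hrep := supp_repeatedT (S.supp_pkT n sk) t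
  have hinit : ∀ {K : ℕ} {p : List (List Bool) × List (List Bool)} {xs : List Str},
      Supp (range K) xs → Supp (range K) (mapT (S.extT n p.1 p.2) xs) :=
    fun hxs π hπ => by rw [ren_mapT_extT, hxs π hπ]
  have hrun : ∀ (π : Perm ℕ) (pks : List Str),
      ren π (runT A (update (load [unary n]) inReg (pks.flatMap frame))) =
        runT A (update (load [unary n]) inReg ((ren π pks).flatMap frame)) :=
    fun π pks => by
      rw [ren_runT, ren_update, ren_load, ren_flatMap_frame, ren_cons, unary, ren_ofBits, ren_nil]
  have step1 : AccLe N1 (S.tabT n (R * 2 ^ z) e >>= fun p =>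
        repeatedT (S.framesT n (p.1 ++ sk :: p.2)) t >>= fun pks =>
        advT n (fun _ => S.stepT n z R (p.1 ++ sk :: p.2)) A (fun h μ =>
          S.versT n (toBits (μ outReg)) (p.1 ++ sk :: p.2) (ofBits (toBits (μ sigReg))) >>=
          fun bs => .ret (hitR M (2 ^ z) e k h (toBits (μ outReg)) (bs.getD e false))) q pks)
      (S.tabT n (R * 2 ^ z) e >>= fun p => repeatedT (S.pkT n sk) t >>= fun xs =>
        mapT (S.extT n p.1 p.2) xs >>= fun pks =>
        runT A (update (load [unary n]) inReg (pks.flatMap frame)) >>= fun μ =>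
        S.pkT n sk >>= fun x => S.endT n M z R A q e k sk p x μ) := by
    refine AccLe.bind_of_ev ((S.supp_tabT n _ e).range_of_closed N1) (S.ev_tabT n _ e)
      fun N2 h2 p hp _ => ?_
    subst hp
    refine (S.repeatedT_framesT n p.1 p.2 sk t fun π _ => hadv _ π).le.trans ?_
    exact AccLe.bind (hrep.range_of_closed N2) fun N3 h3 xs hxs =>
      AccLe.bind (hinit hxs) fun N4 h4 pks hpks =>
      AccLe.bind ((supp_init n hpks).runT A) fun N5 h5 μ hμ => S.queriesT_le_endT n hk he sk hμ
  refine step1.trans ?_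
  -- The challenger acts before its adversary, so its `t` public keys go in front of the rest of the
  -- table.
  refine (AccEq.swap (S.supp_tabT n _ e) (hrep.range_of_closed N1) fun π _ p xs => ?_).le.trans ?_
  · rw [ren_eq π p]
    exact Tree.ren_bind_eq (S.ren_mapT_extT n π _ _ xs) fun pks => Tree.ren_bind_eq (hrun π pks)
      fun μ => Tree.ren_bind_closed (S.supp_pkT n sk) fun x => S.ren_endT n π sk p x μ
  refine AccLe.bind (hrep.range_of_closed N1) fun N2 h2 xs hxs => ?_
  -- The last public key also has to precede the table and the first activation of the forger.
  have := (AccEq.swap (n := N2) (S.supp_pkT n sk) (t2 := S.tabT n (R * 2 ^ z) e >>= fun p =>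
      mapT (S.extT n p.1 p.2) xs >>= fun pks =>
      runT A (update (load [unary n]) inReg (pks.flatMap frame)) >>= fun μ => pure (p, μ))
    (f := fun x w => S.endT n M z R A q e k sk w.1 x w.2) ?_ ?_).symm.le
  · simpa only [bind_assoc, pure_bind] using this
  · refine Supp.bind ((S.supp_tabT n _ e).range_of_closed N2) fun π hπ p => ?_
    rw [ren_eq π p]
    refine Tree.ren_bind_eq (by rw [ren_mapT_extT, hxs π hπ]) fun pks =>
      Tree.ren_bind_eq (hrun π pks) fun μ => ?_
    rw [Tree.ren_pure, ren_mk, ren_eq π p]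
  · rintro π - x ⟨p, μ⟩
    rw [ren_endT, ren_mk, ren_eq π p]

variable {S n}

lemma all_repeated {α : Type} (c : Comp α) (k : ℕ) :
    All (fun l => l.length = k) (repeated c k) := by
  induction k with
  | zero => exact All.pure rfl
  | succ k ih =>
    exact (All.true c).bind fun a _ => ih.bind fun l hl => All.pure (by rw [List.length_cons, hl])

/-- The game for the table scheme. -/
lemma prob_experiment_table (hS : S.Efficient) (cs : List ℕ) :
    prob ((S.table cs).experiment A n t q) (Wins M) =
      acc (S.coreT n (size (evalL cs n)) (rows n) A t q >>= fun o =>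
        .ret (winR M (cols cs n) (rows n) o.1 o.2.1 o.2.2)) 0 (single ∅ 1) := by
  classical
  -- The game as it is defined, with the public key for the verification generated before the
  -- adversary is activated.
  have h1 : (S.table cs).experiment A n t q = interp
      (repeatedT (S.keyT n) (tsize cs n) >>= fun l => repeatedT (S.framesT n l) t >>= fun pks =>
        S.framesT n l >>= fun pk =>
        advT n (fun _ => S.stepT n (size (evalL cs n)) (rows n) l) A (fun h μ =>
          (fun (ms : List (List Bool)) (μ : Mem) =>
            S.compsT n (toBits (μ outReg)) (tsize cs n) pk (ofBits (toBits (μ sigReg))) >>=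
            fun bs => pure (ms.reverse, toBits (μ outReg),
              decide (failC (cols cs n) (rows n) bs = 0))) (h.map Prod.fst) μ) q pks) := by
    rw [experiment, table_SKGen hS, bind_assoc, interp_bind]
    rw [interp_repeatedT]
    refine (all_repeated _ _).bind_congr fun l hl => ?_
    simp only [pure_bind, table_PKGen hS, interp_bind, interp_repeatedT, advT, table_Ver hS,
      interp_runT]
    congr 1; funext pks; congr 1; funext pk
    simp only [activate, run, map_eq_pure_bind, bind_assoc, pure_bind]
    congr 1; funext o
    have := interp_queriesT (A := A) (F := fun (ms : List (List Bool)) (μ : Mem) =>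
        S.compsT n (toBits (μ outReg)) (tsize cs n) pk (ofBits (toBits (μ sigReg))) >>= fun bs =>
          pure (ms.reverse, toBits (μ outReg), decide (failC (cols cs n) (rows n) bs = 0)))
      (fun _ m => (table_Sign hS hl m).symm) q [] o.1
    refine Eq.trans ?_ this.symm
    simp only [interp_bind, interp_pure, List.map_nil, List.reverse_nil, List.nil_append,
      List.reverse_append, List.reverse_reverse]
  rw [h1, prob_interp]
  simp only [coreT, advT, bind_assoc, queriesT_bind, pure_bind]
  have hB : Below 0 (single ∅ 1 : Ket) := fun s hs i hi => by
    have := Finsupp.support_single_subset hs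
    rw [Finset.mem_singleton.1 this] at hi
    simp at hi
  refine AccEq.bind_of_ev (Supp.range_of_closed (supp_repeatedT (S.supp_keyT n) _) 0)
    (ev_repeatedT _ _) (fun N1 h1 l hl _ => ?_) 0 le_rfl _ hB
  refine AccEq.bind (Supp.range_of_closed (supp_repeatedT (S.supp_framesT n l) t) N1)
    fun N2 h2 pks hpks => ?_
  have hF : ∀ (π : Perm ℕ) pk (h : Hist) (μ : Mem),
      ren π (S.compsT n (toBits (μ outReg)) (tsize cs n) pk (ofBits (toBits (μ sigReg))) >>= fun bs =>
        Tree.ret (if Wins M ((h.map Prod.fst).reverse, toBits (μ outReg),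
          decide (failC (cols cs n) (rows n) bs = 0)) then 1 else 0 : ℝ)) =
      (S.compsT n (toBits (ren π μ outReg)) (tsize cs n) (ren π pk)
        (ofBits (toBits (ren π μ sigReg))) >>= fun bs =>
        Tree.ret (if Wins M ((h.map Prod.fst).reverse, toBits (ren π μ outReg),
          decide (failC (cols cs n) (rows n) bs = 0)) then 1 else 0 : ℝ)) := by
    intro π pk h μ
    simp only [ren_mem_apply, toBits_ren]
    exact Tree.ren_bind_eq (S.ren_compsT n π _ _ _ _) fun bs => by
      rw [Tree.ren_ret, ren_eq, ren_eq]
  -- This public key is now moved past the first activation and past all queries, and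
  -- `framesT_compsT` then splits it among the components.
  refine (AccEq.swap (S.supp_framesT n l) ((supp_init n hpks).runT A) fun π _ pk μ =>
    ren_queriesT (fun j m => S.supp_stepT n l m) (hF π pk) q [] μ).trans
    (AccEq.bind ((supp_init n hpks).runT A) fun N3 h3 μ hμ =>
    (queriesT_swap (S.supp_framesT n l) (fun j m => S.supp_stepT n l m) hF q [] hμ).trans ?_)
  have key : ∀ (h : Hist) (ν : Mem) K, AccEq K (S.framesT n l >>= fun pk =>
      S.compsT n (toBits (ν outReg)) (tsize cs n) pk (ofBits (toBits (ν sigReg))) >>= fun bs =>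
        Tree.ret (if Wins M ((h.map Prod.fst).reverse, toBits (ν outReg),
          decide (failC (cols cs n) (rows n) bs = 0)) then 1 else 0 : ℝ))
      (S.versT n (toBits (ν outReg)) l (ofBits (toBits (ν sigReg))) >>= fun bs =>
        .ret (winR M (cols cs n) (rows n) h (toBits (ν outReg)) bs)) := by
    intro h ν K
    have := S.framesT_compsT n (toBits (ν outReg)) l (ofBits (toBits (ν sigReg)))
      (fun bs => winR M (cols cs n) (rows n) h (toBits (ν outReg)) bs) K
    rw [hl] at this
    simp only [winR] at this ⊢
    -- `Wins` asks only for membership in the list of queried messages, so its order is irrelevant.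
    simpa [Wins] using this
  exact (queriesT_mono (fun j m => S.supp_stepT n l m) q [] hμ fun p _ K _ ν _ =>
    (key _ ν K).le).antisymm (queriesT_mono (fun j m => S.supp_stepT n l m) q [] hμ
      fun p _ K _ ν _ => (key _ ν K).symm.le)

end

end QDS

/-! ### The programs of the reduction and the trees that describe them -/

section

variable {α β : Type}

open Classical in
/-- The probability of `E`, for a given start. -/
def mass (c : Comp α) (E : α → Prop) (h : Heap) : ℝ :=
  ((c h).map fun o => if E o.1 then o.2.weight else 0).sum

/-- Monotonicity under a common prefix at the level of branches, for comparisons that involve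
programs with an invariant `p` of their results rather than trees. -/
lemma mass_bind_le {c : Comp α} {p : α → Prop} {f g : α → Comp β} {E : β → Prop} (hc : All p c)
    (hfg : ∀ a, p a → ∀ h, mass (f a) E h ≤ mass (g a) E h) (h : Heap) :
    mass (c >>= f) E h ≤ mass (c >>= g) E h := by
  simp only [mass, comp_bind_apply] at hfg ⊢
  have := hc h
  generalize c h = l at this
  induction l with
  | nil => exact le_rfl
  | cons o l ih =>
    simp only [List.flatMap_cons, List.map_append, List.sum_append]
    exact add_le_add (hfg _ (this o List.mem_cons_self) _)
      (ih fun o ho => this o (List.mem_cons_of_mem _ ho))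

lemma mass_nonneg (c : Comp α) (E : α → Prop) (h : Heap) : 0 ≤ mass c E h := by
  refine List.sum_nonneg fun x hx => ?_
  obtain ⟨o, -, rfl⟩ := List.mem_map.1 hx
  split_ifs
  · exact Finsupp.sum_nonneg fun _ _ => by positivity
  · exact le_rfl

lemma mass_pure {a : α} {E : α → Prop} (ha : ¬ E a) (h : Heap) : mass (pure a) E h = 0 := by
  show List.sum [_] = 0
  simp [ha]

lemma activate_bind {A : Prog} {μ : Mem} {x : Str} {c : Comp Mem} {T : ℕ}
    (h : Runs A (update μ inReg x) c T) (f : Mem → Comp β) :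
    (activate A μ x >>= fun o => f o.1) = c >>= f := by
  simp only [← h.run_eq, run, map_eq_pure_bind, bind_assoc, pure_bind, activate]

end

namespace QDS

variable {S : QDS} {n : ℕ} {cs qs cl : List ℕ} {A : Prog} {sk : List Bool}

lemma slotsC_maskOf {N e : ℕ} (he : e < N) : slotsC S.skGen n N (maskOf e) =
    interp (S.tabT n N e) >>= fun p => pure (p.1.map some ++ none :: p.2.map some) := by
  induction e generalizing N with
  | zero =>
    obtain ⟨N, rfl⟩ := Nat.exists_eq_succ_of_ne_zero he.ne'
    simp only [slotsC, slotC, maskOf, topTrue, List.replicate_zero, List.nil_append, if_true,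
      List.tail_cons, slotsC_nil, tabT, interp_bind, interp_pure, bind_assoc, pure_bind,
      Nat.succ_eq_add_one, Nat.add_sub_cancel, Nat.sub_zero, List.map_nil,
      show repeatedT (S.keyT n) 0 = pure [] from rfl]
  | succ e ih =>
    obtain ⟨N, rfl⟩ := Nat.exists_eq_succ_of_ne_zero (Nat.ne_zero_of_lt he)
    have hm : maskOf (e + 1) = .bit false :: maskOf e := rfl
    simp only [hm, slotsC, slotC, topTrue, List.tail_cons, ih (Nat.lt_of_succ_lt_succ he), tabT,
      repeatedT_succ, interp_bind, interp_pure, interp_keyT, SKGen, bind_assoc, pure_bind,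
      List.map_cons, List.cons_append, Bool.false_eq_true, if_false]
    rw [show N + 1 - 1 - (e + 1) = N - 1 - e by omega]

lemma iterM_extendStep {K : Prog} {f : Str → Tree Str}
    (hf : ∀ y, runOn K n [ofBits sk, y] = interp (f y)) (ys : List Str) {c : ℕ}
    (hc : ys.length ≤ c) (acc : Str) :
    iterM (extendStep K n sk) c (ys.flatMap frame, acc) = interp (mapT f ys) >>= fun pks =>
      pure ([], (pks.flatMap frame).reverse ++ acc) := by
  induction c generalizing ys acc with
  | zero =>
    obtain rfl := List.length_eq_zero_iff.1 (Nat.le_zero.1 hc)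
    rfl
  | succ c ih =>
    cases ys with
    | nil =>
      rw [iterM, List.flatMap_nil, extendStep, pure_bind]
      exact ih [] (Nat.zero_le _) acc
    | cons y ys =>
      obtain ⟨d, l, hd⟩ : ∃ d l, (y :: ys).flatMap frame = d :: l :=
        List.exists_cons_of_length_pos (by simp [frame])
      rw [iterM, hd, extendStep, ← hd, List.flatMap_cons, unframe_frame]
      simp only [bind_assoc, pure_bind, hf, mapT, interp_bind, interp_pure,
        ih ys (Nat.le_of_succ_le_succ hc), List.flatMap_cons, List.reverse_append,
        List.append_assoc]

section

variable {l1 l2 : List (List Bool)}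

/-- A table with an empty slot. -/
def holed (l1 l2 : List (List Bool)) : List Bool :=
  encSlots (l1.map some ++ none :: l2.map some)

lemma runOn_signP_holed (hS : S.Efficient) (hl : l1.length + (l2.length + 1) = tsize cs n)
    (m σ : List Bool) : runOn (signP cs S.sign) n [ofBits (holed l1 l2), ofBits m, ofBits σ] =
      interp (S.simStepT n (size (evalL cs n)) (rows n) l1 l2 σ m) >>= fun w =>
        pure (ofBits (encSlots w.2)) := by
  rw [holed, runOn_signP hS.2.2.1 n _ (by simpa using hl)]
  simp only [simStepT, interp_bind, interp_selT, interp_pure, bind_assoc, pure_bind]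
  refine (all_selC _ _).bind_congr fun us hus => ?_
  rw [S.interp_simSigsT _ _ _ _ _ _ (by
    rw [length_flatMap_rowSel hus.2, hus.1]; exact lt_of_lt_of_eq (by omega) hl)]
  rfl

lemma queryC_holed (hS : S.Efficient) (hl : l1.length + (l2.length + 1) = tsize cs n)
    (σ : List Bool) (a : Mem) : queryC (signP cs S.sign) A n (holed l1 l2) σ a =
      interp (S.simStepT n (size (evalL cs n)) (rows n) l1 l2 σ (toBits (a outReg)) >>=
        fun w => runT A (update a inReg (ofBits (encSlots w.2)))) := by
  simp only [queryC, ← outReg.eq_1, runOn_signP_holed hS hl, interp_bind, interp_runT, bind_assoc,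
    pure_bind]

variable {γ : Type}

lemma iterM_firstStep (hS : S.Efficient) (hl : l1.length + (l2.length + 1) = tsize cs n)
    {F : Hist → Mem → Tree γ} {G : ℕ × Mem → Comp γ} (k q : ℕ) (h : Hist) (a : Mem)
    (hF : ∀ h' a, h'.length = h.length + min k q → interp (F h' a) = G (q - k, a)) :
    interp (queriesT (fun _ => S.simStepT n (size (evalL cs n)) (rows n) l1 l2 []) A F
      (min k q) h a) = iterM (firstStep (signP cs S.sign) A n (holed l1 l2)) k (q, a) >>= G := by
  induction k generalizing q h a with
  | zero =>
    rw [Nat.zero_min, queriesT, iterM, pure_bind, hF h a (by simp), Nat.sub_zero]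
  | succ k ih =>
    rw [iterM]
    cases q with
    | zero =>
      have := ih 0 h a fun h' a hh => by rw [hF h' a (by simpa using hh)]; simp
      rw [firstStep, pure_bind, ← this, Nat.min_zero, Nat.min_zero]
    | succ q =>
      rw [firstStep, queryC_holed hS hl, Nat.succ_min_succ, queriesT]
      simp only [interp_bind, bind_assoc, pure_bind]
      congr 1; funext w; congr 1; funext a'
      exact ih q _ a' fun h' a hh => by
        rw [hF h' a (by simp at hh ⊢; omega), Nat.succ_sub_succ]

/-- The register holds `σ` exactly as long as the history has length `k`. This links the program,
which clears the register after one query, to the tree, which compares query numbers. -/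
lemma iterM_restStep (hS : S.Efficient) (hl : l1.length + (l2.length + 1) = tsize cs n)
    {F : Hist → Mem → Tree γ} {G : Mem → Comp γ} (hF : ∀ h a, interp (F h a) = G a)
    (σ : List Bool) (k j : ℕ) (h : Hist) (z : Str × Mem)
    (hj : j = 0 ∨ k ≤ h.length ∧ toBits z.1 = if h.length = k then σ else []) :
    interp (queriesT (fun i => S.simStepT n (size (evalL cs n)) (rows n) l1 l2
      (if i = k then σ else [])) A F j h z.2) =
      iterM (restStep (signP cs S.sign) A n (holed l1 l2)) j z >>= fun z => G z.2 := by
  induction j generalizing h z with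
  | zero => rw [queriesT, iterM, pure_bind, hF]
  | succ j ih =>
    obtain ⟨h1, h2⟩ := hj.resolve_left (Nat.succ_ne_zero j)
    rw [iterM, restStep, queryC_holed hS hl, h2, queriesT]
    simp only [interp_bind, bind_assoc, pure_bind]
    congr 1; funext w; congr 1; funext a'
    exact ih _ ([], a') (Or.inr ⟨by simp; omega, by
      rw [if_neg (by simp; omega)]; rfl⟩)

end

end QDS

/-! ### The reduction as an adversary in the one-time game -/

namespace QDS

section

variable (S : QDS) (n : ℕ) (cs qs cl : List ℕ) (A : Prog)

/-- The reduction for the scheme `S`. -/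
def breaker : Prog := reduction cs qs cl (skGenP cs S.skGen) (pkGenP S.pkGen) (signP cs S.sign) A

/-- The one-time game with the reduction as adversary. -/
def oneT (t : ℕ) : Tree (List (List Bool) × List Bool × Bool) :=
  S.keyT n >>= fun sk => repeatedT (S.pkT n sk) t >>= fun xs => S.pkT n sk >>= fun x =>
    unifT (size n + size (evalL cs n)) >>= fun e => unifT (size (evalL qs n)) >>= fun k =>
      S.redT n (size (evalL cs n)) (rows n) A (evalL qs n) e k sk xs x

/-- The end of the game, after the first activation of the reduction. -/
def tailC (sk : List Bool) (x : Str) (y : ℕ × ℕ × Str × ℕ × Mem) :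
    Comp (List (List Bool) × List Bool × Bool) :=
  S.Sign n sk (toBits (y.2.2.2.2 outReg)) >>= fun σ =>
    iterM (restStep (signP cs S.sign) A n (toBits y.2.2.1)) y.2.2.2.1 (ofBits σ, y.2.2.2.2) >>=
    fun z => interp (S.compT n (toBits (z.2 outReg)) x
      (slotAt y.1 (ofBits (toBits (z.2 sigReg))))) >>= fun b =>
      pure ([toBits (y.2.2.2.2 outReg)], toBits (z.2 outReg), b)

variable {S n cs qs cl A}

lemma runOn_skGenP_maskOf (hS : S.Efficient) {e : ℕ} (he : e < tsize cs n) :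
    runOn (skGenP cs S.skGen) n [maskOf e] = interp (S.tabT n (rows n * cols cs n) e) >>= fun p =>
      pure (ofBits (holed p.1 p.2)) := by
  rw [runOn_skGenP hS.1, slotsC_maskOf he, bind_assoc]
  simp only [pure_bind, holed, tsize]

lemma runOn_pkGenP_holed (hS : S.Efficient) (l1 l2 : List (List Bool)) (y : Str) :
    runOn (pkGenP S.pkGen) n [ofBits (holed l1 l2), y] = interp (S.extT n l1 l2 y) := by
  rw [holed, runOn_pkGenP hS.2.1, interp_extT]

/-- By `hx` the public keys of the challenger fit into the clipped length, so clipping has no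
effect. -/
lemma interp_redT (hS : S.Efficient) (sk : List Bool) {xs : List Str} (x : Str)
    (hx : (xs.flatMap frame).length ≤ evalL cl n) :
    interp (unifT (size n + size (evalL cs n)) >>= fun e =>
      unifT (size (evalL qs n)) >>= fun k =>
      S.redT n (size (evalL cs n)) (rows n) A (evalL qs n) e k sk xs x) =
    phaseOneC cs qs cl (skGenP cs S.skGen) (pkGenP S.pkGen) (signP cs S.sign) A n
      (xs.flatMap frame) >>= S.tailC n cs A sk x := by
  simp only [phaseOneC, interp_bind, interp_unifT, bind_assoc, pure_bind, List.take_of_length_le hx]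
  refine (all_unifC _).bind_congr fun e he => ?_
  have he' : e < tsize cs n := by rwa [tsize, rows, cols, ← pow_add]
  refine bind_congr fun k => ?_
  rw [runOn_skGenP_maskOf hS he', redT, ← cols, ← tsize]
  simp only [tabT, interp_bind, interp_repeatedT, interp_pure, bind_assoc, pure_bind]
  refine (all_repeated _ _).bind_congr fun l1 h1 => (all_repeated _ _).bind_congr fun l2 h2 => ?_
  have hl : l1.length + (l2.length + 1) = tsize cs n := by omega
  have hc : xs.length ≤ (xs.flatMap frame).length := by
    rw [List.length_flatMap]
    exact List.length_le_sum_of_one_le _ (by simp [frame]) |>.trans_eq' (by simp)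
  rw [toBits_ofBits, iterM_extendStep (runOn_pkGenP_holed hS l1 l2) xs hc]
  simp only [bind_assoc, pure_bind, List.append_nil, List.reverse_reverse, advT, interp_bind,
    interp_runT]
  refine bind_congr fun pks => bind_congr fun a => ?_
  refine iterM_firstStep hS hl (G := fun y => S.tailC n cs A sk x
    (e, k, ofBits (holed l1 l2), y.1, y.2)) k _ [] a fun h a hh => ?_
  simp only [interp_bind, interp_sigT, tailC, toBits_ofBits]
  refine bind_congr fun σ => ?_
  have := iterM_restStep (A := A) hS hl (F := fun _ μ' => S.compT n (toBits (μ' outReg)) x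
    (slotAt e (ofBits (toBits (μ' sigReg)))) >>= fun b =>
      pure ([toBits (a outReg)], toBits (μ' outReg), b)) (fun _ _ => rfl) σ k (evalL qs n - k) h
    (ofBits σ, a) (by
      rw [List.length_nil, zero_add] at hh
      by_cases hk : k ≤ evalL qs n
      · rw [min_eq_left hk] at hh
        exact Or.inr ⟨hh.ge, by rw [if_pos hh, toBits_ofBits]⟩
      · exact Or.inl (by omega))
  simpa only [interp_bind, interp_pure] using this

/-- Equality may fail in one case: if the forgery has no component at `e`, `tailC` counts a loss,
whereas the program submits the empty signature, which the challenger could accept. -/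
lemma mass_tailC_le {W V T1 T2 T3 b b' : ℕ} {M : Set (List Bool)}
    (B : Bounds cs qs cl (skGenP cs S.skGen) (pkGenP S.pkGen) (signP cs S.sign) A n b W V T1 T2 T3)
    (hb : ∀ xs : List Str, xs.length ≤ evalL qs n + 1 →
      All (fun o => o.2 ≤ b') (activations A (load [unary n]) xs)) {sk : List Bool}
    (hσ : ∀ m : List Bool, m.length ≤ b' → All (fun σ => σ.length ≤ evalL cl n) (S.Sign n sk m))
    {x X s : Str} {e k q' : ℕ} {a : Mem} (he : e < tsize cs n) (hs : s.length ≤ T1)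
    (hq : q' ≤ evalL qs n) (ha : AInv A n V (1 + evalL qs n - q') a) (h : Heap) :
    mass (S.tailC n cs A sk x (e, k, s, q', a)) (Wins M) h ≤
      mass (S.Sign n sk (toBits (firstMem cs qs cl n X e k s q' a outReg)) >>= fun σ =>
        activate (S.breaker cs qs cl A) (firstMem cs qs cl n X e k s q' a) (ofBits σ) >>= fun o =>
        S.Ver n x (toBits (o.1 outReg)) (toBits (o.1 sigReg)) >>= fun v =>
        pure ([toBits (firstMem cs qs cl n X e k s q' a outReg)], toBits (o.1 outReg), v))
        (Wins M) h := by
  have hm : toBits (firstMem cs qs cl n X e k s q' a outReg) = toBits (a outReg) := by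
    show toBits (ofBits _) = _
    rw [toBits_ofBits]; rfl
  rw [hm, tailC]
  have hl : (toBits (a outReg)).length ≤ b' := (length_toBits_le _).trans
    (ha.1.length hb (by omega) (by norm_num [outReg]))
  refine mass_bind_le (hσ _ hl) (fun σ hσ h => ?_) h
  obtain ⟨f, hf, hR⟩ := activate_reduction_two B (x := X) (k := k) he hs hq ha (ofBits σ)
  rw [List.take_of_length_le (by rwa [length_ofBits])] at hR
  rw [breaker, activate_bind hR (fun μ => S.Ver n x (toBits (μ outReg)) (toBits (μ sigReg)) >>=
    fun v => pure ([toBits (a outReg)], toBits (μ outReg), v)), bind_assoc]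
  simp only [pure_bind]
  refine mass_bind_le (All.true _) (fun z _ h => ?_) h
  have h4 : toBits (f z outReg) = toBits (z.2 outReg) := by
    rw [outReg, (hf z).1, toBits_ofBits]
  have h5 := (hf z).2
  rw [h4, sigReg, h5, slotAt]
  have hbits := ((isBits_ofBits (toBits (z.2 5))).dropSlot_iterate e).readSlot.1
  cases hr : (readSlot (dropSlot^[e] (ofBits (toBits (z.2 5))))).1 with
  | none =>
    have : interp (S.compT n (toBits (z.2 outReg)) x none) = pure false := rfl
    simp only [Option.map_none, this, pure_bind]
    rw [mass_pure (fun h => by simpa using h.2.2.2)]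
    exact mass_nonneg _ _ _
  | some s =>
    rw [hr, map_some, map_some, Option.some.injEq] at hbits
    rw [map_some, compT, map_some, interp_verT, compV, Option.getD_some, Ver]

/-- The reduction plays the one-time game. -/
lemma prob_oneT_le {W V T1 T2 T3 b b' t L : ℕ} {M : Set (List Bool)} (hS : S.Efficient)
    (B : Bounds cs qs cl (skGenP cs S.skGen) (pkGenP S.pkGen) (signP cs S.sign) A n b W V T1 T2 T3)
    (hb : ∀ xs : List Str, xs.length ≤ evalL qs n + 1 →
      All (fun o => o.2 ≤ b') (activations A (load [unary n]) xs))
    (hK : All (fun sk => All (fun y => y.length ≤ L) (S.PKGen n sk) ∧ ∀ m : List Bool,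
      m.length ≤ b' → All (fun σ => σ.length ≤ evalL cl n) (S.Sign n sk m)) (S.SKGen n))
    (hL : t * (2 * L + 1) ≤ evalL cl n) :
    prob (interp (S.oneT n cs qs A t)) (Wins M) ≤
      prob (S.experiment (S.breaker cs qs cl A) n t 1) (Wins M) := by
  show mass _ _ _ ≤ mass _ _ _
  rw [oneT, interp_bind, interp_keyT, experiment]
  refine mass_bind_le hK (fun sk hsk h => ?_) _
  rw [interp_bind, interp_repeatedT, interp_pkT]
  -- A key of at most `L` cells takes at most 2L + 1 cells when framed.
  have hrep : All (fun l => (l.flatMap frame).length ≤ evalL cl n) (repeated (S.PKGen n sk) t) := by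
    refine All.mono (p := fun l => (l.flatMap frame).length ≤ t * (2 * L + 1)) ?_
      fun l hl => hl.trans hL
    clear hL
    induction t with
    | zero => exact All.pure (by simp)
    | succ t ih =>
      refine hsk.1.bind fun y hy => ih.bind fun l hl => All.pure ?_
      rw [List.flatMap_cons, List.length_append, length_frame]
      rw [Nat.add_mul, one_mul]
      omega
  refine mass_bind_le hrep (fun xs hxs h => ?_) h
  rw [interp_bind, interp_pkT]
  refine mass_bind_le (All.true _) (fun x _ h => ?_) h
  rw [interp_redT hS sk x hxs]
  simp only [queries, bind_assoc, pure_bind]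
  rw [activate_bind (A := S.breaker cs qs cl A) (activate_reduction_one B (xs.flatMap frame)) (fun μ =>
    S.Sign n sk (toBits (μ outReg)) >>= fun σ => activate (S.breaker cs qs cl A) μ (ofBits σ) >>=
    fun o => S.Ver n x (toBits (o.1 outReg)) (toBits (o.1 sigReg)) >>= fun v =>
      pure ([toBits (μ outReg)], toBits (o.1 outReg), v)), bind_assoc]
  simp only [pure_bind]
  exact mass_bind_le (runs_phaseOne B).2 (fun y hy h =>
    mass_tailC_le B hb hsk.2 hy.1 hy.2.1 hy.2.2.1 hy.2.2.2 h) h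

end

end QDS

/-! ### The security bound -/

lemma acc_mono_of_ev {α : Type} {Q : α → Prop} {t : Tree α} (ht : t.Ev Q) {f g : α → Tree ℝ}
    (h : ∀ a, Q a → ∀ n ψ, acc (f a) n ψ ≤ acc (g a) n ψ) (n : ℕ) (ψ : Ket) :
    acc (t >>= f) n ψ ≤ acc (t >>= g) n ψ := by
  induction t generalizing n ψ with
  | ret a => exact h a ht n ψ
  | alloc k ih => exact ih _ (ht _) _ _
  | gate g k ih => exact ih ht _ _
  | meas i k ih => exact add_le_add (ih _ (ht _) _ _) (ih _ (ht _) _ _)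

lemma below_empty : Below 0 (single ∅ 1 : Ket) := fun s hs i hi => by
  have := Finsupp.support_single_subset hs
  rw [Finset.mem_singleton.1 this] at hi
  simp at hi

namespace QDS

section

variable (S : QDS) (n : ℕ) {z R : ℕ} {A : Prog} {q t : ℕ} {M : Set (List Bool)}

lemma ren_redT (e k : ℕ) (sk : List Bool) (π : Perm ℕ) (xs : List Str)
    (x : Str) : ren π (S.redT n z R A q e k sk xs x) =
      S.redT n z R A q e k sk (ren π xs) (ren π x) := by
  refine Tree.ren_bind_closed (S.supp_tabT n _ e) fun p => ?_
  rw [ren_eq π p]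
  refine Tree.ren_bind_eq (S.ren_mapT_extT n π _ _ xs) fun pks =>
    ren_advT n (fun j m => S.supp_simStepT n _ m) (fun h μ => ?_) _ pks
  simp only [ren_mem_apply, toBits_ren]
  refine Tree.ren_bind_closed (S.supp_sigT n _ _) fun σ => ?_
  rw [ren_eq π σ]
  refine ren_queriesT (fun j m => S.supp_simStepT n _ m) (fun h μ => ?_) _ _ _
  simp only [ren_mem_apply, toBits_ren]
  exact Tree.ren_bind_eq (S.ren_compT n π _ _ _) fun b => by
    rw [Tree.ren_pure, ren_eq, ren_eq]

lemma ev_coreT : (S.coreT n z R A t q).Ev fun o => o.1.length = q :=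
  (Tree.ev_true _).bind fun l _ => (Tree.ev_true _).bind fun pks _ => (Tree.ev_true _).bind
    fun μ _ => ev_queriesT q [] μ fun h μ hh => (Tree.ev_true _).bind fun bs _ => by
      show h.length = q
      simpa using hh

/-- The keys of the one-time game. -/
def keysT (t : ℕ) : Tree (List Bool × List Str × Str) :=
  S.keyT n >>= fun sk => repeatedT (S.pkT n sk) t >>= fun xs => S.pkT n sk >>= fun x =>
    pure (sk, xs, x)

lemma supp_keysT : Supp ∅ (S.keysT n t) :=
  (S.supp_keyT n).closed_bind fun π sk => by
    rw [ren_eq π sk]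
    exact Tree.ren_bind_closed (supp_repeatedT (S.supp_pkT n sk) t) fun xs =>
      Tree.ren_bind_closed (S.supp_pkT n sk) fun x => by
        rw [Tree.ren_pure, ren_mk, ren_mk, ren_eq π sk]

/-- The one-time game for a given choice of the reduction. -/
def guessT (M : Set (List Bool)) (z R : ℕ) (A : Prog) (t q e k : ℕ) : Tree ℝ :=
  S.keysT n t >>= fun w => S.redT n z R A q e k w.1 w.2.1 w.2.2 >>= fun r => .ret (oneR M r)

lemma ren_redT_oneR (e k : ℕ) (π : Perm ℕ) (w : List Bool × List Str × Str) :
    ren π (S.redT n z R A q e k w.1 w.2.1 w.2.2 >>= fun r => Tree.ret (oneR M r)) =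
      (S.redT n z R A q e k (ren π w).1 (ren π w).2.1 (ren π w).2.2 >>= fun r =>
        .ret (oneR M r)) := by
  obtain ⟨sk, xs, x⟩ := w
  rw [ren_mk, ren_mk, ren_eq π sk]
  exact Tree.ren_bind_eq (S.ren_redT n e k sk π xs x) fun r => by
    rw [Tree.ren_ret, ren_eq, ren_eq]

lemma supp_guessT (e k : ℕ) : Supp ∅ (S.guessT n M z R A t q e k) :=
  (S.supp_keysT n).closed_bind fun π w => S.ren_redT_oneR n e k π w

lemma oneR_nonneg (r : List (List Bool) × List Bool × Bool) : 0 ≤ oneR M r := by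
  rw [oneR]
  split_ifs <;> norm_num

lemma acc_guessT_nonneg (e k m : ℕ) (ψ : Ket) : 0 ≤ acc (S.guessT n M z R A t q e k) m ψ := by
  refine acc_nonneg ((Tree.ev_true _).bind fun w _ => ?_) m ψ
  exact (Tree.ev_true _).bind fun r _ => oneR_nonneg r

variable {S n} {cs qs cl : List ℕ}

/-- The guesses are drawn independently of the keys of the challenger, so they can be moved to the
front and averaged there. -/
lemma prob_oneT : prob (interp (S.oneT n cs qs A t)) (Wins M) =
    (∑ e ∈ range (2 ^ (size n + size (evalL cs n))),
      ∑ k ∈ range (2 ^ size (evalL qs n)),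
      acc (S.guessT n M (size (evalL cs n)) (rows n) A t (evalL qs n) e k) 0
        (single ∅ 1)) /
      (2 ^ size (evalL qs n) * 2 ^ (size n + size (evalL cs n))) := by
  classical
  have hU : ∀ e, Supp ∅ (unifT (size (evalL qs n)) >>= fun k =>
      S.guessT n M (size (evalL cs n)) (rows n) A t (evalL qs n) e k) := fun e =>
    (supp_unifT _).closed_bind fun π k => by
      rw [ren_eq π k, S.supp_guessT n e k π (by simp)]
  have h1 := acc_unifT (z := size n + size (evalL cs n))
    (fun e => (hU e).range_of_closed 0) le_rfl below_empty
  have h2 := fun e => acc_unifT (z := size (evalL qs n)) (fun k => (S.supp_guessT n (M := M)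
    (z := size (evalL cs n)) (R := rows n) (A := A) (t := t) (q := evalL qs n) e
    k).range_of_closed 0) le_rfl below_empty
  simp only [h2, ← Finset.sum_div, div_div] at h1
  rw [← h1, prob_interp]
  have key := AccEq.swap (n := 0) (t1 := unifT (size n + size (evalL cs n)) >>= fun e =>
      unifT (size (evalL qs n)) >>= fun k => pure (e, k)) (t2 := S.keysT n t)
    (f := fun u w => S.redT n (size (evalL cs n)) (rows n) A (evalL qs n) u.1 u.2 w.1 w.2.1 w.2.2
      >>= fun r => .ret (oneR M r)) ((supp_unifT _).closed_bind fun π e => by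
        rw [ren_eq π e]
        exact Tree.ren_bind_closed (supp_unifT _) fun k => by rw [ren_eq π k]; rfl)
    ((S.supp_keysT n).range_of_closed 0) fun π _ u w => by
      rw [ren_eq π u]; exact S.ren_redT_oneR n _ _ π w
  simp only [bind_assoc, pure_bind, keysT] at key
  simp only [guessT, keysT, bind_assoc, pure_bind]
  rw [key 0 le_rfl _ below_empty]
  simp only [oneT, bind_assoc]
  congr!

/-- The factor is the number of equally likely guesses. Each term of the union bound is the success
probability of the reduction for one fixed guess. -/
lemma prob_table_le (hS : S.Efficient) (hq : 1 ≤ evalL qs n)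
    (hc : 2 * (evalL qs n * evalL qs n) ≤ cols cs n) :
    prob ((S.table cs).experiment A n t (evalL qs n)) (Wins M) ≤ (1 / 2) ^ rows n +
      2 ^ size (evalL qs n) * 2 ^ (size n + size (evalL cs n)) *
        prob (interp (S.oneT n cs qs A t)) (Wins M) := by
  rw [prob_experiment_table hS, prob_oneT, mul_div_cancel₀ _ (by positivity), pow_add]
  set q := evalL qs n with hq'
  set I := range (rows n * cols cs n) ×ˢ range q with hI
  refine (acc_mono_of_ev (S.ev_coreT n) (f := fun o => .ret (winR M (cols cs n) (rows n) o.1 o.2.1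
    o.2.2)) (g := fun o => .ret (collR (rows n) o.1 + ∑ i ∈ I,
    hitR M (cols cs n) i.1 i.2 o.1 o.2.1 (o.2.2.getD i.1 false))) (fun o ho m ψ =>
      mul_le_mul_of_nonneg_right (winR_le M hq ho _ _) (nsq_nonneg ψ)) _ _).trans ?_
  -- The index `none` stands for the event that all rows collide, `some i` for the guess `i`.
  rw [acc_bind_sum (Finset.insertNone I) _ (g := fun i o => match i with
    | none => .ret (collR (rows n) o.1)
    | some i => .ret (hitR M (cols cs n) i.1 i.2 o.1 o.2.1 (o.2.2.getD i.1 false)))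
    fun o m ψ => by simp only [acc, Finset.sum_insertNone, add_mul, Finset.sum_mul],
    Finset.sum_insertNone]
  refine add_le_add ?_ ?_
  · refine (S.coreT_coll n hc 0 0 le_rfl _ below_empty).trans_eq ?_
    simp [acc, nsq]
  · rw [hI, Finset.sum_product]
    -- Only guesses k < q are needed, but `k` ranges over 2^`size q` values; the surplus terms are
    -- nonnegative.
    refine Finset.sum_le_sum fun e he => (Finset.sum_le_sum fun k hk => ?_).trans
      (Finset.sum_le_sum_of_subset_of_nonneg (range_mono (Nat.lt_size_self q).le)
        fun k _ _ => S.acc_guessT_nonneg n e k _ _)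
    refine (S.coreT_hit_le n (Finset.mem_range.1 he) (Finset.mem_range.1 hk) 0 0 le_rfl _
      below_empty).trans_eq ?_
    simp only [guessT, keysT, bind_assoc, pure_bind]

end

end QDS

/-! ### Correctness of the table scheme -/

/-- Every row has a selected position, and there the verdict is positive. -/
lemma failC_eq_zero {C : ℕ} {us : List ℕ} (hu : ∀ u ∈ us, u < C) {bs : List Bool}
    (h : ∀ i < us.length * C, (us.flatMap (rowSel C)).getD i false = true → bs.getD i false = true) :
    failC C us.length bs = 0 := by
  induction us generalizing bs with
  | nil => rfl
  | cons u us ih =>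
    have hC : (rowSel C u).length = C := by
      have := hu u List.mem_cons_self
      simp [rowSel]; omega
    have hl : (u :: us).length * C = C + us.length * C := by rw [List.length_cons]; ring
    rw [List.length_cons, failC, ih (fun v hv => hu v (List.mem_cons_of_mem _ hv)) fun i hi hs => ?_,
      if_neg]
    · rw [List.count_eq_zero]
      refine not_not.2 ?_
      have := h (C - 1 - u) (by have := hu u List.mem_cons_self; omega)
        (by rw [List.flatMap_cons, List.getD_append _ _ _ _ (by
          have := hu u List.mem_cons_self; omega)]; simp [rowSel])
      have hlt : C - 1 - u < bs.length := by
        by_contra hb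
        rw [List.getD_eq_default _ _ (by omega)] at this
        cases this
      rw [List.getD_eq_getElem _ _ hlt] at this
      rw [← this]
      exact List.mem_take_iff_getElem.2 ⟨_, by have := hu u List.mem_cons_self; omega, rfl⟩
    · have := h (C + i) (by omega) (by
        rw [List.flatMap_cons, List.getD_append_right _ _ _ _ (by omega), hC,
          Nat.add_sub_cancel_left, hs])
      simpa [List.getD, List.getElem?_drop] using this

lemma acc_true_add_false (t : Tree Bool) (n : ℕ) (ψ : Ket) :
    acc (t >>= fun b => .ret (if b = true then 1 else 0)) n ψ +
      acc (t >>= fun b => .ret (if b = false then 1 else 0)) n ψ = nsq ψ := by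
  have h := acc_bind_sum Finset.univ t (f := fun _ => .ret 1)
    (g := fun b0 b => .ret (if b = b0 then 1 else 0)) (fun b m φ => by cases b <;> simp [acc]) n ψ
  rw [acc_bind_ret_const, one_mul, Fintype.sum_bool] at h
  exact h.symm

lemma slotAt_encSlots_succ (k : ℕ) (s : Slot) (l : List Slot) :
    slotAt (k + 1) (ofBits (encSlots (s :: l))) = slotAt k (ofBits (encSlots l)) := by
  rw [slotAt, iterate_succ_apply, dropSlot, readSlot_encSlots, slotAt]

namespace QDS

section

variable (S : QDS) (n : ℕ) {cs : List ℕ}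

/-- The probability that an honest signature is rejected. -/
def badT (sk m : List Bool) : Tree ℝ :=
  S.pkT n sk >>= fun y => S.sigT n sk m >>= fun σ => S.compT n m y (some σ) >>= fun b =>
    .ret (if b = false then 1 else 0)

lemma supp_badT (sk m : List Bool) : Supp ∅ (S.badT n sk m) :=
  (S.supp_pkT n sk).closed_bind fun π y => Tree.ren_bind_closed (S.supp_sigT n sk m) fun σ => by
    rw [ren_eq π σ]
    exact Tree.ren_bind_eq (S.ren_compT n π _ _ _) fun b => by
      rw [Tree.ren_ret, ren_eq, ren_eq]

lemma acc_badT_nonneg (sk m : List Bool) (k : ℕ) (ψ : Ket) : 0 ≤ acc (S.badT n sk m) k ψ := by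
  refine acc_nonneg ((Tree.ev_true _).bind fun y _ => (Tree.ev_true _).bind fun σ _ => ?_) k ψ
  exact (Tree.ev_true _).bind fun b _ => by
    show (0 : ℝ) ≤ if b = false then 1 else 0
    split_ifs <;> norm_num

/-- One component of an honest signature. -/
lemma sigsT_badT (m : List Bool) (l1 l2 : List (List Bool)) (sk : List Bool) {bs : List Bool}
    (hb : bs.getD l1.length false = true) (N : ℕ) :
    AccEq N (S.sigsT n m bs (l1 ++ sk :: l2) >>= fun r => S.pkT n sk >>= fun y =>
      S.compT n m y (slotAt l1.length (ofBits (encSlots r))) >>= fun b =>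
        .ret (if b = false then 1 else 0)) (S.badT n sk m) := by
  have hs : ∀ o, Supp ∅ (S.pkT n sk >>= fun y => S.compT n m y o >>= fun b =>
      Tree.ret (if b = false then 1 else 0 : ℝ)) := fun o =>
    (S.supp_pkT n sk).closed_bind fun π y => Tree.ren_bind_eq (S.ren_compT n π _ _ _) fun b => by
      rw [Tree.ren_ret, ren_eq, ren_eq]
  induction l1 generalizing bs with
  | nil =>
    cases bs with
    | nil => cases hb
    | cons b bs =>
      obtain rfl : b = true := hb
      simp only [List.nil_append, sigsT, bind_assoc, pure_bind, List.length_nil]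
      have h0 : ∀ (σ : List Bool) r, slotAt 0 (ofBits (encSlots (some σ :: r))) = some σ := by
        intro σ r
        rw [slotAt, Function.iterate_zero_apply, readSlot_encSlots, map_some,
          map_some, toBits_ofBits]
      simp only [h0]
      refine (AccEq.bind ((S.supp_sigT n sk m).range_of_closed N) fun K _ σ _ =>
        AccEq.discard (S.supp_sigsT n m bs l2) ((hs (some σ)).range_of_closed K)).trans ?_
      exact AccEq.swap (S.supp_sigT n sk m) ((S.supp_pkT n sk).range_of_closed N) fun π _ σ y => by
        rw [ren_eq π σ]
        exact Tree.ren_bind_eq (S.ren_compT n π _ _ _) fun b => by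
          rw [Tree.ren_ret, ren_eq, ren_eq]
  | cons x l1 ih =>
    cases bs with
    | nil => cases hb
    | cons b bs =>
      have := ih (bs := bs) hb
      cases b <;> simp only [List.cons_append, sigsT, bind_assoc, pure_bind, List.length_cons,
        slotAt_encSlots_succ]
      · exact this
      · exact (AccEq.discard (S.supp_sigT n x m) (((S.supp_sigsT n m bs _).closed_bind fun π r => by
          rw [ren_eq π r]; exact hs _ π (by simp)).range_of_closed N)).trans this

/-- The table scheme, with the public key computed at the end. -/
def honestT (m : List Bool) (z R : ℕ) (g : List ℕ → List Bool → ℝ) (l : List (List Bool)) :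
    Tree ℝ :=
  S.stepT n z R l m >>= fun w => S.versT n m l (ofBits (encSlots w.2)) >>= fun bs => .ret (g w.1 bs)

lemma supp_honestT (m : List Bool) (z R : ℕ) (g : List ℕ → List Bool → ℝ)
    (l : List (List Bool)) : Supp ∅ (S.honestT n m z R g l) :=
  (S.supp_stepT n l m).closed_bind fun π w => by
    rw [ren_eq π w]
    exact Tree.ren_bind_closed (S.supp_versT n _ _ _) fun bs => by
      rw [Tree.ren_ret, ren_eq, ren_eq]

/-- The verdict at position `i` involves only key number `i`. Once the other keys and the choice of
columns are discarded, an honest run of the one-time scheme is left; if `i` is not selected, the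
left side vanishes. -/
lemma honestT_le_badT (m : List Bool) (z R : ℕ) {i : ℕ} (hi : i < R * 2 ^ z) (N : ℕ) :
    AccLe N (repeatedT (S.keyT n) (R * 2 ^ z) >>= S.honestT n m z R fun us bs =>
        if (us.flatMap (rowSel (2 ^ z))).getD i false = true ∧ bs.getD i false = false then 1 else 0)
      (S.keyT n >>= fun sk => S.badT n sk m) := by
  refine (S.repeatedT_keyT n hi (S.supp_honestT n m z R _) N).le.trans
    (AccLe.bind ((S.supp_keyT n).range_of_closed N) fun N1 _ sk _ => ?_)
  refine AccLe.trans (AccLe.bind_of_ev ((S.supp_tabT n _ i).range_of_closed N1) (S.ev_tabT n _ i)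
    (g := fun _ => S.badT n sk m) fun N2 _ p hp _ => ?_)
    (AccEq.discard (S.supp_tabT n _ i) ((S.supp_badT n sk m).range_of_closed N1)).le
  subst hp
  simp only [honestT, stepT, bind_assoc, pure_bind]
  refine AccLe.trans (AccLe.bind ((supp_selT z R).range_of_closed N2)
    (g := fun _ => S.badT n sk m) fun N3 _ us _ => ?_)
    (AccEq.discard (supp_selT z R) ((S.supp_badT n sk m).range_of_closed N2)).le
  by_cases hb : (us.flatMap (rowSel (2 ^ z))).getD p.1.length false = true
  · simp only [hb, true_and]
    exact (AccEq.bind ((S.supp_sigsT n _ _ _).range_of_closed N3) fun N4 _ r _ =>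
      S.versT_single n m p.1 p.2 sk _ (fun b => if b = false then 1 else 0) N4).le.trans
      (S.sigsT_badT n m p.1 p.2 sk hb N3).le
  · simp only [hb, Bool.false_eq_true, false_and, if_false]
    intro k _ ψ _
    rw [← bind_assoc, acc_bind_ret_const, zero_mul]
    exact S.acc_badT_nonneg n sk m k ψ

/-- Union bound: an honest signature is rejected only if one of its selected components is, and
there are R · 2^z positions. -/
lemma honestT_fail_le (m : List Bool) (z R : ℕ) :
    acc (repeatedT (S.keyT n) (R * 2 ^ z) >>= S.honestT n m z R fun _ bs =>
      if failC (2 ^ z) R bs = 0 then 0 else 1) 0 (single ∅ 1) ≤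
      (R * 2 ^ z : ℕ) * acc (S.keyT n >>= fun sk => S.badT n sk m) 0 (single ∅ 1) := by
  have e : ∀ g : List ℕ → List Bool → ℝ, (repeatedT (S.keyT n) (R * 2 ^ z) >>=
      S.honestT n m z R g) = (repeatedT (S.keyT n) (R * 2 ^ z) >>= fun l => S.stepT n z R l m >>=
        fun w => S.versT n m l (ofBits (encSlots w.2)) >>= fun bs => pure (w.1, bs)) >>= fun o =>
          .ret (g o.1 o.2) := fun g => by
    simp only [bind_assoc, pure_bind]
    rfl
  have hev : (repeatedT (S.keyT n) (R * 2 ^ z) >>= fun l => S.stepT n z R l m >>=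
      fun w => S.versT n m l (ofBits (encSlots w.2)) >>= fun bs => pure (w.1, bs)).Ev fun o =>
        o.1.length = R ∧ ∀ u ∈ o.1, u < 2 ^ z := by
    refine (Tree.ev_true _).bind fun l _ => Tree.Ev.bind (Q := fun w => w.1.length = R ∧
      ∀ u ∈ w.1, u < 2 ^ z) ?_ fun w hw => (Tree.ev_true _).bind fun bs _ => ?_
    · exact (ev_selT _ _).bind fun us hus => (Tree.ev_true _).bind fun r _ => hus
    · exact hw
  let g (i : ℕ) (us : List ℕ) (bs : List Bool) : ℝ :=
    if (us.flatMap (rowSel (2 ^ z))).getD i false = true ∧ bs.getD i false = false then 1 else 0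
  rw [e]
  refine (acc_mono_of_ev hev (g := fun o => .ret (∑ i ∈ range (R * 2 ^ z), g i o.1 o.2))
    (fun o ho k ψ => mul_le_mul_of_nonneg_right ?_ (nsq_nonneg ψ)) 0 _).trans ?_
  · have h0 : ∀ i ∈ range (R * 2 ^ z), 0 ≤ g i o.1 o.2 := fun i _ => by
      simp only [g]
      split_ifs <;> norm_num
    split_ifs with hf
    · exact Finset.sum_nonneg h0
    · by_contra hlt
      refine hf (ho.1 ▸ failC_eq_zero ho.2 fun i hi hs => ?_)
      by_contra hb
      refine hlt (le_trans ?_ (Finset.single_le_sum h0 (Finset.mem_range.2 (ho.1 ▸ hi))))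
      rw [show g i o.1 o.2 = 1 from if_pos ⟨hs, by simpa using hb⟩]
  · rw [acc_bind_sum (range (R * 2 ^ z)) _ (g := fun i o => .ret (g i o.1 o.2))
      fun o k ψ => by simp only [acc, Finset.sum_mul]]
    simp only [← e]
    rw [← nsmul_eq_mul]
    refine (Finset.sum_le_card_nsmul _ _ _ fun i hi => S.honestT_le_badT n m _ _
      (Finset.mem_range.1 hi) 0 0 le_rfl _ below_empty).trans_eq ?_
    rw [Finset.card_range]

variable {S n}

lemma prob_honestRun (m : List Bool) : prob (S.honestRun n m) (fun v => v = true) =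
    1 - acc (S.keyT n >>= fun sk => S.badT n sk m) 0 (single ∅ 1) := by
  have h : S.honestRun n m = interp (S.keyT n >>= fun sk => S.pkT n sk >>= fun y =>
      S.sigT n sk m >>= fun σ => S.compT n m y (some σ)) := by
    simp only [honestRun, interp_bind, interp_keyT, interp_pkT, interp_sigT, compT, interp_verT,
      map_some, compV, Ver]
  have := acc_true_add_false (S.keyT n >>= fun sk => S.pkT n sk >>= fun y =>
      S.sigT n sk m >>= fun σ => S.compT n m y (some σ)) 0 (single ∅ 1)
  rw [h, prob_interp, eq_sub_iff_add_eq]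
  simp only [bind_assoc] at this
  simp only [bind_assoc, badT]
  convert this
  simp [nsq]

/-- The public key is moved behind the signing, where it can be split among the components, and the
union bound `honestT_fail_le` applies. -/
lemma prob_honestRun_table (hS : S.Efficient) (cs : List ℕ) (m : List Bool) :
    1 - tsize cs n * (1 - prob (S.honestRun n m) fun v => v = true) ≤
      prob ((S.table cs).honestRun n m) fun v => v = true := by
  have h : (S.table cs).honestRun n m = interp (repeatedT (S.keyT n) (tsize cs n) >>= fun l =>
      S.framesT n l >>= fun pk => S.stepT n (size (evalL cs n)) (rows n) l m >>= fun w =>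
      S.compsT n m (tsize cs n) pk (ofBits (encSlots w.2)) >>= fun bs =>
        pure (decide (failC (cols cs n) (rows n) bs = 0))) := by
    rw [honestRun, table_SKGen hS, bind_assoc, interp_bind, interp_repeatedT]
    refine (all_repeated _ _).bind_congr fun l hl => ?_
    simp only [pure_bind, table_PKGen hS, interp_bind, table_Sign hS hl, table_Ver hS, bind_assoc,
      interp_pure]
  have h1 := acc_true_add_false (repeatedT (S.keyT n) (tsize cs n) >>= fun l =>
      S.framesT n l >>= fun pk => S.stepT n (size (evalL cs n)) (rows n) l m >>= fun w =>
      S.compsT n m (tsize cs n) pk (ofBits (encSlots w.2)) >>= fun bs =>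
        pure (decide (failC (cols cs n) (rows n) bs = 0))) 0 (single ∅ 1)
  have hn : nsq (single ∅ 1 : Ket) = 1 := by simp [nsq]
  rw [hn] at h1
  rw [h, prob_interp, prob_honestRun, sub_sub_cancel]
  refine le_trans (sub_le_sub_left (le_trans (le_of_eq ?_)
    (S.honestT_fail_le n m (size (evalL cs n)) (rows n))) 1) (eq_sub_of_add_eq h1).ge
  simp only [bind_assoc, pure_bind]
  refine AccEq.bind_of_ev ((supp_repeatedT (S.supp_keyT n) _).range_of_closed 0)
    (ev_repeatedT _ _) (fun N _ l hl _ => ?_) 0 le_rfl _ below_empty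
  have hc : ∀ (π : Perm ℕ) s pk, ren π (S.compsT n m (tsize cs n) pk s >>= fun bs =>
      Tree.ret (if decide (failC (cols cs n) (rows n) bs = 0) = false then 1 else 0 : ℝ)) =
      (S.compsT n m (tsize cs n) (ren π pk) s >>= fun bs =>
        .ret (if decide (failC (cols cs n) (rows n) bs = 0) = false then 1 else 0)) :=
    fun π s pk => Tree.ren_bind_eq (S.ren_compsT n π _ _ _ _) fun bs => by
      rw [Tree.ren_ret, ren_eq, ren_eq]
  refine (AccEq.swap (S.supp_framesT n l) ((S.supp_stepT n l m).range_of_closed N)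
    fun π _ pk w => by rw [ren_eq π w, hc]).trans
    (AccEq.bind ((S.supp_stepT n l m).range_of_closed N) fun K _ w _ => ?_)
  have := S.framesT_compsT n m l (ofBits (encSlots w.2)) (fun bs =>
    if decide (failC (cols cs n) (rows n) bs = 0) = false then 1 else 0) K
  rw [hl] at this
  simp at this ⊢
  exact this

end

end QDS

/-! ### Negligible functions -/

lemma negligible_half_pow : Negligible fun n => (1 / 2 : ℝ) ^ n := fun k =>
  tendsto_pow_const_mul_const_pow_of_abs_lt_one k (by rw [abs_of_pos] <;> norm_num)

/-- No bound is asked for at 0, where a nonzero polynomial `q` may vanish. -/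
lemma Negligible.of_le {f g : ℕ → ℝ} (hg : Negligible g) (hf : ∀ n, 0 ≤ f n)
    (h : ∀ n, 1 ≤ n → f n ≤ g n) : Negligible f :=
  Asymptotics.SuperpolynomialDecay.trans_eventually_abs_le hg <|
    Filter.eventually_atTop.2 ⟨1, fun n hn => by
      simpa only [Function.comp, abs_of_nonneg (hf n)] using (h n hn).trans (le_abs_self _)⟩

lemma Negligible.eval_mul {f : ℕ → ℝ} (hf : Negligible f) (p : ℕ[X]) :
    Negligible fun n => (p.eval n : ℕ) * f n := by
  have := Asymptotics.SuperpolynomialDecay.polynomial_mul hf (p.map (Nat.castRingHom ℝ))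
  refine this.congr fun n => ?_
  rw [Polynomial.eval_natCast_map, Nat.coe_castRingHom, Nat.cast_id]

/-! ### Asymptotics: efficiency, correctness and security of the table scheme -/

namespace QDS

variable {S : QDS}

lemma table_efficient (hS : S.Efficient) (cs : List ℕ) : (S.table cs).Efficient :=
  ⟨(isQPT_skGenP cs hS.1).of_succ, (isQPT_pkGenP hS.2.1).of_succ,
    (isQPT_signP cs hS.2.2.1).of_succ, isQPT_verP cs hS.2.2.2⟩

lemma table_correct {M : ℕ → Set (List Bool)} (hS : S.Efficient) (hC : S.Correct M)
    (cs : List ℕ) : (S.table cs).Correct M := by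
  obtain ⟨ε, hε, h⟩ := hC
  obtain ⟨p, hp⟩ := polyB_tsize cs
  -- Enlarging the number of keys to a polynomial bound requires a nonnegative error, which `ε` need
  -- not be.
  have hε' : Negligible fun n => |ε n| :=
    Asymptotics.SuperpolynomialDecay.trans_abs_le hε fun n => (abs_abs _).le
  refine ⟨_, hε'.eval_mul p, fun n m hm => le_trans (sub_le_sub_left ?_ 1)
    (prob_honestRun_table hS cs m)⟩
  have h1 := h n m hm
  refine (mul_le_mul_of_nonneg_left (?_ : _ ≤ |ε n|) (Nat.cast_nonneg _)).trans
    (mul_le_mul_of_nonneg_right (Nat.cast_le.2 (hp n)) (abs_nonneg _))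
  linarith [le_abs_self (ε n)]

/-- The clock of the reduction. -/
lemma exists_clock (hS : S.Efficient) (a t : ℕ[X]) : ∃ (cl : List ℕ) (L : ℕ → ℕ), ∀ n,
    t.eval n * (2 * L n + 1) ≤ evalL cl n ∧
    All (fun sk => All (fun y => y.length ≤ L n) (S.PKGen n sk) ∧ ∀ m : List Bool,
      m.length ≤ a.eval n → All (fun σ => σ.length ≤ evalL cl n) (S.Sign n sk m)) (S.SKGen n) := by
  obtain ⟨p, hp⟩ := hS.1.bound
  obtain ⟨p', hp'⟩ := hS.2.1.bound
  obtain ⟨r, hr⟩ := hS.2.2.1.bound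
  -- `X + p` bounds the security parameter together with the length of the secret key. The first
  -- summand makes room for `t` framed public keys, the second for a signature on a message of the
  -- length bounded by `a`.
  obtain ⟨cl, hcl⟩ := exists_evalL (t * (2 * p'.comp (X + p) + 1) + r.comp (X + p + a))
  refine ⟨cl, fun n => p'.eval (n + p.eval n), fun n => ?_⟩
  have e : evalL cl n = t.eval n * (2 * p'.eval (n + p.eval n) + 1) +
      r.eval (n + p.eval n + a.eval n) := by
    rw [hcl]
    simp [eval_comp]
  refine ⟨e ▸ Nat.le_add_right _ _, ?_⟩
  refine (all_runOn_length (by simp) (hp n [] n rfl (by simp))).bind fun x hx => All.pure ?_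
  have hx' := (length_toBits_le x).trans hx
  refine ⟨all_runOn_length (by simp) (hp' n _ _ rfl (by simpa using hx')), fun m hm => ?_⟩
  refine (all_runOn_length (by simp) (hr n [ofBits (toBits x), ofBits m] (n + p.eval n + a.eval n)
    rfl (by simp; omega))).bind fun σ hσ => All.pure ?_
  rw [e]
  exact ((length_toBits_le σ).trans hσ).trans (Nat.le_add_left _ _)

lemma table_secure {M : ℕ → Set (List Bool)} {q : ℕ[X]} (hq : q ≠ 0) (hS : S.Efficient)
    (hM : S.Secure M fun _ => 1) {cs : List ℕ}
    (hcs : ∀ n, evalL cs n = 2 * (q.eval n * q.eval n)) :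
    (S.table cs).Secure M fun n => q.eval n := by
  intro A t hA
  obtain ⟨qs, hqs⟩ := exists_evalL q
  have hA' : IsQPTAdversary (evalL qs) A := by rwa [show evalL qs = fun n => q.eval n from funext hqs]
  obtain ⟨a, ha⟩ := id hA'
  obtain ⟨cl, L, hcl⟩ := exists_clock hS a t
  have hG := isQPT_skGenP cs hS.1
  have hK := isQPT_pkGenP hS.2.1
  have hP := isQPT_signP cs hS.2.2.1
  obtain ⟨b, W, V, T1, T2, T3, hB, -⟩ := exists_bounds cs cl hG hK hP hA'
  have hneg := hM (S.breaker cs qs cl A) t (isQPTAdversary_reduction cs cl hG hK hP hA')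
  -- A polynomial bound for the number of guesses (e, k).
  obtain ⟨p, hp⟩ := (polyB_two_pow_size (polyB_evalL qs)).mul (polyB_tsize cs)
  refine Negligible.of_le (Asymptotics.SuperpolynomialDecay.add negligible_half_pow
    (hneg.eval_mul p)) (fun n => mass_nonneg _ _ _) fun n hn => ?_
  -- The leading term alone is at least 1, since its coefficient is a positive integer and n ≥ 1.
  have hq1 : 1 ≤ q.eval n := by
    rw [Polynomial.eval_eq_sum_range]
    refine le_trans ?_ (Finset.single_le_sum (fun i _ => Nat.zero_le _)
      (Finset.mem_range.2 (Nat.lt_succ_self q.natDegree)))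
    exact Nat.mul_pos (Nat.pos_of_ne_zero (Polynomial.leadingCoeff_ne_zero.2 hq))
      (Nat.pow_pos hn)
  -- The number of columns exceeds 2q² because every number is smaller than 2 to its binary length.
  have h1 := prob_table_le (A := A) (t := t.eval n) (M := M n) hS (n := n) (cs := cs) (qs := qs)
    (by rwa [hqs]) (by rw [hqs, ← hcs]; exact (Nat.lt_size_self _).le)
  rw [hqs] at h1
  refine h1.trans (add_le_add ?_ ?_)
  -- There are more than n rows.
  · exact pow_le_pow_of_le_one (by norm_num) (by norm_num) (Nat.lt_size_self n).le
  · refine mul_le_mul ?_ (prob_oneT_le hS (hB n) (fun xs hxs h o ho => ha n xs hxs h o ho)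
      (hcl n).2 (hcl n).1) (mass_nonneg _ _ _) (Nat.cast_nonneg _)
    have : 2 ^ size (evalL qs n) * tsize cs n ≤ p.eval n := hp n
    rw [tsize, rows, cols, ← pow_add, hqs] at this
    exact_mod_cast this

end QDS

end QDSModel
end

theorem mainTheorem4 (M : ℕ → Set (List Bool)) (q : Polynomial ℕ) (hq : q ≠ 0)
    (h : ∃ S : QDSModel.QDS, S.IsTimeSecure M (fun _ => 1)) :
    ∃ S : QDSModel.QDS, S.IsTimeSecure M (fun n => q.eval n) := by
  obtain ⟨S, hE, hC, hM⟩ := h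
  -- With at least 2q² columns, the collision bound q² / C of a row is at most 1/2.
  obtain ⟨cs, hcs⟩ := QDSModel.exists_evalL (2 * (q * q))
  exact ⟨S.table cs, QDSModel.QDS.table_efficient hE cs, QDSModel.QDS.table_correct hE hC cs,
    QDSModel.QDS.table_secure hq hE hM fun n => by rw [hcs]; simp⟩
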